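/- Let $\mathbb{T}=\mathbb{R}/2\pi\mathbb{Z}$ and let $F\in L^2(\mathbb{T}\times\mathbb{R}_+)$ satisfy $\int_{\mathbb{T}}F(x,z)\,dx=0$ for almost every $z>0$. With $F_k(y)=\frac1{2\pi}\int_0^{2\pi}F(x,y)e^{-ikx}\,dx$, put $$\Psi(x,z)=\int_0^{\infty}\sum_{k\in\mathbb{Z}\setminus\{0\}}G_k(z,y)F_k(y)e^{ikx}\,dy,\qquad G_k(z,y)=-\frac1{|k|}\begin{cases}e^{-|k|z}\sinh(|k|y),& y<z,\\ e^{-|k|y}\sinh(|k|z),& z\le y.\end{cases}$$ Then $\Psi$ is continuous on $\mathbb{T}\times[0,\infty)$ and solves the Dirichlet problem $\Delta\Psi=F$ in $\mathbb{T}\times\mathbb{R}_+$ (in the sense of distributions), $\Psi(x,0)=0$. Moreover, with all norms taken on $\mathbb{T}\times\mathbb{R}_+$ and all derivatives understood weakly: 1. For every real $s\ge1$ there is a constant $C_s$, depending only on $s$, such that for all such $F\in H^{s-1}$, $\ \|\nabla\Psi\|_{H^s}\le C_s\|F\|_{H^{s-1}}$. There is moreover an absolute constant $C$ such that: 2. if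 $F\in H^2$, then $\|D^2\Psi\|_{L^\infty}\le C\big(1+\|F\|_{L^\infty}\ln(2+\|F\|_{H^2})\big)$; 3. if $F\in H^1$, then $\|\nabla\Psi\|_{L^\infty}\le C\big(1+\|F\|_{L^2}\,(\ln(2+\|F\|_{H^1}))^{1/2}\big)$; 4. if $F=\operatorname{div}H$ (in the sense of distributions) with a vector field $H\in H^2$, then $\|\nabla\Psi\|_{L^\infty}\le C\big(1+\|H\|_{L^\infty}\ln(2+\|H\|_{H^2})\big)$. Here, for $s\ge 0$ with integer part $m$ and fractional part $\sigma$, $\|f\|_{H^s}^2=\sum_{|\beta|\le m}\|\partial^\beta f\|_{L^2}^2$, to which, when $\sigma>0$, one adds $\sum_{|\beta|=m}\iint\frac{|\partial^\beta f(p)-\partial^\beta f(q)|^2}{d(p,q)^{2+2\sigma}}\,dp\,dq$, with $d$ the flat distance of $\mathbb{T}\times\mathbb{R}$. Functions may be real- or complex-valued. -/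

import Mathlib

open scoped ENNReal ContDiff

noncomputable section

namespace HalfCylinder

/- The half-cylinder `𝕋 × ℝ₊` with `𝕋 = ℝ / 2πℤ`.  A function on it is represented by a function on
`ℝ × ℝ`, `2π`-periodic in the first variable `x`; only its values at heights `z > 0` (`z ≥ 0` for the
potential) matter. -/

/-- The open upper half-plane, the universal cover of `𝕋 × ℝ₊`. -/
def upperHalf : Set (ℝ × ℝ) := Set.univ ×ˢ Set.Ioi 0

/-- One period of the half-plane. -/
def cell : Set (ℝ × ℝ) := Set.Ioc 0 (2 * Real.pi) ×ˢ Set.Ioi 0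

/-- The Lebesgue measure of `𝕋 × ℝ₊`, carried by one period. -/
def cellMeasure : MeasureTheory.Measure (ℝ × ℝ) := MeasureTheory.volume.restrict cell

/-- `2π`-periodicity in the horizontal variable. -/
def IsPeriodic (f : ℝ × ℝ → ℂ) : Prop :=
  ∀ x z : ℝ, 0 < z → f (x + 2 * Real.pi, z) = f (x, z)

/-- Classical partial derivatives of test functions. -/
def dx (φ : ℝ × ℝ → ℝ) : ℝ × ℝ → ℝ := fun p => fderiv ℝ φ p (1, 0)

def dz (φ : ℝ × ℝ → ℝ) : ℝ × ℝ → ℝ := fun p => fderiv ℝ φ p (0, 1)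

/-- `∂ₓ^{β₁} ∂_z^{β₂} φ`. -/
def partialDeriv (β : ℕ × ℕ) (φ : ℝ × ℝ → ℝ) : ℝ × ℝ → ℝ := dx^[β.1] (dz^[β.2] φ)

/-- Smooth functions with compact support in the open half-plane. -/
structure IsTestFunction (φ : ℝ × ℝ → ℝ) : Prop where
  smooth : ContDiff ℝ ∞ φ
  compact : HasCompactSupport φ
  support : tsupport φ ⊆ upperHalf

/-- `g` is the weak derivative `∂ₓ^{β₁} ∂_z^{β₂} f` in the open half-plane. -/
structure IsWeakDeriv (β : ℕ × ℕ) (f g : ℝ × ℝ → ℂ) : Prop where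
  locInt : MeasureTheory.LocallyIntegrableOn f upperHalf
  locInt_deriv : MeasureTheory.LocallyIntegrableOn g upperHalf
  integral_eq : ∀ φ : ℝ × ℝ → ℝ, IsTestFunction φ →
    ∫ p in upperHalf, (partialDeriv β φ p : ℂ) * f p =
      (-1) ^ (β.1 + β.2) * ∫ p in upperHalf, (φ p : ℂ) * g p

/-- The flat distance of `𝕋 × ℝ`. -/
def cylDist (p q : ℝ × ℝ) : ℝ :=
  Real.sqrt (‖((p.1 - q.1 : ℝ) : AddCircle (2 * Real.pi))‖ ^ 2 + (p.2 - q.2) ^ 2)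

/-- The square of the Gagliardo (Sobolev-Slobodeckij) seminorm of order `σ ∈ (0, 1)` on the
two-dimensional domain `𝕋 × ℝ₊`; no such term is present for `σ = 0`. -/
def gagliardoSq (σ : ℝ) (g : ℝ × ℝ → ℂ) : ℝ≥0∞ :=
  if σ = 0 then 0 else
    ∫⁻ p in cell, ∫⁻ q in cell, ‖g p - g q‖ₑ ^ 2 / ENNReal.ofReal (cylDist p q ^ (2 + 2 * σ))

/-- The norm of `H^s(𝕋 × ℝ₊)` for real `s ≥ 0`: with `m` the integer part and `σ` the fractional
part of `s`, the square root of
`∑_{|β| ≤ m} ‖∂^β f‖²_{L²} + ∑_{|β| = m} [∂^β f]²_{σ}`.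
Weak derivatives being unique almost everywhere, all families `D` give the same value; the norm is
`∞` when a weak derivative does not exist.  For integral `s` this is the usual norm
`(∑_{|β| ≤ s} ‖∂^β f‖²_{L²})^{1/2}`. -/
def hsNorm (s : ℝ) (f : ℝ × ℝ → ℂ) : ℝ≥0∞ :=
  ⨅ (D : ℕ × ℕ → ℝ × ℝ → ℂ) (_ : ∀ β : ℕ × ℕ, β.1 + β.2 ≤ ⌊s⌋₊ → IsWeakDeriv β f (D β)),
    ((∑ n ∈ Finset.range (⌊s⌋₊ + 1), ∑ β ∈ Finset.HasAntidiagonal.antidiagonal n,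
        ∫⁻ p in cell, ‖D β p‖ₑ ^ 2) +
      ∑ β ∈ Finset.HasAntidiagonal.antidiagonal ⌊s⌋₊, gagliardoSq (Int.fract s) (D β)) ^ (1 / 2 : ℝ)

/-- `‖(f, g)‖_{H^s}` for a vector field with components `f`, `g`. -/
def hsNormPair (s : ℝ) (f g : ℝ × ℝ → ℂ) : ℝ≥0∞ :=
  (hsNorm s f ^ 2 + hsNorm s g ^ 2) ^ (1 / 2 : ℝ)

/-- `‖∇Ψ‖_{H^s}`, `∞` when the weak gradient of `Ψ` does not exist or is not in `H^s`. -/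
def gradHsNorm (s : ℝ) (Ψ : ℝ × ℝ → ℂ) : ℝ≥0∞ :=
  ⨅ (P : ℝ × ℝ → ℂ) (Q : ℝ × ℝ → ℂ) (_ : IsWeakDeriv (1, 0) Ψ P) (_ : IsWeakDeriv (0, 1) Ψ Q),
    hsNormPair s P Q

/-- The norm of `L²(𝕋 × ℝ₊)`. -/
def l2Norm (f : ℝ × ℝ → ℂ) : ℝ≥0∞ := MeasureTheory.eLpNorm f 2 cellMeasure

/-- The norm of `L^∞(𝕋 × ℝ₊)`. -/
def supNorm (f : ℝ × ℝ → ℂ) : ℝ≥0∞ := MeasureTheory.eLpNorm f ∞ cellMeasure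

/-- `‖D^m Ψ‖_{L^∞}`, the maximum of the `L^∞` norms of all weak partial derivatives of order `m`;
`∞` when one of these does not exist. -/
def derivSupNorm (m : ℕ) (Ψ : ℝ × ℝ → ℂ) : ℝ≥0∞ :=
  ⨅ (D : ℕ × ℕ → ℝ × ℝ → ℂ) (_ : ∀ β : ℕ × ℕ, β.1 + β.2 = m → IsWeakDeriv β Ψ (D β)),
    ⨆ β ∈ Finset.HasAntidiagonal.antidiagonal m, supNorm (D β)

/-- `F = div (H₁, H₂)` in the sense of distributions in the half-plane. -/
structure IsWeakDiv (H₁ H₂ F : ℝ × ℝ → ℂ) : Prop where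
  locInt_fst : MeasureTheory.LocallyIntegrableOn H₁ upperHalf
  locInt_snd : MeasureTheory.LocallyIntegrableOn H₂ upperHalf
  locInt : MeasureTheory.LocallyIntegrableOn F upperHalf
  integral_eq : ∀ φ : ℝ × ℝ → ℝ, IsTestFunction φ →
    ∫ p in upperHalf, ((dx φ p : ℂ) * H₁ p + (dz φ p : ℂ) * H₂ p) =
      - ∫ p in upperHalf, (φ p : ℂ) * F p

/-- The source terms: square integrable functions on `𝕋 × ℝ₊` with zero horizontal mean. -/
structure IsSource (F : ℝ × ℝ → ℂ) : Prop where
  periodic : IsPeriodic F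
  memLp : MeasureTheory.MemLp F 2 cellMeasure
  mean_zero : ∀ᵐ z ∂(MeasureTheory.volume.restrict (Set.Ioi (0 : ℝ))),
    ∫ x in (0 : ℝ)..(2 * Real.pi), F (x, z) = 0

/-- The horizontal Fourier coefficient `F_k(y)`, so that `F(x, y) = ∑_k F_k(y) e^{ikx}`. -/
def coeff (F : ℝ × ℝ → ℂ) (k : ℤ) (y : ℝ) : ℂ :=
  (1 / (2 * Real.pi) : ℂ) *
    ∫ x in (0 : ℝ)..(2 * Real.pi), F (x, y) * Complex.exp (-(Complex.I * k * x))

/-- The Green function of `∂_z² - k²` on `ℝ₊` with the Dirichlet condition at `0`. -/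
def green (k : ℤ) (z y : ℝ) : ℝ :=
  if y < z then -(1 / |(k : ℝ)| * Real.exp (-|(k : ℝ)| * z) * Real.sinh (|(k : ℝ)| * y))
  else -(1 / |(k : ℝ)| * Real.exp (-|(k : ℝ)| * y) * Real.sinh (|(k : ℝ)| * z))

/-- `Ψ(x, z) = ∫₀^∞ ∑_{k ≠ 0} G_k(z, y) F_k(y) e^{ikx} dy`. -/
def potential (F : ℝ × ℝ → ℂ) : ℝ × ℝ → ℂ := fun p =>
  ∫ y in Set.Ioi (0 : ℝ), ∑' k : {k : ℤ // k ≠ 0},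
    (green k p.2 y : ℂ) * coeff F k y * Complex.exp (Complex.I * (k : ℤ) * p.1)

/-- `Ψ` is a solution of `ΔΨ = F` in `𝕋 × ℝ₊` (in the sense of distributions), `Ψ = 0` on
`𝕋 × {0}`. -/
structure SolvesDirichlet (F Ψ : ℝ × ℝ → ℂ) : Prop where
  periodic : IsPeriodic Ψ
  continuousOn : ContinuousOn Ψ (Set.univ ×ˢ Set.Ici 0)
  boundary : ∀ x : ℝ, Ψ (x, 0) = 0
  laplace : ∀ φ : ℝ × ℝ → ℝ, IsTestFunction φ →
    ∫ p in upperHalf, ((partialDeriv (2, 0) φ p + partialDeriv (0, 2) φ p : ℝ) : ℂ) * Ψ p =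
      ∫ p in upperHalf, (φ p : ℂ) * F p

end HalfCylinder

end

open MeasureTheory Set Filter Topology

noncomputable section

namespace HalfCylinder

/-! In horizontal Fourier modes the Dirichlet problem becomes u'' - κ² u = f on the half-line with
u(0) = 0 and κ = |k| ≥ 1. Its Green function is an image kernel: -κ⁻¹ times half the difference of U
= exp(-κ|z-y|) and W = exp(-κ(z+y)) (`green_eq`). Together with the odd kernel V, which is U with
the sign of z - y, these give all derivatives of the potential up to second order: their modes are
U, V, W applied to f and multiplied by factors of modulus at most κ, plus the local term f in the
second vertical derivative.

Square integrable theory. By Schur's test a kernel bounded by U has norm at most 2/κ on L² of the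
half-line, so second derivatives are bounded mode by mode, uniformly in k. `parseval` and
`exists_of_coeff` turn this into bounds on the half-cylinder; `isWeakDeriv_of_modes`,
`IsWeakDeriv.coeff_x` and `IsWeakDeriv.coeff_z` carry weak derivatives from modes to functions and
back. For higher orders, ∂ₓ commutes with the solution operator, and ∂_z²Ψ = F - ∂ₓ²Ψ trades two
vertical derivatives for two horizontal ones (`IsPeriodicFamily.potential_weak`,
`exists_potential_deriv`).

Fractional orders. The Gagliardo seminorm is an integral over increments, which Parseval splits into
modes (`gagliardoSq_eq`). If a mode and κ⁻¹ times its vertical derivative both have energy at most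
I, its seminorm is at most a constant times κ^{2σ} I (`modeIncrement_le`,
`exists_lintegral_step_le`). Conversely, horizontal increments of size about 1/κ already force the
seminorm of any mode with k ≠ 0 to be at least a constant times κ^{2σ} times its energy
(`le_lintegral_modeIncrement`). So comparisons of energies mode by mode give comparisons of
seminorms.

Logarithmic bounds of second derivatives. At fixed height difference τ, the sum over k is
convolution with ∑ m(k) exp(-|k|τ) e^{ikx}, where |m(k)| = |k|. Geometric series dominate it by a
multiple of the Poisson kernel, with mean 1/sinh τ. Heights τ ≥ δ therefore cost ‖F‖_∞ log(1/δ),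
while heights τ < δ are handled by Cauchy–Schwarz and cost √δ ∑|k| ‖F_k‖, at most a constant times
√δ (1 + ‖F‖_{H²}). The choice δ = (1 + ‖F‖_{H²})⁻² balances the two.

Gradient. Its modes are bounded by |k|^{-1/2} ‖F_k‖. This is summed by Cauchy–Schwarz up to |k| of
order (1 + ‖F‖_{H¹})², which costs the square root of a logarithm, and by the H¹ norm beyond. For F
= div H an integration by parts in the kernels (`kernelOp_weakDeriv`), without boundary terms,
reduces the gradient to the first order operators above acting on H₁ and H₂, plus H₂ minus its
horizontal mean. -/

/-- A locally integrable function times a test function is integrable. -/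
lemma integrable_testFunction_mul {E : Type*} [NormedAddCommGroup E] [MeasurableSpace E]
    [BorelSpace E] {μ : Measure E} {U : Set E} {f : E → ℂ} (hf : LocallyIntegrableOn f U μ)
    {φ : E → ℝ} (hc : Continuous φ) (hs : HasCompactSupport φ) (hU : tsupport φ ⊆ U) :
    Integrable (fun p => (φ p : ℂ) * f p) μ := by
  have hK : IsCompact (tsupport φ) := hs
  have h1 : IntegrableOn f (tsupport φ) μ := hf.integrableOn_compact_subset hU hK
  have h2 : IntegrableOn (fun p => (φ p : ℂ) * f p) (tsupport φ) μ :=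
    h1.continuousOn_mul (Complex.continuous_ofReal.comp hc).continuousOn hK
  refine (integrableOn_iff_integrable_of_support_subset ?_).1 h2
  intro p hp
  apply subset_tsupport
  intro h
  simp [h] at hp

lemma setIntegral_testFunction_mul {E : Type*} [NormedAddCommGroup E] [MeasurableSpace E]
    {μ : Measure E} {U : Set E} (f : E → ℂ)
    {φ : E → ℝ} (hU : tsupport φ ⊆ U) :
    ∫ p in U, (φ p : ℂ) * f p ∂μ = ∫ p, (φ p : ℂ) * f p ∂μ := by
  refine setIntegral_eq_integral_of_forall_compl_eq_zero fun p hp => ?_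
  have : φ p = 0 := image_eq_zero_of_notMem_tsupport fun h => hp (hU h)
  simp [this]

lemma _root_.MeasureTheory.LocallyIntegrableOn.congr_ae {E : Type*} [TopologicalSpace E]
    [LocallyCompactSpace E] [T2Space E]
    [MeasurableSpace E] {μ : Measure E} {U : Set E} {f g : E → ℂ}
    (hf : LocallyIntegrableOn f U μ) (hU : IsOpen U) (h : ∀ᵐ p ∂(μ.restrict U), f p = g p) :
    LocallyIntegrableOn g U μ := by
  rw [locallyIntegrableOn_iff hU.isLocallyClosed]
  intro K hK hKc
  exact (hf.integrableOn_compact_subset hK hKc).congr (ae_restrict_of_ae_restrict_of_subset hK h)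

/-! ### Weak derivatives on the half-line -/

/-- Test functions on the half-line. -/
structure IsTestFunctionHL (η : ℝ → ℝ) : Prop where
  smooth : ContDiff ℝ ∞ η
  compact : HasCompactSupport η
  support : tsupport η ⊆ Ioi 0

/-- `g` is the weak derivative of `f` on the half-line `(0, ∞)`. -/
structure IsWeakDerivHL (f g : ℝ → ℂ) : Prop where
  locInt : LocallyIntegrableOn f (Ioi 0)
  locInt_deriv : LocallyIntegrableOn g (Ioi 0)
  integral_eq : ∀ η : ℝ → ℝ, IsTestFunctionHL η →
    ∫ z in Ioi 0, ((deriv η z : ℝ) : ℂ) * f z = - ∫ z in Ioi 0, (η z : ℂ) * g z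

lemma IsTestFunctionHL.deriv {η : ℝ → ℝ} (h : IsTestFunctionHL η) :
    IsTestFunctionHL (deriv η) where
  smooth := by
    have := h.smooth
    exact (contDiff_infty_iff_deriv.1 this).2
  compact := h.compact.deriv
  support := (tsupport_deriv_subset).trans h.support

lemma IsTestFunctionHL.integrable_mul {η : ℝ → ℝ} (h : IsTestFunctionHL η) {f : ℝ → ℂ}
    (hf : LocallyIntegrableOn f (Ioi 0)) : Integrable fun z => (η z : ℂ) * f z :=
  integrable_testFunction_mul hf h.smooth.continuous h.compact h.support

lemma IsTestFunctionHL.mul_smooth {η a : ℝ → ℝ} (h : IsTestFunctionHL η) (ha : ContDiff ℝ ∞ a) :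
    IsTestFunctionHL (fun z => a z * η z) where
  smooth := ha.mul h.smooth
  compact := h.compact.mul_left
  support := (tsupport_mul_subset_right).trans h.support

lemma ae_eq_of_integral_testFunctionHL {f g : ℝ → ℂ} (hf : LocallyIntegrableOn f (Ioi 0))
    (hg : LocallyIntegrableOn g (Ioi 0))
    (h : ∀ η : ℝ → ℝ, IsTestFunctionHL η →
      ∫ z in Ioi 0, (η z : ℂ) * f z = ∫ z in Ioi 0, (η z : ℂ) * g z) :
    ∀ᵐ z ∂(volume.restrict (Ioi (0 : ℝ))), f z = g z := by
  rw [ae_restrict_iff' measurableSet_Ioi]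
  have := isOpen_Ioi.ae_eq_zero_of_integral_contDiff_smul_eq_zero (hf.sub hg) (μ := volume) ?_
  · filter_upwards [this] with z hz hz0
    exact sub_eq_zero.1 (hz hz0)
  · intro η h1 h2 h3
    have hη : IsTestFunctionHL η := ⟨h1, h2, h3⟩
    have := h η hη
    rw [setIntegral_testFunction_mul f h3, setIntegral_testFunction_mul g h3] at this
    rw [← sub_eq_zero, ← integral_sub (hη.integrable_mul hf) (hη.integrable_mul hg)] at this
    rw [← this]
    congr 1
    ext z
    simp [mul_sub]

namespace IsWeakDerivHL

variable {f g f₁ g₁ : ℝ → ℂ}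

lemma add (h : IsWeakDerivHL f g) (h₁ : IsWeakDerivHL f₁ g₁) :
    IsWeakDerivHL (fun z => f z + f₁ z) (fun z => g z + g₁ z) where
  locInt := h.locInt.add h₁.locInt
  locInt_deriv := h.locInt_deriv.add h₁.locInt_deriv
  integral_eq η hη := by
    simp only [mul_add]
    rw [integral_add (hη.deriv.integrable_mul h.locInt).integrableOn
        (hη.deriv.integrable_mul h₁.locInt).integrableOn,
      integral_add (hη.integrable_mul h.locInt_deriv).integrableOn
        (hη.integrable_mul h₁.locInt_deriv).integrableOn, h.integral_eq η hη,
      h₁.integral_eq η hη]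
    ring

lemma const_mul (h : IsWeakDerivHL f g) (c : ℂ) :
    IsWeakDerivHL (fun z => c * f z) (fun z => c * g z) where
  locInt := h.locInt.smul c
  locInt_deriv := h.locInt_deriv.smul c
  integral_eq η hη := by
    simp only [mul_left_comm _ c]
    rw [integral_const_mul, integral_const_mul, h.integral_eq η hη]
    ring

lemma congr (h : IsWeakDerivHL f g) (hf : ∀ᵐ z ∂(volume.restrict (Ioi (0 : ℝ))), f z = f₁ z)
    (hg : ∀ᵐ z ∂(volume.restrict (Ioi (0 : ℝ))), g z = g₁ z) : IsWeakDerivHL f₁ g₁ where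
  locInt := h.locInt.congr_ae isOpen_Ioi hf
  locInt_deriv := h.locInt_deriv.congr_ae isOpen_Ioi hg
  integral_eq η hη := by
    have h1 : ∫ z in Ioi 0, ((deriv η z : ℝ) : ℂ) * f z = ∫ z in Ioi 0, ((deriv η z : ℝ) : ℂ) * f₁ z :=
      integral_congr_ae (hf.mono fun z hz => by simp only [hz])
    have h2 : ∫ z in Ioi 0, (η z : ℂ) * g z = ∫ z in Ioi 0, (η z : ℂ) * g₁ z :=
      integral_congr_ae (hg.mono fun z hz => by simp only [hz])
    rw [← h1, ← h2, h.integral_eq η hη]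

lemma sub (h : IsWeakDerivHL f g) (h₁ : IsWeakDerivHL f₁ g₁) :
    IsWeakDerivHL (fun z => f z - f₁ z) (fun z => g z - g₁ z) := by
  have := h.add (h₁.const_mul (-1))
  simpa [sub_eq_add_neg] using this

/-- The product rule with a smooth factor. -/
lemma smooth_mul (h : IsWeakDerivHL f g) {a : ℝ → ℝ} (ha : ContDiff ℝ ∞ a) :
    IsWeakDerivHL (fun z => a z * f z) (fun z => deriv a z * f z + a z * g z) := by
  have hd : ContDiff ℝ ∞ (deriv a) := (contDiff_infty_iff_deriv.1 ha).2
  have hl : ∀ {b : ℝ → ℝ} {u : ℝ → ℂ}, ContDiff ℝ ∞ b → LocallyIntegrableOn u (Ioi 0) →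
      LocallyIntegrableOn (fun z => (b z : ℂ) * u z) (Ioi 0) := fun hb hu =>
    hu.continuousOn_mul (Complex.continuous_ofReal.comp hb.continuous).continuousOn
      isOpen_Ioi.isLocallyClosed
  refine ⟨hl ha h.locInt, (hl hd h.locInt).add (hl ha h.locInt_deriv), fun η hη => ?_⟩
  have h1 := h.integral_eq _ (hη.mul_smooth ha)
  have h2 : ∀ z, deriv (fun z => a z * η z) z = deriv a z * η z + a z * deriv η z := fun z =>
    deriv_mul (ha.differentiable (by simp) z) (hη.smooth.differentiable (by simp) z)
  have h3 := (hη.mul_smooth hd).integrable_mul h.locInt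
  have h4 := (hη.deriv.mul_smooth ha).integrable_mul h.locInt
  have h5 := (hη.mul_smooth ha).integrable_mul h.locInt_deriv
  have h6 : ∫ z in Ioi 0, ((deriv (fun z => a z * η z) z : ℝ) : ℂ) * f z =
      (∫ z in Ioi 0, ((deriv a z * η z : ℝ) : ℂ) * f z) +
      ∫ z in Ioi 0, ((a z * deriv η z : ℝ) : ℂ) * f z := by
    rw [← integral_add h3.integrableOn h4.integrableOn]
    congr 1
    ext z
    rw [h2]
    push_cast
    ring
  have h7 : ∫ z in Ioi 0, (η z : ℂ) * (deriv a z * f z + a z * g z) =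
      (∫ z in Ioi 0, ((deriv a z * η z : ℝ) : ℂ) * f z) +
      ∫ z in Ioi 0, ((a z * η z : ℝ) : ℂ) * g z := by
    rw [← integral_add h3.integrableOn h5.integrableOn]
    congr 1
    ext z
    push_cast
    ring
  have h8 : ∫ z in Ioi 0, ((deriv η z : ℝ) : ℂ) * (a z * f z) =
      ∫ z in Ioi 0, ((a z * deriv η z : ℝ) : ℂ) * f z := by
    congr 1
    ext z
    push_cast
    ring
  rw [h7, h8]
  rw [h6] at h1
  linear_combination h1

end IsWeakDerivHL

/-- Constants have weak derivative zero. -/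
lemma isWeakDerivHL_const (c : ℂ) : IsWeakDerivHL (fun _ => c) (fun _ => 0) where
  locInt := (locallyIntegrable_const c).locallyIntegrableOn _
  locInt_deriv := (locallyIntegrable_const 0).locallyIntegrableOn _
  integral_eq η hη := by
    have h0 : ∫ z, deriv η z = 0 :=
      integral_eq_zero_of_hasDerivAt_of_integrable
        (fun z => (hη.smooth.differentiable (by simp) z).hasDerivAt)
        (hη.deriv.smooth.continuous.integrable_of_hasCompactSupport hη.deriv.compact)
        (hη.smooth.continuous.integrable_of_hasCompactSupport hη.compact)
    rw [setIntegral_testFunction_mul _ hη.deriv.support, integral_mul_const,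
      integral_complex_ofReal, h0]
    simp

/-- A primitive has the expected weak derivative. -/
lemma isWeakDerivHL_primitive {g : ℝ → ℂ} (hg : ∀ R : ℝ, IntegrableOn g (Ioc 0 R)) :
    IsWeakDerivHL (fun z => ∫ y in (0 : ℝ)..z, g y) g where
  locInt := by
    refine ContinuousOn.locallyIntegrableOn ?_ measurableSet_Ioi
    intro z hz
    have h1 : ContinuousOn (fun z => ∫ y in (0 : ℝ)..z, g y) (Icc 0 (z + 1)) := by
      have := intervalIntegral.continuousOn_primitive_interval (μ := volume) (f := g) (a := 0)
        (b := z + 1) ?_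
      · rwa [uIcc_of_le (by linarith [mem_Ioi.1 hz])] at this
      · rw [uIcc_of_le (by linarith [mem_Ioi.1 hz]), integrableOn_Icc_iff_integrableOn_Ioc]
        exact hg _
    exact (h1.continuousAt (Icc_mem_nhds hz (by linarith))).continuousWithinAt
  locInt_deriv := by
    rw [locallyIntegrableOn_iff isOpen_Ioi.isLocallyClosed]
    intro K hK hKc
    obtain ⟨R, hR⟩ := hKc.bddAbove
    exact (hg R).mono_set fun z hz => ⟨hK hz, hR hz⟩
  integral_eq η hη := by
    obtain ⟨R, hR⟩ := hη.compact.bddAbove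
    have hvan : ∀ z, R < z → η z = 0 := fun z hz =>
      image_eq_zero_of_notMem_tsupport fun h => absurd (hR h) (not_le.2 hz)
    have hvan' : ∀ z, R < z → deriv η z = 0 := fun z hz =>
      image_eq_zero_of_notMem_tsupport fun h => absurd (hR (tsupport_deriv_subset h)) (not_le.2 hz)
    have red : ∀ u : ℝ → ℂ, (∀ z, R < z → u z = 0) →
        ∫ z in Ioi 0, u z = ∫ z in Ioc 0 R, u z := fun u hu => by
      refine setIntegral_eq_of_subset_of_forall_sdiff_eq_zero measurableSet_Ioi
        Ioc_subset_Ioi_self fun z hz => hu z ?_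
      by_contra h
      exact hz.2 ⟨hz.1, not_lt.1 h⟩
    rw [red _ fun z hz => by simp [hvan' z hz], red _ fun z hz => by simp [hvan z hz]]
    set μ := volume.restrict (Ioc (0 : ℝ) R) with hμ
    -- Fubini on the triangle y ≤ z: integrating η'(z) g(y) first over y gives the left side, first
    -- over z gives (η(R) - η(y)) g(y). Only integrability of g is used.
    let k : ℝ × ℝ → ℂ := indicator {p | p.2 ≤ p.1} fun p => ((deriv η p.1 : ℝ) : ℂ) * g p.2
    have hk : Integrable k (μ.prod μ) := by
      refine Integrable.indicator ?_ (measurableSet_le measurable_snd measurable_fst)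
      refine Integrable.mul_prod (f := fun z => ((deriv η z : ℝ) : ℂ)) ?_ (hg R)
      exact ((hη.deriv.smooth.continuous.integrable_of_hasCompactSupport
        hη.deriv.compact).ofReal).integrableOn
    have h1 : ∀ z ∈ Ioc 0 R, ((deriv η z : ℝ) : ℂ) * ∫ y in (0 : ℝ)..z, g y = ∫ y, k (z, y) ∂μ := by
      intro z hz
      have e : ∀ y, k (z, y) = indicator (Iic z) (fun y => ((deriv η z : ℝ) : ℂ) * g y) y := fun y => by
        simp [k, indicator]
      simp only [e]
      rw [integral_indicator measurableSet_Iic, hμ, Measure.restrict_restrict measurableSet_Iic,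
        integral_const_mul, intervalIntegral.integral_of_le hz.1.le]
      congr 3
      ext y
      simp only [mem_inter_iff, mem_Iic, mem_Ioc]
      constructor
      · exact fun h => ⟨h.2, h.1, h.2.trans hz.2⟩
      · exact fun h => ⟨h.2.1, h.1⟩
    have h2 : ∀ y ∈ Ioc 0 R, -((η y : ℂ) * g y) = ∫ z, k (z, y) ∂μ := by
      intro y hy
      have e : ∀ z, k (z, y) = indicator (Ici y) (fun z => ((deriv η z : ℝ) : ℂ) * g y) z := fun z => by
        simp [k, indicator]
      simp only [e]
      rw [integral_indicator measurableSet_Ici, hμ, Measure.restrict_restrict measurableSet_Ici,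
        integral_mul_const]
      have : Ici y ∩ Ioc 0 R = Icc y R := by
        ext z
        simp only [mem_inter_iff, mem_Ici, mem_Ioc, mem_Icc]
        constructor
        · exact fun h => ⟨h.1, h.2.2⟩
        · exact fun h => ⟨h.1, hy.1.trans_le h.1, h.2⟩
      rw [this, integral_Icc_eq_integral_Ioc, ← intervalIntegral.integral_of_le hy.2,
        intervalIntegral.integral_ofReal, intervalIntegral.integral_deriv_eq_sub
          (fun z _ => hη.smooth.differentiable (by simp) z)
          (hη.deriv.smooth.continuous.intervalIntegrable _ _)]
      -- R is merely an upper bound of the support and may belong to it, so η(R) = 0 comes from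
      -- continuity and the vanishing of η beyond R.
      have hR0 : η R = 0 := by
        have hcl : IsClosed {z | η z = 0} := isClosed_eq hη.smooth.continuous continuous_const
        have : R ∈ closure (Ioi R) := by simp
        exact hcl.closure_subset_iff.2 (fun z hz => hvan z hz) this
      rw [hR0]
      push_cast
      ring
    rw [← integral_neg, setIntegral_congr_fun measurableSet_Ioc h1,
      setIntegral_congr_fun measurableSet_Ioc h2]
    exact integral_integral_swap hk

/-- A function on the half-line with vanishing weak derivative is constant. -/
lemma IsWeakDerivHL.ae_eq_const {f : ℝ → ℂ} (h : IsWeakDerivHL f fun _ => 0) :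
    ∃ c : ℂ, ∀ᵐ z ∂(volume.restrict (Ioi (0 : ℝ))), f z = c := by
  -- The du Bois-Reymond argument. With η₀ of integral one, supported in [1, 3], the function η -
  -- (∫η) η₀ has mean zero, hence is the derivative of a test function and is annihilated by f. The
  -- constant is therefore ∫ η₀ f.
  let b : ContDiffBump (2 : ℝ) := ⟨1 / 2, 1, by norm_num, by norm_num⟩
  let η₀ : ℝ → ℝ := b.normed volume
  have hη₀ : IsTestFunctionHL η₀ := by
    refine ⟨b.contDiff_normed, b.hasCompactSupport_normed, ?_⟩
    rw [b.tsupport_normed_eq, Real.closedBall_eq_Icc]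
    intro z hz
    have := hz.1
    norm_num [b] at this
    exact lt_of_lt_of_le zero_lt_one this
  refine ⟨∫ z in Ioi 0, (η₀ z : ℂ) * f z, ?_⟩
  refine ae_eq_of_integral_testFunctionHL h.locInt
    ((locallyIntegrable_const _).locallyIntegrableOn _) fun η hη => ?_
  set m : ℝ := ∫ z, η z with hm
  let θ : ℝ → ℝ := fun z => η z - m * η₀ z
  have hθi : Integrable θ :=
    (hη.smooth.continuous.integrable_of_hasCompactSupport hη.compact).sub
      ((hη₀.smooth.continuous.integrable_of_hasCompactSupport hη₀.compact).const_mul m)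
  have hθ0 : ∫ z, θ z = 0 := by
    rw [integral_sub (hη.smooth.continuous.integrable_of_hasCompactSupport hη.compact)
      ((hη₀.smooth.continuous.integrable_of_hasCompactSupport hη₀.compact).const_mul m),
      integral_const_mul, b.integral_normed, mul_one, hm, sub_self]
  have hθs : ContDiff ℝ ∞ θ := hη.smooth.sub (contDiff_const.mul hη₀.smooth)
  let Θ : ℝ → ℝ := fun z => ∫ y in (0 : ℝ)..z, θ y
  have hΘd : ∀ z, HasDerivAt Θ (θ z) z := fun z =>
    intervalIntegral.integral_hasDerivAt_right (hθs.continuous.intervalIntegrable _ _)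
      (hθs.continuous.stronglyMeasurableAtFilter _ _) hθs.continuous.continuousAt
  have hΘd' : deriv Θ = θ := funext fun z => (hΘd z).deriv
  -- The support of the primitive must stay away from 0, so r is the minimum of the union of the two
  -- compact supports, which is positive.
  obtain ⟨r, hr, R, hR⟩ : ∃ r > 0, ∃ R, ∀ z, z ∉ Icc r R → θ z = 0 := by
    have hK : IsCompact (tsupport η ∪ tsupport η₀) := hη.compact.union hη₀.compact
    have hsub : tsupport η ∪ tsupport η₀ ⊆ Ioi 0 := union_subset hη.support hη₀.support
    have hne : (tsupport η ∪ tsupport η₀).Nonempty := by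
      refine ⟨2, Or.inr (subset_tsupport _ ?_)⟩
      intro h
      have h1 : (2 : ℝ) ∈ Function.support η₀ := by
        rw [b.support_normed_eq]
        exact Metric.mem_ball_self (by norm_num [b])
      exact h1 h
    obtain ⟨R, hR⟩ := hK.bddAbove
    refine ⟨_, hsub (hK.sInf_mem hne), R, fun z hz => ?_⟩
    have hz' : z ∉ tsupport η ∪ tsupport η₀ := fun h =>
      hz ⟨csInf_le hK.bddBelow h, hR h⟩
    have h1 : η z = 0 := image_eq_zero_of_notMem_tsupport fun h => hz' (Or.inl h)
    have h2 : η₀ z = 0 := image_eq_zero_of_notMem_tsupport fun h => hz' (Or.inr h)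
    simp [θ, h1, h2]
  have hΘ0 : ∀ z, z ∉ Icc r R → Θ z = 0 := by
    intro z hz
    by_cases hzr : z < r
    · refine intervalIntegral.integral_zero_ae (Eventually.of_forall fun y hy => hR y fun h => ?_)
      have := hy.2
      rcases le_total 0 z with h0 | h0
      · rw [max_eq_right h0] at this
        linarith [h.1]
      · rw [max_eq_left h0] at this
        linarith [h.1]
    · have hzR : R < z := by
        by_contra h
        exact hz ⟨not_lt.1 hzr, not_lt.1 h⟩
      have hz0 : 0 ≤ z := hr.le.trans (not_lt.1 hzr)
      rw [← hθ0]
      simp only [Θ]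
      rw [intervalIntegral.integral_of_le hz0]
      refine setIntegral_eq_integral_of_forall_compl_eq_zero fun y hy => hR y fun h => hy ?_
      exact ⟨hr.trans_le h.1, h.2.trans hzR.le⟩
  have hΘ : IsTestFunctionHL Θ := by
    refine ⟨contDiff_infty_iff_deriv.2 ⟨fun z => (hΘd z).differentiableAt, hΘd' ▸ hθs⟩,
      HasCompactSupport.intro isCompact_Icc hΘ0, ?_⟩
    refine (closure_minimal (fun z hz => ?_) isClosed_Icc).trans
      (fun z (hz : z ∈ Icc r R) => hr.trans_le hz.1)
    by_contra h
    exact hz (hΘ0 z h)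
  have key := h.integral_eq Θ hΘ
  rw [hΘd'] at key
  simp only [mul_zero, integral_zero, neg_zero] at key
  have e : ∫ z in Ioi 0, ((θ z : ℝ) : ℂ) * f z =
      (∫ z in Ioi 0, (η z : ℂ) * f z) - m * ∫ z in Ioi 0, (η₀ z : ℂ) * f z := by
    rw [← integral_const_mul, ← integral_sub (hη.integrable_mul h.locInt).integrableOn
      ((hη₀.integrable_mul h.locInt).integrableOn.const_mul _)]
    congr 1
    ext z
    simp only [θ]
    push_cast
    ring
  rw [e, sub_eq_zero] at key
  rw [key, integral_mul_const]
  congr 1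
  have := setIntegral_testFunction_mul (μ := volume) (fun _ => (1 : ℂ)) hη.support
  simp only [mul_one] at this
  rw [this, integral_complex_ofReal]

/-! ### Integral operators with exponentially decaying kernels -/

lemma sq_lintegral_mul_le {α : Type*} [MeasurableSpace α] {μ : Measure α} {f g : α → ℝ≥0∞}
    (hf : AEMeasurable f μ) (hg : AEMeasurable g μ) :
    (∫⁻ a, f a * g a ∂μ) ^ 2 ≤ (∫⁻ a, f a ^ 2 ∂μ) * ∫⁻ a, g a ^ 2 ∂μ := by
  have h := ENNReal.lintegral_mul_le_Lp_mul_Lq μ Real.HolderConjugate.two_two hf hg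
  have h2 : ∀ x : ℝ≥0∞, x ^ (2 : ℝ) = x ^ 2 := fun x => by
    rw [← ENNReal.rpow_natCast]; norm_num
  have h3 : ∀ x : ℝ≥0∞, (x ^ (1 / 2 : ℝ)) ^ 2 = x := fun x => by
    rw [← ENNReal.rpow_natCast, ← ENNReal.rpow_mul]; norm_num
  simp only [h2, Pi.mul_apply] at h
  calc _ ≤ _ := pow_le_pow_left' h 2
    _ = _ := by rw [mul_pow, h3, h3]

lemma eLpNorm_two_sq {α : Type*} [MeasurableSpace α] (f : α → ℂ) (μ : Measure α) :
    eLpNorm f 2 μ ^ 2 = ∫⁻ a, ‖f a‖ₑ ^ 2 ∂μ := by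
  have := eLpNorm_nnreal_pow_eq_lintegral (f := f) (μ := μ) (p := 2) (by norm_num)
  simp only [NNReal.coe_ofNat, ENNReal.coe_ofNat] at this
  have h2 : ∀ x : ℝ≥0∞, x ^ (2 : ℝ) = x ^ 2 := fun x => by
    rw [← ENNReal.rpow_natCast]; norm_num
  simpa only [h2] using this

lemma memLp_two_iff {α : Type*} [MeasurableSpace α] {f : α → ℂ} {μ : Measure α} :
    MemLp f 2 μ ↔ AEStronglyMeasurable f μ ∧ ∫⁻ a, ‖f a‖ₑ ^ 2 ∂μ ≠ ⊤ := by
  rw [← eLpNorm_two_sq, MemLp]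
  simp [lt_top_iff_ne_top]

lemma lintegral_exp_neg_abs {c : ℝ} (hc : 0 < c) (z : ℝ) :
    ∫⁻ y, ENNReal.ofReal (Real.exp (-c * |z - y|)) = ENNReal.ofReal (2 / c) := by
  have h0 : ∫ x : ℝ, Real.exp (-c * |x|) = 2 / c := by
    rw [integral_comp_abs (f := fun x => Real.exp (-c * x)), integral_exp_mul_Ioi (by linarith)]
    simp
    ring
  have h1 : Integrable fun x : ℝ => Real.exp (-c * |x|) := by
    -- The integral of a non-integrable function is 0 by convention, so the nonzero value 2/c
    -- already proves integrability.
    refine not_imp_comm.1 integral_undef ?_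
    rw [h0]
    positivity
  rw [lintegral_sub_left_eq_self (fun y => ENNReal.ofReal (Real.exp (-c * |y|))) z,
    ← ofReal_integral_eq_lintegral_ofReal h1 (Eventually.of_forall fun _ => (Real.exp_pos _).le), h0]

/-- Kernels on the half-line dominated by `exp (-κ |z - y|)`. -/
structure IsExpKernel (κ : ℝ) (K : ℝ → ℝ → ℝ) : Prop where
  measurable : Measurable (Function.uncurry K)
  bound : ∀ z y, 0 ≤ z → 0 < y → |K z y| ≤ Real.exp (-κ * |z - y|)

/-- The integral operator on the half-line with kernel `K`. -/
def kernelOp (K : ℝ → ℝ → ℝ) (f : ℝ → ℂ) (z : ℝ) : ℂ := ∫ y in Ioi 0, (K z y : ℂ) * f y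

section

variable {κ : ℝ} {K : ℝ → ℝ → ℝ} {f : ℝ → ℂ}

/-- Cauchy–Schwarz with ∫ exp(-2κ|z-y|) dy = 1/κ. This pointwise gain of κ^{-1/2} makes the series
of the potential converge uniformly and drives the gradient bound. -/
lemma sq_lintegral_exp_mul_le (hκ : 0 < κ) (hf : AEStronglyMeasurable f (volume.restrict (Ioi 0)))
    (z : ℝ) :
    (∫⁻ y in Ioi 0, ENNReal.ofReal (Real.exp (-κ * |z - y|)) * ‖f y‖ₑ) ^ 2 ≤
      ENNReal.ofReal (1 / κ) * ∫⁻ y in Ioi 0, ‖f y‖ₑ ^ 2 := by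
  refine (sq_lintegral_mul_le ?_ hf.enorm).trans ?_
  · exact (by fun_prop : Measurable fun y => ENNReal.ofReal (Real.exp (-κ * |z - y|))).aemeasurable
  gcongr
  refine (setLIntegral_le_lintegral _ _).trans ?_
  have h := lintegral_exp_neg_abs (c := 2 * κ) (by linarith) z
  rw [show 2 / (2 * κ) = 1 / κ by field_simp] at h
  rw [← h]
  refine le_of_eq (lintegral_congr fun y => ?_)
  rw [← ENNReal.ofReal_pow (Real.exp_pos _).le, ← Real.exp_nat_mul]
  congr 2
  push_cast
  ring

lemma IsExpKernel.enorm_le (hK : IsExpKernel κ K) {z y : ℝ} (hz : 0 ≤ z) (hy : 0 < y) :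
    ‖(K z y : ℂ) * f y‖ₑ ≤ ENNReal.ofReal (Real.exp (-κ * |z - y|)) * ‖f y‖ₑ := by
  rw [enorm_mul]
  gcongr
  rw [← ofReal_norm, Complex.norm_real]
  exact ENNReal.ofReal_le_ofReal (hK.bound z y hz hy)

lemma IsExpKernel.lintegral_enorm_le (hK : IsExpKernel κ K) {z : ℝ} (hz : 0 ≤ z) :
    ∫⁻ y in Ioi 0, ‖(K z y : ℂ) * f y‖ₑ ≤
      ∫⁻ y in Ioi 0, ENNReal.ofReal (Real.exp (-κ * |z - y|)) * ‖f y‖ₑ :=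
  setLIntegral_mono' measurableSet_Ioi fun _ hy => hK.enorm_le hz hy

lemma IsExpKernel.aestronglyMeasurable (hK : IsExpKernel κ K)
    (hf : AEStronglyMeasurable f (volume.restrict (Ioi 0))) (z : ℝ) :
    AEStronglyMeasurable (fun y => (K z y : ℂ) * f y) (volume.restrict (Ioi 0)) := by
  refine AEStronglyMeasurable.mul ?_ hf
  exact (Complex.measurable_ofReal.comp
    (hK.measurable.comp measurable_prodMk_left)).aestronglyMeasurable

lemma IsExpKernel.integrable (hK : IsExpKernel κ K) (hκ : 0 < κ)
    (hf : MemLp f 2 (volume.restrict (Ioi 0))) {z : ℝ} (hz : 0 ≤ z) :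
    IntegrableOn (fun y => (K z y : ℂ) * f y) (Ioi 0) := by
  refine ⟨hK.aestronglyMeasurable hf.1 z, (hK.lintegral_enorm_le hz).trans_lt ?_⟩
  have h := sq_lintegral_exp_mul_le hκ hf.1 z
  have h2 : ENNReal.ofReal (1 / κ) * ∫⁻ y in Ioi 0, ‖f y‖ₑ ^ 2 < ⊤ :=
    ENNReal.mul_lt_top ENNReal.ofReal_lt_top (memLp_two_iff.1 hf).2.lt_top
  exact (ENNReal.pow_lt_top_iff.1 (h.trans_lt h2)).resolve_right (by norm_num)

lemma IsExpKernel.aestronglyMeasurable_kernelOp (hK : IsExpKernel κ K)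
    (hf : AEStronglyMeasurable f (volume.restrict (Ioi 0))) :
    AEStronglyMeasurable (kernelOp K f) (volume.restrict (Ioi 0)) := by
  refine AEStronglyMeasurable.integral_prod_right' (f := fun p : ℝ × ℝ => (K p.1 p.2 : ℂ) * f p.2) ?_
  refine AEStronglyMeasurable.mul ?_ hf.comp_snd
  exact (Complex.measurable_ofReal.comp hK.measurable).aestronglyMeasurable

/-- Young's inequality for exponential kernels. -/
lemma IsExpKernel.lintegral_kernelOp_sq_le (hK : IsExpKernel κ K) (hκ : 0 < κ)
    (hf : AEStronglyMeasurable f (volume.restrict (Ioi 0))) :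
    ∫⁻ z in Ioi 0, ‖kernelOp K f z‖ₑ ^ 2 ≤
      ENNReal.ofReal (2 / κ) ^ 2 * ∫⁻ y in Ioi 0, ‖f y‖ₑ ^ 2 := by
  set E : ℝ → ℝ → ℝ≥0∞ := fun z y => ENNReal.ofReal (Real.exp (-κ * |z - y|)) with hE
  have hEm : Measurable (Function.uncurry E) := by
    have : Measurable fun p : ℝ × ℝ => ENNReal.ofReal (Real.exp (-κ * |p.1 - p.2|)) := by fun_prop
    exact this
  have h1 : ∀ z ∈ Ioi (0 : ℝ), ‖kernelOp K f z‖ₑ ^ 2 ≤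
      ENNReal.ofReal (2 / κ) * ∫⁻ y in Ioi 0, E z y * ‖f y‖ₑ ^ 2 := by
    intro z hz
    refine (pow_le_pow_left' ((enorm_integral_le_lintegral_enorm _).trans
      (hK.lintegral_enorm_le (le_of_lt hz))) 2).trans ?_
    -- Schur's test: the kernel is written as r² and Cauchy–Schwarz is applied to r · (r f). The
    -- mass 2/κ then appears once from the y-integral and once from the z-integral.
    set r : ℝ → ℝ≥0∞ := fun y => ENNReal.ofReal (Real.exp (-κ * |z - y| / 2)) with hr
    have hrr : ∀ y, ENNReal.ofReal (Real.exp (-κ * |z - y|)) = r y ^ 2 := fun y => by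
      rw [hr, ← ENNReal.ofReal_pow (Real.exp_pos _).le, ← Real.exp_nat_mul]
      congr 2
      push_cast
      ring
    have hrm : Measurable r := by simp only [hr]; fun_prop
    have e : ∀ y, ENNReal.ofReal (Real.exp (-κ * |z - y|)) * ‖f y‖ₑ = r y * (r y * ‖f y‖ₑ) :=
      fun y => by rw [hrr]; ring
    simp only [e]
    refine (sq_lintegral_mul_le hrm.aemeasurable (hrm.aemeasurable.mul hf.enorm)).trans ?_
    gcongr
    · rw [← lintegral_exp_neg_abs hκ z]
      refine (setLIntegral_le_lintegral _ _).trans (le_of_eq (lintegral_congr fun y => (hrr y).symm))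
    · simp only [Pi.mul_apply, mul_pow, hE, hrr, le_refl]
  have hjm : AEMeasurable (Function.uncurry fun z y => E z y * ‖f y‖ₑ ^ 2)
      ((volume.restrict (Ioi 0)).prod (volume.restrict (Ioi 0))) :=
    hEm.aemeasurable.mul ((hf.comp_snd).enorm.pow_const 2)
  calc _ ≤ ∫⁻ z in Ioi 0, ENNReal.ofReal (2 / κ) * ∫⁻ y in Ioi 0, E z y * ‖f y‖ₑ ^ 2 :=
        setLIntegral_mono' measurableSet_Ioi h1
    _ = ENNReal.ofReal (2 / κ) * ∫⁻ z in Ioi 0, ∫⁻ y in Ioi 0, E z y * ‖f y‖ₑ ^ 2 :=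
        lintegral_const_mul' _ _ ENNReal.ofReal_ne_top
    _ = ENNReal.ofReal (2 / κ) * ∫⁻ y in Ioi 0, ∫⁻ z in Ioi 0, E z y * ‖f y‖ₑ ^ 2 := by
        rw [lintegral_lintegral_swap hjm]
    _ ≤ ENNReal.ofReal (2 / κ) * ∫⁻ y in Ioi 0, ENNReal.ofReal (2 / κ) * ‖f y‖ₑ ^ 2 := by
        gcongr with y
        have hm : Measurable fun z => E z y := hEm.comp measurable_prodMk_right
        rw [lintegral_mul_const _ hm]
        gcongr
        rw [← lintegral_exp_neg_abs hκ y]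
        refine (setLIntegral_le_lintegral _ _).trans (le_of_eq (lintegral_congr fun z => ?_))
        rw [hE, abs_sub_comm]
    _ = _ := by
        rw [lintegral_const_mul' _ _ ENNReal.ofReal_ne_top]
        ring

lemma IsExpKernel.memLp_kernelOp (hK : IsExpKernel κ K) (hκ : 0 < κ)
    (hf : MemLp f 2 (volume.restrict (Ioi 0))) :
    MemLp (kernelOp K f) 2 (volume.restrict (Ioi 0)) := by
  rw [memLp_two_iff]
  refine ⟨hK.aestronglyMeasurable_kernelOp hf.1, ne_top_of_le_ne_top ?_
    (hK.lintegral_kernelOp_sq_le hκ hf.1)⟩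
  exact ENNReal.mul_ne_top (by finiteness) (memLp_two_iff.1 hf).2

end

/-! ### The even, odd and reflected kernels and their differential equations -/

/-- The even exponential kernel. -/
def kerU (κ z y : ℝ) : ℝ := Real.exp (-κ * |z - y|)

/-- The odd exponential kernel. -/
def kerV (κ z y : ℝ) : ℝ := if y < z then Real.exp (-κ * |z - y|) else -Real.exp (-κ * |z - y|)

/-- The reflected exponential kernel. -/
def kerW (κ z y : ℝ) : ℝ := Real.exp (-κ * |z + y|)

lemma isExpKernel_kerU (κ : ℝ) : IsExpKernel κ (kerU κ) where
  measurable := by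
    have : Measurable fun p : ℝ × ℝ => Real.exp (-κ * |p.1 - p.2|) := by fun_prop
    exact this
  bound z y _ _ := by rw [kerU, abs_of_pos (Real.exp_pos _)]

lemma isExpKernel_kerV (κ : ℝ) : IsExpKernel κ (kerV κ) where
  measurable := by
    have : Measurable fun p : ℝ × ℝ => Real.exp (-κ * |p.1 - p.2|) := by fun_prop
    exact Measurable.ite (measurableSet_lt measurable_snd measurable_fst) this this.neg
  bound z y _ _ := by
    unfold kerV
    split_ifs
    · rw [abs_of_pos (Real.exp_pos _)]
    · rw [abs_neg, abs_of_pos (Real.exp_pos _)]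

/-- On the half-line |z - y| ≤ z + y, so the reflected kernel obeys every bound of the direct one.
-/
lemma isExpKernel_kerW {κ : ℝ} (hκ : 0 < κ) : IsExpKernel κ (kerW κ) where
  measurable := by
    have : Measurable fun p : ℝ × ℝ => Real.exp (-κ * |p.1 + p.2|) := by fun_prop
    exact this
  bound z y hz hy := by
    rw [kerW, abs_of_pos (Real.exp_pos _), Real.exp_le_exp]
    have : |z - y| ≤ |z + y| := by
      rw [abs_of_pos (by linarith : 0 < z + y), abs_le]
      constructor <;> linarith
    nlinarith

section

variable {κ : ℝ} {f : ℝ → ℂ}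

lemma integrableOn_exp_mul_Ioc (hf : MemLp f 2 (volume.restrict (Ioi 0))) (c R : ℝ) :
    IntegrableOn (fun y => ((Real.exp (c * y) : ℝ) : ℂ) * f y) (Ioc 0 R) := by
  have h1 : MemLp f 2 (volume.restrict (Ioc 0 R)) :=
    hf.mono_measure (Measure.restrict_mono Ioc_subset_Ioi_self le_rfl)
  have h2 : IntegrableOn f (Icc 0 R) := by
    rw [integrableOn_Icc_iff_integrableOn_Ioc]
    exact h1.integrable (by norm_num)
  have h3 : IntegrableOn (fun y => ((Real.exp (c * y) : ℝ) : ℂ) * f y) (Icc 0 R) :=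
    h2.continuousOn_mul (by fun_prop) isCompact_Icc
  exact h3.mono_set Ioc_subset_Icc_self

/-- The primitive of `exp (c y) f y`. -/
def expPrim (c : ℝ) (f : ℝ → ℂ) (z : ℝ) : ℂ := ∫ y in (0 : ℝ)..z, ((Real.exp (c * y) : ℝ) : ℂ) * f y

/-- The Laplace transform of `f` at `κ`. -/
def laplaceAt (κ : ℝ) (f : ℝ → ℂ) : ℂ := ∫ y in Ioi 0, ((Real.exp (-κ * y) : ℝ) : ℂ) * f y

lemma integrableOn_laplaceAt (hκ : 0 < κ) (hf : MemLp f 2 (volume.restrict (Ioi 0))) :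
    IntegrableOn (fun y => ((Real.exp (-κ * y) : ℝ) : ℂ) * f y) (Ioi 0) := by
  refine ((isExpKernel_kerU κ).integrable hκ hf le_rfl).congr_fun (fun y hy => ?_) measurableSet_Ioi
  simp only [kerU, zero_sub, abs_neg]
  rw [abs_of_pos hy]

lemma kernelOp_kerW (f : ℝ → ℂ) {z : ℝ} (hz : 0 ≤ z) :
    kernelOp (kerW κ) f z = (Real.exp (-κ * z) : ℝ) * laplaceAt κ f := by
  unfold kernelOp laplaceAt
  rw [← integral_const_mul]
  refine setIntegral_congr_fun measurableSet_Ioi fun y (hy : 0 < y) => ?_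
  simp only [kerW]
  rw [abs_of_pos (by linarith), mul_add, Real.exp_add]
  push_cast
  ring

/-- Factoring the exponential at y = z shows the dependence on z through exponentials and primitives
only, from which continuity up to 0 and weak derivatives can be read off. The value s is 1 for the
even and -1 for the odd kernel; the diagonal y = z is a null set and is left free. -/
lemma kernelOp_split (hκ : 0 < κ) (hf : MemLp f 2 (volume.restrict (Ioi 0))) {K : ℝ → ℝ → ℝ} {s : ℝ}
    {z : ℝ} (hz : 0 ≤ z) (h1 : ∀ y, y < z → K z y = Real.exp (-κ * |z - y|))
    (h2 : ∀ y, z < y → K z y = s * Real.exp (-κ * |z - y|)) :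
    kernelOp K f z = (Real.exp (-κ * z) : ℝ) * expPrim κ f z +
      s * ((Real.exp (κ * z) : ℝ) * (laplaceAt κ f - expPrim (-κ) f z)) := by
  have hL := integrableOn_laplaceAt hκ hf
  have e0 : laplaceAt κ f - expPrim (-κ) f z =
      ∫ y in Ioi z, ((Real.exp (-κ * y) : ℝ) : ℂ) * f y := by
    have := setIntegral_union (Ioc_disjoint_Ioi (le_refl z)) measurableSet_Ioi
      (hL.mono_set (Ioc_subset_Ioi_self : Ioc 0 z ⊆ Ioi 0)) (hL.mono_set (Ioi_subset_Ioi hz))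
    rw [Ioc_union_Ioi_eq_Ioi hz] at this
    rw [laplaceAt, this, expPrim, intervalIntegral.integral_of_le hz]
    ring
  have e1 : ∀ y ∈ Ioo 0 z, ((Real.exp (-κ * z) : ℝ) : ℂ) * (((Real.exp (κ * y) : ℝ) : ℂ) * f y) =
      (K z y : ℂ) * f y := by
    intro y hy
    rw [h1 y hy.2, abs_of_pos (by linarith [hy.2]), ← mul_assoc, ← Complex.ofReal_mul,
      ← Real.exp_add]
    congr 3
    ring
  have e2 : ∀ y ∈ Ioi z, (s : ℂ) * (((Real.exp (κ * z) : ℝ) : ℂ) *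
      (((Real.exp (-κ * y) : ℝ) : ℂ) * f y)) = (K z y : ℂ) * f y := by
    intro y hy
    rw [h2 y hy, abs_of_neg (by linarith [mem_Ioi.1 hy])]
    have : Real.exp (-κ * -(z - y)) = Real.exp (κ * z) * Real.exp (-κ * y) := by
      rw [← Real.exp_add]
      congr 1
      ring
    rw [this]
    push_cast
    ring
  have i1 : IntegrableOn (fun y => (K z y : ℂ) * f y) (Ioc 0 z) := by
    rw [integrableOn_Ioc_iff_integrableOn_Ioo]
    refine IntegrableOn.congr_fun ?_ e1 measurableSet_Ioo
    exact ((integrableOn_exp_mul_Ioc hf κ z).mono_set Ioo_subset_Ioc_self).const_mul _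
  have i2 : IntegrableOn (fun y => (K z y : ℂ) * f y) (Ioi z) := by
    refine IntegrableOn.congr_fun ?_ e2 measurableSet_Ioi
    exact ((hL.mono_set (Ioi_subset_Ioi hz)).const_mul _).const_mul _
  have := setIntegral_union (Ioc_disjoint_Ioi (le_refl z)) measurableSet_Ioi i1 i2
  rw [Ioc_union_Ioi_eq_Ioi hz] at this
  rw [kernelOp, this, e0, expPrim, intervalIntegral.integral_of_le hz, ← integral_const_mul,
    ← integral_const_mul, ← integral_const_mul, ← setIntegral_congr_fun measurableSet_Ioi e2,
    integral_Ioc_eq_integral_Ioo, integral_Ioc_eq_integral_Ioo,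
    ← setIntegral_congr_fun measurableSet_Ioo e1]

lemma kernelOp_kerU (hκ : 0 < κ) (hf : MemLp f 2 (volume.restrict (Ioi 0))) {z : ℝ} (hz : 0 ≤ z) :
    kernelOp (kerU κ) f z = (Real.exp (-κ * z) : ℝ) * expPrim κ f z +
      (Real.exp (κ * z) : ℝ) * (laplaceAt κ f - expPrim (-κ) f z) := by
  rw [kernelOp_split hκ hf (s := 1) hz (fun y _ => rfl) (fun y _ => by rw [one_mul]; rfl)]
  push_cast
  ring

lemma kernelOp_kerV (hκ : 0 < κ) (hf : MemLp f 2 (volume.restrict (Ioi 0))) {z : ℝ} (hz : 0 ≤ z) :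
    kernelOp (kerV κ) f z = (Real.exp (-κ * z) : ℝ) * expPrim κ f z -
      (Real.exp (κ * z) : ℝ) * (laplaceAt κ f - expPrim (-κ) f z) := by
  rw [kernelOp_split hκ hf (s := -1) hz (fun y hy => by simp [kerV, hy])
    (fun y hy => by simp [kerV, hy.le])]
  push_cast
  ring

lemma continuousOn_expPrim (hf : MemLp f 2 (volume.restrict (Ioi 0))) (c : ℝ) :
    ContinuousOn (expPrim c f) (Ici 0) := by
  intro z (hz : 0 ≤ z)
  have h1 : ContinuousOn (expPrim c f) (Icc 0 (z + 1)) := by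
    have := intervalIntegral.continuousOn_primitive_interval (μ := volume)
      (f := fun y => ((Real.exp (c * y) : ℝ) : ℂ) * f y) (a := 0) (b := z + 1) ?_
    · rwa [uIcc_of_le (by linarith)] at this
    · rw [uIcc_of_le (by linarith), integrableOn_Icc_iff_integrableOn_Ioc]
      exact integrableOn_exp_mul_Ioc hf _ _
  refine (h1 z ⟨hz, by linarith⟩).mono_of_mem_nhdsWithin ?_
  filter_upwards [self_mem_nhdsWithin, nhdsWithin_le_nhds (Iio_mem_nhds (by linarith : z < z + 1))]
    with y h1 h2 using ⟨h1, le_of_lt h2⟩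

lemma continuousOn_kernelOp_kerU (hκ : 0 < κ) (hf : MemLp f 2 (volume.restrict (Ioi 0))) :
    ContinuousOn (kernelOp (kerU κ) f) (Ici 0) := by
  refine ContinuousOn.congr ?_ fun z hz => kernelOp_kerU hκ hf hz
  exact ((by fun_prop : ContinuousOn _ _).mul (continuousOn_expPrim hf κ)).add
    ((by fun_prop : ContinuousOn _ _).mul (continuousOn_const.sub (continuousOn_expPrim hf (-κ))))

lemma continuousOn_kernelOp_kerV (hκ : 0 < κ) (hf : MemLp f 2 (volume.restrict (Ioi 0))) :
    ContinuousOn (kernelOp (kerV κ) f) (Ici 0) := by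
  refine ContinuousOn.congr ?_ fun z hz => kernelOp_kerV hκ hf hz
  exact ((by fun_prop : ContinuousOn _ _).mul (continuousOn_expPrim hf κ)).sub
    ((by fun_prop : ContinuousOn _ _).mul (continuousOn_const.sub (continuousOn_expPrim hf (-κ))))

lemma continuousOn_kernelOp_kerW : ContinuousOn (kernelOp (kerW κ) f) (Ici 0) := by
  refine ContinuousOn.congr ?_ fun z hz => kernelOp_kerW f hz
  fun_prop

lemma expPrim_zero (c : ℝ) (f : ℝ → ℂ) : expPrim c f 0 = 0 := by simp [expPrim]

lemma deriv_exp_const_mul (c z : ℝ) :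
    deriv (fun z : ℝ => Real.exp (c * z)) z = c * Real.exp (c * z) := by
  have : HasDerivAt (fun z : ℝ => Real.exp (c * z)) (Real.exp (c * z) * (c * 1)) z :=
    ((hasDerivAt_id z).const_mul c).exp
  rw [this.deriv]
  ring

lemma isWeakDerivHL_exp_mul_expPrim (hf : MemLp f 2 (volume.restrict (Ioi 0))) (c : ℝ) :
    IsWeakDerivHL (fun z => (Real.exp (-c * z) : ℝ) * expPrim c f z)
      (fun z => -c * ((Real.exp (-c * z) : ℝ) * expPrim c f z) + f z) := by
  have h := (isWeakDerivHL_primitive (integrableOn_exp_mul_Ioc hf c)).smooth_mul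
    (a := fun z => Real.exp (-c * z)) (by fun_prop)
  refine h.congr (ae_of_all _ fun z => rfl) (ae_of_all _ fun z => ?_)
  rw [deriv_exp_const_mul, ← mul_assoc ((Real.exp (-c * z) : ℝ) : ℂ), ← Complex.ofReal_mul (Real.exp _),
    ← Real.exp_add]
  simp only [expPrim]
  rw [show -c * z + c * z = 0 by ring, Real.exp_zero]
  push_cast
  ring

lemma isWeakDerivHL_exp_mul (c : ℝ) (a : ℂ) :
    IsWeakDerivHL (fun z => (Real.exp (c * z) : ℝ) * a)
      (fun z => c * ((Real.exp (c * z) : ℝ) * a)) := by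
  have h := (isWeakDerivHL_const a).smooth_mul (a := fun z => Real.exp (c * z)) (by fun_prop)
  refine h.congr (ae_of_all _ fun z => rfl) (ae_of_all _ fun z => ?_)
  rw [deriv_exp_const_mul]
  push_cast
  ring

lemma isWeakDerivHL_kernelOp_kerU (hκ : 0 < κ) (hf : MemLp f 2 (volume.restrict (Ioi 0))) :
    IsWeakDerivHL (kernelOp (kerU κ) f) (fun z => -κ * kernelOp (kerV κ) f z) := by
  have h1 := isWeakDerivHL_exp_mul_expPrim hf κ
  have h2 := isWeakDerivHL_exp_mul_expPrim hf (-κ)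
  have h3 := isWeakDerivHL_exp_mul κ (laplaceAt κ f)
  refine ((h1.add h3).sub h2).congr ?_ ?_
  · refine (ae_restrict_mem measurableSet_Ioi).mono fun z hz => ?_
    rw [kernelOp_kerU hκ hf (le_of_lt hz), neg_neg]
    ring
  · refine (ae_restrict_mem measurableSet_Ioi).mono fun z hz => ?_
    rw [kernelOp_kerV hκ hf (le_of_lt hz), neg_neg]
    push_cast
    ring

/-- The two primitives contribute f each. For the odd kernel, which jumps by 2 across the diagonal,
these terms add up; for the even kernel they cancel. -/
lemma isWeakDerivHL_kernelOp_kerV (hκ : 0 < κ) (hf : MemLp f 2 (volume.restrict (Ioi 0))) :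
    IsWeakDerivHL (kernelOp (kerV κ) f) (fun z => -κ * kernelOp (kerU κ) f z + 2 * f z) := by
  have h1 := isWeakDerivHL_exp_mul_expPrim hf κ
  have h2 := isWeakDerivHL_exp_mul_expPrim hf (-κ)
  have h3 := isWeakDerivHL_exp_mul κ (laplaceAt κ f)
  refine ((h1.sub h3).add h2).congr ?_ ?_
  · refine (ae_restrict_mem measurableSet_Ioi).mono fun z hz => ?_
    rw [kernelOp_kerV hκ hf (le_of_lt hz), neg_neg]
    ring
  · refine (ae_restrict_mem measurableSet_Ioi).mono fun z hz => ?_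
    rw [kernelOp_kerU hκ hf (le_of_lt hz), neg_neg]
    push_cast
    ring

lemma isWeakDerivHL_kernelOp_kerW :
    IsWeakDerivHL (kernelOp (kerW κ) f) (fun z => -κ * kernelOp (kerW κ) f z) := by
  refine (isWeakDerivHL_exp_mul (-κ) (laplaceAt κ f)).congr ?_ ?_
  · exact (ae_restrict_mem measurableSet_Ioi).mono fun z hz => (kernelOp_kerW f (le_of_lt hz)).symm
  · refine (ae_restrict_mem measurableSet_Ioi).mono fun z hz => ?_
    rw [kernelOp_kerW f (le_of_lt hz)]
    push_cast
    ring

/-- A square integrable solution of `u'' = κ² u` on the half-line that vanishes at the origin is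
trivial. -/
lemma IsWeakDerivHL.eq_zero_of_second {R S : ℝ → ℂ} (hκ : 0 < κ) (h1 : IsWeakDerivHL R S)
    (h2 : IsWeakDerivHL S fun z => κ ^ 2 * R z)
    (hR : MemLp R 2 (volume.restrict (Ioi 0))) (hS : MemLp S 2 (volume.restrict (Ioi 0)))
    (h0 : Tendsto R (𝓝[>] 0) (𝓝 0)) :
    (∀ᵐ z ∂(volume.restrict (Ioi (0 : ℝ))), R z = 0) ∧
      ∀ᵐ z ∂(volume.restrict (Ioi (0 : ℝ))), S z = 0 := by
  -- The operator factors: S + κR satisfies T' = κT, so exp(-κz)(S + κR) is a constant c. Then |S +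
  -- κR| ≥ |c| on a set of infinite measure, which square integrability permits only for c = 0.
  have e1 : ∀ᵐ z ∂(volume.restrict (Ioi (0 : ℝ))), S z + κ * R z = 0 := by
    have hT := (h2.add (h1.const_mul κ)).smooth_mul (a := fun z => Real.exp (-κ * z)) (by fun_prop)
    obtain ⟨c, hc⟩ := IsWeakDerivHL.ae_eq_const (hT.congr (ae_of_all _ fun z => rfl)
      (ae_of_all _ fun z => by
        rw [deriv_exp_const_mul]
        push_cast
        ring))
    have hc0 : c = 0 := by
      by_contra hne
      have hm : MemLp (fun z => S z + κ * R z) 2 (volume.restrict (Ioi 0)) :=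
        hS.add (hR.const_mul (κ : ℂ))
      refine (memLp_two_iff.1 hm).2 (top_le_iff.1 ?_)
      calc (⊤ : ℝ≥0∞) = ∫⁻ z in Ioi (0 : ℝ), ‖c‖ₑ ^ 2 := by
            rw [setLIntegral_const, Real.volume_Ioi, ENNReal.mul_top]
            simpa using hne
        _ ≤ _ := by
            refine lintegral_mono_ae ?_
            filter_upwards [hc, ae_restrict_mem measurableSet_Ioi] with z hz hz0
            rw [← hz, enorm_mul]
            refine pow_le_pow_left' ?_ 2
            refine (mul_le_mul_left (?_ : _ ≤ (1 : ℝ≥0∞)) _).trans_eq (one_mul _)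
            rw [← ofReal_norm, Complex.norm_real, Real.norm_of_nonneg (Real.exp_pos _).le]
            refine ENNReal.ofReal_le_one.2 (Real.exp_le_one_iff.2 ?_)
            have := mul_pos hκ (mem_Ioi.1 hz0)
            linarith
    filter_upwards [hc] with z hz
    rw [hc0] at hz
    exact (mul_eq_zero.1 hz).resolve_left (by simp)
  -- What remains is R' = -κR, so exp(κz) R is constant; its limit at the origin is 0.
  have e2 : ∀ᵐ z ∂(volume.restrict (Ioi (0 : ℝ))), R z = 0 := by
    have hT := h1.smooth_mul (a := fun z => Real.exp (κ * z)) (by fun_prop)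
    obtain ⟨c, hc⟩ := IsWeakDerivHL.ae_eq_const (hT.congr (ae_of_all _ fun z => rfl)
      (g₁ := fun _ => 0) (e1.mono fun z hz => by
        rw [deriv_exp_const_mul]
        push_cast
        linear_combination (Complex.exp (κ * z)) * hz))
    have hc0 : c = 0 := by
      by_contra hne
      have hlim : Tendsto (fun z => ((Real.exp (κ * z) : ℝ) : ℂ) * R z) (𝓝[>] 0) (𝓝 0) := by
        have : Tendsto (fun z => ((Real.exp (κ * z) : ℝ) : ℂ)) (𝓝[>] 0)
            (𝓝 ((Real.exp (κ * 0) : ℝ) : ℂ)) :=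
          ((by fun_prop : Continuous fun z => ((Real.exp (κ * z) : ℝ) : ℂ)).tendsto 0).mono_left
            nhdsWithin_le_nhds
        simpa using this.mul h0
      have hev := hlim.eventually_ne (Ne.symm hne)
      obtain ⟨ε, hε, hεs⟩ := mem_nhdsGT_iff_exists_Ioo_subset.1 hev
      have h3 := ae_restrict_of_ae_restrict_of_subset (Ioo_subset_Ioi_self : Ioo 0 ε ⊆ Ioi 0) hc
      have h4 : ∀ᵐ z ∂(volume.restrict (Ioo 0 ε)), False := by
        filter_upwards [h3, ae_restrict_mem measurableSet_Ioo] with z hz hz'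
        exact hεs hz' hz
      simp only [eventually_false_iff_eq_bot, ae_eq_bot, Measure.restrict_eq_zero,
        Real.volume_Ioo] at h4
      simp only [sub_zero, ENNReal.ofReal_eq_zero] at h4
      exact absurd hε (not_lt.2 h4)
    filter_upwards [hc] with z hz
    rw [hc0] at hz
    exact (mul_eq_zero.1 hz).resolve_left (by simp)
  refine ⟨e2, ?_⟩
  filter_upwards [e1, e2] with z h1 h2
  simpa [h2] using h1

/-- Integration by parts in the exponential kernels. -/
lemma kernelOp_weakDeriv {b g : ℝ → ℂ} (hκ : 0 < κ) (h : IsWeakDerivHL b g)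
    (hb : MemLp b 2 (volume.restrict (Ioi 0))) (hg : MemLp g 2 (volume.restrict (Ioi 0))) :
    (∀ᵐ z ∂(volume.restrict (Ioi (0 : ℝ))), kernelOp (kerU κ) g z - kernelOp (kerW κ) g z =
      -κ * (kernelOp (kerV κ) b z + kernelOp (kerW κ) b z)) ∧
    ∀ᵐ z ∂(volume.restrict (Ioi (0 : ℝ))), kernelOp (kerV κ) g z - kernelOp (kerW κ) g z =
      2 * b z - κ * (kernelOp (kerU κ) b z + kernelOp (kerW κ) b z) := by
  have mU := (isExpKernel_kerU κ).memLp_kernelOp hκ hg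
  have mV := (isExpKernel_kerV κ).memLp_kernelOp hκ hg
  have mW := (isExpKernel_kerW hκ).memLp_kernelOp hκ hg
  have nU := (isExpKernel_kerU κ).memLp_kernelOp hκ hb
  have nV := (isExpKernel_kerV κ).memLp_kernelOp hκ hb
  have nW := (isExpKernel_kerW hκ).memLp_kernelOp hκ hb
  -- Instead of integrating by parts against the merely weakly differentiable b, uniqueness for the
  -- equation is used: R is the defect of the first identity, S is its derivative and -κ times the
  -- defect of the second, and S' = κ²R.
  set R : ℝ → ℂ := fun z => (kernelOp (kerU κ) g z - kernelOp (kerW κ) g z) +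
    κ * (kernelOp (kerV κ) b z + kernelOp (kerW κ) b z) with hR
  set S : ℝ → ℂ := fun z => -κ * (kernelOp (kerV κ) g z - kernelOp (kerW κ) g z) +
    κ * (2 * b z - κ * (kernelOp (kerU κ) b z + kernelOp (kerW κ) b z)) with hS
  have wU := isWeakDerivHL_kernelOp_kerU hκ hg
  have wV := isWeakDerivHL_kernelOp_kerV hκ hg
  have wW := isWeakDerivHL_kernelOp_kerW (κ := κ) (f := g)
  have vU := isWeakDerivHL_kernelOp_kerU hκ hb
  have vV := isWeakDerivHL_kernelOp_kerV hκ hb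
  have vW := isWeakDerivHL_kernelOp_kerW (κ := κ) (f := b)
  have h1 : IsWeakDerivHL R S :=
    ((wU.sub wW).add ((vV.add vW).const_mul κ)).congr (ae_of_all _ fun z => rfl)
      (ae_of_all _ fun z => by simp only [hS]; ring)
  have h2 : IsWeakDerivHL S fun z => κ ^ 2 * R z :=
    (((wV.sub wW).const_mul (-κ)).add (((h.const_mul 2).sub
      ((vU.add vW).const_mul κ)).const_mul κ)).congr (ae_of_all _ fun z => rfl)
      (ae_of_all _ fun z => by simp only [hR]; ring)
  have mR : MemLp R 2 (volume.restrict (Ioi 0)) :=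
    (mU.sub mW).add ((nV.add nW).const_mul (κ : ℂ))
  have mS : MemLp S 2 (volume.restrict (Ioi 0)) :=
    ((mV.sub mW).const_mul (-κ : ℂ)).add
      (((hb.const_mul 2).sub ((nU.add nW).const_mul (κ : ℂ))).const_mul (κ : ℂ))
  -- At z = 0 the even and reflected kernels agree and the odd one is the negative of the reflected
  -- one, so both brackets vanish. No boundary value of b is involved.
  have h0 : Tendsto R (𝓝[>] 0) (𝓝 0) := by
    have hc : ContinuousOn R (Ici 0) :=
      ((continuousOn_kernelOp_kerU hκ hg).sub continuousOn_kernelOp_kerW).add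
        (continuousOn_const.mul ((continuousOn_kernelOp_kerV hκ hb).add continuousOn_kernelOp_kerW))
    have := (hc 0 (self_mem_Ici)).tendsto.mono_left (nhdsWithin_mono 0 Ioi_subset_Ici_self)
    have hR0 : R 0 = 0 := by
      simp only [hR]
      rw [kernelOp_kerU hκ hg le_rfl, kernelOp_kerV hκ hb le_rfl, kernelOp_kerW g le_rfl,
        kernelOp_kerW b le_rfl, expPrim_zero, expPrim_zero, expPrim_zero, expPrim_zero]
      simp
    rwa [hR0] at this
  obtain ⟨r1, r2⟩ := h1.eq_zero_of_second hκ h2 mR mS h0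
  have hκ' : (κ : ℂ) ≠ 0 := by exact_mod_cast hκ.ne'
  constructor
  · filter_upwards [r1] with z hz
    linear_combination hz
  · filter_upwards [r2] with z hz
    have : (κ : ℂ) * (-(kernelOp (kerV κ) g z - kernelOp (kerW κ) g z) +
      (2 * b z - κ * (kernelOp (kerU κ) b z + kernelOp (kerW κ) b z))) = 0 := by
      rw [← hz]
      simp only [hS]
      ring
    have := (mul_eq_zero.1 this).resolve_left hκ'
    linear_combination -this

end

/-! ### Fourier modes on the half-cylinder: Parseval and Riesz–Fischer -/

lemma ae_eq_of_lintegral_sub_sq {α : Type*} [MeasurableSpace α] {μ : Measure α} {f g : α → ℂ}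
    (hf : AEStronglyMeasurable f μ) (hg : AEStronglyMeasurable g μ)
    (h : ∫⁻ a, ‖f a - g a‖ₑ ^ 2 ∂μ = 0) : f =ᵐ[μ] g := by
  have hm : AEMeasurable (fun a => ‖f a - g a‖ₑ ^ 2) μ := (hf.sub hg).enorm.pow_const 2
  rw [lintegral_eq_zero_iff' hm] at h
  filter_upwards [h] with p hp
  simpa [sub_eq_zero] using hp

/-- The Lebesgue measure of the half-line. -/
abbrev halfLine : Measure ℝ := volume.restrict (Ioi 0)

/-- The Lebesgue measure of the period. -/
abbrev period : Measure ℝ := volume.restrict (Ioc 0 (2 * Real.pi))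

/-- The character `x ↦ exp (i k x)`. -/
def character (k : ℤ) (x : ℝ) : ℂ := Complex.exp (Complex.I * k * x)

lemma norm_character (k : ℤ) (x : ℝ) : ‖character k x‖ = 1 := by
  rw [character, show Complex.I * k * x = ((k * x : ℝ) : ℂ) * Complex.I by push_cast; ring,
    Complex.norm_exp_ofReal_mul_I]

lemma enorm_character (k : ℤ) (x : ℝ) : ‖character k x‖ₑ = 1 := by
  rw [← ofReal_norm, norm_character, ENNReal.ofReal_one]

lemma continuous_character (k : ℤ) : Continuous (character k) := by
  unfold character
  fun_prop

lemma character_add (k : ℤ) (x y : ℝ) : character k (x + y) = character k x * character k y := by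
  rw [character, character, character, ← Complex.exp_add]
  congr 1
  push_cast
  ring

lemma character_two_pi (k : ℤ) : character k (2 * Real.pi) = 1 := by
  rw [character, Complex.exp_eq_one_iff]
  exact ⟨k, by push_cast; ring⟩

lemma character_periodic (k : ℤ) (x : ℝ) : character k (x + 2 * Real.pi) = character k x := by
  rw [character_add, character_two_pi, mul_one]

lemma integral_character (k : ℤ) :
    ∫ x in (0 : ℝ)..(2 * Real.pi), character k x = if k = 0 then 2 * Real.pi else 0 := by
  split_ifs with h
  · simp [character, h]
  · have hc : Complex.I * (k : ℂ) ≠ 0 := mul_ne_zero Complex.I_ne_zero (by exact_mod_cast h)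
    unfold character
    rw [integral_exp_mul_complex hc]
    have := character_two_pi k
    rw [character] at this
    rw [this]
    simp

lemma cellMeasure_eq : cellMeasure = period.prod halfLine := by
  rw [cellMeasure, cell, Measure.prod_restrict, Measure.volume_eq_prod]

lemma coeff_eq_fourierCoeffOn (f : ℝ × ℝ → ℂ) (k : ℤ) (y : ℝ) :
    coeff f k y = fourierCoeffOn Real.two_pi_pos (fun x => f (x, y)) k := by
  rw [fourierCoeffOn_eq_integral, coeff, sub_zero, Complex.real_smul]
  congr 1
  · push_cast
    ring
  · refine intervalIntegral.integral_congr fun x _ => ?_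
    simp only [fourier_coe_apply, smul_eq_mul]
    rw [mul_comm]
    congr 2
    have : (Real.pi : ℂ) ≠ 0 := by exact_mod_cast Real.pi_ne_zero
    push_cast
    field_simp
    try ring

lemma aestronglyMeasurable_coeff {f : ℝ × ℝ → ℂ} (hf : AEStronglyMeasurable f cellMeasure) (k : ℤ) :
    AEStronglyMeasurable (coeff f k) halfLine := by
  unfold coeff
  refine AEStronglyMeasurable.const_mul ?_ _
  simp only [intervalIntegral.integral_of_le Real.two_pi_pos.le]
  rw [cellMeasure_eq] at hf
  refine AEStronglyMeasurable.integral_prod_right' (μ := halfLine) (ν := period)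
    (f := fun p : ℝ × ℝ => f (p.2, p.1) * Complex.exp (-(Complex.I * k * p.2))) ?_
  refine (hf.prod_swap).mul (Continuous.aestronglyMeasurable (by fun_prop))

lemma setLIntegral_cell {g : ℝ × ℝ → ℝ≥0∞} (hg : AEMeasurable g cellMeasure) :
    ∫⁻ p in cell, g p = ∫⁻ y in Ioi 0, ∫⁻ x in Ioc 0 (2 * Real.pi), g (x, y) := by
  have : ∫⁻ p in cell, g p = ∫⁻ p, g p ∂cellMeasure := rfl
  rw [this, cellMeasure_eq, lintegral_prod_symm]
  rwa [← cellMeasure_eq]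

lemma ae_slice_memLp {f : ℝ × ℝ → ℂ} (hf : MemLp f 2 cellMeasure) :
    ∀ᵐ y ∂halfLine, MemLp (fun x => f (x, y)) 2 period := by
  obtain ⟨h1, h2⟩ := memLp_two_iff.1 hf
  have h3 : ∫⁻ y, ∫⁻ x, ‖f (x, y)‖ₑ ^ 2 ∂period ∂halfLine ≠ ⊤ := by
    rw [← setLIntegral_cell (h1.enorm.pow_const 2)]
    exact h2
  have h4 : AEStronglyMeasurable f (period.prod halfLine) := by rwa [← cellMeasure_eq]
  have h5 := ae_lt_top' ((h4.enorm.pow_const 2).prod_swap.lintegral_prod_right') h3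
  filter_upwards [h5, h4.prod_swap.prodMk_left] with y hy hy'
  exact memLp_two_iff.2 ⟨hy', hy.ne⟩

lemma ae_slice_intervalIntegrable {f : ℝ × ℝ → ℂ} (hf : MemLp f 2 cellMeasure) :
    ∀ᵐ y ∂halfLine, IntervalIntegrable (fun x => f (x, y)) volume 0 (2 * Real.pi) := by
  filter_upwards [ae_slice_memLp hf] with y hy
  rw [intervalIntegrable_iff_integrableOn_Ioc_of_le Real.two_pi_pos.le]
  exact hy.integrable (by norm_num)

lemma parseval_slice {u : ℝ × ℝ → ℂ} {y : ℝ} (hu : MemLp (fun x => u (x, y)) 2 period) :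
    ∫⁻ x in Ioc 0 (2 * Real.pi), ‖u (x, y)‖ₑ ^ 2 =
      ENNReal.ofReal (2 * Real.pi) * ∑' k : ℤ, ‖coeff u k y‖ₑ ^ 2 := by
  have h := hasSum_sq_fourierCoeffOn Real.two_pi_pos hu
  simp only [← coeff_eq_fourierCoeffOn, sub_zero] at h
  have h1 : ∀ k : ℤ, ‖coeff u k y‖ₑ ^ 2 = ENNReal.ofReal (‖coeff u k y‖ ^ 2) := fun k => by
    rw [← ofReal_norm, ENNReal.ofReal_pow (norm_nonneg _)]
  simp only [h1]
  rw [← ENNReal.ofReal_tsum_of_nonneg (fun _ => by positivity) h.summable, h.tsum_eq,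
    ← ENNReal.ofReal_mul Real.two_pi_pos.le, smul_eq_mul, ← mul_assoc,
    mul_inv_cancel₀ Real.two_pi_pos.ne', one_mul, intervalIntegral.integral_of_le Real.two_pi_pos.le,
    ofReal_integral_eq_lintegral_ofReal ((memLp_two_iff_integrable_sq_norm hu.1).1 hu) (ae_of_all _ fun _ => by positivity)]
  refine lintegral_congr fun x => ?_
  rw [← ofReal_norm, ENNReal.ofReal_pow (norm_nonneg _)]

/-- Parseval's identity on the half-cylinder. -/
lemma parseval {f : ℝ × ℝ → ℂ} (hf : MemLp f 2 cellMeasure) :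
    ∫⁻ p in cell, ‖f p‖ₑ ^ 2 =
      ENNReal.ofReal (2 * Real.pi) * ∑' k : ℤ, ∫⁻ y in Ioi 0, ‖coeff f k y‖ₑ ^ 2 := by
  rw [setLIntegral_cell (hf.1.enorm.pow_const 2),
    lintegral_congr_ae ((ae_slice_memLp hf).mono fun y hy => parseval_slice hy),
    lintegral_const_mul' _ _ ENNReal.ofReal_ne_top,
    lintegral_tsum fun k => (aestronglyMeasurable_coeff hf.1 k).enorm.pow_const 2]

lemma ofReal_two_pi_ne_zero : ENNReal.ofReal (2 * Real.pi) ≠ 0 := by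
  simpa using Real.pi_pos

lemma tsum_lintegral_coeff_ne_top {f : ℝ × ℝ → ℂ} (hf : MemLp f 2 cellMeasure) :
    ∑' k : ℤ, ∫⁻ y in Ioi 0, ‖coeff f k y‖ₑ ^ 2 ≠ ⊤ := by
  have h := (memLp_two_iff.1 hf).2
  have : ENNReal.ofReal (2 * Real.pi) * ∑' k : ℤ, ∫⁻ y in Ioi 0, ‖coeff f k y‖ₑ ^ 2 ≠ ⊤ := by
    rw [← parseval hf]
    exact h
  exact fun h => this (by rw [h, ENNReal.mul_top ofReal_two_pi_ne_zero])

lemma memLp_coeff {f : ℝ × ℝ → ℂ} (hf : MemLp f 2 cellMeasure) (k : ℤ) :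
    MemLp (coeff f k) 2 halfLine :=
  memLp_two_iff.2 ⟨aestronglyMeasurable_coeff hf.1 k,
    ENNReal.ne_top_of_tsum_ne_top (tsum_lintegral_coeff_ne_top hf) k⟩

lemma coeff_congr {f g : ℝ × ℝ → ℂ} (h : f =ᵐ[cellMeasure] g) (k : ℤ) :
    coeff f k =ᵐ[halfLine] coeff g k := by
  have h1 : ∀ᵐ p ∂(halfLine.prod period), f p.swap = g p.swap := by
    rw [cellMeasure_eq] at h
    exact (Measure.measurePreserving_swap (μ := halfLine) (ν := period)).quasiMeasurePreserving.ae h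
  filter_upwards [Measure.ae_ae_of_ae_prod h1] with y hy
  unfold coeff
  congr 1
  rw [intervalIntegral.integral_of_le Real.two_pi_pos.le,
    intervalIntegral.integral_of_le Real.two_pi_pos.le]
  refine integral_congr_ae (hy.mono fun x hx => ?_)
  simp only [Prod.swap_prod_mk] at hx
  simp only [hx]

lemma coeff_add {f g : ℝ × ℝ → ℂ} (hf : MemLp f 2 cellMeasure) (hg : MemLp g 2 cellMeasure)
    (k : ℤ) : ∀ᵐ y ∂halfLine, coeff (fun p => f p + g p) k y = coeff f k y + coeff g k y := by
  filter_upwards [ae_slice_intervalIntegrable hf, ae_slice_intervalIntegrable hg] with y h1 h2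
  unfold coeff
  rw [← mul_add, ← intervalIntegral.integral_add (h1.mul_continuousOn (by fun_prop))
    (h2.mul_continuousOn (by fun_prop))]
  simp only [add_mul]

lemma coeff_const_mul (f : ℝ × ℝ → ℂ) (c : ℂ) (k : ℤ) (y : ℝ) :
    coeff (fun p => c * f p) k y = c * coeff f k y := by
  unfold coeff
  simp only [mul_assoc c]
  rw [intervalIntegral.integral_const_mul]
  ring

lemma coeff_sub {f g : ℝ × ℝ → ℂ} (hf : MemLp f 2 cellMeasure) (hg : MemLp g 2 cellMeasure)
    (k : ℤ) : ∀ᵐ y ∂halfLine, coeff (fun p => f p - g p) k y = coeff f k y - coeff g k y := by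
  filter_upwards [coeff_add hf (hg.const_mul (-1)) k] with y hy
  simp only [coeff_const_mul] at hy
  have e : (fun p => f p + -1 * g p) = fun p => f p - g p := by
    ext p
    ring
  rw [e] at hy
  rw [hy]
  ring

/-- The trigonometric polynomial with coefficients `c k`, `k ∈ s`. -/
def trigPoly (s : Finset ℤ) (c : ℤ → ℝ → ℂ) (p : ℝ × ℝ) : ℂ := ∑ k ∈ s, c k p.2 * character k p.1

lemma trigPoly_periodic (s : Finset ℤ) (c : ℤ → ℝ → ℂ) : IsPeriodic (trigPoly s c) := by
  intro x z _
  simp only [trigPoly, character_periodic]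

lemma memLp_mode {c : ℝ → ℂ} (hc : MemLp c 2 halfLine) (k : ℤ) :
    MemLp (fun p : ℝ × ℝ => c p.2 * character k p.1) 2 cellMeasure := by
  have hm : AEStronglyMeasurable (fun p : ℝ × ℝ => c p.2 * character k p.1) cellMeasure := by
    rw [cellMeasure_eq]
    exact hc.1.comp_snd.mul
      ((continuous_character k).comp continuous_fst).aestronglyMeasurable
  refine memLp_two_iff.2 ⟨hm, ?_⟩
  have := setLIntegral_cell (hm.enorm.pow_const 2)
  have e : ∫⁻ p, ‖c p.2 * character k p.1‖ₑ ^ 2 ∂cellMeasure =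
    ∫⁻ p in cell, ‖c p.2 * character k p.1‖ₑ ^ 2 := rfl
  rw [e, this]
  simp only [enorm_mul, enorm_character, mul_one, setLIntegral_const, Real.volume_Ioc]
  rw [lintegral_mul_const' _ _ ENNReal.ofReal_ne_top]
  exact ENNReal.mul_ne_top (memLp_two_iff.1 hc).2 ENNReal.ofReal_ne_top

lemma memLp_trigPoly (s : Finset ℤ) {c : ℤ → ℝ → ℂ} (hc : ∀ k, MemLp (c k) 2 halfLine) :
    MemLp (trigPoly s c) 2 cellMeasure := by
  unfold trigPoly
  exact memLp_finsetSum s fun k _ => memLp_mode (hc k) k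

lemma coeff_trigPoly (s : Finset ℤ) (c : ℤ → ℝ → ℂ) (k : ℤ) (y : ℝ) :
    coeff (trigPoly s c) k y = if k ∈ s then c k y else 0 := by
  unfold coeff trigPoly
  have e : ∀ x : ℝ, (∑ j ∈ s, c j y * character j x) * Complex.exp (-(Complex.I * k * x)) =
      ∑ j ∈ s, c j y * character (j - k) x := by
    intro x
    rw [Finset.sum_mul]
    refine Finset.sum_congr rfl fun j _ => ?_
    rw [mul_assoc, character, character, ← Complex.exp_add]
    congr 2
    push_cast
    ring
  simp only [e]
  rw [intervalIntegral.integral_finsetSum fun j _ =>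
    (((continuous_character (j - k)).const_mul (c j y)).intervalIntegrable _ _)]
  simp only [intervalIntegral.integral_const_mul, integral_character, sub_eq_zero, apply_ite Complex.ofReal,
    Complex.ofReal_zero, mul_ite, mul_zero, Finset.sum_ite_eq']
  split_ifs
  · have : (Real.pi : ℂ) ≠ 0 := by exact_mod_cast Real.pi_ne_zero
    push_cast
    field_simp
  · rfl

lemma parseval_trigPoly (s : Finset ℤ) {c : ℤ → ℝ → ℂ} (hc : ∀ k, MemLp (c k) 2 halfLine) :
    ∫⁻ p in cell, ‖trigPoly s c p‖ₑ ^ 2 =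
      ENNReal.ofReal (2 * Real.pi) * ∑ k ∈ s, ∫⁻ y in Ioi 0, ‖c k y‖ₑ ^ 2 := by
  rw [parseval (memLp_trigPoly s hc), tsum_eq_sum (s := s)]
  · congr 1
    refine Finset.sum_congr rfl fun k hk => ?_
    simp [coeff_trigPoly, hk]
  · intro k hk
    simp [coeff_trigPoly, hk]

lemma parseval_sub_trigPoly (s : Finset ℤ) {f : ℝ × ℝ → ℂ} (hf : MemLp f 2 cellMeasure) :
    ∫⁻ p in cell, ‖f p - trigPoly s (coeff f) p‖ₑ ^ 2 =
      ENNReal.ofReal (2 * Real.pi) *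
        ∑' k : {k : ℤ // k ∉ s}, ∫⁻ y in Ioi 0, ‖coeff f k y‖ₑ ^ 2 := by
  have hS := memLp_trigPoly s (memLp_coeff hf)
  rw [parseval (f := fun p => f p - trigPoly s (coeff f) p) (hf.sub hS)]
  congr 1
  have e : ∀ k : ℤ, ∫⁻ y in Ioi 0, ‖coeff (fun p => f p - trigPoly s (coeff f) p) k y‖ₑ ^ 2 =
      indicator {k : ℤ | k ∉ s} (fun k => ∫⁻ y in Ioi 0, ‖coeff f k y‖ₑ ^ 2) k := by
    intro k
    rw [lintegral_congr_ae ((coeff_sub hf hS k).mono fun y hy => by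
      rw [hy, coeff_trigPoly] : _ =ᵐ[halfLine] fun y =>
        ‖coeff f k y - if k ∈ s then coeff f k y else 0‖ₑ ^ 2)]
    by_cases hk : k ∈ s <;> simp [hk]
  simp only [e]
  exact (tsum_subtype {k : ℤ | k ∉ s} fun k => ∫⁻ y in Ioi 0, ‖coeff f k y‖ₑ ^ 2).symm

/-- The Fourier series of a square integrable function converges in `L²`. -/
lemma tendsto_lintegral_sub_trigPoly {f : ℝ × ℝ → ℂ} (hf : MemLp f 2 cellMeasure) :
    Tendsto (fun s : Finset ℤ => ∫⁻ p in cell, ‖f p - trigPoly s (coeff f) p‖ₑ ^ 2) atTop (𝓝 0) := by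
  simp only [parseval_sub_trigPoly _ hf]
  have := ENNReal.Tendsto.const_mul
    (ENNReal.tendsto_tsum_compl_atTop_zero (tsum_lintegral_coeff_ne_top hf))
    (Or.inr (ENNReal.ofReal_ne_top (r := 2 * Real.pi)))
  rwa [mul_zero] at this

lemma ae_eq_of_coeff_eq {f g : ℝ × ℝ → ℂ} (hf : MemLp f 2 cellMeasure) (hg : MemLp g 2 cellMeasure)
    (h : ∀ k, coeff f k =ᵐ[halfLine] coeff g k) : f =ᵐ[cellMeasure] g := by
  have h1 : ∫⁻ p, ‖f p - g p‖ₑ ^ 2 ∂cellMeasure = 0 := by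
    have := parseval (f := fun p => f p - g p) (hf.sub hg)
    rw [cellMeasure, this]
    simp only [mul_eq_zero, ENNReal.tsum_eq_zero]
    refine Or.inr fun k => ?_
    rw [← lintegral_zero (μ := halfLine)]
    refine lintegral_congr_ae ?_
    filter_upwards [coeff_sub hf hg k, h k] with y h1 h2
    rw [h1, h2]
    simp
  exact ae_eq_of_lintegral_sub_sq hf.1 hg.1 h1

/-- The `2π`-periodic extension of the restriction of a function to the cell. -/
def periodize (f : ℝ × ℝ → ℂ) (p : ℝ × ℝ) : ℂ := f (toIocMod Real.two_pi_pos 0 p.1, p.2)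

lemma periodize_periodic (f : ℝ × ℝ → ℂ) : IsPeriodic (periodize f) := by
  intro x z _
  simp only [periodize, toIocMod_add_right]

lemma periodize_eq (f : ℝ × ℝ → ℂ) {p : ℝ × ℝ} (hp : p ∈ cell) : periodize f p = f p := by
  unfold periodize
  rw [(toIocMod_eq_self Real.two_pi_pos).2 (by simpa using hp.1)]

lemma periodize_ae_eq (f : ℝ × ℝ → ℂ) : periodize f =ᵐ[cellMeasure] f :=
  (ae_restrict_mem (measurableSet_Ioc.prod measurableSet_Ioi)).mono fun _ hp => periodize_eq f hp

/-- Square integrable functions on the half-cylinder. -/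
structure IsPeriodicL2 (f : ℝ × ℝ → ℂ) : Prop where
  periodic : IsPeriodic f
  memLp : MemLp f 2 cellMeasure

lemma isPeriodicL2_periodize {f : ℝ × ℝ → ℂ} (hf : MemLp f 2 cellMeasure) :
    IsPeriodicL2 (periodize f) :=
  ⟨periodize_periodic f, (memLp_congr_ae (periodize_ae_eq f)).2 hf⟩

/-- The Riesz–Fischer theorem on the half-cylinder. -/
lemma exists_of_coeff {c : ℤ → ℝ → ℂ} (hc : ∀ k, MemLp (c k) 2 halfLine)
    (hs : ∑' k : ℤ, ∫⁻ y in Ioi 0, ‖c k y‖ₑ ^ 2 ≠ ⊤) :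
    ∃ f, IsPeriodicL2 f ∧ ∀ k, coeff f k =ᵐ[halfLine] c k := by
  let a : ℤ → Lp ℂ 2 cellMeasure := fun k => (memLp_mode (hc k) k).toLp
  have ha : ∀ t : Finset ℤ, ∑ k ∈ t, a k = (memLp_trigPoly t hc).toLp := by
    intro t
    induction t using Finset.cons_induction with
    | empty =>
      rw [Finset.sum_empty]
      refine (MemLp.toLp_zero (MemLp.zero')).symm.trans ?_
      congr 1
    | cons k t hk ih =>
      rw [Finset.sum_cons, ih, ← MemLp.toLp_add]
      refine MemLp.toLp_congr _ _ (ae_of_all _ fun p => ?_)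
      simp only [Pi.add_apply, trigPoly, Finset.sum_cons]
  -- Parseval for finite sums turns convergence of the sum of energies into the Cauchy criterion for
  -- the series in the complete space L².
  have hnorm : ∀ t : Finset ℤ, ENNReal.ofReal (‖∑ k ∈ t, a k‖) ^ 2 =
      ENNReal.ofReal (2 * Real.pi) * ∑ k ∈ t, ∫⁻ y in Ioi 0, ‖c k y‖ₑ ^ 2 := by
    intro t
    rw [ha, ofReal_norm, Lp.enorm_toLp, eLpNorm_two_sq]
    exact parseval_trigPoly t hc
  have hsum : Summable a := by
    rw [summable_iff_vanishing_norm]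
    intro ε hε
    have h1 := ENNReal.Tendsto.const_mul (ENNReal.tendsto_tsum_compl_atTop_zero hs)
      (Or.inr (ENNReal.ofReal_ne_top (r := 2 * Real.pi)))
    rw [mul_zero] at h1
    obtain ⟨s, hs'⟩ := (h1.eventually (gt_mem_nhds
      (by positivity : (0 : ℝ≥0∞) < ENNReal.ofReal ε ^ 2))).exists
    refine ⟨s, fun t ht => ?_⟩
    have h2 : ENNReal.ofReal (‖∑ k ∈ t, a k‖) ^ 2 < ENNReal.ofReal ε ^ 2 := by
      refine lt_of_le_of_lt ?_ hs'
      rw [hnorm]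
      gcongr
      have e : ∑ k ∈ t, ∫⁻ y in Ioi 0, ‖c k y‖ₑ ^ 2 =
          ∑ k ∈ t, indicator {k : ℤ | k ∉ s} (fun k => ∫⁻ y in Ioi 0, ‖c k y‖ₑ ^ 2) k := by
        refine Finset.sum_congr rfl fun k hk => ?_
        rw [indicator_of_mem]
        exact Finset.disjoint_left.1 ht hk
      rw [e]
      refine (ENNReal.sum_le_tsum t).trans_eq ?_
      exact (tsum_subtype {k : ℤ | k ∉ s} fun k => ∫⁻ y in Ioi 0, ‖c k y‖ₑ ^ 2).symm
    have h3 : ENNReal.ofReal (‖∑ k ∈ t, a k‖) < ENNReal.ofReal ε := by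
      by_contra hle
      exact absurd h2 (not_lt.2 (pow_le_pow_left' (not_lt.1 hle) 2))
    exact (ENNReal.ofReal_lt_ofReal_iff hε).1 h3
  set F : Lp ℂ 2 cellMeasure := ∑' k, a k with hF
  have hFm : MemLp (F : ℝ × ℝ → ℂ) 2 cellMeasure := Lp.memLp F
  refine ⟨periodize F, isPeriodicL2_periodize hFm, fun k => ?_⟩
  refine (coeff_congr (periodize_ae_eq _) k).trans ?_
  have hlim : Tendsto (fun t : Finset ℤ => ENNReal.ofReal (‖F - ∑ k ∈ t, a k‖) ^ 2) atTop (𝓝 0) := by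
    have h1 : Tendsto (fun t : Finset ℤ => F - ∑ k ∈ t, a k) atTop (𝓝 (F - F)) :=
      tendsto_const_nhds.sub hsum.hasSum
    rw [sub_self] at h1
    have h2 := ENNReal.Tendsto.pow (n := 2) (ENNReal.tendsto_ofReal h1.norm)
    simpa using h2
  -- As soon as t contains k, the k-th mode of F minus the partial sum is the mode of F minus c k.
  -- Parseval bounds its energy by the squared L² error, which tends to 0.
  have hle : ∀ᶠ t : Finset ℤ in atTop, ENNReal.ofReal (2 * Real.pi) *
      ∫⁻ y in Ioi 0, ‖coeff F k y - c k y‖ₑ ^ 2 ≤ ENNReal.ofReal (‖F - ∑ k ∈ t, a k‖) ^ 2 := by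
    filter_upwards [eventually_ge_atTop {k}] with t ht
    have hk : k ∈ t := ht (Finset.mem_singleton_self k)
    have hT := memLp_trigPoly t hc
    have e : eLpNorm (↑↑(F - ∑ k ∈ t, a k)) 2 cellMeasure =
        eLpNorm (fun p => F p - trigPoly t c p) 2 cellMeasure := by
      refine eLpNorm_congr_ae ?_
      rw [ha]
      filter_upwards [Lp.coeFn_sub F hT.toLp, hT.coeFn_toLp] with p h1 h2
      rw [h1, Pi.sub_apply, h2]
    rw [ofReal_norm, Lp.enorm_def, e, eLpNorm_two_sq]
    have h3 := parseval (f := fun p => F p - trigPoly t c p) (hFm.sub hT)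
    have h4 : ∫⁻ p, ‖F p - trigPoly t c p‖ₑ ^ 2 ∂cellMeasure =
      ∫⁻ p in cell, ‖F p - trigPoly t c p‖ₑ ^ 2 := rfl
    rw [h4, h3]
    gcongr
    refine le_trans (le_of_eq ?_) (ENNReal.le_tsum k)
    refine lintegral_congr_ae ((coeff_sub hFm hT k).mono fun y hy => ?_)
    simp only
    rw [hy, coeff_trigPoly, if_pos hk]
  have h0 : ENNReal.ofReal (2 * Real.pi) * ∫⁻ y in Ioi 0, ‖coeff F k y - c k y‖ₑ ^ 2 = 0 :=
    le_antisymm (ge_of_tendsto hlim hle) zero_le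
  have h1 := (mul_eq_zero.1 h0).resolve_left ofReal_two_pi_ne_zero
  exact ae_eq_of_lintegral_sub_sq (memLp_coeff hFm k).1 (hc k).1 h1

/-! ### Test functions and weak derivatives in the half-plane -/

lemma isOpen_upperHalf : IsOpen upperHalf := isOpen_univ.prod isOpen_Ioi

lemma measurableSet_cell : MeasurableSet cell := measurableSet_Ioc.prod measurableSet_Ioi

lemma cell_subset_upperHalf : cell ⊆ upperHalf := fun _ hp => ⟨trivial, hp.2⟩

section TestFunctions

variable {φ : ℝ × ℝ → ℝ}

lemma contDiff_fderiv_apply (hφ : ContDiff ℝ ∞ φ) (v : ℝ × ℝ) :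
    ContDiff ℝ ∞ fun p => fderiv ℝ φ p v :=
  (hφ.fderiv_right (m := ∞) (by simp)).clm_apply contDiff_const

lemma IsTestFunction.fderiv_apply (h : IsTestFunction φ) (v : ℝ × ℝ) :
    IsTestFunction fun p => fderiv ℝ φ p v where
  smooth := contDiff_fderiv_apply h.smooth v
  compact := h.compact.fderiv_apply ℝ v
  support := (tsupport_fderiv_apply_subset ℝ v).trans h.support

lemma IsTestFunction.dx (h : IsTestFunction φ) : IsTestFunction (dx φ) := h.fderiv_apply _

lemma IsTestFunction.dz (h : IsTestFunction φ) : IsTestFunction (dz φ) := h.fderiv_apply _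

lemma IsTestFunction.iterate_dx (h : IsTestFunction φ) (a : ℕ) : IsTestFunction (HalfCylinder.dx^[a] φ) := by
  induction a with
  | zero => exact h
  | succ a ih =>
    rw [Function.iterate_succ_apply']
    exact ih.dx

lemma IsTestFunction.iterate_dz (h : IsTestFunction φ) (a : ℕ) : IsTestFunction (HalfCylinder.dz^[a] φ) := by
  induction a with
  | zero => exact h
  | succ a ih =>
    rw [Function.iterate_succ_apply']
    exact ih.dz

lemma IsTestFunction.partialDeriv (h : IsTestFunction φ) (β : ℕ × ℕ) :
    IsTestFunction (partialDeriv β φ) := (h.iterate_dz _).iterate_dx _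

lemma dz_dx_comm (h : ContDiff ℝ ∞ φ) : dz (dx φ) = dx (dz φ) := by
  ext p
  have hd : DifferentiableAt ℝ (fderiv ℝ φ) p :=
    (h.fderiv_right (m := ∞) (by simp)).differentiable (by simp) p
  have e : ∀ v w : ℝ × ℝ, fderiv ℝ (fun q => fderiv ℝ φ q v) p w =
      fderiv ℝ (fderiv ℝ φ) p w v := fun v w => by
    rw [fderiv_clm_apply hd (differentiableAt_const v)]
    simp
  have hs : IsSymmSndFDerivAt ℝ φ p := h.contDiffAt.isSymmSndFDerivAt (by
    simp only [minSmoothness_of_isRCLikeNormedField]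
    exact WithTop.coe_le_coe.2 (OrderTop.le_top (2 : ℕ∞)))
  change fderiv ℝ (fun q => fderiv ℝ φ q (1, 0)) p (0, 1) =
    fderiv ℝ (fun q => fderiv ℝ φ q (0, 1)) p (1, 0)
  rw [e, e]
  exact hs _ _

lemma iterate_dz_dx_comm (h : IsTestFunction φ) (b : ℕ) : dz^[b] (dx φ) = dx (dz^[b] φ) := by
  induction b with
  | zero => rfl
  | succ b ih =>
    rw [Function.iterate_succ_apply', Function.iterate_succ_apply', ih,
      dz_dx_comm (h.iterate_dz b).smooth]

lemma iterate_dz_iterate_dx_comm (h : IsTestFunction φ) (a b : ℕ) :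
    dz^[b] (dx^[a] φ) = dx^[a] (dz^[b] φ) := by
  induction a with
  | zero => rfl
  | succ a ih =>
    rw [Function.iterate_succ_apply', Function.iterate_succ_apply',
      iterate_dz_dx_comm (h.iterate_dx a), ih]

lemma partialDeriv_partialDeriv (h : IsTestFunction φ) (β γ : ℕ × ℕ) :
    partialDeriv γ (partialDeriv β φ) = partialDeriv (β + γ) φ := by
  simp only [partialDeriv, Prod.fst_add, Prod.snd_add]
  rw [iterate_dz_iterate_dx_comm (h.iterate_dz _), ← Function.iterate_add_apply,
    ← Function.iterate_add_apply, add_comm γ.1, add_comm γ.2]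

lemma IsTestFunction.integrable_mul (h : IsTestFunction φ) {f : ℝ × ℝ → ℂ}
    (hf : LocallyIntegrableOn f upperHalf) : Integrable fun p => (φ p : ℂ) * f p :=
  integrable_testFunction_mul hf h.smooth.continuous h.compact h.support

end TestFunctions

namespace IsWeakDeriv

variable {β γ : ℕ × ℕ} {f g h f₁ g₁ : ℝ × ℝ → ℂ}

lemma add (h : IsWeakDeriv β f g) (h₁ : IsWeakDeriv β f₁ g₁) :
    IsWeakDeriv β (fun p => f p + f₁ p) (fun p => g p + g₁ p) where
  locInt := h.locInt.add h₁.locInt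
  locInt_deriv := h.locInt_deriv.add h₁.locInt_deriv
  integral_eq φ hφ := by
    simp only [mul_add]
    rw [integral_add ((hφ.partialDeriv β).integrable_mul h.locInt).integrableOn
        ((hφ.partialDeriv β).integrable_mul h₁.locInt).integrableOn,
      integral_add (hφ.integrable_mul h.locInt_deriv).integrableOn
        (hφ.integrable_mul h₁.locInt_deriv).integrableOn, h.integral_eq φ hφ,
      h₁.integral_eq φ hφ]
    ring

lemma const_mul (h : IsWeakDeriv β f g) (c : ℂ) :
    IsWeakDeriv β (fun p => c * f p) (fun p => c * g p) where
  locInt := h.locInt.smul c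
  locInt_deriv := h.locInt_deriv.smul c
  integral_eq φ hφ := by
    simp only [mul_left_comm _ c]
    rw [integral_const_mul, integral_const_mul, h.integral_eq φ hφ]
    ring

lemma sub (h : IsWeakDeriv β f g) (h₁ : IsWeakDeriv β f₁ g₁) :
    IsWeakDeriv β (fun p => f p - f₁ p) (fun p => g p - g₁ p) := by
  have := h.add (h₁.const_mul (-1))
  simpa [sub_eq_add_neg] using this

lemma congr (h : IsWeakDeriv β f g) (hf : ∀ᵐ p ∂(volume.restrict upperHalf), f p = f₁ p)
    (hg : ∀ᵐ p ∂(volume.restrict upperHalf), g p = g₁ p) : IsWeakDeriv β f₁ g₁ where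
  locInt := h.locInt.congr_ae isOpen_upperHalf hf
  locInt_deriv := h.locInt_deriv.congr_ae isOpen_upperHalf hg
  integral_eq φ hφ := by
    have h1 : ∫ p in upperHalf, (partialDeriv β φ p : ℂ) * f p =
        ∫ p in upperHalf, (partialDeriv β φ p : ℂ) * f₁ p :=
      integral_congr_ae (hf.mono fun z hz => by simp only [hz])
    have h2 : ∫ p in upperHalf, (φ p : ℂ) * g p = ∫ p in upperHalf, (φ p : ℂ) * g₁ p :=
      integral_congr_ae (hg.mono fun z hz => by simp only [hz])
    rw [← h1, ← h2, h.integral_eq φ hφ]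

lemma comp (h₁ : IsWeakDeriv β f g) (h₂ : IsWeakDeriv γ g h) : IsWeakDeriv (γ + β) f h where
  locInt := h₁.locInt
  locInt_deriv := h₂.locInt_deriv
  integral_eq φ hφ := by
    rw [← partialDeriv_partialDeriv hφ, h₁.integral_eq _ (hφ.partialDeriv γ),
      h₂.integral_eq φ hφ, ← mul_assoc, ← pow_add]
    congr 2
    simp only [Prod.fst_add, Prod.snd_add]
    ring

/-- Since ∂^γ φ is again a test function, the definition of the first derivative can be read
backwards. Higher derivatives of the potential, once known in one order, thereby become derivatives
of lower ones. -/
lemma of_comp (h₁ : IsWeakDeriv β f g) (h₂ : IsWeakDeriv (γ + β) f h) : IsWeakDeriv γ g h where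
  locInt := h₁.locInt_deriv
  locInt_deriv := h₂.locInt_deriv
  integral_eq φ hφ := by
    have e1 := h₂.integral_eq φ hφ
    rw [← partialDeriv_partialDeriv hφ, h₁.integral_eq _ (hφ.partialDeriv γ)] at e1
    have e2 : ((-1 : ℂ) ^ (β.1 + β.2)) * (-1) ^ (β.1 + β.2) = 1 := by
      rw [← mul_pow]
      norm_num
    have e3 : (-1 : ℂ) ^ ((γ + β).1 + (γ + β).2) = (-1) ^ (β.1 + β.2) * (-1) ^ (γ.1 + γ.2) := by
      rw [← pow_add]
      congr 1
      simp only [Prod.fst_add, Prod.snd_add]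
      ring
    rw [e3] at e1
    linear_combination (-1 : ℂ) ^ (β.1 + β.2) * e1 -
      ((∫ p in upperHalf, (partialDeriv γ φ p : ℂ) * g p) -
        (-1) ^ (γ.1 + γ.2) * ∫ p in upperHalf, (φ p : ℂ) * h p) * e2

lemma refl (hf : LocallyIntegrableOn f upperHalf) : IsWeakDeriv 0 f f where
  locInt := hf
  locInt_deriv := hf
  integral_eq φ _ := by simp [partialDeriv]

end IsWeakDeriv

lemma ae_eq_of_integral_testFunction {f g : ℝ × ℝ → ℂ} (hf : LocallyIntegrableOn f upperHalf)
    (hg : LocallyIntegrableOn g upperHalf)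
    (h : ∀ φ : ℝ × ℝ → ℝ, IsTestFunction φ →
      ∫ p in upperHalf, (φ p : ℂ) * f p = ∫ p in upperHalf, (φ p : ℂ) * g p) :
    ∀ᵐ p ∂(volume.restrict upperHalf), f p = g p := by
  rw [ae_restrict_iff' isOpen_upperHalf.measurableSet]
  have := isOpen_upperHalf.ae_eq_zero_of_integral_contDiff_smul_eq_zero (hf.sub hg) (μ := volume) ?_
  · filter_upwards [this] with z hz hz0
    exact sub_eq_zero.1 (hz hz0)
  · intro φ h1 h2 h3
    have hφ : IsTestFunction φ := ⟨h1, h2, h3⟩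
    have := h φ hφ
    rw [setIntegral_testFunction_mul f h3, setIntegral_testFunction_mul g h3] at this
    rw [← sub_eq_zero, ← integral_sub (hφ.integrable_mul hf) (hφ.integrable_mul hg)] at this
    rw [← this]
    congr 1
    ext z
    simp [mul_sub]

/-- Weak derivatives are unique almost everywhere. -/
lemma IsWeakDeriv.unique {β : ℕ × ℕ} {f g h : ℝ × ℝ → ℂ} (h₁ : IsWeakDeriv β f g)
    (h₂ : IsWeakDeriv β f h) : ∀ᵐ p ∂(volume.restrict upperHalf), g p = h p := by
  refine ae_eq_of_integral_testFunction h₁.locInt_deriv h₂.locInt_deriv fun φ hφ => ?_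
  have := (h₁.integral_eq φ hφ).symm.trans (h₂.integral_eq φ hφ)
  exact mul_left_cancel₀ (pow_ne_zero _ (by norm_num)) this

/-! ### Periodic functions on the half-plane -/

section Periodic

/-- The horizontal translate of the cell by `n` periods. -/
def cellShift (n : ℤ) : Set (ℝ × ℝ) :=
  Ioc (2 * Real.pi * n) (2 * Real.pi * n + 2 * Real.pi) ×ˢ Ioi 0

lemma measurableSet_cellShift (n : ℤ) : MeasurableSet (cellShift n) :=
  measurableSet_Ioc.prod measurableSet_Ioi

/-- The translation by `n` periods. -/
def shift (n : ℤ) (p : ℝ × ℝ) : ℝ × ℝ := p + (2 * Real.pi * n, 0)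

lemma measurePreserving_shift (n : ℤ) :
    MeasurePreserving (shift n) cellMeasure (volume.restrict (cellShift n)) := by
  have h := (measurePreserving_add_right (volume : Measure (ℝ × ℝ)) (2 * Real.pi * n, 0)).restrict_preimage
    (measurableSet_cellShift n)
  have e : (fun p : ℝ × ℝ => p + (2 * Real.pi * n, 0)) ⁻¹' cellShift n = cell := by
    ext p
    simp only [cellShift, cell, mem_preimage, mem_prod, mem_Ioc, Prod.fst_add, Prod.snd_add, mem_Ioi]
    constructor
    · rintro ⟨⟨h1, h2⟩, h3⟩
      exact ⟨⟨by linarith, by linarith⟩, by linarith⟩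
    · rintro ⟨⟨h1, h2⟩, h3⟩
      exact ⟨⟨by linarith, by linarith⟩, by linarith⟩
  rw [e] at h
  exact h

lemma measurableEmbedding_shift (n : ℤ) : MeasurableEmbedding (shift n) :=
  (MeasurableEquiv.addRight ((2 * Real.pi * n, 0) : ℝ × ℝ)).measurableEmbedding

lemma IsPeriodic.add_int_mul {f : ℝ × ℝ → ℂ} (hf : IsPeriodic f) (n : ℤ) (x : ℝ) {z : ℝ} (hz : 0 < z) :
    f (x + 2 * Real.pi * n, z) = f (x, z) := by
  have hp : Function.Periodic (fun x => f (x, z)) (2 * Real.pi) := fun x => hf x z hz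
  have := hp.int_mul n x
  rwa [mul_comm] at this

lemma IsPeriodic.comp_shift {f : ℝ × ℝ → ℂ} (hf : IsPeriodic f) (n : ℤ) {p : ℝ × ℝ} (hp : 0 < p.2) :
    f (shift n p) = f p := by
  have := hf.add_int_mul n p.1 hp
  rwa [show (p.1 + 2 * Real.pi * n, p.2) = shift n p from
    Prod.ext rfl (add_zero _).symm] at this

lemma ae_cell_pos : ∀ᵐ p ∂cellMeasure, 0 < p.2 :=
  (ae_restrict_mem measurableSet_cell).mono fun _ hp => hp.2

lemma IsPeriodic.comp_shift_ae {f : ℝ × ℝ → ℂ} (hf : IsPeriodic f) (n : ℤ) :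
    f ∘ shift n =ᵐ[cellMeasure] f :=
  ae_cell_pos.mono fun _ hp => hf.comp_shift n hp

lemma IsPeriodic.aestronglyMeasurable_cellShift {f : ℝ × ℝ → ℂ} (hf : IsPeriodic f)
    (hm : AEStronglyMeasurable f cellMeasure) (n : ℤ) :
    AEStronglyMeasurable f (volume.restrict (cellShift n)) := by
  rw [← (measurePreserving_shift n).aestronglyMeasurable_comp_iff (measurableEmbedding_shift n)]
  exact hm.congr (hf.comp_shift_ae n).symm

lemma IsPeriodic.lintegral_cellShift {f : ℝ × ℝ → ℂ} (hf : IsPeriodic f) (n : ℤ) :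
    ∫⁻ p in cellShift n, ‖f p‖ₑ ^ 2 = ∫⁻ p in cell, ‖f p‖ₑ ^ 2 := by
  rw [← (measurePreserving_shift n).lintegral_comp_emb (measurableEmbedding_shift n)]
  exact lintegral_congr_ae ((hf.comp_shift_ae n).mono fun p hp => by
    simp only [Function.comp_apply] at hp
    simp only [hp])

lemma exists_mem_cellShift {p : ℝ × ℝ} (hp : 0 < p.2) :
    p ∈ cellShift (⌈p.1 / (2 * Real.pi)⌉ - 1) := by
  have h0 := Real.two_pi_pos
  have h1 := Int.le_ceil (p.1 / (2 * Real.pi))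
  have h2 := Int.ceil_lt_add_one (p.1 / (2 * Real.pi))
  have e : p.1 = p.1 / (2 * Real.pi) * (2 * Real.pi) := by field_simp
  refine ⟨⟨?_, ?_⟩, hp⟩
  · push_cast
    nlinarith
  · push_cast
    nlinarith

lemma exists_finset_cellShift {K : Set (ℝ × ℝ)} (hK : IsCompact K) (hU : K ⊆ upperHalf) :
    ∃ s : Finset ℤ, K ⊆ ⋃ n ∈ s, cellShift n := by
  obtain ⟨R, hR⟩ := hK.isBounded.exists_norm_le
  refine ⟨Finset.Icc (⌈-R / (2 * Real.pi)⌉ - 1) (⌈R / (2 * Real.pi)⌉ - 1), fun p hp => ?_⟩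
  have h1 : |p.1| ≤ R := (norm_fst_le p).trans (hR p hp)
  refine mem_iUnion₂.2 ⟨_, ?_, exists_mem_cellShift (hU hp).2⟩
  rw [Finset.mem_Icc]
  have h0 := Real.two_pi_pos
  refine ⟨sub_le_sub_right (Int.ceil_le_ceil ?_) 1, sub_le_sub_right (Int.ceil_le_ceil ?_) 1⟩
  · exact div_le_div_of_nonneg_right (abs_le.1 h1).1 h0.le
  · exact div_le_div_of_nonneg_right (abs_le.1 h1).2 h0.le

lemma ae_cell_of_ae_upperHalf {P : ℝ × ℝ → Prop} (h : ∀ᵐ p ∂(volume.restrict upperHalf), P p) :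
    ∀ᵐ p ∂cellMeasure, P p := ae_restrict_of_ae_restrict_of_subset cell_subset_upperHalf h

lemma IsPeriodicL2.locallyIntegrableOn {f : ℝ × ℝ → ℂ} (hf : IsPeriodicL2 f) :
    LocallyIntegrableOn f upperHalf := by
  rw [locallyIntegrableOn_iff isOpen_upperHalf.isLocallyClosed]
  intro K hK hKc
  obtain ⟨s, hs⟩ := exists_finset_cellShift hKc hK
  have e : K = ⋃ n ∈ s, cellShift n ∩ K := by
    rw [← iUnion₂_inter, inter_eq_right.2 hs]
  rw [e, integrableOn_finset_iUnion]
  intro n _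
  have h1 : MemLp f 2 (volume.restrict (cellShift n)) := by
    rw [memLp_two_iff]
    refine ⟨hf.periodic.aestronglyMeasurable_cellShift hf.memLp.1 n, ?_⟩
    rw [hf.periodic.lintegral_cellShift]
    exact (memLp_two_iff.1 hf.memLp).2
  have h2 : MemLp f 2 (volume.restrict (cellShift n ∩ K)) :=
    h1.mono_measure (Measure.restrict_mono inter_subset_left le_rfl)
  have : IsFiniteMeasure (volume.restrict (cellShift n ∩ K)) :=
    ⟨by
      rw [Measure.restrict_apply_univ]
      exact (measure_mono inter_subset_right).trans_lt hKc.measure_lt_top⟩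
  exact h2.integrable (by norm_num)

/-- Test functions act continuously on square integrable periodic functions. -/
lemma IsTestFunction.exists_bound {φ : ℝ × ℝ → ℝ} (hφ : IsTestFunction φ) :
    ∃ C : ℝ≥0∞, C ≠ ⊤ ∧ ∀ g : ℝ × ℝ → ℂ, IsPeriodicL2 g →
      ‖∫ p in upperHalf, (φ p : ℂ) * g p‖ₑ ≤ C * (∫⁻ p in cell, ‖g p‖ₑ ^ 2) ^ (1 / 2 : ℝ) := by
  -- A compact support is covered by finitely many translates of the cell. Cauchy–Schwarz on each
  -- gives C as the number of translates times the L² norm of φ.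
  obtain ⟨s, hs⟩ := exists_finset_cellShift hφ.compact hφ.support
  have hsq : ∀ x y : ℝ≥0∞, x ^ 2 ≤ y → x ≤ y ^ (1 / 2 : ℝ) := fun x y h => by
    calc x = (x ^ 2) ^ (1 / 2 : ℝ) := by
          rw [← ENNReal.rpow_natCast, ← ENNReal.rpow_mul]
          norm_num
      _ ≤ _ := ENNReal.rpow_le_rpow h (by norm_num)
  have hφc : Continuous fun p => (φ p : ℂ) := Complex.continuous_ofReal.comp hφ.smooth.continuous
  have hfin : ∫⁻ p, ‖(φ p : ℂ)‖ₑ ^ 2 ≠ ⊤ := by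
    have : MemLp (fun p => (φ p : ℂ)) 2 volume := hφc.memLp_of_hasCompactSupport
      (hφ.compact.comp_left Complex.ofReal_zero)
    exact (memLp_two_iff.1 this).2
  refine ⟨s.card * (∫⁻ p, ‖(φ p : ℂ)‖ₑ ^ 2) ^ (1 / 2 : ℝ),
    ENNReal.mul_ne_top (by finiteness) (by finiteness), fun g hg => ?_⟩
  rw [setIntegral_testFunction_mul _ hφ.support]
  have h0 : ∫ p, (φ p : ℂ) * g p = ∫ p in ⋃ n ∈ s, cellShift n, (φ p : ℂ) * g p :=
    (setIntegral_testFunction_mul _ hs).symm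
  rw [h0]
  refine (enorm_integral_le_lintegral_enorm _).trans ?_
  calc _ ≤ ∑ n ∈ s, ∫⁻ p in cellShift n, ‖(φ p : ℂ) * g p‖ₑ := by
        have hU : (⋃ n ∈ s, cellShift n) = ⋃ n : s, cellShift n := biUnion_eq_iUnion _ _
        rw [hU]
        refine (lintegral_iUnion_le _ _).trans_eq ?_
        rw [tsum_fintype]
        exact Finset.sum_coe_sort s fun n => ∫⁻ p in cellShift n, ‖(φ p : ℂ) * g p‖ₑ
    _ ≤ ∑ n ∈ s, ((∫⁻ p, ‖(φ p : ℂ)‖ₑ ^ 2) ^ (1 / 2 : ℝ) *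
        (∫⁻ p in cell, ‖g p‖ₑ ^ 2) ^ (1 / 2 : ℝ)) := by
        refine Finset.sum_le_sum fun n _ => ?_
        rw [← ENNReal.mul_rpow_of_nonneg _ _ (by norm_num)]
        refine hsq _ _ ?_
        simp only [enorm_mul]
        refine (sq_lintegral_mul_le hφc.enorm.aemeasurable
          (hg.periodic.aestronglyMeasurable_cellShift hg.memLp.1 n).enorm).trans ?_
        rw [hg.periodic.lintegral_cellShift]
        gcongr
        exact Measure.restrict_le_self
    _ = _ := by
        rw [Finset.sum_const, nsmul_eq_mul, mul_assoc]

end Periodic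

lemma locallyIntegrableOn_of_memLp {c : ℝ → ℂ} (hc : MemLp c 2 halfLine) :
    LocallyIntegrableOn c (Ioi 0) :=
  locallyIntegrableOn_of_locallyIntegrable_restrict (hc.locallyIntegrable (by norm_num))

/-! ### From Fourier modes to weak derivatives -/

section Synthesis

variable {β : ℕ × ℕ} {f g : ℝ × ℝ → ℂ}

lemma isPeriodicL2_mode {c : ℝ → ℂ} (hc : MemLp c 2 halfLine) (k : ℤ) :
    IsPeriodicL2 fun p => c p.2 * character k p.1 where
  periodic x z _ := by simp only [character_periodic]
  memLp := memLp_mode hc k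

lemma isPeriodicL2_trigPoly (s : Finset ℤ) {c : ℤ → ℝ → ℂ} (hc : ∀ k, MemLp (c k) 2 halfLine) :
    IsPeriodicL2 (trigPoly s c) := ⟨trigPoly_periodic s c, memLp_trigPoly s hc⟩

lemma isWeakDeriv_trigPoly (s : Finset ℤ) {c d : ℤ → ℝ → ℂ}
    (h : ∀ k, IsWeakDeriv β (fun p => c k p.2 * character k p.1) fun p => d k p.2 * character k p.1) :
    IsWeakDeriv β (trigPoly s c) (trigPoly s d) := by
  induction s using Finset.cons_induction with
  | empty =>
    have := (h 0).const_mul 0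
    have e : ∀ a : ℤ → ℝ → ℂ, trigPoly ∅ a = fun _ => 0 := fun a => by
      ext p
      simp [trigPoly]
    rw [e, e]
    simpa only [zero_mul] using this
  | cons k t hk ih =>
    have := (h k).add ih
    have e : ∀ a : ℤ → ℝ → ℂ, trigPoly (Finset.cons k t hk) a =
        fun p => a k p.2 * character k p.1 + trigPoly t a p := fun a => by
      ext p
      simp only [trigPoly, Finset.sum_cons]
    rw [e, e]
    exact this

lemma IsTestFunction.tendsto_integral_trigPoly {φ : ℝ × ℝ → ℝ} (hφ : IsTestFunction φ)
    (hf : IsPeriodicL2 f) :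
    Tendsto (fun s : Finset ℤ => ∫ p in upperHalf, (φ p : ℂ) * trigPoly s (coeff f) p) atTop
      (𝓝 (∫ p in upperHalf, (φ p : ℂ) * f p)) := by
  obtain ⟨C, hC, hb⟩ := hφ.exists_bound
  have hT : ∀ s, IsPeriodicL2 (trigPoly s (coeff f)) := fun s =>
    isPeriodicL2_trigPoly s (memLp_coeff hf.memLp)
  have h1 : Tendsto (fun s : Finset ℤ => C * (∫⁻ p in cell, ‖f p - trigPoly s (coeff f) p‖ₑ ^ 2) ^
      (1 / 2 : ℝ)) atTop (𝓝 0) := by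
    have := ENNReal.Tendsto.const_mul ((tendsto_lintegral_sub_trigPoly hf.memLp).ennrpow_const
      (1 / 2 : ℝ)) (Or.inr hC)
    simpa using this
  rw [tendsto_iff_edist_tendsto_0]
  refine tendsto_of_tendsto_of_tendsto_of_le_of_le tendsto_const_nhds h1 (fun _ => zero_le)
    fun s => ?_
  have h2 := hb (fun p => f p - trigPoly s (coeff f) p)
    ⟨fun x z hz => by simp only [hf.periodic x z hz, (hT s).periodic x z hz],
      hf.memLp.sub (hT s).memLp⟩
  refine le_trans (le_of_eq ?_) h2
  rw [edist_comm, edist_eq_enorm_sub, ← integral_sub (hφ.integrable_mul hf.locallyIntegrableOn).integrableOn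
    (hφ.integrable_mul (hT s).locallyIntegrableOn).integrableOn]
  simp only [mul_sub]

/-- A relation between Fourier modes that holds weakly holds between the functions. -/
lemma isWeakDeriv_of_modes (hf : IsPeriodicL2 f) (hg : IsPeriodicL2 g)
    (h : ∀ k, IsWeakDeriv β (fun p => coeff f k p.2 * character k p.1)
      fun p => coeff g k p.2 * character k p.1) : IsWeakDeriv β f g where
  locInt := hf.locallyIntegrableOn
  locInt_deriv := hg.locallyIntegrableOn
  integral_eq φ hφ := by
    -- Both sides of the weak identity are continuous in L², hence limits of the same expressions
    -- for trigonometric polynomials, where the identity holds by linearity.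
    have h1 := (hφ.partialDeriv β).tendsto_integral_trigPoly hf
    have h2 := (hφ.tendsto_integral_trigPoly hg).const_mul ((-1) ^ (β.1 + β.2))
    refine tendsto_nhds_unique h1 (h2.congr fun s => ?_)
    exact ((isWeakDeriv_trigPoly s h).integral_eq φ hφ).symm

lemma upperHalf_prod : (volume : Measure (ℝ × ℝ)).restrict upperHalf =
    (volume : Measure ℝ).prod halfLine := by
  rw [upperHalf, Measure.volume_eq_prod, ← Measure.prod_restrict, Measure.restrict_univ]

lemma IsTestFunction.hasCompactSupport_slice_left {φ : ℝ × ℝ → ℝ} (h : IsTestFunction φ) (z : ℝ) :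
    HasCompactSupport fun x => φ (x, z) := by
  refine HasCompactSupport.intro (h.compact.isCompact.image continuous_fst) fun x hx => ?_
  exact image_eq_zero_of_notMem_tsupport fun hm => hx ⟨_, hm, rfl⟩

lemma IsTestFunction.slice_right {φ : ℝ × ℝ → ℝ} (h : IsTestFunction φ) (x : ℝ) :
    IsTestFunctionHL fun z => φ (x, z) where
  smooth := h.smooth.comp (contDiff_const.prodMk contDiff_id)
  compact := by
    refine HasCompactSupport.intro (h.compact.isCompact.image continuous_snd) fun z hz => ?_
    exact image_eq_zero_of_notMem_tsupport fun hm => hz ⟨_, hm, rfl⟩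
  support := by
    have hK := h.compact.isCompact.image continuous_snd
    refine (closure_minimal (fun z hz => ?_) hK.isClosed).trans
      (fun z (hz : z ∈ Prod.snd '' tsupport φ) => ?_)
    · exact ⟨(x, z), subset_tsupport _ hz, rfl⟩
    · obtain ⟨p, hp, rfl⟩ := hz
      exact (h.support hp).2

lemma hasDerivAt_dx {φ : ℝ × ℝ → ℝ} (h : ContDiff ℝ ∞ φ) (x z : ℝ) :
    HasDerivAt (fun x => φ (x, z)) (dx φ (x, z)) x := by
  have h1 : HasFDerivAt φ (fderiv ℝ φ (x, z)) (x, z) :=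
    (h.differentiable (by simp) (x, z)).hasFDerivAt
  exact h1.comp_hasDerivAt x ((hasDerivAt_id x).prodMk (hasDerivAt_const x z))

lemma hasDerivAt_dz {φ : ℝ × ℝ → ℝ} (h : ContDiff ℝ ∞ φ) (x z : ℝ) :
    HasDerivAt (fun z => φ (x, z)) (dz φ (x, z)) z := by
  have h1 : HasFDerivAt φ (fderiv ℝ φ (x, z)) (x, z) :=
    (h.differentiable (by simp) (x, z)).hasFDerivAt
  exact h1.comp_hasDerivAt z ((hasDerivAt_const z x).prodMk (hasDerivAt_id z))

lemma hasDerivAt_character (k : ℤ) (x : ℝ) :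
    HasDerivAt (character k) (Complex.I * k * character k x) x := by
  have h1 : HasDerivAt (fun x : ℝ => Complex.I * k * (x : ℂ)) (Complex.I * k) x := by
    simpa using (Complex.ofRealCLM.hasDerivAt (x := x)).const_mul (Complex.I * k)
  rw [mul_comm]
  exact h1.cexp

/-- The horizontal weak derivative of a Fourier mode. -/
lemma isWeakDeriv_mode_x {c : ℝ → ℂ} (hc : MemLp c 2 halfLine) (k : ℤ) :
    IsWeakDeriv (1, 0) (fun p => c p.2 * character k p.1)
      (fun p => (Complex.I * k * c p.2) * character k p.1) where
  locInt := (isPeriodicL2_mode hc k).locallyIntegrableOn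
  locInt_deriv := (isPeriodicL2_mode (hc.const_mul (Complex.I * k)) k).locallyIntegrableOn
  integral_eq φ hφ := by
    have i1 := hφ.dx.integrable_mul (isPeriodicL2_mode hc k).locallyIntegrableOn
    have i2 := hφ.integrable_mul (isPeriodicL2_mode (hc.const_mul (Complex.I * k)) k).locallyIntegrableOn
    have i1' := i1.integrableOn (s := upperHalf)
    have i2' := i2.integrableOn (s := upperHalf)
    rw [IntegrableOn, upperHalf_prod] at i1' i2'
    simp only [partialDeriv, Function.iterate_one, Function.iterate_zero, id_eq, add_zero, pow_one]
    rw [upperHalf_prod, integral_prod_symm _ i1', integral_prod_symm _ i2', neg_one_mul,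
      ← integral_neg]
    congr 1
    ext z
    have hs := hφ.hasCompactSupport_slice_left z
    have hs' := hφ.dx.hasCompactSupport_slice_left z
    have hcx : Continuous fun x => ((φ (x, z) : ℝ) : ℂ) :=
      Complex.continuous_ofReal.comp (hφ.smooth.continuous.comp (by fun_prop))
    have hcx' : Continuous fun x => ((dx φ (x, z) : ℝ) : ℂ) :=
      Complex.continuous_ofReal.comp (hφ.dx.smooth.continuous.comp (by fun_prop))
    have hsc : HasCompactSupport fun x => ((φ (x, z) : ℝ) : ℂ) := hs.comp_left Complex.ofReal_zero
    have hsc' : HasCompactSupport fun x => ((dx φ (x, z) : ℝ) : ℂ) :=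
      hs'.comp_left Complex.ofReal_zero
    have key := integral_mul_deriv_eq_deriv_mul_of_integrable
      (u := fun x => ((φ (x, z) : ℝ) : ℂ)) (v := fun x => c z * character k x)
      (u' := fun x => ((dx φ (x, z) : ℝ) : ℂ)) (v' := fun x => c z * (Complex.I * k * character k x))
      (fun x _ => (hasDerivAt_dx hφ.smooth x z).ofReal_comp)
      (fun x _ => (hasDerivAt_character k x).const_mul (c z))
      ((hcx.mul (by have := continuous_character k; fun_prop)).integrable_of_hasCompactSupport
        hsc.mul_right)
      ((hcx'.mul (by have := continuous_character k; fun_prop)).integrable_of_hasCompactSupport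
        hsc'.mul_right)
      ((hcx.mul (by have := continuous_character k; fun_prop)).integrable_of_hasCompactSupport
        hsc.mul_right)
    have e : ∫ x, (φ (x, z) : ℂ) * (Complex.I * k * c z * character k x) =
        ∫ x, (φ (x, z) : ℂ) * (c z * (Complex.I * k * character k x)) := by
      congr 1
      ext x
      ring
    simp only
    rw [e, key, neg_neg]

/-- The vertical weak derivative of a Fourier mode. -/
lemma isWeakDeriv_mode_z {c d : ℝ → ℂ} (hc : MemLp c 2 halfLine) (hd : MemLp d 2 halfLine)
    (h : IsWeakDerivHL c d) (k : ℤ) :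
    IsWeakDeriv (0, 1) (fun p => c p.2 * character k p.1) (fun p => d p.2 * character k p.1) where
  locInt := (isPeriodicL2_mode hc k).locallyIntegrableOn
  locInt_deriv := (isPeriodicL2_mode hd k).locallyIntegrableOn
  integral_eq φ hφ := by
    have i1 := hφ.dz.integrable_mul (isPeriodicL2_mode hc k).locallyIntegrableOn
    have i2 := hφ.integrable_mul (isPeriodicL2_mode hd k).locallyIntegrableOn
    have i1' := i1.integrableOn (s := upperHalf)
    have i2' := i2.integrableOn (s := upperHalf)
    rw [IntegrableOn, upperHalf_prod] at i1' i2'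
    simp only [partialDeriv, Function.iterate_one, Function.iterate_zero, id_eq, zero_add, pow_one]
    rw [upperHalf_prod, integral_prod _ i1', integral_prod _ i2', neg_one_mul, ← integral_neg]
    congr 1
    ext x
    have key := h.integral_eq _ (hφ.slice_right x)
    simp only [(hasDerivAt_dz hφ.smooth x _).deriv] at key
    simp only [← mul_assoc]
    rw [integral_mul_const, integral_mul_const, key, neg_mul]

end Synthesis

/-! ### From weak derivatives to Fourier modes -/

section Analysis

variable {f g : ℝ × ℝ → ℂ}

/-- A smooth function whose translates by the period sum to one. -/
def cutoff (x : ℝ) : ℝ := Real.smoothTransition x - Real.smoothTransition (x - 2 * Real.pi)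

lemma contDiff_cutoff : ContDiff ℝ ∞ cutoff :=
  Real.smoothTransition.contDiff.sub
    (Real.smoothTransition.contDiff.comp (contDiff_id.sub contDiff_const))

lemma cutoff_eq_zero {x : ℝ} (hx : x ∉ Ioc 0 (4 * Real.pi)) : cutoff x = 0 := by
  have hpi := Real.pi_gt_three
  unfold cutoff
  by_cases h : 0 < x
  · have h4 : 4 * Real.pi < x := by
      by_contra h'
      exact hx ⟨h, not_lt.1 h'⟩
    rw [Real.smoothTransition.one_of_one_le (by linarith),
      Real.smoothTransition.one_of_one_le (by linarith), sub_self]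
  · rw [Real.smoothTransition.zero_of_nonpos (by linarith),
      Real.smoothTransition.zero_of_nonpos (by linarith), sub_self]

lemma hasCompactSupport_cutoff : HasCompactSupport cutoff :=
  HasCompactSupport.intro (K := Icc 0 (4 * Real.pi)) isCompact_Icc fun _ hx =>
    cutoff_eq_zero fun h => hx (Ioc_subset_Icc_self h)

/-- The cut-off lives on two periods, so only two translates matter above the cell. Their sum
telescopes to the transition function at x + 2π, where it is 1, minus its value at x - 2π, where it
is 0. -/
lemma cutoff_add {x : ℝ} (hx : x ∈ Ioc 0 (2 * Real.pi)) :
    cutoff x + cutoff (x + 2 * Real.pi) = 1 := by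
  have hpi := Real.pi_gt_three
  unfold cutoff
  rw [add_sub_cancel_right, Real.smoothTransition.zero_of_nonpos (x := x - 2 * Real.pi)
    (by linarith [hx.2]), Real.smoothTransition.one_of_one_le (x := x + 2 * Real.pi) (by linarith [hx.1])]
  ring

/-- Where the transition equals 0 or 1 it attains a global extremum; this covers the endpoints 0 and
1. -/
lemma deriv_smoothTransition_eq_zero {x : ℝ} (hx : x ≤ 0 ∨ 1 ≤ x) :
    deriv Real.smoothTransition x = 0 := by
  rcases hx with hx | hx
  · refine IsLocalMin.deriv_eq_zero (Eventually.of_forall fun y => ?_)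
    rw [Real.smoothTransition.zero_of_nonpos hx]
    exact Real.smoothTransition.nonneg y
  · refine IsLocalMax.deriv_eq_zero (Eventually.of_forall fun y => ?_)
    rw [Real.smoothTransition.one_of_one_le hx]
    exact Real.smoothTransition.le_one y

lemma deriv_cutoff (x : ℝ) : deriv cutoff x =
    deriv Real.smoothTransition x - deriv Real.smoothTransition (x - 2 * Real.pi) := by
  have hd : Differentiable ℝ Real.smoothTransition :=
    (Real.smoothTransition.contDiff (n := 1)).differentiable (by simp)
  have h2 := (hd (x - 2 * Real.pi)).hasDerivAt.comp x ((hasDerivAt_id x).sub_const (2 * Real.pi))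
  have := ((hd x).hasDerivAt.sub h2).deriv
  rw [mul_one] at this
  exact this

lemma deriv_cutoff_add {x : ℝ} (hx : x ∈ Ioc 0 (2 * Real.pi)) :
    deriv cutoff x + deriv cutoff (x + 2 * Real.pi) = 0 := by
  have hpi := Real.pi_gt_three
  rw [deriv_cutoff, deriv_cutoff, add_sub_cancel_right,
    deriv_smoothTransition_eq_zero (x := x - 2 * Real.pi) (Or.inl (by linarith [hx.2])),
    deriv_smoothTransition_eq_zero (x := x + 2 * Real.pi) (Or.inr (by linarith [hx.1]))]
  ring

lemma deriv_cutoff_eq_zero {x : ℝ} (hx : x ∉ Ioc 0 (4 * Real.pi)) : deriv cutoff x = 0 := by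
  have hpi := Real.pi_gt_three
  rw [deriv_cutoff]
  by_cases h : 0 < x
  · have h4 : 4 * Real.pi < x := by
      by_contra h'
      exact hx ⟨h, not_lt.1 h'⟩
    rw [deriv_smoothTransition_eq_zero (Or.inr (by linarith)),
      deriv_smoothTransition_eq_zero (Or.inr (by linarith)), sub_self]
  · rw [deriv_smoothTransition_eq_zero (Or.inl (by linarith)),
      deriv_smoothTransition_eq_zero (Or.inl (by linarith)), sub_self]

/-- Unfolding an integral over the half-plane to the cell. -/
lemma integral_unfold {ρ : ℝ → ℝ} (hρ : Continuous ρ) (h0 : ∀ x, x ∉ Ioc 0 (4 * Real.pi) → ρ x = 0)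
    {r : ℝ} (hr : ∀ x ∈ Ioc 0 (2 * Real.pi), ρ x + ρ (x + 2 * Real.pi) = r)
    {h : ℝ × ℝ → ℂ} (hp : IsPeriodic h) (hi : IntegrableOn h cell) :
    ∫ p in upperHalf, (ρ p.1 : ℂ) * h p = r * ∫ p in cell, h p := by
  have hpi := Real.pi_pos
  obtain ⟨C, hC⟩ : ∃ C, ∀ x, ‖ρ x‖ ≤ C := by
    have : HasCompactSupport ρ := HasCompactSupport.intro (K := Icc 0 (4 * Real.pi)) isCompact_Icc
      fun _ hx => h0 _ fun h => hx (Ioc_subset_Icc_self h)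
    exact hρ.bounded_above_of_compact_support this
  have hbd : ∀ a : ℝ, IntegrableOn (fun p : ℝ × ℝ => (ρ (p.1 + a) : ℂ) * h p) cell := fun a =>
    hi.bdd_mul (c := C) (Continuous.aestronglyMeasurable (by fun_prop))
      (ae_of_all _ fun p => by simpa using hC (p.1 + a))
  have hmp := measurePreserving_shift 1
  have hme := measurableEmbedding_shift 1
  have e1 : ∀ p ∈ cell, (fun p : ℝ × ℝ => (ρ p.1 : ℂ) * h p) (shift 1 p) =
      (ρ (p.1 + 2 * Real.pi) : ℂ) * h p := fun p hp' => by
    simp only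
    rw [hp.comp_shift 1 hp'.2]
    simp [shift]
  have i1 : IntegrableOn (fun p : ℝ × ℝ => (ρ p.1 : ℂ) * h p) (cellShift 1) := by
    rw [IntegrableOn, ← hmp.integrable_comp_emb hme]
    exact (hbd (2 * Real.pi)).congr_fun (fun p hp' => (e1 p hp').symm) measurableSet_cell
  have i0 : IntegrableOn (fun p : ℝ × ℝ => (ρ p.1 : ℂ) * h p) cell := by simpa using hbd 0
  have hd : Disjoint cell (cellShift 1) := by
    rw [Set.disjoint_left]
    intro p h1 h2
    have a1 := h1.1.2
    have a2 := h2.1.1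
    push_cast at a2
    linarith
  have hsub : cell ∪ cellShift 1 ⊆ upperHalf :=
    union_subset cell_subset_upperHalf fun p hp' => ⟨trivial, hp'.2⟩
  rw [setIntegral_eq_of_subset_of_forall_sdiff_eq_zero isOpen_upperHalf.measurableSet hsub,
    setIntegral_union hd (measurableSet_cellShift 1) i0 i1, ← hmp.integral_comp hme]
  · have e2 : ∫ p, (fun p : ℝ × ℝ => (ρ p.1 : ℂ) * h p) (shift 1 p) ∂cellMeasure =
        ∫ p in cell, (ρ (p.1 + 2 * Real.pi) : ℂ) * h p :=
      setIntegral_congr_fun measurableSet_cell e1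
    rw [e2, ← integral_add i0 (hbd (2 * Real.pi)), ← integral_const_mul]
    refine setIntegral_congr_fun measurableSet_cell fun p hp' => ?_
    rw [← hr p.1 hp'.1]
    push_cast
    ring
  · rintro p ⟨h1, h2⟩
    rw [h0 p.1 fun hx => h2 ?_]
    · simp
    · by_cases hx2 : p.1 ≤ 2 * Real.pi
      · exact Or.inl ⟨⟨hx.1, hx2⟩, h1.2⟩
      · refine Or.inr ⟨⟨?_, ?_⟩, h1.2⟩ <;> push_cast <;> linarith [hx.2]

lemma isTestFunction_prod {α η : ℝ → ℝ} (hα : ContDiff ℝ ∞ α) (hs : HasCompactSupport α)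
    (hη : IsTestFunctionHL η) : IsTestFunction fun p : ℝ × ℝ => α p.1 * η p.2 := by
  have hK : IsCompact (tsupport α ×ˢ tsupport η) := hs.isCompact.prod hη.compact
  have hz : ∀ p : ℝ × ℝ, p ∉ tsupport α ×ˢ tsupport η → α p.1 * η p.2 = 0 := fun p hp => by
    by_cases h : p.1 ∈ tsupport α
    · rw [image_eq_zero_of_notMem_tsupport fun h' => hp ⟨h, h'⟩, mul_zero]
    · rw [image_eq_zero_of_notMem_tsupport h, zero_mul]
  refine ⟨(hα.comp contDiff_fst).mul (hη.smooth.comp contDiff_snd), HasCompactSupport.intro hK hz, ?_⟩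
  refine (closure_minimal (fun p hp => ?_) hK.isClosed).trans fun p hp => ⟨trivial, hη.support hp.2⟩
  by_contra h
  exact hp (hz p h)

lemma dx_prod {α η : ℝ → ℝ} (hα : ContDiff ℝ ∞ α) (hη : ContDiff ℝ ∞ η) (p : ℝ × ℝ) :
    dx (fun p : ℝ × ℝ => α p.1 * η p.2) p = deriv α p.1 * η p.2 := by
  have h1 := hasDerivAt_dx (φ := fun p : ℝ × ℝ => α p.1 * η p.2)
    ((hα.comp contDiff_fst).mul (hη.comp contDiff_snd)) p.1 p.2
  have h2 := (hα.differentiable (by simp) p.1).hasDerivAt.mul_const (η p.2)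
  exact h1.unique h2

lemma dz_prod {α η : ℝ → ℝ} (hα : ContDiff ℝ ∞ α) (hη : ContDiff ℝ ∞ η) (p : ℝ × ℝ) :
    dz (fun p : ℝ × ℝ => α p.1 * η p.2) p = α p.1 * deriv η p.2 := by
  have h1 := hasDerivAt_dz (φ := fun p : ℝ × ℝ => α p.1 * η p.2)
    ((hα.comp contDiff_fst).mul (hη.comp contDiff_snd)) p.1 p.2
  have h2 := (hη.differentiable (by simp) p.2).hasDerivAt.const_mul (α p.1)
  exact h1.unique h2

lemma IsTestFunctionHL.memLp {η : ℝ → ℝ} (hη : IsTestFunctionHL η) :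
    MemLp (fun z => (η z : ℂ)) 2 halfLine := by
  have : MemLp (fun z => (η z : ℂ)) 2 volume :=
    (Complex.continuous_ofReal.comp hη.smooth.continuous).memLp_of_hasCompactSupport
      (hη.compact.comp_left Complex.ofReal_zero)
  exact this.mono_measure Measure.restrict_le_self

lemma integrableOn_cell_mul {c : ℝ → ℂ} (hc : MemLp c 2 halfLine) (hf : MemLp f 2 cellMeasure) :
    IntegrableOn (fun p => c p.2 * f p) cell := by
  have h0 := memLp_mode hc 0
  have e : (fun p : ℝ × ℝ => c p.2 * character 0 p.1) = fun p => c p.2 := by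
    ext p
    simp [character]
  rw [e] at h0
  exact h0.integrable_mul hf

lemma integral_mul_coeff {c : ℝ → ℂ} (hc : MemLp c 2 halfLine) (hf : MemLp f 2 cellMeasure)
    (k : ℤ) : ∫ p in cell, character (-k) p.1 * (c p.2 * f p) =
      2 * Real.pi * ∫ z in Ioi 0, c z * coeff f k z := by
  have hi : IntegrableOn (fun p => character (-k) p.1 * (c p.2 * f p)) cell :=
    (integrableOn_cell_mul hc hf).bdd_mul (c := 1)
      ((continuous_character (-k)).comp continuous_fst).aestronglyMeasurable
      (ae_of_all _ fun p => (norm_character _ _).le)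
  have e : ∫ p in cell, character (-k) p.1 * (c p.2 * f p) =
    ∫ p, character (-k) p.1 * (c p.2 * f p) ∂cellMeasure := rfl
  have hi' : Integrable (fun p => character (-k) p.1 * (c p.2 * f p)) cellMeasure := hi
  rw [cellMeasure_eq] at hi'
  rw [e, cellMeasure_eq, integral_prod_symm _ hi', ← integral_const_mul]
  congr 1
  ext z
  have hpi : (Real.pi : ℂ) ≠ 0 := by exact_mod_cast Real.pi_ne_zero
  rw [coeff, intervalIntegral.integral_of_le Real.two_pi_pos.le]
  have e2 : ∀ x : ℝ, character (-k) x * (c z * f (x, z)) =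
      c z * (f (x, z) * Complex.exp (-(Complex.I * k * x))) := fun x => by
    have : character (-k) x = Complex.exp (-(Complex.I * k * x)) := by
      rw [character]
      congr 1
      push_cast
      ring
    rw [this]
    ring
  simp only [e2]
  rw [integral_const_mul]
  field_simp

lemma character_neg_eq (k : ℤ) (x : ℝ) :
    character (-k) x = Real.cos (k * x) - Complex.I * Real.sin (k * x) := by
  rw [character, show Complex.I * ((-k : ℤ) : ℂ) * x = ((-(k * x) : ℝ) : ℂ) * Complex.I by
    push_cast; ring, Complex.exp_mul_I, ← Complex.ofReal_cos, ← Complex.ofReal_sin, Real.cos_neg,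
    Real.sin_neg]
  push_cast
  ring

lemma cos_periodic_int (k : ℤ) (x : ℝ) : Real.cos (k * (x + 2 * Real.pi)) = Real.cos (k * x) := by
  rw [mul_add, Real.cos_add_int_mul_two_pi]

lemma sin_periodic_int (k : ℤ) (x : ℝ) : Real.sin (k * (x + 2 * Real.pi)) = Real.sin (k * x) := by
  rw [mul_add, Real.sin_add_int_mul_two_pi]

variable {k : ℤ} {η w : ℝ → ℝ}

lemma integrableOn_trig_mul (hw : Continuous w) (hb : ∀ x, |w x| ≤ 1) (hη : IsTestFunctionHL η)
    (hf : IsPeriodicL2 f) : IntegrableOn (fun p => (w p.1 : ℂ) * ((η p.2 : ℂ) * f p)) cell :=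
  (integrableOn_cell_mul hη.memLp hf.memLp).bdd_mul (c := 1)
    (Continuous.aestronglyMeasurable (by fun_prop)) (ae_of_all _ fun p => by simpa using hb p.1)

lemma integral_cutoff_mul (hw : Continuous w) (hb : ∀ x, |w x| ≤ 1)
    (hp : ∀ x, w (x + 2 * Real.pi) = w x) (hη : IsTestFunctionHL η) (hf : IsPeriodicL2 f) :
    ∫ p in upperHalf, (cutoff p.1 : ℂ) * (w p.1 * (η p.2 * f p)) =
      ∫ p in cell, (w p.1 : ℂ) * (η p.2 * f p) := by
  rw [integral_unfold contDiff_cutoff.continuous (fun x hx => cutoff_eq_zero hx)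
    (fun x hx => cutoff_add hx) ?_ (integrableOn_trig_mul hw hb hη hf)]
  · simp
  · intro x z hz
    simp only [hp, hf.periodic x z hz]

/-- The translates of the cut-off sum to one, so those of its derivative sum to zero. This removes
the term that the product rule creates when a periodic weight is made compactly supported. -/
lemma integral_deriv_cutoff_mul (hw : Continuous w) (hb : ∀ x, |w x| ≤ 1)
    (hp : ∀ x, w (x + 2 * Real.pi) = w x) (hη : IsTestFunctionHL η) (hf : IsPeriodicL2 f) :
    ∫ p in upperHalf, ((deriv cutoff p.1 : ℝ) : ℂ) * (w p.1 * (η p.2 * f p)) = 0 := by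
  rw [integral_unfold ((contDiff_infty_iff_deriv.1 contDiff_cutoff).2).continuous
    (fun x hx => deriv_cutoff_eq_zero hx)
    (fun x hx => deriv_cutoff_add hx) ?_ (integrableOn_trig_mul hw hb hη hf)]
  · simp
  · intro x z hz
    simp only [hp, hf.periodic x z hz]

lemma isTestFunction_cutoff (hw : ContDiff ℝ ∞ w) (hη : IsTestFunctionHL η) :
    IsTestFunction fun p : ℝ × ℝ => (cutoff p.1 * w p.1) * η p.2 :=
  isTestFunction_prod (contDiff_cutoff.mul hw) hasCompactSupport_cutoff.mul_right hη

/-- Testing a weak vertical derivative against `w(x) η(z)`. -/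
lemma IsWeakDeriv.integral_cell_z (h : IsWeakDeriv (0, 1) f g) (hf : IsPeriodicL2 f)
    (hg : IsPeriodicL2 g) (hw : ContDiff ℝ ∞ w) (hb : ∀ x, |w x| ≤ 1)
    (hp : ∀ x, w (x + 2 * Real.pi) = w x) (hη : IsTestFunctionHL η) :
    ∫ p in cell, (w p.1 : ℂ) * (((deriv η p.2 : ℝ) : ℂ) * f p) =
      -∫ p in cell, (w p.1 : ℂ) * (η p.2 * g p) := by
  have key := h.integral_eq _ (isTestFunction_cutoff hw hη)
  simp only [partialDeriv, Function.iterate_one, Function.iterate_zero, id_eq, zero_add, pow_one,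
    dz_prod (contDiff_cutoff.mul hw) hη.smooth] at key
  rw [← integral_cutoff_mul hw.continuous hb hp hη.deriv hf,
    ← integral_cutoff_mul hw.continuous hb hp hη hg]
  have e1 : ∀ p : ℝ × ℝ, (cutoff p.1 : ℂ) * (w p.1 * (((deriv η p.2 : ℝ) : ℂ) * f p)) =
      ((cutoff p.1 * w p.1 * deriv η p.2 : ℝ) : ℂ) * f p := fun p => by
    push_cast
    ring
  have e2 : ∀ p : ℝ × ℝ, (cutoff p.1 : ℂ) * (w p.1 * (η p.2 * g p)) =
      ((cutoff p.1 * w p.1 * η p.2 : ℝ) : ℂ) * g p := fun p => by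
    push_cast
    ring
  simp only [e1, e2]
  rw [key, neg_one_mul]

/-- Testing a weak horizontal derivative against `w(x) η(z)`. -/
lemma IsWeakDeriv.integral_cell_x (h : IsWeakDeriv (1, 0) f g) (hf : IsPeriodicL2 f)
    (hg : IsPeriodicL2 g) (hw : ContDiff ℝ ∞ w) (hb : ∀ x, |w x| ≤ 1)
    (hp : ∀ x, w (x + 2 * Real.pi) = w x) {v : ℝ → ℝ} {m : ℝ} (hv : ContDiff ℝ ∞ v)
    (hvb : ∀ x, |v x| ≤ 1) (hvp : ∀ x, v (x + 2 * Real.pi) = v x)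
    (hvw : ∀ x, deriv w x = m * v x) (hη : IsTestFunctionHL η) :
    m * ∫ p in cell, (v p.1 : ℂ) * (η p.2 * f p) = -∫ p in cell, (w p.1 : ℂ) * (η p.2 * g p) := by
  have key := h.integral_eq _ (isTestFunction_cutoff hw hη)
  have hd : ∀ x, deriv (fun x => cutoff x * w x) x =
      deriv cutoff x * w x + m * (cutoff x * v x) := fun x => by
    have := deriv_fun_mul (contDiff_cutoff.differentiable (by simp) x)
      (hw.differentiable (by simp) x)
    rw [this, hvw]
    ring
  simp only [partialDeriv, Function.iterate_one, Function.iterate_zero, id_eq, add_zero, pow_one,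
    dx_prod (contDiff_cutoff.mul hw) hη.smooth, hd, neg_one_mul] at key
  rw [← integral_cutoff_mul hv.continuous hvb hvp hη hf,
    ← integral_cutoff_mul hw.continuous hb hp hη hg]
  have e1 : ∫ p in upperHalf, ((cutoff p.1 * w p.1 * η p.2 : ℝ) : ℂ) * g p =
      ∫ p in upperHalf, (cutoff p.1 : ℂ) * (w p.1 * (η p.2 * g p)) := by
    congr 1
    ext p
    push_cast
    ring
  have dc : ContDiff ℝ ∞ (deriv cutoff) := (contDiff_infty_iff_deriv.1 contDiff_cutoff).2
  have i1 := ((isTestFunction_prod (dc.mul hw)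
    hasCompactSupport_cutoff.deriv.mul_right hη).integrable_mul hf.locallyIntegrableOn).integrableOn
    (s := upperHalf)
  have i2 := ((isTestFunction_cutoff hv hη).integrable_mul hf.locallyIntegrableOn).integrableOn
    (s := upperHalf)
  have e2 : ∫ p in upperHalf,
      (((deriv cutoff p.1 * w p.1 + m * (cutoff p.1 * v p.1)) * η p.2 : ℝ) : ℂ) * f p =
      (∫ p in upperHalf, ((deriv cutoff p.1 * w p.1 * η p.2 : ℝ) : ℂ) * f p) +
      m * ∫ p in upperHalf, ((cutoff p.1 * v p.1 * η p.2 : ℝ) : ℂ) * f p := by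
    rw [← integral_const_mul, ← integral_add i1 (i2.const_mul _)]
    congr 1
    ext p
    push_cast
    ring
  have e3 : ∫ p in upperHalf, ((deriv cutoff p.1 * w p.1 * η p.2 : ℝ) : ℂ) * f p = 0 := by
    rw [← integral_deriv_cutoff_mul hw.continuous hb hp hη hf]
    congr 1
    ext p
    push_cast
    ring
  have e4 : ∫ p in upperHalf, ((cutoff p.1 * v p.1 * η p.2 : ℝ) : ℂ) * f p =
      ∫ p in upperHalf, (cutoff p.1 : ℂ) * (v p.1 * (η p.2 * f p)) := by
    congr 1
    ext p
    push_cast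
    ring
  rw [e1, e2, e3, zero_add, e4] at key
  exact key

lemma contDiff_cos_int (k : ℤ) : ContDiff ℝ ∞ fun x : ℝ => Real.cos (k * x) :=
  Real.contDiff_cos.comp (contDiff_const.mul contDiff_id)

lemma contDiff_sin_int (k : ℤ) : ContDiff ℝ ∞ fun x : ℝ => Real.sin (k * x) :=
  Real.contDiff_sin.comp (contDiff_const.mul contDiff_id)

/-- Test functions are real valued, so a Fourier mode is reached by testing with cosine and sine
separately. -/
lemma integral_character_mul (hη : IsTestFunctionHL η) (hf : IsPeriodicL2 f) (k : ℤ) :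
    ∫ p in cell, character (-k) p.1 * ((η p.2 : ℂ) * f p) =
      (∫ p in cell, ((Real.cos (k * p.1) : ℝ) : ℂ) * (η p.2 * f p)) -
        Complex.I * ∫ p in cell, ((Real.sin (k * p.1) : ℝ) : ℂ) * (η p.2 * f p) := by
  rw [← integral_const_mul, ← integral_sub
    (integrableOn_trig_mul (contDiff_cos_int k).continuous (fun x => Real.abs_cos_le_one _) hη hf)
    ((integrableOn_trig_mul (contDiff_sin_int k).continuous
      (fun x => Real.abs_sin_le_one _) hη hf).const_mul _)]
  congr 1
  ext p
  rw [character_neg_eq]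
  ring

/-- The Fourier modes of a weak vertical derivative. -/
lemma IsWeakDeriv.coeff_z (h : IsWeakDeriv (0, 1) f g) (hf : IsPeriodicL2 f)
    (hg : IsPeriodicL2 g) (k : ℤ) : IsWeakDerivHL (coeff f k) (coeff g k) where
  locInt := locallyIntegrableOn_of_memLp (memLp_coeff hf.memLp k)
  locInt_deriv := locallyIntegrableOn_of_memLp (memLp_coeff hg.memLp k)
  integral_eq η hη := by
    have h1 := h.integral_cell_z hf hg (contDiff_cos_int k) (fun x => Real.abs_cos_le_one _)
      (cos_periodic_int k) hη
    have h2 := h.integral_cell_z hf hg (contDiff_sin_int k) (fun x => Real.abs_sin_le_one _)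
      (sin_periodic_int k) hη
    have e1 := integral_character_mul hη.deriv hf k
    have e2 := integral_character_mul hη hg k
    rw [integral_mul_coeff hη.deriv.memLp hf.memLp] at e1
    rw [integral_mul_coeff hη.memLp hg.memLp] at e2
    have hpi : (2 * Real.pi : ℂ) ≠ 0 := by exact_mod_cast Real.two_pi_pos.ne'
    refine mul_left_cancel₀ hpi ?_
    rw [e1, mul_neg, e2, h1, h2]
    ring

/-- The Fourier modes of a weak horizontal derivative. -/
lemma IsWeakDeriv.coeff_x (h : IsWeakDeriv (1, 0) f g) (hf : IsPeriodicL2 f)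
    (hg : IsPeriodicL2 g) (k : ℤ) : ∀ᵐ z ∂halfLine, coeff g k z = Complex.I * k * coeff f k z := by
  have lf : LocallyIntegrableOn (coeff f k) (Ioi 0) :=
    locallyIntegrableOn_of_memLp (memLp_coeff hf.memLp k)
  have lg : LocallyIntegrableOn (coeff g k) (Ioi 0) :=
    locallyIntegrableOn_of_memLp (memLp_coeff hg.memLp k)
  refine ae_eq_of_integral_testFunctionHL lg (lf.smul (Complex.I * k)) fun η hη => ?_
  have h1 := h.integral_cell_x hf hg (contDiff_cos_int k) (fun x => Real.abs_cos_le_one _)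
    (cos_periodic_int k) (v := fun x => Real.sin (k * x)) (m := -k) (contDiff_sin_int k)
    (fun x => Real.abs_sin_le_one _) (sin_periodic_int k) (fun x => by
      have := ((hasDerivAt_id x).const_mul (k : ℝ)).cos.deriv
      simp only [id_eq, mul_one] at this
      rw [this]
      ring) hη
  have h2 := h.integral_cell_x hf hg (contDiff_sin_int k) (fun x => Real.abs_sin_le_one _)
    (sin_periodic_int k) (v := fun x => Real.cos (k * x)) (m := k) (contDiff_cos_int k)
    (fun x => Real.abs_cos_le_one _) (cos_periodic_int k) (fun x => by
      have := ((hasDerivAt_id x).const_mul (k : ℝ)).sin.deriv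
      simp only [id_eq, mul_one] at this
      rw [this]
      ring) hη
  have e1 := integral_character_mul hη hf k
  have e2 := integral_character_mul hη hg k
  rw [integral_mul_coeff hη.memLp hf.memLp] at e1
  rw [integral_mul_coeff hη.memLp hg.memLp] at e2
  have hpi : (2 * Real.pi : ℂ) ≠ 0 := by exact_mod_cast Real.two_pi_pos.ne'
  refine mul_left_cancel₀ hpi ?_
  have e3 : ∫ z in Ioi 0, (η z : ℂ) * (Complex.I * k * coeff f k z) =
      Complex.I * k * ∫ z in Ioi 0, (η z : ℂ) * coeff f k z := by
    rw [← integral_const_mul]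
    congr 1
    ext z
    ring
  rw [e3, e2]
  simp only [Complex.ofReal_neg, Complex.ofReal_intCast] at h1 h2
  linear_combination h1 - Complex.I * h2 - Complex.I * k * e1 + (k : ℂ) *
    (∫ p in cell, ((Real.sin (k * p.1) : ℝ) : ℂ) * (η p.2 * f p)) * Complex.I_mul_I

end Analysis

/-! ### The Dirichlet Green function mode by mode -/

/-- The `L²` norm on the half-line as a real number. -/
def l2HL (f : ℝ → ℂ) : ℝ := (eLpNorm f 2 halfLine).toReal

lemma l2HL_nonneg (f : ℝ → ℂ) : 0 ≤ l2HL f := ENNReal.toReal_nonneg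

lemma ofReal_l2HL_sq {f : ℝ → ℂ} (hf : MemLp f 2 halfLine) :
    ENNReal.ofReal (l2HL f ^ 2) = ∫⁻ y in Ioi 0, ‖f y‖ₑ ^ 2 := by
  rw [ENNReal.ofReal_pow (l2HL_nonneg f), l2HL, ENNReal.ofReal_toReal hf.2.ne, eLpNorm_two_sq]

lemma IsExpKernel.norm_lintegral_le {κ : ℝ} {K : ℝ → ℝ → ℝ} {f : ℝ → ℂ} (hK : IsExpKernel κ K)
    (hκ : 0 < κ) (hf : MemLp f 2 halfLine) {z : ℝ} (hz : 0 ≤ z) :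
    ∫ y in Ioi 0, ‖(K z y : ℂ) * f y‖ ≤ (√κ)⁻¹ * l2HL f := by
  rw [integral_norm_eq_lintegral_enorm (hK.aestronglyMeasurable hf.1 z)]
  refine ENNReal.toReal_le_of_le_ofReal (mul_nonneg (by positivity) (l2HL_nonneg f)) ?_
  by_contra hlt
  have h1 : ENNReal.ofReal ((√κ)⁻¹ * l2HL f) ^ 2 < (∫⁻ y in Ioi 0, ‖(K z y : ℂ) * f y‖ₑ) ^ 2 :=
    ENNReal.pow_right_strictMono (n := 2) (by norm_num) (not_le.1 hlt)
  have h2 := (pow_le_pow_left' (hK.lintegral_enorm_le (f := f) hz) 2).trans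
    (sq_lintegral_exp_mul_le hκ hf.1 z)
  refine absurd h1 (not_lt.2 (h2.trans_eq ?_))
  rw [← ofReal_l2HL_sq hf, ← ENNReal.ofReal_mul (by positivity),
    ← ENNReal.ofReal_pow (mul_nonneg (by positivity) (l2HL_nonneg f)), mul_pow, inv_pow,
    Real.sq_sqrt hκ.le, one_div]

lemma IsExpKernel.norm_kernelOp_le {κ : ℝ} {K : ℝ → ℝ → ℝ} {f : ℝ → ℂ} (hK : IsExpKernel κ K)
    (hκ : 0 < κ) (hf : MemLp f 2 halfLine) {z : ℝ} (hz : 0 ≤ z) :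
    ‖kernelOp K f z‖ ≤ (√κ)⁻¹ * l2HL f :=
  (norm_integral_le_integral_norm _).trans (hK.norm_lintegral_le hκ hf hz)

/-- The Dirichlet kernel `(exp (-κ |z - y|) - exp (-κ (z + y))) / 2`. -/
def kerA (κ z y : ℝ) : ℝ := (kerU κ z y - kerW κ z y) / 2

/-- The vertical derivative of the Dirichlet kernel, divided by `-κ`. -/
def kerB (κ z y : ℝ) : ℝ := (kerV κ z y - kerW κ z y) / 2

lemma IsExpKernel.half_sub {κ : ℝ} {K L : ℝ → ℝ → ℝ} (hK : IsExpKernel κ K) (hL : IsExpKernel κ L) :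
    IsExpKernel κ fun z y => (K z y - L z y) / 2 where
  measurable := (hK.measurable.sub hL.measurable).div_const 2
  bound z y hz hy := by
    rw [abs_div, abs_two, div_le_iff₀ (by norm_num)]
    have h1 := hK.bound z y hz hy
    have h2 := hL.bound z y hz hy
    linarith [abs_sub (K z y) (L z y)]

lemma isExpKernel_kerA {κ : ℝ} (hκ : 0 < κ) : IsExpKernel κ (kerA κ) :=
  (isExpKernel_kerU κ).half_sub (isExpKernel_kerW hκ)

lemma isExpKernel_kerB {κ : ℝ} (hκ : 0 < κ) : IsExpKernel κ (kerB κ) :=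
  (isExpKernel_kerV κ).half_sub (isExpKernel_kerW hκ)

lemma kernelOp_half_sub {κ : ℝ} {K L : ℝ → ℝ → ℝ} {f : ℝ → ℂ} (hK : IsExpKernel κ K)
    (hL : IsExpKernel κ L) (hκ : 0 < κ) (hf : MemLp f 2 halfLine) {z : ℝ} (hz : 0 ≤ z) :
    kernelOp (fun z y => (K z y - L z y) / 2) f z = (1 / 2 : ℂ) * (kernelOp K f z - kernelOp L f z) := by
  unfold kernelOp
  rw [← integral_sub (hK.integrable hκ hf hz) (hL.integrable hκ hf hz), ← integral_const_mul]
  congr 1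
  ext y
  push_cast
  ring

section

variable {κ : ℝ} {f : ℝ → ℂ}

lemma kernelOp_kerA (hκ : 0 < κ) (hf : MemLp f 2 halfLine) {z : ℝ} (hz : 0 ≤ z) :
    kernelOp (kerA κ) f z = (1 / 2 : ℂ) * (kernelOp (kerU κ) f z - kernelOp (kerW κ) f z) :=
  kernelOp_half_sub (isExpKernel_kerU κ) (isExpKernel_kerW hκ) hκ hf hz

lemma kernelOp_kerB (hκ : 0 < κ) (hf : MemLp f 2 halfLine) {z : ℝ} (hz : 0 ≤ z) :
    kernelOp (kerB κ) f z = (1 / 2 : ℂ) * (kernelOp (kerV κ) f z - kernelOp (kerW κ) f z) :=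
  kernelOp_half_sub (isExpKernel_kerV κ) (isExpKernel_kerW hκ) hκ hf hz

lemma ae_halfLine_pos : ∀ᵐ z ∂halfLine, 0 < z := ae_restrict_mem measurableSet_Ioi

lemma isWeakDerivHL_kerA (hκ : 0 < κ) (hf : MemLp f 2 halfLine) :
    IsWeakDerivHL (kernelOp (kerA κ) f) fun z => -κ * kernelOp (kerB κ) f z := by
  refine (((isWeakDerivHL_kernelOp_kerU hκ hf).sub
    (isWeakDerivHL_kernelOp_kerW (κ := κ) (f := f))).const_mul
    (1 / 2 : ℂ)).congr ?_ ?_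
  · exact ae_halfLine_pos.mono fun z hz => (kernelOp_kerA hκ hf hz.le).symm
  · refine ae_halfLine_pos.mono fun z hz => ?_
    rw [kernelOp_kerB hκ hf hz.le]
    ring

lemma isWeakDerivHL_kerB (hκ : 0 < κ) (hf : MemLp f 2 halfLine) :
    IsWeakDerivHL (kernelOp (kerB κ) f) fun z => f z - κ * kernelOp (kerA κ) f z := by
  refine (((isWeakDerivHL_kernelOp_kerV hκ hf).sub
    (isWeakDerivHL_kernelOp_kerW (κ := κ) (f := f))).const_mul
    (1 / 2 : ℂ)).congr ?_ ?_
  · exact ae_halfLine_pos.mono fun z hz => (kernelOp_kerB hκ hf hz.le).symm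
  · refine ae_halfLine_pos.mono fun z hz => ?_
    rw [kernelOp_kerA hκ hf hz.le]
    ring

lemma continuousOn_kernelOp_kerA (hκ : 0 < κ) (hf : MemLp f 2 halfLine) :
    ContinuousOn (kernelOp (kerA κ) f) (Ici 0) :=
  ((continuousOn_kernelOp_kerU hκ hf).sub continuousOn_kernelOp_kerW).const_mul (1 / 2 : ℂ)
    |>.congr fun _ hz => kernelOp_kerA hκ hf hz

end

/-- The modulus of a wave number. -/
def wave (k : ℤ) : ℝ := |(k : ℝ)|

lemma wave_nonneg (k : ℤ) : 0 ≤ wave k := abs_nonneg _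

lemma one_le_wave {k : ℤ} (hk : k ≠ 0) : 1 ≤ wave k := by
  unfold wave
  exact_mod_cast Int.one_le_abs hk

lemma wave_pos {k : ℤ} (hk : k ≠ 0) : 0 < wave k := zero_lt_one.trans_le (one_le_wave hk)

lemma wave_sq (k : ℤ) : wave k ^ 2 = (k : ℝ) ^ 2 := sq_abs _

/-- Expanding the hyperbolic sine of the smaller height against the exponential of the larger one
gives the direct kernel minus its mirror image at -y. -/
lemma green_eq {k : ℤ} (hk : k ≠ 0) {z y : ℝ} (hz : 0 ≤ z) (hy : 0 < y) :
    green k z y = -(1 / wave k) * kerA (wave k) z y := by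
  have h := (wave_pos hk).ne'
  unfold green kerA kerU kerW
  rw [abs_of_pos (by linarith : 0 < z + y)]
  have hw : |(k : ℝ)| = wave k := rfl
  simp only [hw]
  split_ifs with hyz
  · rw [abs_of_pos (by linarith), Real.sinh_eq, show -wave k * (z - y) = -wave k * z + wave k * y by ring,
      show -wave k * (z + y) = -wave k * z + -(wave k * y) by ring, Real.exp_add, Real.exp_add]
    ring
  · rw [abs_of_nonpos (by linarith), Real.sinh_eq,
      show -wave k * -(z - y) = -wave k * y + wave k * z by ring,
      show -wave k * (z + y) = -wave k * y + -(wave k * z) by ring, Real.exp_add, Real.exp_add]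
    ring

/-- The modes of `κ⁻¹ (-Δ)` applied to the potential. -/
def opA (k : ℤ) (f : ℝ → ℂ) (z : ℝ) : ℂ := if k = 0 then 0 else kernelOp (kerA (wave k)) f z

/-- The modes of the vertical derivative of the potential. -/
def opB (k : ℤ) (f : ℝ → ℂ) (z : ℝ) : ℂ := if k = 0 then 0 else kernelOp (kerB (wave k)) f z

lemma opA_of_ne {k : ℤ} (hk : k ≠ 0) (f : ℝ → ℂ) : opA k f = kernelOp (kerA (wave k)) f := by
  ext z
  simp [opA, hk]

lemma opB_of_ne {k : ℤ} (hk : k ≠ 0) (f : ℝ → ℂ) : opB k f = kernelOp (kerB (wave k)) f := by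
  ext z
  simp [opB, hk]

lemma opA_zero (f : ℝ → ℂ) : opA 0 f = fun _ => 0 := by
  ext z
  simp [opA]

lemma opB_zero (f : ℝ → ℂ) : opB 0 f = fun _ => 0 := by
  ext z
  simp [opB]

section Modes

variable {k : ℤ} {f : ℝ → ℂ}

lemma memLp_opA (hf : MemLp f 2 halfLine) (k : ℤ) : MemLp (opA k f) 2 halfLine := by
  by_cases hk : k = 0
  · subst hk
    rw [opA_zero]
    exact MemLp.zero'
  · rw [opA_of_ne hk]
    exact (isExpKernel_kerA (wave_pos hk)).memLp_kernelOp (wave_pos hk) hf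

lemma memLp_opB (hf : MemLp f 2 halfLine) (k : ℤ) : MemLp (opB k f) 2 halfLine := by
  by_cases hk : k = 0
  · subst hk
    rw [opB_zero]
    exact MemLp.zero'
  · rw [opB_of_ne hk]
    exact (isExpKernel_kerB (wave_pos hk)).memLp_kernelOp (wave_pos hk) hf

/-- The multiplier costs at most κ and the operator gains 2/κ, so the norm is at most 2 and its
square 4, uniformly in the wave number. -/
lemma lintegral_wave_kernelOp_le {K : ℝ → ℝ → ℝ} (hk : k ≠ 0) (hK : IsExpKernel (wave k) K)
    (hf : MemLp f 2 halfLine) {a : ℂ} (ha : ‖a‖ ≤ wave k) :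
    ∫⁻ z in Ioi 0, ‖a * kernelOp K f z‖ₑ ^ 2 ≤ 4 * ∫⁻ z in Ioi 0, ‖f z‖ₑ ^ 2 := by
  have hw := wave_pos hk
  simp only [enorm_mul, mul_pow]
  rw [lintegral_const_mul' _ _ (by finiteness)]
  refine (mul_le_mul_right (hK.lintegral_kernelOp_sq_le hw hf.1) _).trans ?_
  rw [← mul_assoc, ← mul_pow]
  gcongr
  have h1 : ‖a‖ₑ * ENNReal.ofReal (2 / wave k) ≤ 2 := by
    rw [← ofReal_norm, ← ENNReal.ofReal_mul (norm_nonneg a), ← ENNReal.ofReal_ofNat 2]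
    refine ENNReal.ofReal_le_ofReal ?_
    rw [mul_div_assoc', div_le_iff₀ hw]
    linarith
  calc _ ≤ (2 : ℝ≥0∞) ^ 2 := pow_le_pow_left' h1 2
    _ = 4 := by norm_num

lemma lintegral_opA_le (hf : MemLp f 2 halfLine) {a : ℂ} (ha : ‖a‖ ≤ wave k) :
    ∫⁻ z in Ioi 0, ‖a * opA k f z‖ₑ ^ 2 ≤ 4 * ∫⁻ z in Ioi 0, ‖f z‖ₑ ^ 2 := by
  by_cases hk : k = 0
  · subst hk
    simp [opA_zero]
  · rw [opA_of_ne hk]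
    exact lintegral_wave_kernelOp_le hk (isExpKernel_kerA (wave_pos hk)) hf ha

lemma lintegral_opB_le (hf : MemLp f 2 halfLine) {a : ℂ} (ha : ‖a‖ ≤ wave k) :
    ∫⁻ z in Ioi 0, ‖a * opB k f z‖ₑ ^ 2 ≤ 4 * ∫⁻ z in Ioi 0, ‖f z‖ₑ ^ 2 := by
  by_cases hk : k = 0
  · subst hk
    simp [opB_zero]
  · rw [opB_of_ne hk]
    exact lintegral_wave_kernelOp_le hk (isExpKernel_kerB (wave_pos hk)) hf ha

lemma isWeakDerivHL_opA (hf : MemLp f 2 halfLine) (k : ℤ) :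
    IsWeakDerivHL (opA k f) fun z => -wave k * opB k f z := by
  by_cases hk : k = 0
  · subst hk
    rw [opA_zero, opB_zero]
    simpa using isWeakDerivHL_const 0
  · rw [opA_of_ne hk, opB_of_ne hk]
    exact isWeakDerivHL_kerA (wave_pos hk) hf

/-- For k = 0 the operators are set to zero, and the equation survives only if the zero mode of the
source vanishes. This is where the zero mean enters. -/
lemma isWeakDerivHL_opB (hf : MemLp f 2 halfLine) (h0 : k = 0 → ∀ᵐ z ∂halfLine, f z = 0) :
    IsWeakDerivHL (opB k f) fun z => f z - wave k * opA k f z := by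
  by_cases hk : k = 0
  · subst hk
    rw [opA_zero, opB_zero]
    refine (isWeakDerivHL_const 0).congr (ae_of_all _ fun _ => rfl) ?_
    filter_upwards [h0 rfl] with z hz
    simp [hz]
  · rw [opA_of_ne hk, opB_of_ne hk]
    exact isWeakDerivHL_kerB (wave_pos hk) hf

lemma norm_opA_le (hf : MemLp f 2 halfLine) {z : ℝ} (hz : 0 ≤ z) :
    ‖opA k f z‖ ≤ (√(wave k))⁻¹ * l2HL f := by
  by_cases hk : k = 0
  · subst hk
    simp [opA_zero, wave]
  · rw [opA_of_ne hk]
    exact (isExpKernel_kerA (wave_pos hk)).norm_kernelOp_le (wave_pos hk) hf hz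

lemma norm_opB_le (hf : MemLp f 2 halfLine) {z : ℝ} (hz : 0 ≤ z) :
    ‖opB k f z‖ ≤ (√(wave k))⁻¹ * l2HL f := by
  by_cases hk : k = 0
  · subst hk
    simp [opB_zero, wave]
  · rw [opB_of_ne hk]
    exact (isExpKernel_kerB (wave_pos hk)).norm_kernelOp_le (wave_pos hk) hf hz

lemma continuousOn_opA (hf : MemLp f 2 halfLine) (k : ℤ) : ContinuousOn (opA k f) (Ici 0) := by
  by_cases hk : k = 0
  · subst hk
    rw [opA_zero]
    exact continuousOn_const
  · rw [opA_of_ne hk]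
    exact continuousOn_kernelOp_kerA (wave_pos hk) hf

end Modes

/-- A square integrable function whose Fourier series converges absolutely and uniformly is the sum
of its series. -/
lemma ae_eq_tsum {f : ℝ × ℝ → ℂ} (hf : IsPeriodicL2 f) {c : ℤ → ℝ → ℂ}
    (hc : ∀ k, coeff f k =ᵐ[halfLine] c k) {b : ℤ → ℝ} (hb : ∀ k, ∀ z, 0 < z → ‖c k z‖ ≤ b k)
    (hs : Summable b) : f =ᵐ[cellMeasure] fun p => ∑' k, c k p.2 * character k p.1 := by
  have hcm : ∀ k, MemLp (c k) 2 halfLine := fun k => (memLp_congr_ae (hc k)).1 (memLp_coeff hf.memLp k)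
  -- Symmetric partial sums: a sequence is needed because pointwise limits of measurable functions
  -- and Fatou's lemma require a countable index.
  let s : ℕ → Finset ℤ := fun n => Finset.Icc (-(n : ℤ)) n
  have hst : Tendsto s atTop atTop := by
    refine tendsto_atTop_finset_of_monotone (fun m n hmn => ?_) fun k => ⟨k.natAbs, ?_⟩
    · exact Finset.Icc_subset_Icc (by simpa using hmn) (by simpa using hmn)
    · simp only [s, Finset.mem_Icc]
      omega
  have hT : ∀ t : Finset ℤ, trigPoly t (coeff f) =ᵐ[cellMeasure] trigPoly t c := fun t => by
    refine ae_eq_of_coeff_eq (memLp_trigPoly t (memLp_coeff hf.memLp)) (memLp_trigPoly t hcm) fun k => ?_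
    filter_upwards [hc k] with y hy
    simp only [coeff_trigPoly, hy]
  have hlim : ∀ p : ℝ × ℝ, 0 < p.2 → Tendsto (fun n => trigPoly (s n) c p) atTop
      (𝓝 (∑' k, c k p.2 * character k p.1)) := fun p hp => by
    have : Summable fun k => c k p.2 * character k p.1 := by
      refine Summable.of_norm_bounded hs fun k => ?_
      rw [norm_mul, norm_character, mul_one]
      exact hb k _ hp
    exact this.hasSum.comp hst
  have hm : AEStronglyMeasurable (fun p : ℝ × ℝ => ∑' k, c k p.2 * character k p.1) cellMeasure :=
    aestronglyMeasurable_of_tendsto_ae atTop (fun n => (memLp_trigPoly (s n) hcm).1)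
      (ae_cell_pos.mono hlim)
  refine ae_eq_of_lintegral_sub_sq hf.memLp.1 hm (le_antisymm ?_ zero_le)
  -- By Fatou, the squared distance from f to the pointwise sum is at most the lower limit of the
  -- squared L² errors of the partial sums, which is 0.
  have h1 : ∫⁻ p, ‖f p - ∑' k, c k p.2 * character k p.1‖ₑ ^ 2 ∂cellMeasure =
      ∫⁻ p, liminf (fun n => ‖f p - trigPoly (s n) c p‖ₑ ^ 2) atTop ∂cellMeasure := by
    refine lintegral_congr_ae (ae_cell_pos.mono fun p hp => ?_)
    have h2 : Tendsto (fun n => f p - trigPoly (s n) c p) atTop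
        (𝓝 (f p - ∑' k, c k p.2 * character k p.1)) := tendsto_const_nhds.sub (hlim p hp)
    exact ((ENNReal.Tendsto.pow (n := 2) h2.enorm).liminf_eq).symm
  rw [h1]
  refine (lintegral_liminf_le' fun n =>
    (hf.memLp.1.sub (memLp_trigPoly (s n) hcm).1).enorm.pow_const 2).trans_eq ?_
  have h3 := (tendsto_lintegral_sub_trigPoly hf.memLp).comp hst
  refine (h3.congr fun n => ?_).liminf_eq
  refine lintegral_congr_ae ((hT (s n)).mono fun p hp => ?_)
  simp only [hp, Pi.sub_apply]

/-! ### The potential and its first and second derivatives -/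

section Family

variable {F : ℝ × ℝ → ℂ}

lemma summable_l2HL_coeff_sq (hF : MemLp F 2 cellMeasure) :
    Summable fun k => l2HL (coeff F k) ^ 2 := by
  have h := tsum_lintegral_coeff_ne_top hF
  simp only [← ofReal_l2HL_sq (memLp_coeff hF _)] at h
  have := ENNReal.summable_toReal h
  simpa only [ENNReal.toReal_ofReal (sq_nonneg _)] using this

lemma exists_of_coeff_le (hF : MemLp F 2 cellMeasure) {c : ℤ → ℝ → ℂ}
    (hc : ∀ k, MemLp (c k) 2 halfLine)
    (h : ∀ k, ∫⁻ z in Ioi 0, ‖c k z‖ₑ ^ 2 ≤ 4 * ∫⁻ z in Ioi 0, ‖coeff F k z‖ₑ ^ 2) :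
    ∃ f, IsPeriodicL2 f ∧ ∀ k, coeff f k =ᵐ[halfLine] c k := by
  refine exists_of_coeff hc (ne_top_of_le_ne_top ?_ (ENNReal.tsum_le_tsum h))
  rw [ENNReal.tsum_mul_left]
  exact ENNReal.mul_ne_top (by finiteness) (tsum_lintegral_coeff_ne_top hF)

/-- Weak horizontal derivatives from Fourier modes. -/
lemma isWeakDeriv_x_of_coeff {f g : ℝ × ℝ → ℂ} (hf : IsPeriodicL2 f) (hg : IsPeriodicL2 g)
    (h : ∀ k, ∀ᵐ z ∂halfLine, coeff g k z = Complex.I * k * coeff f k z) :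
    IsWeakDeriv (1, 0) f g := by
  refine isWeakDeriv_of_modes hf hg fun k => ?_
  refine (isWeakDeriv_mode_x (memLp_coeff hf.memLp k) k).congr (ae_of_all _ fun _ => rfl) ?_
  rw [upperHalf_prod]
  have : ∀ᵐ p : ℝ × ℝ ∂((volume : Measure ℝ).prod halfLine),
      coeff g k p.2 = Complex.I * k * coeff f k p.2 :=
    Measure.quasiMeasurePreserving_snd.ae (h k)
  filter_upwards [this] with p hp
  rw [hp]

/-- Weak vertical derivatives from Fourier modes. -/
lemma isWeakDeriv_z_of_coeff {f g : ℝ × ℝ → ℂ} (hf : IsPeriodicL2 f) (hg : IsPeriodicL2 g)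
    (h : ∀ k, IsWeakDerivHL (coeff f k) (coeff g k)) : IsWeakDeriv (0, 1) f g :=
  isWeakDeriv_of_modes hf hg fun k =>
    isWeakDeriv_mode_z (memLp_coeff hf.memLp k) (memLp_coeff hg.memLp k) (h k) k

lemma IsSource.isPeriodicL2 (hF : IsSource F) : IsPeriodicL2 F := ⟨hF.periodic, hF.memLp⟩

lemma IsSource.coeff_zero (hF : IsSource F) : ∀ᵐ z ∂halfLine, coeff F 0 z = 0 := by
  filter_upwards [hF.mean_zero] with z hz
  simp [coeff, hz]

lemma summable_wave_rpow {a : ℝ} (ha : 1 < a) : Summable fun k : ℤ => (wave k) ^ (-a) := by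
  simpa [wave] using Real.summable_abs_int_rpow ha

/-- The product of κ^{-3/2} and ‖F_k‖ is at most κ^{-3} + ‖F_k‖², and both are summable; at k = 0
the inverse of zero is zero. This single series justifies the exchange of sum and integral, the
continuity of the potential and its identification with its Fourier series. -/
lemma summable_sqrt_wave_mul (hF : MemLp F 2 cellMeasure) :
    Summable fun k : ℤ => (wave k)⁻¹ * ((√(wave k))⁻¹ * l2HL (coeff F k)) := by
  refine Summable.of_nonneg_of_le (fun k => ?_) (fun k => ?_)
    ((summable_wave_rpow (a := 3) (by norm_num)).add (summable_l2HL_coeff_sq hF))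
  · exact mul_nonneg (inv_nonneg.2 (abs_nonneg _))
      (mul_nonneg (by positivity) (l2HL_nonneg _))
  · have h0 : 0 ≤ wave k := abs_nonneg _
    have e : (wave k) ^ (-3 : ℝ) = ((wave k)⁻¹ * (√(wave k))⁻¹) ^ 2 := by
      rw [mul_pow, inv_pow (√(wave k)), Real.sq_sqrt h0, Real.rpow_neg h0,
        show (3 : ℝ) = ((3 : ℕ) : ℝ) by norm_num, Real.rpow_natCast]
      ring
    rw [e, ← mul_assoc]
    nlinarith [sq_nonneg ((wave k)⁻¹ * (√(wave k))⁻¹ - l2HL (coeff F k)),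
      sq_nonneg ((wave k)⁻¹ * (√(wave k))⁻¹ + l2HL (coeff F k))]

/-- The Fourier series of the potential. -/
lemma potential_eq (hF : MemLp F 2 cellMeasure) {p : ℝ × ℝ} (hp : 0 ≤ p.2) :
    potential F p = ∑' k : ℤ, -((wave k)⁻¹ : ℝ) * opA k (coeff F k) p.2 * character k p.1 := by
  let G : {k : ℤ // k ≠ 0} → ℝ → ℂ := fun k y =>
    (green k p.2 y : ℂ) * coeff F k y * Complex.exp (Complex.I * (k : ℤ) * p.1)
  have e : ∀ (k : {k : ℤ // k ≠ 0}), ∀ y ∈ Ioi (0 : ℝ), G k y =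
      (-((wave k)⁻¹ : ℝ) * character k p.1 : ℂ) * ((kerA (wave k) p.2 y : ℂ) * coeff F k y) := by
    intro k y hy
    simp only [G]
    rw [green_eq k.2 hp hy, character]
    push_cast
    ring
  have i1 : ∀ k, IntegrableOn (G k) (Ioi 0) := fun k => by
    refine IntegrableOn.congr_fun ?_ (fun y hy => (e k y hy).symm) measurableSet_Ioi
    exact ((isExpKernel_kerA (wave_pos k.2)).integrable (wave_pos k.2) (memLp_coeff hF k) hp).const_mul _
  have i2 : Summable fun k => ∫ y in Ioi 0, ‖G k y‖ := by
    refine Summable.of_nonneg_of_le (fun k => integral_nonneg fun y => norm_nonneg _) (fun k => ?_)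
      ((summable_sqrt_wave_mul hF).subtype {k : ℤ | k ≠ 0})
    rw [setIntegral_congr_fun measurableSet_Ioi fun y hy => congrArg norm (e k y hy)]
    simp only [norm_mul _ ((kerA (wave k) p.2 _ : ℂ) * _), norm_mul _ (character k p.1), norm_character, mul_one]
    rw [integral_const_mul, norm_neg, Complex.norm_real, Real.norm_of_nonneg
      (inv_nonneg.2 (wave_pos k.2).le)]
    have hw := (wave_pos k.2).le
    exact mul_le_mul_of_nonneg_left ((isExpKernel_kerA (wave_pos k.2)).norm_lintegral_le
      (wave_pos k.2) (memLp_coeff hF k) hp) (inv_nonneg.2 hw)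
  have h1 : potential F p = ∑' k, ∫ y in Ioi 0, G k y :=
    (integral_tsum_of_summable_integral_norm i1 i2).symm
  have h2 : ∀ k : {k : ℤ // k ≠ 0}, ∫ y in Ioi 0, G k y =
      (fun k : ℤ => -((wave k)⁻¹ : ℝ) * opA k (coeff F k) p.2 * character k p.1) k := fun k => by
    rw [setIntegral_congr_fun measurableSet_Ioi (e k), integral_const_mul]
    simp only [opA_of_ne k.2, kernelOp]
    ring
  rw [h1, tsum_congr h2]
  refine tsum_subtype_eq_of_support_subset (s := {k : ℤ | k ≠ 0})
    (f := fun k : ℤ => -((wave k)⁻¹ : ℝ) * opA k (coeff F k) p.2 * character k p.1) fun k hk => ?_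
  rintro rfl
  simp [opA_zero] at hk

lemma norm_potential_term_le (hF : MemLp F 2 cellMeasure) (k : ℤ) {z : ℝ} (hz : 0 ≤ z) :
    ‖-((wave k)⁻¹ : ℝ) * opA k (coeff F k) z‖ ≤
      (wave k)⁻¹ * ((√(wave k))⁻¹ * l2HL (coeff F k)) := by
  have h0 : 0 ≤ (wave k)⁻¹ := inv_nonneg.2 (abs_nonneg _)
  rw [norm_mul, norm_neg, Complex.norm_real, Real.norm_of_nonneg h0]
  exact mul_le_mul_of_nonneg_left (norm_opA_le (memLp_coeff hF k) hz) h0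

lemma potential_periodic (F : ℝ × ℝ → ℂ) : IsPeriodic (potential F) := by
  intro x z _
  have := fun k x => character_periodic k x
  simp only [character] at this
  unfold potential
  simp only [this]

lemma continuousOn_potential (hF : MemLp F 2 cellMeasure) :
    ContinuousOn (potential F) (univ ×ˢ Ici 0) := by
  refine ContinuousOn.congr (f := fun p : ℝ × ℝ =>
    ∑' k : ℤ, -((wave k)⁻¹ : ℝ) * opA k (coeff F k) p.2 * character k p.1) ?_
    fun p hp => potential_eq hF hp.2
  refine continuousOn_tsum (u := fun k => (wave k)⁻¹ * ((√(wave k))⁻¹ * l2HL (coeff F k)))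
    (fun k => ?_) (summable_sqrt_wave_mul hF) fun k p hp => ?_
  · have h1 : ContinuousOn (fun p : ℝ × ℝ => opA k (coeff F k) p.2) (univ ×ˢ Ici 0) :=
      (continuousOn_opA (memLp_coeff hF k) k).comp continuousOn_snd fun p hp => hp.2
    exact (h1.const_mul _).mul ((continuous_character k).comp continuous_fst).continuousOn
  · rw [norm_mul, norm_character, mul_one]
    exact norm_potential_term_le hF k hp.2

lemma wave_inv_le (k : ℤ) : (wave k)⁻¹ ≤ wave k := by
  by_cases hk : k = 0
  · simp [hk, wave]
  · exact (inv_le_one_of_one_le₀ (one_le_wave hk)).trans (one_le_wave hk)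

lemma norm_wave_inv (k : ℤ) : ‖(-((wave k)⁻¹ : ℝ) : ℂ)‖ ≤ wave k := by
  rw [norm_neg, Complex.norm_real, Real.norm_of_nonneg (inv_nonneg.2 (wave_nonneg k))]
  exact wave_inv_le k

lemma norm_I_mul (k : ℤ) : ‖Complex.I * k‖ = wave k := by
  rw [norm_mul, Complex.norm_I, one_mul, Complex.norm_intCast, wave]

lemma one_le_wave_or (k : ℤ) : k = 0 ∨ 1 ≤ wave k := by
  by_cases hk : k = 0
  · exact Or.inl hk
  · exact Or.inr (one_le_wave hk)

/-- Riesz–Fischer provides an L² function with the expected modes. Its series converges uniformly,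
so it agrees almost everywhere with the pointwise defined potential, and the modes of the latter
need not be computed by integration. -/
lemma potential_spec (hF : MemLp F 2 cellMeasure) : IsPeriodicL2 (potential F) ∧
    ∀ k, coeff (potential F) k =ᵐ[halfLine] fun z => -((wave k)⁻¹ : ℝ) * opA k (coeff F k) z := by
  obtain ⟨f, hf, hfc⟩ := exists_of_coeff_le hF
    (c := fun k z => -((wave k)⁻¹ : ℝ) * opA k (coeff F k) z)
    (fun k => (memLp_opA (memLp_coeff hF k) k).const_mul _)
    (fun k => lintegral_opA_le (memLp_coeff hF k) (norm_wave_inv k))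
  have h1 := ae_eq_tsum hf hfc (fun k z hz => norm_potential_term_le hF k hz.le)
    (summable_sqrt_wave_mul hF)
  have h2 : f =ᵐ[cellMeasure] potential F := by
    filter_upwards [h1, ae_cell_pos] with p hp hp0
    rw [hp, potential_eq hF hp0.le]
  exact ⟨⟨potential_periodic F, (memLp_congr_ae h2).1 hf.memLp⟩,
    fun k => (coeff_congr h2 k).symm.trans (hfc k)⟩

/-- The first and second order weak derivatives of a potential, in terms of Fourier modes. -/
structure IsDerivFamily (F X Z T S : ℝ × ℝ → ℂ) : Prop where
  x : IsPeriodicL2 X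
  z : IsPeriodicL2 Z
  xx : IsPeriodicL2 T
  xz : IsPeriodicL2 S
  coeff_x : ∀ k, coeff X k =ᵐ[halfLine] fun z => -(Complex.I * k * ((wave k)⁻¹ : ℝ)) * opA k (coeff F k) z
  coeff_z : ∀ k, coeff Z k =ᵐ[halfLine] opB k (coeff F k)
  coeff_xx : ∀ k, coeff T k =ᵐ[halfLine] fun z => wave k * opA k (coeff F k) z
  coeff_xz : ∀ k, coeff S k =ᵐ[halfLine] fun z => Complex.I * k * opB k (coeff F k) z

/-- The uniform operator bounds make all four mode families square summable. The second vertical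
derivative needs no family of its own, since by the equation it is F - T. -/
lemma exists_derivFamily (hF : MemLp F 2 cellMeasure) : ∃ X Z T S, IsDerivFamily F X Z T S := by
  have hA := fun k => memLp_opA (memLp_coeff hF k) k
  have hB := fun k => memLp_opB (memLp_coeff hF k) k
  obtain ⟨X, hX, hXc⟩ := exists_of_coeff_le hF
    (c := fun k z => -(Complex.I * k * ((wave k)⁻¹ : ℝ)) * opA k (coeff F k) z)
    (fun k => (hA k).const_mul _) (fun k => lintegral_opA_le (memLp_coeff hF k) (by
      rw [norm_neg, norm_mul, norm_I_mul, Complex.norm_real, Real.norm_of_nonneg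
        (inv_nonneg.2 (wave_nonneg k))]
      rcases one_le_wave_or k with rfl | h
      · simp [wave]
      · rwa [mul_inv_cancel₀ (by linarith)]))
  obtain ⟨Z, hZ, hZc⟩ := exists_of_coeff_le hF (c := fun k => opB k (coeff F k)) hB (fun k => by
    rcases one_le_wave_or k with rfl | h
    · simp [opB_zero]
    · simpa using lintegral_opB_le (k := k) (a := 1) (memLp_coeff hF k) (by simpa using h))
  obtain ⟨T, hT, hTc⟩ := exists_of_coeff_le hF (c := fun k z => wave k * opA k (coeff F k) z)
    (fun k => (hA k).const_mul _) (fun k => lintegral_opA_le (memLp_coeff hF k) (by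
      rw [Complex.norm_real, Real.norm_of_nonneg (wave_nonneg k)]))
  obtain ⟨S, hS, hSc⟩ := exists_of_coeff_le hF (c := fun k z => Complex.I * k * opB k (coeff F k) z)
    (fun k => (hB k).const_mul _) (fun k => lintegral_opB_le (memLp_coeff hF k) (norm_I_mul k).le)
  exact ⟨X, Z, T, S, hX, hZ, hT, hS, hXc, hZc, hTc, hSc⟩

namespace IsDerivFamily

variable {X Z T S : ℝ × ℝ → ℂ}

lemma weak_x (h : IsDerivFamily F X Z T S) (hF : MemLp F 2 cellMeasure) :
    IsWeakDeriv (1, 0) (potential F) X := by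
  obtain ⟨hP, hPc⟩ := potential_spec hF
  refine isWeakDeriv_x_of_coeff hP h.x fun k => ?_
  filter_upwards [hPc k, h.coeff_x k] with z h1 h2
  rw [h1, h2]
  ring

lemma weak_z (h : IsDerivFamily F X Z T S) (hF : MemLp F 2 cellMeasure) :
    IsWeakDeriv (0, 1) (potential F) Z := by
  obtain ⟨hP, hPc⟩ := potential_spec hF
  refine isWeakDeriv_z_of_coeff hP h.z fun k => ?_
  refine ((isWeakDerivHL_opA (memLp_coeff hF k) k).const_mul (-((wave k)⁻¹ : ℝ))).congr
    (hPc k).symm ?_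
  filter_upwards [h.coeff_z k] with z hz
  rw [hz]
  rcases one_le_wave_or k with rfl | hk
  · simp [opB_zero]
  · have : (wave k : ℂ) ≠ 0 := by exact_mod_cast (by linarith : wave k ≠ 0)
    push_cast
    field_simp

lemma weak_xx (h : IsDerivFamily F X Z T S) : IsWeakDeriv (1, 0) X T := by
  refine isWeakDeriv_x_of_coeff h.x h.xx fun k => ?_
  filter_upwards [h.coeff_x k, h.coeff_xx k] with z h1 h2
  rw [h1, h2]
  rcases one_le_wave_or k with rfl | hk
  · simp [opA_zero]
  · have h0 : (wave k : ℂ) ≠ 0 := by exact_mod_cast (by linarith : wave k ≠ 0)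
    have h3 : (wave k : ℂ) ^ 2 = (k : ℂ) ^ 2 := by exact_mod_cast wave_sq k
    push_cast
    field_simp
    linear_combination opA k (coeff F k) z * h3 + (k : ℂ) ^ 2 * opA k (coeff F k) z * Complex.I_sq

lemma weak_xz (h : IsDerivFamily F X Z T S) : IsWeakDeriv (1, 0) Z S := by
  refine isWeakDeriv_x_of_coeff h.z h.xz fun k => ?_
  filter_upwards [h.coeff_z k, h.coeff_xz k] with z h1 h2
  rw [h1, h2]

lemma weak_zz (h : IsDerivFamily F X Z T S) (hF : IsSource F) :
    IsWeakDeriv (0, 1) Z (fun p => F p - T p) := by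
  refine isWeakDeriv_z_of_coeff h.z ⟨fun x z hz => ?_, hF.memLp.sub h.xx.memLp⟩ fun k => ?_
  · simp only [hF.periodic x z hz, h.xx.periodic x z hz]
  refine (isWeakDerivHL_opB (k := k) (memLp_coeff hF.memLp k) (fun hk => hk ▸ hF.coeff_zero)).congr
    (h.coeff_z k).symm ?_
  filter_upwards [coeff_sub hF.memLp h.xx.memLp k, h.coeff_xx k] with z h1 h2
  rw [h1, h2]

end IsDerivFamily

/-- The potential solves the Dirichlet problem. -/
theorem solvesDirichlet_potential (hF : IsSource F) : SolvesDirichlet F (potential F) where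
  periodic := potential_periodic F
  continuousOn := continuousOn_potential hF.memLp
  boundary x := by
    refine setIntegral_eq_zero_of_forall_eq_zero fun y hy => ?_
    simp [green, not_lt.2 (mem_Ioi.1 hy).le]
  laplace φ hφ := by
    obtain ⟨X, Z, T, S, h⟩ := exists_derivFamily hF.memLp
    have h1 := ((h.weak_x hF.memLp).comp h.weak_xx).integral_eq φ hφ
    have h2 := ((h.weak_z hF.memLp).comp (h.weak_zz hF)).integral_eq φ hφ
    have lP := (potential_spec hF.memLp).1.locallyIntegrableOn
    have lT := h.xx.locallyIntegrableOn
    have lF := hF.isPeriodicL2.locallyIntegrableOn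
    simp only [Prod.mk_add_mk] at h1 h2
    norm_num at h1 h2
    have e : ∫ p in upperHalf, ((partialDeriv (2, 0) φ p + partialDeriv (0, 2) φ p : ℝ) : ℂ) *
        potential F p = (∫ p in upperHalf, (partialDeriv (2, 0) φ p : ℂ) * potential F p) +
        ∫ p in upperHalf, (partialDeriv (0, 2) φ p : ℂ) * potential F p := by
      rw [← integral_add ((hφ.partialDeriv _).integrable_mul lP).integrableOn
        ((hφ.partialDeriv _).integrable_mul lP).integrableOn]
      congr 1
      ext p
      push_cast
      ring
    have i : IntegrableOn (fun p => (φ p : ℂ) * (F p - T p)) upperHalf :=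
      (hφ.integrable_mul (lF.sub lT)).integrableOn
    rw [e, h1, h2, ← integral_add (hφ.integrable_mul lT).integrableOn i]
    congr 1
    ext p
    ring

end Family

/-! ### Translations and vertical increments -/

section Translation

lemma setLIntegral_Ioc_add (g : ℝ → ℝ≥0∞) (a b c : ℝ) :
    ∫⁻ x in Ioc a b, g (c + x) = ∫⁻ x in Ioc (c + a) (c + b), g x := by
  have h := (measurePreserving_add_left (volume : Measure ℝ) c).setLIntegral_comp_preimage_emb
    (measurableEmbedding_addLeft c) g (Ioc (c + a) (c + b))
  rwa [preimage_const_add_Ioc, add_sub_cancel_left, add_sub_cancel_left] at h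

lemma setLIntegral_Ioi_add (g : ℝ → ℝ≥0∞) (a c : ℝ) :
    ∫⁻ x in Ioi a, g (x + c) = ∫⁻ x in Ioi (a + c), g x := by
  have h := (measurePreserving_add_right (volume : Measure ℝ) c).setLIntegral_comp_preimage_emb
    (measurableEmbedding_addRight c) g (Ioi (a + c))
  rwa [preimage_add_const_Ioi, add_sub_cancel_right] at h

lemma setLIntegral_Ioi_zero_add_le (g : ℝ → ℝ≥0∞) {c : ℝ} (hc : 0 ≤ c) :
    ∫⁻ x in Ioi 0, g (x + c) ≤ ∫⁻ x in Ioi 0, g x := by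
  rw [setLIntegral_Ioi_add, zero_add]
  exact lintegral_mono_set (Ioi_subset_Ioi hc)

/-- The integrals of a periodic function over all periods agree. -/
lemma setLIntegral_periodic {g : ℝ → ℝ≥0∞} (hg : Function.Periodic g (2 * Real.pi)) (a b : ℝ) :
    ∫⁻ x in Ioc a (a + 2 * Real.pi), g x = ∫⁻ x in Ioc b (b + 2 * Real.pi), g x := by
  have : Fact (0 < 2 * Real.pi) := ⟨Real.two_pi_pos⟩
  have h := fun t => AddCircle.lintegral_preimage (2 * Real.pi) t hg.lift
  simp only [Function.Periodic.lift_coe] at h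
  rw [h a, h b]

lemma ae_halfLine_add {P : ℝ → Prop} (h : ∀ᵐ z ∂halfLine, P z) {c : ℝ} (hc : 0 ≤ c) :
    ∀ᵐ z ∂halfLine, P (z + c) := by
  rw [ae_restrict_iff' measurableSet_Ioi] at h ⊢
  filter_upwards [(measurePreserving_add_right (volume : Measure ℝ) c).quasiMeasurePreserving.ae h]
    with z hz hz0
  exact hz (by simpa using add_pos_of_pos_of_nonneg hz0 hc)

/-- The vertical increments of a function are controlled by its weak derivative. -/
lemma IsWeakDerivHL.lintegral_increment_le {u v : ℝ → ℂ} (h : IsWeakDerivHL u v)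
    (hv : MemLp v 2 halfLine) {t : ℝ} (ht : 0 ≤ t) :
    ∫⁻ z in Ioi 0, ‖u (z + t) - u z‖ₑ ^ 2 ≤
      ENNReal.ofReal (t ^ 2) * ∫⁻ z in Ioi 0, ‖v z‖ₑ ^ 2 := by
  -- A measurable representative is taken so that (z, y) ↦ w(z + y) is jointly measurable, as
  -- Tonelli requires below.
  obtain ⟨w, hwm, hvw⟩ := hv.1
  have hw : MemLp w 2 halfLine := (memLp_congr_ae hvw).1 hv
  have hwi : ∀ a b : ℝ, 0 ≤ a → IntegrableOn w (Ioc a b) := fun a b ha =>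
    ((hw.mono_measure (Measure.restrict_mono (fun z hz => ha.trans_lt hz.1) le_rfl)).integrable
      (by norm_num))
  -- Up to a constant u is the primitive of w, so almost every increment of u is an integral of w
  -- over an interval of length t. Cauchy–Schwarz gives one factor t and integration in z the other.
  have h1 : IsWeakDerivHL (fun z => u z - ∫ y in (0 : ℝ)..z, w y) fun _ => 0 := by
    refine (h.sub (isWeakDerivHL_primitive fun R => hwi 0 R le_rfl)).congr
      (ae_of_all _ fun _ => rfl) ?_
    filter_upwards [hvw] with z hz
    rw [hz, sub_self]
  obtain ⟨c, hc⟩ := h1.ae_eq_const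
  have h2 : ∀ᵐ z ∂halfLine, ‖u (z + t) - u z‖ₑ ^ 2 ≤
      ENNReal.ofReal t * ∫⁻ y in Ioc 0 t, ‖w (z + y)‖ₑ ^ 2 := by
    filter_upwards [hc, ae_halfLine_add hc ht, ae_halfLine_pos] with z h1 h2 hz
    have e : u (z + t) - u z = ∫ y in Ioc z (z + t), w y := by
      rw [← intervalIntegral.integral_of_le (by linarith),
        ← intervalIntegral.integral_interval_sub_left (a := 0)]
      · linear_combination h2 - h1
      · rw [intervalIntegrable_iff_integrableOn_Ioc_of_le (by linarith)]
        exact hwi _ _ le_rfl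
      · rw [intervalIntegrable_iff_integrableOn_Ioc_of_le hz.le]
        exact hwi _ _ le_rfl
    rw [e]
    calc _ ≤ (∫⁻ y in Ioc z (z + t), 1 * ‖w y‖ₑ) ^ 2 := by
          simp only [one_mul]
          exact pow_le_pow_left' (enorm_integral_le_lintegral_enorm _) 2
      _ ≤ (∫⁻ y in Ioc z (z + t), 1 ^ 2) * ∫⁻ y in Ioc z (z + t), ‖w y‖ₑ ^ 2 :=
          sq_lintegral_mul_le aemeasurable_const hwm.measurable.enorm.aemeasurable
      _ = _ := by
          rw [setLIntegral_Ioc_add (fun y => ‖w y‖ₑ ^ 2), add_zero]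
          simp
  have hm : Measurable (Function.uncurry fun z y : ℝ => ‖w (z + y)‖ₑ ^ 2) :=
    (hwm.measurable.comp (measurable_fst.add measurable_snd)).enorm.pow_const 2
  calc _ ≤ ∫⁻ z in Ioi 0, ENNReal.ofReal t * ∫⁻ y in Ioc 0 t, ‖w (z + y)‖ₑ ^ 2 :=
        lintegral_mono_ae h2
    _ = ENNReal.ofReal t * ∫⁻ y in Ioc 0 t, ∫⁻ z in Ioi 0, ‖w (z + y)‖ₑ ^ 2 := by
        rw [lintegral_const_mul' _ _ ENNReal.ofReal_ne_top, lintegral_lintegral_swap hm.aemeasurable]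
    _ ≤ ENNReal.ofReal t * ∫⁻ y in Ioc 0 t, ∫⁻ z in Ioi 0, ‖w z‖ₑ ^ 2 := by
        gcongr ENNReal.ofReal t * ?_
        exact setLIntegral_mono' measurableSet_Ioc fun y hy =>
          setLIntegral_Ioi_zero_add_le (fun z => ‖w z‖ₑ ^ 2) hy.1.le
    _ = _ := by
        rw [setLIntegral_const, Real.volume_Ioc, sub_zero, mul_comm (∫⁻ z in Ioi 0, _), ← mul_assoc,
          ← ENNReal.ofReal_mul ht, ← sq]
        congr 1
        refine lintegral_congr_ae (hvw.mono fun z hz => ?_)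
        simp only [← hz]

end Translation

/-! ### Increments of Fourier modes -/

section Increments

variable {u : ℝ × ℝ → ℂ}

/-- A square integrable function has a Borel measurable periodic representative. -/
lemma IsPeriodicL2.exists_measurable (hu : IsPeriodicL2 u) :
    ∃ v, Measurable v ∧ IsPeriodicL2 v ∧ u =ᵐ[cellMeasure] v := by
  obtain ⟨w, hwm, huw⟩ := hu.memLp.1
  have h1 : u =ᵐ[cellMeasure] periodize w := huw.trans (periodize_ae_eq w).symm
  refine ⟨periodize w, ?_, ⟨periodize_periodic w, (memLp_congr_ae h1).1 hu.memLp⟩, h1⟩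
  have : Fact (0 < 2 * Real.pi) := ⟨Real.two_pi_pos⟩
  have h2 : Measurable (toIocMod Real.two_pi_pos 0) :=
    measurable_subtype_coe.comp
      ((AddCircle.measurableEquivIoc (2 * Real.pi) 0).measurable.comp AddCircle.measurable_mk')
  exact hwm.measurable.comp ((h2.comp measurable_fst).prodMk measurable_snd)

lemma measurable_coeff (hu : Measurable u) (k : ℤ) : Measurable (coeff u k) := by
  unfold coeff
  refine Measurable.const_mul ?_ _
  simp only [intervalIntegral.integral_of_le Real.two_pi_pos.le]
  refine (StronglyMeasurable.integral_prod_right' (ν := period)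
    (f := fun p : ℝ × ℝ => u (p.2, p.1) * Complex.exp (-(Complex.I * k * p.2))) ?_).measurable
  refine Measurable.stronglyMeasurable ?_
  exact (hu.comp measurable_swap).mul (Continuous.measurable (by fun_prop))

lemma coeff_comp_add (hu : IsPeriodic u) (h : ℝ × ℝ) (k : ℤ) {z : ℝ} (hz : 0 < z + h.2) :
    coeff (fun p => u (p + h)) k z = character k h.1 * coeff u k (z + h.2) := by
  have e : ∀ x : ℝ, u ((x, z) + h) * Complex.exp (-(Complex.I * k * x)) = character k h.1 *
      (u (x + h.1, z + h.2) * Complex.exp (-(Complex.I * k * (x + h.1 : ℝ)))) := fun x => by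
    rw [character, mul_left_comm, ← Complex.exp_add]
    congr 2
    push_cast
    ring
  have hp : Function.Periodic (fun x : ℝ => u (x, z + h.2) * Complex.exp (-(Complex.I * k * x)))
      (2 * Real.pi) := fun x => by
    have h1 := character_periodic (-k) x
    simp only [character, Int.cast_neg, mul_neg, neg_mul] at h1
    simp only [hu x _ hz, h1]
  unfold coeff
  simp only [e]
  rw [intervalIntegral.integral_const_mul, intervalIntegral.integral_comp_add_right
    (fun x : ℝ => u (x, z + h.2) * Complex.exp (-(Complex.I * k * x))), zero_add, add_comm (2 * Real.pi),
    hp.intervalIntegral_add_eq h.1 0, zero_add]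
  ring

lemma IsPeriodicL2.memLp_comp_add (hu : IsPeriodicL2 u) (hm : Measurable u) {h : ℝ × ℝ}
    (hh : 0 ≤ h.2) : MemLp (fun p => u (p + h)) 2 cellMeasure := by
  have hm' : Measurable fun p => u (p + h) := hm.comp (measurable_id.add_const h)
  refine memLp_two_iff.2 ⟨hm'.aestronglyMeasurable, ne_top_of_le_ne_top (memLp_two_iff.1 hu.memLp).2 ?_⟩
  change ∫⁻ p in cell, ‖u (p + h)‖ₑ ^ 2 ≤ ∫⁻ p in cell, ‖u p‖ₑ ^ 2
  rw [setLIntegral_cell (hm'.enorm.pow_const 2).aemeasurable,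
    setLIntegral_cell (hm.enorm.pow_const 2).aemeasurable]
  calc _ = ∫⁻ z in Ioi 0, ∫⁻ x in Ioc 0 (2 * Real.pi), ‖u (x, z + h.2)‖ₑ ^ 2 := by
        refine setLIntegral_congr_fun measurableSet_Ioi fun z hz => ?_
        have hz' : 0 < z + h.2 := add_pos_of_pos_of_nonneg hz hh
        have hp : Function.Periodic (fun x : ℝ => ‖u (x, z + h.2)‖ₑ ^ 2) (2 * Real.pi) := fun x => by
          simp only [hu.periodic x _ hz']
        have h1 := setLIntegral_Ioc_add (fun x => ‖u (x, z + h.2)‖ₑ ^ 2) 0 (2 * Real.pi) h.1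
        rw [add_zero, setLIntegral_periodic hp h.1 0, zero_add] at h1
        rw [← h1]
        refine lintegral_congr fun x => ?_
        rw [show ((x, z) : ℝ × ℝ) + h = (h.1 + x, z + h.2) from Prod.ext (add_comm _ _) rfl]
    _ ≤ _ := setLIntegral_Ioi_zero_add_le
        (fun z => ∫⁻ x in Ioc 0 (2 * Real.pi), ‖u (x, z)‖ₑ ^ 2) hh

/-- The increments of a Fourier mode. -/
def modeIncrement (k : ℤ) (f : ℝ → ℂ) (h : ℝ × ℝ) : ℝ≥0∞ :=
  ∫⁻ z in Ioi 0, ‖character k h.1 * f (z + h.2) - f z‖ₑ ^ 2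

/-- The increments of a function in terms of its Fourier modes. -/
lemma IsPeriodicL2.lintegral_increment (hu : IsPeriodicL2 u) (hm : Measurable u) {h : ℝ × ℝ}
    (hh : 0 ≤ h.2) : ∫⁻ p in cell, ‖u p - u (p + h)‖ₑ ^ 2 =
      ENNReal.ofReal (2 * Real.pi) * ∑' k, modeIncrement k (coeff u k) h := by
  have h1 := hu.memLp_comp_add hm hh
  rw [parseval (f := fun p => u p - u (p + h)) (hu.memLp.sub h1)]
  congr 1
  refine tsum_congr fun k => ?_
  refine lintegral_congr_ae ?_
  filter_upwards [coeff_sub hu.memLp h1 k, ae_halfLine_pos] with z h2 hz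
  rw [h2, coeff_comp_add hu.periodic h k (add_pos_of_pos_of_nonneg hz hh), ← enorm_neg, neg_sub]

lemma modeIncrement_congr {f g : ℝ → ℂ} (hfg : f =ᵐ[halfLine] g) (k : ℤ) {h : ℝ × ℝ} (hh : 0 ≤ h.2) :
    modeIncrement k f h = modeIncrement k g h := by
  refine lintegral_congr_ae ?_
  filter_upwards [hfg, ae_halfLine_add hfg hh] with z h1 h2
  rw [h1, h2]

lemma enorm_sq_eq (a : ℂ) : ‖a‖ₑ ^ 2 = ENNReal.ofReal (‖a‖ ^ 2) := by
  rw [← ofReal_norm, ENNReal.ofReal_pow (norm_nonneg _)]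

lemma enorm_add_sq_le (a b : ℂ) : ‖a + b‖ₑ ^ 2 ≤ 2 * (‖a‖ₑ ^ 2 + ‖b‖ₑ ^ 2) := by
  simp only [enorm_sq_eq]
  rw [← ENNReal.ofReal_add (by positivity) (by positivity), ← ENNReal.ofReal_ofNat 2,
    ← ENNReal.ofReal_mul (by norm_num)]
  refine ENNReal.ofReal_le_ofReal ?_
  nlinarith [norm_add_le a b, norm_nonneg (a + b), sq_nonneg (‖a‖ - ‖b‖)]

lemma enorm_sub_sq_le (a b : ℂ) : ‖a - b‖ₑ ^ 2 ≤ 2 * (‖a‖ₑ ^ 2 + ‖b‖ₑ ^ 2) := by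
  rw [sub_eq_add_neg, ← enorm_neg b]
  exact enorm_add_sq_le a (-b)

lemma lintegral_sub_sq_le {α : Type*} [MeasurableSpace α] {μ : Measure α} {f g : α → ℂ}
    (hf : AEStronglyMeasurable f μ) : ∫⁻ a, ‖f a - g a‖ₑ ^ 2 ∂μ ≤
      2 * (∫⁻ a, ‖f a‖ₑ ^ 2 ∂μ + ∫⁻ a, ‖g a‖ₑ ^ 2 ∂μ) := by
  rw [← lintegral_add_left' (hf.enorm.pow_const 2), ← lintegral_const_mul' _ _ (by finiteness)]
  exact lintegral_mono fun a => enorm_sub_sq_le _ _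

/-- Increments of a mode which, together with its derivative, is controlled by `I`. -/
lemma modeIncrement_le {k : ℤ} {f v : ℝ → ℂ} (hf : MemLp f 2 halfLine) (hv : MemLp v 2 halfLine)
    (hfv : IsWeakDerivHL f v) {I : ℝ≥0∞} (h1 : ∫⁻ z in Ioi 0, ‖f z‖ₑ ^ 2 ≤ I)
    (h2 : ∫⁻ z in Ioi 0, ‖v z‖ₑ ^ 2 ≤ ENNReal.ofReal (wave k ^ 2) * I) {h : ℝ × ℝ} (hh : 0 ≤ h.2) :
    modeIncrement k f h ≤ 4 * ENNReal.ofReal (min 1 ((wave k * ‖h‖) ^ 2)) * I := by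
  have hm : AEStronglyMeasurable (fun z => f (z + h.2)) halfLine := by
    obtain ⟨w, hwm, hfw⟩ := hf.1
    exact ⟨fun z => w (z + h.2), hwm.comp_measurable (measurable_id.add_const _),
      ae_halfLine_add hfw hh⟩
  have hs : ∫⁻ z in Ioi 0, ‖f (z + h.2)‖ₑ ^ 2 ≤ I :=
    (setLIntegral_Ioi_zero_add_le (fun z => ‖f z‖ₑ ^ 2) hh).trans h1
  have hmin : ENNReal.ofReal (min 1 ((wave k * ‖h‖) ^ 2)) =
      min 1 (ENNReal.ofReal ((wave k * ‖h‖) ^ 2)) := by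
    rw [ENNReal.ofReal_min, ENNReal.ofReal_one]
  have hb1 : modeIncrement k f h ≤ 4 * I := by
    refine (lintegral_sub_sq_le (hm.const_mul (character k h.1))).trans ?_
    simp only [enorm_mul, enorm_character, one_mul]
    calc _ ≤ 2 * (I + I) := by gcongr
      _ = 4 * I := by ring
  -- For small increments the phase change, at most κ|h₁|, is separated from the vertical increment,
  -- which costs h₂ times the norm of the derivative.
  have hb2 : modeIncrement k f h ≤ 4 * ENNReal.ofReal ((wave k * ‖h‖) ^ 2) * I := by
    have e : modeIncrement k f h = ∫⁻ z in Ioi 0,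
        ‖(character k h.1 - 1) * f (z + h.2) - (f z - f (z + h.2))‖ₑ ^ 2 := by
      unfold modeIncrement
      congr 1
      ext z
      ring_nf
    have hc : ‖character k h.1 - 1‖ₑ ^ 2 ≤ ENNReal.ofReal ((wave k * ‖h‖) ^ 2) := by
      rw [enorm_sq_eq]
      refine ENNReal.ofReal_le_ofReal (pow_le_pow_left₀ (norm_nonneg _) ?_ 2)
      have h3 := Real.norm_exp_I_mul_ofReal_sub_one_le (x := k * h.1)
      rw [character, show Complex.I * k * h.1 = Complex.I * (k * h.1 : ℝ) by push_cast; ring]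
      refine h3.trans ?_
      rw [norm_mul]
      exact mul_le_mul_of_nonneg_left (norm_fst_le h) (wave_nonneg k)
    have hi : ∫⁻ z in Ioi 0, ‖f z - f (z + h.2)‖ₑ ^ 2 ≤ ENNReal.ofReal ((wave k * ‖h‖) ^ 2) * I := by
      simp only [enorm_sub_rev (f _) (f (_ + h.2))]
      refine (hfv.lintegral_increment_le hv hh).trans ((mul_le_mul_right h2 _).trans ?_)
      rw [← mul_assoc, ← ENNReal.ofReal_mul (sq_nonneg _), ← mul_pow, mul_comm h.2]
      have h4 : h.2 ≤ ‖h‖ := (le_abs_self _).trans (norm_snd_le h)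
      have h5 := wave_nonneg k
      gcongr
    rw [e]
    refine (lintegral_sub_sq_le (hm.const_mul (character k h.1 - 1))).trans ?_
    simp only [enorm_mul, mul_pow]
    rw [lintegral_const_mul' _ _ (by finiteness)]
    simp only [mul_pow] at hc hi
    calc _ ≤ 2 * (ENNReal.ofReal (wave k ^ 2 * ‖h‖ ^ 2) * I +
          ENNReal.ofReal (wave k ^ 2 * ‖h‖ ^ 2) * I) := by gcongr
      _ = _ := by ring
  rw [hmin]
  rcases le_total 1 (ENNReal.ofReal ((wave k * ‖h‖) ^ 2)) with h3 | h3
  · rw [min_eq_left h3, mul_one]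
    exact hb1
  · rw [min_eq_right h3]
    exact hb2

/-- Opposite horizontal increments of a mode control the mode. -/
lemma le_modeIncrement_add {k : ℤ} {f : ℝ → ℂ} (hf : Measurable f) (h₁ h₂ : ℝ) :
    ENNReal.ofReal (2 * Real.sin (k * h₁) ^ 2) * ∫⁻ z in Ioi 0, ‖f z‖ₑ ^ 2 ≤
      modeIncrement k f (h₁, h₂) + modeIncrement k f (-h₁, h₂) := by
  have hm : Measurable fun z => f (z + h₂) := hf.comp (measurable_id.add_const _)
  have e1 : ∀ t z, ‖character k t * f (z + h₂) - f z‖ₑ =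
      ‖f (z + h₂) - character k (-t) * f z‖ₑ := fun t z => by
    have h1 : character k (-t) * character k t = 1 := by
      rw [← character_add, neg_add_cancel]
      simp [character]
    calc _ = ‖character k (-t)‖ₑ * ‖character k t * f (z + h₂) - f z‖ₑ := by
          rw [enorm_character, one_mul]
      _ = _ := by
          rw [← enorm_mul]
          congr 1
          linear_combination f (z + h₂) * h1
  -- Subtracting the two opposite increments eliminates the unknown vertical translate f(z + h₂) and
  -- leaves 2i sin(k h₁) f(z), so the lower bound needs no regularity in z.
  have e2 : ENNReal.ofReal (2 * Real.sin (k * h₁) ^ 2) * ∫⁻ z in Ioi 0, ‖f z‖ₑ ^ 2 =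
      2⁻¹ * ∫⁻ z in Ioi 0, ‖(f (z + h₂) - character k (-h₁) * f z) -
        (f (z + h₂) - character k (- -h₁) * f z)‖ₑ ^ 2 := by
    have h3 : ∀ z, (f (z + h₂) - character k (-h₁) * f z) -
        (f (z + h₂) - character k (- -h₁) * f z) = (2 * Complex.I * Real.sin (k * h₁)) * f z := fun z => by
      rw [Complex.ofReal_sin, Complex.sin, character, character]
      push_cast
      rw [show Complex.I * k * - -(h₁ : ℂ) = k * h₁ * Complex.I by ring,
        show Complex.I * k * -(h₁ : ℂ) = -(k * h₁) * Complex.I by ring]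
      linear_combination (Complex.exp (k * h₁ * Complex.I) - Complex.exp (-(k * h₁) * Complex.I)) *
        f z * Complex.I_mul_I
    simp only [h3, enorm_mul _ (f _), mul_pow]
    rw [lintegral_const_mul' _ _ (by finiteness), ← mul_assoc]
    congr 1
    rw [enorm_sq_eq, norm_mul, norm_mul, Complex.norm_I, Complex.norm_ofNat, Complex.norm_real,
      mul_one, mul_pow, Real.norm_eq_abs, sq_abs]
    generalize Real.sin (k * h₁) ^ 2 = t
    rw [show (2 : ℝ) ^ 2 * t = 2 * (2 * t) by ring, ENNReal.ofReal_mul zero_le_two (q := 2 * t),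
      ENNReal.ofReal_ofNat, ← mul_assoc, ENNReal.inv_mul_cancel two_ne_zero (by finiteness), one_mul]
  have hc : ∀ t, AEStronglyMeasurable (fun z => f (z + h₂) - character k t * f z) halfLine := fun t =>
    (hm.sub (hf.const_mul _)).aestronglyMeasurable
  rw [e2]
  refine (mul_le_mul_right (lintegral_sub_sq_le (hc _)) _).trans ?_
  rw [← mul_assoc, ENNReal.inv_mul_cancel two_ne_zero (by finiteness), one_mul]
  simp only [modeIncrement, e1]
  exact le_rfl

lemma measurable_modeIncrement {k : ℤ} {f : ℝ → ℂ} (hf : Measurable f) :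
    Measurable (modeIncrement k f) := by
  unfold modeIncrement
  refine Measurable.lintegral_prod_right' (f := fun q : (ℝ × ℝ) × ℝ =>
    ‖character k q.1.1 * f (q.2 + q.1.2) - f q.2‖ₑ ^ 2) ?_
  refine Measurable.pow_const (Measurable.enorm ?_) 2
  exact (((continuous_character k).measurable.comp (measurable_fst.comp measurable_fst)).mul
    (hf.comp (measurable_snd.add (measurable_snd.comp measurable_fst)))).sub
    (hf.comp measurable_snd)

end Increments

/-! ### The Gagliardo seminorm as an integral over increments -/

lemma gagliardoSq_congr {u v : ℝ × ℝ → ℂ} (h : u =ᵐ[cellMeasure] v) (σ : ℝ) :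
    gagliardoSq σ u = gagliardoSq σ v := by
  unfold gagliardoSq
  congr 1
  refine lintegral_congr_ae (h.mono fun p hp => ?_)
  refine lintegral_congr_ae (h.mono fun q hq => ?_)
  simp only [hp, hq]

lemma measurable_cylDist : Measurable fun r : (ℝ × ℝ) × (ℝ × ℝ) => cylDist r.1 r.2 := by
  have h : Continuous fun x : ℝ => ((x : ℝ) : AddCircle (2 * Real.pi)) := continuous_quotient_mk'
  have h1 : Continuous fun r : (ℝ × ℝ) × (ℝ × ℝ) => ((r.1.1 - r.2.1 : ℝ) : AddCircle (2 * Real.pi)) :=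
    h.comp (by fun_prop)
  unfold cylDist
  exact (Continuous.sqrt ((h1.norm.pow 2).add (by fun_prop))).measurable

lemma gagliardoSq_sub_le {u v : ℝ × ℝ → ℂ} (hu : AEStronglyMeasurable u cellMeasure) (σ : ℝ) :
    gagliardoSq σ (fun p => u p - v p) ≤ 2 * (gagliardoSq σ u + gagliardoSq σ v) := by
  wlog hm : Measurable u generalizing u
  · obtain ⟨w, hwm, huw⟩ := hu
    rw [gagliardoSq_congr huw, gagliardoSq_congr (u := fun p => u p - v p) (v := fun p => w p - v p)
      (huw.mono fun p hp => by simp only [hp])]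
    exact this hwm.aestronglyMeasurable hwm.measurable
  replace hu := hm
  clear hm
  have hm : Measurable fun r : (ℝ × ℝ) × (ℝ × ℝ) => ‖u r.1 - u r.2‖ₑ ^ 2 /
      ENNReal.ofReal (cylDist r.1 r.2 ^ (2 + 2 * σ)) :=
    (((hu.comp measurable_fst).sub (hu.comp measurable_snd)).enorm.pow_const 2).div
      (measurable_cylDist.pow_const _).ennreal_ofReal
  unfold gagliardoSq
  split_ifs
  · simp
  rw [← lintegral_add_left hm.lintegral_prod_right', ← lintegral_const_mul' _ _ (by finiteness)]
  refine lintegral_mono fun p => ?_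
  have hm' := hm.comp (measurable_const.prodMk measurable_id : Measurable fun q : ℝ × ℝ => (p, q))
  simp only [Function.comp_def] at hm'
  rw [← lintegral_add_left hm', ← lintegral_const_mul' _ _ (by finiteness)]
  refine lintegral_mono fun q => ?_
  rw [← ENNReal.add_div, ← mul_div_assoc, show u p - v p - (u q - v q) = (u p - u q) - (v p - v q) by ring]
  exact ENNReal.div_le_div_right (enorm_sub_sq_le _ _) _

section Unfolding

/-- The measure on the space of increments `(h₁, h₂)`, `|h₁| < π`, `h₂ > 0`. -/
def stepMeasure : Measure (ℝ × ℝ) :=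
  (volume.restrict (Ioo (-Real.pi) Real.pi)).prod (volume.restrict (Ioi 0))

instance : SFinite stepMeasure := by
  unfold stepMeasure
  infer_instance

/-- The Gagliardo weight of an increment. -/
def stepWeight (σ : ℝ) (h : ℝ × ℝ) : ℝ≥0∞ :=
  (ENNReal.ofReal (Real.sqrt (h.1 ^ 2 + h.2 ^ 2) ^ (2 + 2 * σ)))⁻¹

lemma measurable_stepWeight (σ : ℝ) : Measurable (stepWeight σ) := by
  unfold stepWeight
  have : Measurable fun h : ℝ × ℝ => Real.sqrt (h.1 ^ 2 + h.2 ^ 2) :=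
    Continuous.measurable (by fun_prop)
  exact ((this.pow_const _).ennreal_ofReal).inv

lemma cylDist_comm (p q : ℝ × ℝ) : cylDist p q = cylDist q p := by
  unfold cylDist
  rw [show ((p.1 - q.1 : ℝ) : AddCircle (2 * Real.pi)) = -((q.1 - p.1 : ℝ) : AddCircle (2 * Real.pi)) by
    rw [← AddCircle.coe_neg, neg_sub], norm_neg, ← neg_sub p.2 q.2, neg_sq]

/-- Within half a period the distance on the circle is the absolute value, so the weight depends on
the increment alone. -/
lemma cylDist_add (p : ℝ × ℝ) {h : ℝ × ℝ} (hh : |h.1| ≤ Real.pi) :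
    cylDist p (p + h) = Real.sqrt (h.1 ^ 2 + h.2 ^ 2) := by
  have h1 : ‖((p.1 - (p + h).1 : ℝ) : AddCircle (2 * Real.pi))‖ = |h.1| := by
    rw [Prod.fst_add, sub_add_cancel_left, AddCircle.coe_neg, norm_neg,
      AddCircle.norm_coe_eq_abs_iff (2 * Real.pi) Real.two_pi_pos.ne', abs_of_pos Real.two_pi_pos]
    linarith
  unfold cylDist
  rw [h1, sq_abs, Prod.snd_add, sub_add_cancel_left, neg_sq]

lemma cylDist_add_two_pi (p : ℝ × ℝ) (x z : ℝ) :
    cylDist p (x + 2 * Real.pi, z) = cylDist p (x, z) := by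
  unfold cylDist
  rw [← sub_sub]
  simp only [AddCircle.coe_sub _ (p.1 - x), AddCircle.coe_period, sub_zero]

variable {u : ℝ × ℝ → ℂ} {σ : ℝ}

/-- The Gagliardo seminorm as an integral over increments. -/
lemma gagliardoSq_eq (hu : Measurable u) (hp : IsPeriodic u) (hσ : σ ≠ 0) :
    gagliardoSq σ u =
      2 * ∫⁻ h, (∫⁻ p in cell, ‖u p - u (p + h)‖ₑ ^ 2) * stepWeight σ h ∂stepMeasure := by
  let g : (ℝ × ℝ) × (ℝ × ℝ) → ℝ≥0∞ := fun r => ‖u r.1 - u r.2‖ₑ ^ 2 /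
    ENNReal.ofReal (cylDist r.1 r.2 ^ (2 + 2 * σ))
  have hg : Measurable g := (((hu.comp measurable_fst).sub (hu.comp measurable_snd)).enorm.pow_const 2).div
      (measurable_cylDist.pow_const _).ennreal_ofReal
  have hgs : ∀ p q, g (p, q) = g (q, p) := fun p q => by
    simp only [g]
    rw [enorm_sub_rev, cylDist_comm]
  -- The integrand is symmetric, so it suffices to let q lie above p, at the price of a factor 2.
  -- Upward increments never leave the half-cylinder; pairs of equal height form a null set.
  let S : Set ((ℝ × ℝ) × (ℝ × ℝ)) := {r | r.1.2 < r.2.2}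
  have hS : MeasurableSet S := measurableSet_lt (by fun_prop) (by fun_prop)
  let A : (ℝ × ℝ) × (ℝ × ℝ) → ℝ≥0∞ := S.indicator g
  have hA : Measurable A := hg.indicator hS
  have hAp : ∀ p, Measurable fun q => A (p, q) := fun p => hA.comp (measurable_const.prodMk measurable_id)
  have hne : ∀ p : ℝ × ℝ, ∀ᵐ q ∂cellMeasure, q.2 ≠ p.2 := fun p => by
    rw [cellMeasure_eq]
    refine (Measure.quasiMeasurePreserving_snd (μ := period) (ν := halfLine)).ae
      (p := fun y => y ≠ p.2) (ae_restrict_of_ae ?_)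
    exact compl_mem_ae_iff.2 (measure_singleton p.2)
  have h1 : gagliardoSq σ u = ∫⁻ p in cell, ((∫⁻ q in cell, A (p, q)) + ∫⁻ q in cell, A (q, p)) := by
    rw [gagliardoSq, if_neg hσ]
    refine lintegral_congr fun p => ?_
    rw [← lintegral_add_left (hAp p)]
    refine lintegral_congr_ae ((hne p).mono fun q hq => ?_)
    change g (p, q) = A (p, q) + A (q, p)
    rcases lt_or_gt_of_ne hq with h | h
    · have e1 : A (p, q) = 0 := indicator_of_notMem (show (p, q) ∉ S from not_lt.2 h.le) _
      have e2 : A (q, p) = g (q, p) := indicator_of_mem (show (q, p) ∈ S from h) _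
      rw [e1, e2, zero_add, hgs]
    · have e1 : A (q, p) = 0 := indicator_of_notMem (show (q, p) ∉ S from not_lt.2 h.le) _
      have e2 : A (p, q) = g (p, q) := indicator_of_mem (show (p, q) ∈ S from h) _
      rw [e1, e2, add_zero]
  have h2 : ∀ p, 0 < p.2 → ∫⁻ q in cell, A (p, q) =
      ∫⁻ h, ‖u p - u (p + h)‖ₑ ^ 2 * stepWeight σ h ∂stepMeasure := fun p hp0 => by
    have e1 : ∫⁻ q in cell, A (p, q) =
        ∫⁻ y in Ioi p.2, ∫⁻ x in Ioc 0 (2 * Real.pi), g (p, (x, y)) := by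
      rw [setLIntegral_cell (hAp p).aemeasurable]
      have e2 : ∀ y, ∫⁻ x in Ioc 0 (2 * Real.pi), A (p, (x, y)) = (Ioi p.2).indicator
          (fun y => ∫⁻ x in Ioc 0 (2 * Real.pi), g (p, (x, y))) y := fun y => by
        by_cases hy : p.2 < y
        · rw [indicator_of_mem (mem_Ioi.2 hy)]
          exact lintegral_congr fun x => indicator_of_mem (show (p, (x, y)) ∈ S from hy) _
        · rw [indicator_of_notMem (notMem_Ioi.2 (not_lt.1 hy))]
          refine (lintegral_congr fun x => indicator_of_notMem (show (p, (x, y)) ∉ S from hy) _).trans ?_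
          exact lintegral_zero
      simp only [e2]
      rw [lintegral_indicator measurableSet_Ioi, Measure.restrict_restrict measurableSet_Ioi,
        inter_eq_left.2 (Ioi_subset_Ioi hp0.le)]
    have e3 := setLIntegral_Ioi_add (fun y => ∫⁻ x in Ioc 0 (2 * Real.pi), g (p, (x, y))) 0 p.2
    rw [zero_add] at e3
    have hm : Measurable fun h : ℝ × ℝ => ‖u p - u (p + h)‖ₑ ^ 2 * stepWeight σ h :=
      ((measurable_const.sub (hu.comp (measurable_const.add measurable_id))).enorm.pow_const 2).mul
        (measurable_stepWeight σ)
    rw [e1, ← e3, stepMeasure, lintegral_prod_symm _ hm.aemeasurable]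
    refine setLIntegral_congr_fun measurableSet_Ioi fun t ht => ?_
    have ht0 : 0 < t + p.2 := add_pos ht hp0
    have hper : Function.Periodic (fun x => g (p, (x, t + p.2))) (2 * Real.pi) := fun x => by
      simp only [g]
      rw [hp x _ ht0, cylDist_add_two_pi]
    -- Periodicity recentres the horizontal period at p, so that the increments run through (-π, π).
    have e4 := setLIntegral_Ioc_add (fun x => g (p, (x, t + p.2))) (-Real.pi) Real.pi p.1
    have e5 := setLIntegral_periodic hper 0 (p.1 + -Real.pi)
    rw [zero_add, show p.1 + -Real.pi + 2 * Real.pi = p.1 + Real.pi by ring] at e5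
    rw [← restrict_Ioo_eq_restrict_Ioc] at e4
    rw [e5, ← e4]
    refine setLIntegral_congr_fun measurableSet_Ioo fun s hs => ?_
    have e6 : ((p.1 + s, t + p.2) : ℝ × ℝ) = p + (s, t) := Prod.ext rfl (add_comm _ _)
    simp only [g]
    rw [e6, cylDist_add p (h := (s, t)) (abs_le.2 ⟨hs.1.le, hs.2.le⟩), div_eq_mul_inv, stepWeight]
  have hm : Measurable fun r : (ℝ × ℝ) × (ℝ × ℝ) => ‖u r.1 - u (r.1 + r.2)‖ₑ ^ 2 * stepWeight σ r.2 :=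
    (((hu.comp measurable_fst).sub (hu.comp (measurable_fst.add measurable_snd))).enorm.pow_const 2).mul
      ((measurable_stepWeight σ).comp measurable_snd)
  have h3 : ∫⁻ p in cell, ∫⁻ q in cell, A (q, p) = ∫⁻ p in cell, ∫⁻ q in cell, A (p, q) :=
    lintegral_lintegral_swap (hA.comp measurable_swap).aemeasurable
  rw [h1, lintegral_add_left hA.lintegral_prod_right', h3, ← two_mul]
  congr 1
  rw [setLIntegral_congr_fun measurableSet_cell fun p hp => h2 p hp.2,
    lintegral_lintegral_swap hm.aemeasurable]
  refine lintegral_congr fun h => ?_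
  exact lintegral_mul_const _
    ((hu.sub (hu.comp (measurable_id.add_const h))).enorm.pow_const 2)

end Unfolding

/-! ### Two-sided bounds of fractional seminorms by modes -/

lemma ae_stepMeasure_pos : ∀ᵐ h ∂stepMeasure, 0 < h.2 :=
  (Measure.quasiMeasurePreserving_snd (μ := volume.restrict (Ioo (-Real.pi) Real.pi))
    (ν := halfLine)).ae ae_halfLine_pos

lemma stepMeasure_le : stepMeasure ≤ volume := by
  rw [stepMeasure, Measure.prod_restrict]
  exact Measure.restrict_le_self

/-- In polar coordinates the integrand is r^{1-2σ} near 0 and r^{-1-2σ} near infinity; these are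
integrable exactly because σ < 1 and σ > 0. -/
lemma integrable_radial {σ : ℝ} (h0 : 0 < σ) (h1 : σ < 1) :
    Integrable fun h : ℝ × ℝ => min 1 (‖h‖ ^ 2) * ‖h‖ ^ (-(2 + 2 * σ)) := by
  rw [integrable_fun_norm_addHaar volume (f := fun r => min 1 (r ^ 2) * r ^ (-(2 + 2 * σ)))]
  have hd : Module.finrank ℝ (ℝ × ℝ) = 2 := by simp
  rw [hd, ← Ioc_union_Ioi_eq_Ioi zero_le_one]
  refine IntegrableOn.union ?_ ?_
  · have h2 : IntegrableOn (fun r : ℝ => r ^ (1 - 2 * σ)) (Ioc 0 1) := by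
      rw [← intervalIntegrable_iff_integrableOn_Ioc_of_le zero_le_one]
      exact intervalIntegral.intervalIntegrable_rpow' (by linarith)
    refine h2.congr_fun (fun r hr => ?_) measurableSet_Ioc
    have hr0 : 0 < r := hr.1
    simp only [smul_eq_mul]
    rw [min_eq_right (pow_le_one₀ hr0.le hr.2), ← Real.rpow_natCast r (2 - 1), ← Real.rpow_natCast r 2,
      ← Real.rpow_add hr0, ← Real.rpow_add hr0]
    congr 1
    push_cast
    ring
  · have h2 : IntegrableOn (fun r : ℝ => r ^ (-1 - 2 * σ)) (Ioi 1) :=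
      integrableOn_Ioi_rpow_of_lt (by linarith) zero_lt_one
    refine h2.congr_fun (fun r hr => ?_) measurableSet_Ioi
    have hr0 : 0 < r := zero_lt_one.trans hr
    simp only [smul_eq_mul]
    rw [min_eq_left (one_le_pow₀ (mem_Ioi.1 hr).le), ← Real.rpow_natCast r (2 - 1), one_mul,
      ← Real.rpow_add hr0]
    congr 1
    push_cast
    ring

lemma stepWeight_le {σ : ℝ} (h0 : 0 < σ) {h : ℝ × ℝ} (hh : 0 < h.2) :
    stepWeight σ h ≤ ENNReal.ofReal (‖h‖ ^ (-(2 + 2 * σ))) := by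
  have h1 : 0 < ‖h‖ := hh.trans_le ((le_abs_self _).trans (norm_snd_le h))
  have h2 : ‖h‖ ≤ Real.sqrt (h.1 ^ 2 + h.2 ^ 2) := by
    rw [Prod.norm_def]
    refine max_le (Real.abs_le_sqrt ?_) (Real.abs_le_sqrt ?_)
    · linarith [sq_nonneg h.2]
    · linarith [sq_nonneg h.1]
  rw [stepWeight, Real.rpow_neg h1.le, ENNReal.ofReal_inv_of_pos (by positivity)]
  refine ENNReal.inv_le_inv.2 (ENNReal.ofReal_le_ofReal ?_)
  exact Real.rpow_le_rpow h1.le h2 (by linarith)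

/-- After dominating the weight by a radial one on the whole plane, the substitution h ↦ κh scales
the integral by κ^{2+2σ} from the weight and κ^{-2} from the area. -/
lemma exists_lintegral_step_le {σ : ℝ} (h0 : 0 < σ) (h1 : σ < 1) : ∃ C : NNReal, ∀ κ : ℝ, 0 < κ →
    ∫⁻ h, ENNReal.ofReal (min 1 ((κ * ‖h‖) ^ 2)) * stepWeight σ h ∂stepMeasure ≤
      C * ENNReal.ofReal (κ ^ (2 * σ)) := by
  let φ : ℝ → ℝ := fun r => min 1 (r ^ 2) * r ^ (-(2 + 2 * σ))
  have hφ : ∫⁻ h : ℝ × ℝ, ENNReal.ofReal (φ ‖h‖) ≠ ⊤ := (integrable_radial h0 h1).lintegral_lt_top.ne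
  have hφm : Measurable φ := (measurable_const.min (measurable_id.pow_const 2)).mul
    (measurable_id.pow_const _)
  refine ⟨(∫⁻ h : ℝ × ℝ, ENNReal.ofReal (φ ‖h‖)).toNNReal, fun κ hκ => ?_⟩
  rw [ENNReal.coe_toNNReal hφ]
  calc _ ≤ ∫⁻ h, ENNReal.ofReal (κ ^ (2 + 2 * σ)) * ENNReal.ofReal (φ ‖κ • h‖) ∂stepMeasure := by
        refine lintegral_mono_ae (ae_stepMeasure_pos.mono fun h hh => ?_)
        refine (mul_le_mul_right (stepWeight_le h0 hh) _).trans ?_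
        rw [← ENNReal.ofReal_mul (by positivity), ← ENNReal.ofReal_mul (by positivity)]
        refine ENNReal.ofReal_le_ofReal (le_of_eq ?_)
        simp only [φ]
        have e : κ ^ (2 + 2 * σ) * κ ^ (-(2 + 2 * σ)) = 1 := by
          rw [← Real.rpow_add hκ, add_neg_cancel, Real.rpow_zero]
        rw [norm_smul, Real.norm_of_nonneg hκ.le, Real.mul_rpow hκ.le (norm_nonneg h)]
        linear_combination -(min 1 ((κ * ‖h‖) ^ 2) * ‖h‖ ^ (-(2 + 2 * σ))) * e
    _ ≤ ∫⁻ h : ℝ × ℝ, ENNReal.ofReal (κ ^ (2 + 2 * σ)) * ENNReal.ofReal (φ ‖κ • h‖) :=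
        lintegral_mono' stepMeasure_le le_rfl
    _ = ENNReal.ofReal (κ ^ (2 + 2 * σ)) * (ENNReal.ofReal (κ ^ 2)⁻¹ *
        ∫⁻ h : ℝ × ℝ, ENNReal.ofReal (φ ‖h‖)) := by
        rw [lintegral_const_mul' _ _ ENNReal.ofReal_ne_top]
        congr 1
        have hm := Measure.map_addHaar_smul (volume : Measure (ℝ × ℝ)) hκ.ne'
        have hd : Module.finrank ℝ (ℝ × ℝ) = 2 := by simp
        rw [hd, abs_of_nonneg (by positivity)] at hm
        have hφn : Measurable fun h : ℝ × ℝ => ENNReal.ofReal (φ ‖h‖) :=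
          (hφm.comp measurable_norm).ennreal_ofReal
        rw [← lintegral_map hφn (measurable_const_smul κ), hm, lintegral_smul_measure, smul_eq_mul]
    _ = _ := by
        rw [← mul_assoc, ← ENNReal.ofReal_mul (by positivity), mul_comm]
        congr 2
        rw [Real.rpow_add hκ, Real.rpow_ofNat, mul_comm, ← mul_assoc, inv_mul_cancel₀ (by positivity),
          one_mul]

lemma measurePreserving_step_neg : MeasurePreserving (Prod.map (fun x : ℝ => -x) (id : ℝ → ℝ))
    stepMeasure stepMeasure := by
  have h := (Measure.measurePreserving_neg (volume : Measure ℝ)).restrict_preimage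
    (measurableSet_Ioo (a := -Real.pi) (b := Real.pi))
  have e : (Neg.neg ⁻¹' Ioo (-Real.pi) Real.pi : Set ℝ) = Ioo (-Real.pi) Real.pi := by
    simp
  rw [e] at h
  exact h.prod (MeasurePreserving.id _)

/-- Increments of size about 1/κ suffice: there sin(k h₁) is bounded below, the weight is at least
of order κ^{2+2σ}, and the area is of order κ^{-2}. -/
lemma le_lintegral_modeIncrement {σ : ℝ} (h0 : 0 < σ) (h1 : σ < 1) {k : ℤ} (hk : k ≠ 0) {f : ℝ → ℂ}
    (hf : Measurable f) : ENNReal.ofReal (wave k ^ (2 * σ)) * ∫⁻ z in Ioi 0, ‖f z‖ₑ ^ 2 ≤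
      512 * ∫⁻ h, modeIncrement k f h * stepWeight σ h ∂stepMeasure := by
  set κ := wave k with hκ
  set I := ∫⁻ z in Ioi 0, ‖f z‖ₑ ^ 2
  have hκ1 : 1 ≤ κ := one_le_wave hk
  have hκ0 : 0 < κ := wave_pos hk
  let Φ : ℝ × ℝ → ℝ≥0∞ := fun h => modeIncrement k f h * stepWeight σ h
  have hΦ : Measurable Φ := (measurable_modeIncrement hf).mul (measurable_stepWeight σ)
  have e1 : ∫⁻ h, Φ (-h.1, h.2) ∂stepMeasure = ∫⁻ h, Φ h ∂stepMeasure :=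
    measurePreserving_step_neg.lintegral_comp hΦ
  -- On this box 1/2 < κh₁ ≤ 1, so 2 sin² ≥ 1/8; the increment has length at most 2/κ, so the weight
  -- is at least κ^{2+2σ}/16; the area is κ^{-2}/2. The product is κ^{2σ}/256, and adding each
  -- increment to its mirror image doubles the constant to 512. Since κ ≥ 1 the box fits into |h₁| <
  -- π.
  let R : Set (ℝ × ℝ) := Ioc (1 / (2 * κ)) (1 / κ) ×ˢ Ioc 0 (1 / κ)
  have hR : MeasurableSet R := measurableSet_Ioc.prod measurableSet_Ioc
  have hinv : 1 / κ ≤ 1 := by rwa [div_le_one hκ0]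
  have hRm : stepMeasure R = ENNReal.ofReal (1 / (2 * κ)) * ENNReal.ofReal (1 / κ) := by
    have hs1 : Ioc (1 / (2 * κ)) (1 / κ) ⊆ Ioo (-Real.pi) Real.pi := fun x hx =>
      ⟨by linarith [hx.1, Real.pi_pos, (by positivity : 0 < 1 / (2 * κ))],
        by linarith [hx.2, Real.pi_gt_three]⟩
    have hs2 : Ioc 0 (1 / κ) ⊆ Ioi 0 := fun x hx => hx.1
    rw [stepMeasure, Measure.prod_prod, Measure.restrict_apply measurableSet_Ioc,
      Measure.restrict_apply measurableSet_Ioc, inter_eq_left.2 hs1, inter_eq_left.2 hs2,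
      Real.volume_Ioc, Real.volume_Ioc]
    congr 2
    · field_simp
      norm_num
    · ring
  have h2 : ∀ h ∈ R, ENNReal.ofReal (κ ^ (2 + 2 * σ) / 128) * I ≤ Φ h + Φ (-h.1, h.2) := by
    intro h hh
    obtain ⟨⟨ha, hb⟩, hc, hd⟩ := hh
    have hh1 : 0 < h.1 := lt_trans (by positivity) ha
    have hw : ENNReal.ofReal (κ ^ (2 + 2 * σ) / 16) ≤ stepWeight σ h := by
      have hs : Real.sqrt (h.1 ^ 2 + h.2 ^ 2) ≤ 2 / κ := by
        refine Real.sqrt_le_iff.2 ⟨by positivity, ?_⟩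
        have e2 : h.1 ^ 2 ≤ (1 / κ) ^ 2 := pow_le_pow_left₀ hh1.le hb 2
        have e3 : h.2 ^ 2 ≤ (1 / κ) ^ 2 := pow_le_pow_left₀ hc.le hd 2
        have e4 : (2 / κ) ^ 2 = 4 * (1 / κ) ^ 2 := by ring
        nlinarith [sq_nonneg (1 / κ)]
      have hs0 : 0 < Real.sqrt (h.1 ^ 2 + h.2 ^ 2) := Real.sqrt_pos.2 (by positivity)
      have hp : Real.sqrt (h.1 ^ 2 + h.2 ^ 2) ^ (2 + 2 * σ) ≤ 16 / κ ^ (2 + 2 * σ) := by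
        refine (Real.rpow_le_rpow hs0.le hs (by linarith)).trans ?_
        rw [Real.div_rpow zero_le_two hκ0.le]
        gcongr
        calc (2 : ℝ) ^ (2 + 2 * σ) ≤ 2 ^ (4 : ℝ) :=
              Real.rpow_le_rpow_of_exponent_le one_le_two (by linarith)
          _ = 16 := by norm_num
      rw [stepWeight, ← ENNReal.ofReal_inv_of_pos (by positivity)]
      refine ENNReal.ofReal_le_ofReal ?_
      rw [le_inv_comm₀ (by positivity) (by positivity), inv_div]
      exact hp
    have hw' : stepWeight σ (-h.1, h.2) = stepWeight σ h := by
      simp only [stepWeight, neg_sq]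
    have hsin : (1 / 8 : ℝ) ≤ 2 * Real.sin (k * h.1) ^ 2 := by
      have e2 : Real.sin (k * h.1) ^ 2 = Real.sin (κ * h.1) ^ 2 := by
        rw [hκ, wave]
        rcases abs_choice (k : ℝ) with h | h
        · rw [h]
        · rw [h, neg_mul, Real.sin_neg, neg_sq]
      have e3 : 1 / 2 < κ * h.1 := by
        rw [div_lt_iff₀ (by positivity)] at ha
        linarith
      have e4 : κ * h.1 ≤ 1 := by
        rw [le_div_iff₀ hκ0] at hb
        linarith
      have e5 := Real.mul_le_sin (by positivity : 0 ≤ κ * h.1) (by linarith [Real.pi_gt_three])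
      have e6 : (1 / 4 : ℝ) ≤ 2 / Real.pi * (κ * h.1) := by
        rw [div_mul_eq_mul_div, le_div_iff₀ Real.pi_pos]
        linarith [Real.pi_le_four]
      rw [e2]
      nlinarith
    have hm : Φ h + Φ (-h.1, h.2) =
        (modeIncrement k f h + modeIncrement k f (-h.1, h.2)) * stepWeight σ h := by
      simp only [Φ, hw', add_mul]
    rw [hm]
    calc _ = (ENNReal.ofReal (1 / 8) * I) * ENNReal.ofReal (κ ^ (2 + 2 * σ) / 16) := by
          rw [mul_right_comm, ← ENNReal.ofReal_mul (by norm_num)]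
          congr 2
          ring
      _ ≤ _ := by
          refine mul_le_mul' (le_trans ?_ (le_modeIncrement_add hf h.1 h.2)) hw
          gcongr
  have h3 : ENNReal.ofReal (κ ^ (2 + 2 * σ) / 128) * I * stepMeasure R ≤
      2 * ∫⁻ h, Φ h ∂stepMeasure := by
    calc _ = ∫⁻ h in R, ENNReal.ofReal (κ ^ (2 + 2 * σ) / 128) * I ∂stepMeasure := by
          rw [setLIntegral_const]
      _ ≤ ∫⁻ h in R, (Φ h + Φ (-h.1, h.2)) ∂stepMeasure := setLIntegral_mono' hR h2
      _ ≤ ∫⁻ h, (Φ h + Φ (-h.1, h.2)) ∂stepMeasure := setLIntegral_le_lintegral _ _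
      _ = _ := by rw [lintegral_add_left hΦ, e1, two_mul]
  calc _ = 256 * (ENNReal.ofReal (κ ^ (2 + 2 * σ) / 128) * I * stepMeasure R) := by
        rw [hRm, ← ENNReal.ofReal_mul (by positivity), mul_right_comm _ I,
          ← ENNReal.ofReal_mul (by positivity), ← mul_assoc, ← ENNReal.ofReal_ofNat 256,
          ← ENNReal.ofReal_mul (by positivity)]
        congr 2
        rw [Real.rpow_add hκ0, Real.rpow_ofNat]
        field_simp
        norm_num
    _ ≤ 256 * (2 * ∫⁻ h, Φ h ∂stepMeasure) := by gcongr
    _ = _ := by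
        rw [← mul_assoc]
        norm_num
        rfl

/-- Comparison of Gagliardo seminorms by means of Fourier modes. -/
lemma exists_gagliardoSq_le {σ : ℝ} (h0 : 0 < σ) (h1 : σ < 1) : ∃ C : NNReal, ∀ u G : ℝ × ℝ → ℂ,
    IsPeriodicL2 u → IsPeriodicL2 G → ∀ v : ℤ → ℝ → ℂ, (∀ k, MemLp (v k) 2 halfLine) →
    (∀ k, IsWeakDerivHL (coeff u k) (v k)) →
    (∀ k, ∫⁻ z in Ioi 0, ‖coeff u k z‖ₑ ^ 2 ≤ 10 * ∫⁻ z in Ioi 0, ‖coeff G k z‖ₑ ^ 2) →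
    (∀ k, ∫⁻ z in Ioi 0, ‖v k z‖ₑ ^ 2 ≤
      ENNReal.ofReal (wave k ^ 2) * (10 * ∫⁻ z in Ioi 0, ‖coeff G k z‖ₑ ^ 2)) →
    gagliardoSq σ u ≤ C * gagliardoSq σ G := by
  obtain ⟨C, hC⟩ := exists_lintegral_step_le h0 h1
  -- The factor 4 comes from the increment estimate, 10 from the assumed energy bounds, 512 from the
  -- lower bound for G.
  refine ⟨40 * 512 * C, fun u G hu hG v hv huv hb1 hb2 => ?_⟩
  obtain ⟨u', hum, hu', huu⟩ := hu.exists_measurable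
  obtain ⟨G', hGm, hG', hGG⟩ := hG.exists_measurable
  rw [gagliardoSq_congr huu, gagliardoSq_congr hGG, gagliardoSq_eq hum hu'.periodic h0.ne',
    gagliardoSq_eq hGm hG'.periodic h0.ne']
  set I : ℤ → ℝ≥0∞ := fun k => ∫⁻ z in Ioi 0, ‖coeff G k z‖ₑ ^ 2 with hI
  have hI' : ∀ k, I k = ∫⁻ z in Ioi 0, ‖coeff G' k z‖ₑ ^ 2 := fun k =>
    lintegral_congr_ae ((coeff_congr hGG k).mono fun z hz => by simp only [hz])
  have hW : ∀ w : ℝ × ℝ → ℂ, Measurable w → IsPeriodicL2 w →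
      ∫⁻ h, (∫⁻ p in cell, ‖w p - w (p + h)‖ₑ ^ 2) * stepWeight σ h ∂stepMeasure =
      ENNReal.ofReal (2 * Real.pi) *
        ∑' k, ∫⁻ h, modeIncrement k (coeff w k) h * stepWeight σ h ∂stepMeasure := by
    intro w hwm hw
    have hmk : ∀ k, AEMeasurable (fun h => modeIncrement k (coeff w k) h * stepWeight σ h)
        stepMeasure := fun k => ((measurable_modeIncrement (measurable_coeff hwm k)).mul
      (measurable_stepWeight σ)).aemeasurable
    rw [← lintegral_tsum hmk, ← lintegral_const_mul' _ _ ENNReal.ofReal_ne_top]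
    refine lintegral_congr_ae (ae_stepMeasure_pos.mono fun h hh => ?_)
    simp only []
    rw [hw.lintegral_increment hwm hh.le, mul_assoc, ENNReal.tsum_mul_right]
  rw [hW u' hum hu', hW G' hGm hG']
  have hup : ∀ k, ∫⁻ h, modeIncrement k (coeff u' k) h * stepWeight σ h ∂stepMeasure ≤
      40 * 512 * C * ∫⁻ h, modeIncrement k (coeff G' k) h * stepWeight σ h ∂stepMeasure := by
    intro k
    have e1 : ∫⁻ h, modeIncrement k (coeff u' k) h * stepWeight σ h ∂stepMeasure ≤
        ∫⁻ h, 4 * (10 * I k) * (ENNReal.ofReal (min 1 ((wave k * ‖h‖) ^ 2)) * stepWeight σ h)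
          ∂stepMeasure := by
      refine lintegral_mono_ae (ae_stepMeasure_pos.mono fun h hh => ?_)
      rw [← modeIncrement_congr (coeff_congr huu k) k hh.le]
      refine (mul_le_mul_left (modeIncrement_le (memLp_coeff hu.memLp k) (hv k) (huv k) (hb1 k) (hb2 k)
        hh.le) _).trans_eq ?_
      ring
    refine e1.trans ?_
    have hIt : 4 * (10 * I k) ≠ ⊤ := by
      have := (memLp_two_iff.1 (memLp_coeff hG.memLp k)).2
      exact ENNReal.mul_ne_top (by finiteness) (ENNReal.mul_ne_top (by finiteness) this)
    rw [lintegral_const_mul' _ _ hIt]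
    -- The lower bound is not available for k = 0, but there the assumed bound of the vertical
    -- derivative is zero and the upper bound vanishes.
    by_cases hk : k = 0
    · subst hk
      simp [wave]
    · calc _ ≤ 4 * (10 * I k) * (C * ENNReal.ofReal (wave k ^ (2 * σ))) := by
            gcongr
            exact hC _ (wave_pos hk)
        _ = 40 * C * (ENNReal.ofReal (wave k ^ (2 * σ)) * I k) := by ring
        _ ≤ 40 * C * (512 * ∫⁻ h, modeIncrement k (coeff G' k) h * stepWeight σ h ∂stepMeasure) := by
            refine mul_le_mul_right ?_ _
            rw [hI']
            exact le_lintegral_modeIncrement h0 h1 hk (measurable_coeff hGm k)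
        _ = _ := by ring
  calc _ ≤ 2 * (ENNReal.ofReal (2 * Real.pi) * ∑' k, (40 * 512 * C *
        ∫⁻ h, modeIncrement k (coeff G' k) h * stepWeight σ h ∂stepMeasure)) := by
        gcongr with k
        exact hup k
    _ = _ := by
        rw [ENNReal.tsum_mul_left]
        push_cast
        ring

/-! ### Periodicity of weak derivatives -/

section Periodize

lemma dx_comp_shift (φ : ℝ × ℝ → ℝ) (n : ℤ) : dx (φ ∘ shift n) = dx φ ∘ shift n := by
  ext p
  simp only [dx, Function.comp_def, shift, fderiv_comp_add_right]

lemma dz_comp_shift (φ : ℝ × ℝ → ℝ) (n : ℤ) : dz (φ ∘ shift n) = dz φ ∘ shift n := by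
  ext p
  simp only [dz, Function.comp_def, shift, fderiv_comp_add_right]

lemma partialDeriv_comp_shift (β : ℕ × ℕ) (φ : ℝ × ℝ → ℝ) (n : ℤ) :
    partialDeriv β (φ ∘ shift n) = partialDeriv β φ ∘ shift n := by
  have h1 : Function.Semiconj (fun φ : ℝ × ℝ → ℝ => φ ∘ shift n) dx dx := fun φ =>
    (dx_comp_shift φ n).symm
  have h2 : Function.Semiconj (fun φ : ℝ × ℝ → ℝ => φ ∘ shift n) dz dz := fun φ =>
    (dz_comp_shift φ n).symm
  have e1 := (h2.iterate_right β.2).eq φ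
  have e2 := (h1.iterate_right β.1).eq (dz^[β.2] φ)
  exact ((congrArg (dx^[β.1]) e1).symm.trans e2.symm)

lemma shift_mem_upperHalf {n : ℤ} {p : ℝ × ℝ} : shift n p ∈ upperHalf ↔ p ∈ upperHalf := by
  simp [shift, upperHalf]

lemma IsTestFunction.comp_shift {φ : ℝ × ℝ → ℝ} (hφ : IsTestFunction φ) (n : ℤ) :
    IsTestFunction (φ ∘ shift n) where
  smooth := hφ.smooth.comp (contDiff_id.add contDiff_const)
  compact := hφ.compact.comp_homeomorph (Homeomorph.addRight (2 * Real.pi * n, 0))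
  support p hp := by
    have h := (tsupport_comp_subset_preimage φ
      (Homeomorph.addRight ((2 * Real.pi * n, 0) : ℝ × ℝ)).continuous) hp
    exact shift_mem_upperHalf.1 (hφ.support h)

variable {β : ℕ × ℕ} {f g : ℝ × ℝ → ℂ}

lemma measurePreserving_shift_volume (n : ℤ) : MeasurePreserving (shift n) volume volume :=
  measurePreserving_add_right (volume : Measure (ℝ × ℝ)) (2 * Real.pi * n, 0)

lemma locallyIntegrableOn_comp_shift (hg : LocallyIntegrableOn g upperHalf) (n : ℤ) :
    LocallyIntegrableOn (g ∘ shift n) upperHalf := by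
  rw [locallyIntegrableOn_iff isOpen_upperHalf.isLocallyClosed] at hg ⊢
  intro K hK hKc
  have hc : Continuous (shift n) := continuous_id.add continuous_const
  have h := hg (shift n '' K) (by
    rintro _ ⟨p, hp, rfl⟩
    exact shift_mem_upperHalf.2 (hK hp)) (hKc.image hc)
  rw [← (measurePreserving_shift_volume n).integrableOn_comp_preimage (measurableEmbedding_shift n),
    preimage_image_eq _ (measurableEmbedding_shift n).injective] at h
  exact h

lemma integral_testFunction_comp_shift {φ : ℝ × ℝ → ℝ} (hφ : IsTestFunction φ) (f : ℝ × ℝ → ℂ)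
    (n : ℤ) : ∫ p in upperHalf, ((φ ∘ shift (-n)) p : ℂ) * f p =
      ∫ p in upperHalf, (φ p : ℂ) * (f ∘ shift n) p := by
  rw [setIntegral_testFunction_mul _ (hφ.comp_shift (-n)).support,
    setIntegral_testFunction_mul _ hφ.support,
    ← (measurePreserving_shift_volume n).integral_comp (measurableEmbedding_shift n)]
  congr 1
  ext p
  have e : shift (-n) (shift n p) = p := by
    ext <;> simp [shift]
  simp only [Function.comp_apply, e]

lemma IsWeakDeriv.comp_shift (h : IsWeakDeriv β f g) (n : ℤ) :
    IsWeakDeriv β (f ∘ shift n) (g ∘ shift n) where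
  locInt := locallyIntegrableOn_comp_shift h.locInt n
  locInt_deriv := locallyIntegrableOn_comp_shift h.locInt_deriv n
  integral_eq φ hφ := by
    rw [← integral_testFunction_comp_shift hφ, ← integral_testFunction_comp_shift (hφ.partialDeriv β),
      ← partialDeriv_comp_shift, h.integral_eq _ (hφ.comp_shift (-n))]

/-- Square integrable weak derivatives of periodic functions are periodic. -/
lemma IsWeakDeriv.periodize (h : IsWeakDeriv β f g) (hf : IsPeriodic f)
    (hg : ∫⁻ p in cell, ‖g p‖ₑ ^ 2 ≠ ⊤) :
    IsPeriodicL2 (periodize g) ∧ IsWeakDeriv β f (periodize g) := by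
  have hm : AEStronglyMeasurable g cellMeasure :=
    (h.locInt_deriv.aestronglyMeasurable).mono_measure (Measure.restrict_mono cell_subset_upperHalf le_rfl)
  refine ⟨isPeriodicL2_periodize (memLp_two_iff.2 ⟨hm, hg⟩), h.congr (ae_of_all _ fun _ => rfl) ?_⟩
  -- The translate of g is a weak derivative of the translate of f, which is f, so uniqueness gives
  -- invariance almost everywhere. As there are countably many translations, this also covers the
  -- shift depending on p that the periodization uses.
  have h1 : ∀ n : ℤ, ∀ᵐ p ∂(volume.restrict upperHalf), g p = g (shift n p) := fun n => by
    refine h.unique ((h.comp_shift n).congr ?_ (ae_of_all _ fun _ => rfl))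
    rw [ae_restrict_iff' isOpen_upperHalf.measurableSet]
    exact ae_of_all _ fun p hp => hf.comp_shift n hp.2
  filter_upwards [ae_all_iff.2 h1] with p hp
  rw [hp (-toIocDiv Real.two_pi_pos 0 p.1), HalfCylinder.periodize]
  congr 1
  refine Prod.ext ?_ (by simp [shift])
  simp only [shift, Prod.fst_add, toIocMod, zsmul_eq_mul]
  push_cast
  ring

end Periodize

/-! ### Second derivatives of the potential in fractional spaces -/

section Potential

variable {F G : ℝ × ℝ → ℂ}

lemma potential_congr (h : F =ᵐ[cellMeasure] G) : potential F = potential G := by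
  ext p
  refine integral_congr_ae ?_
  filter_upwards [ae_all_iff.2 fun k : ℤ => coeff_congr h k] with y hy
  simp only [hy]

lemma opA_congr {f g : ℝ → ℂ} (h : f =ᵐ[halfLine] g) (k : ℤ) : opA k f = opA k g := by
  ext z
  unfold opA kernelOp
  split_ifs
  · rfl
  · exact integral_congr_ae (h.mono fun y hy => by simp only [hy])

lemma opB_congr {f g : ℝ → ℂ} (h : f =ᵐ[halfLine] g) (k : ℤ) : opB k f = opB k g := by
  ext z
  unfold opB kernelOp
  split_ifs
  · rfl
  · exact integral_congr_ae (h.mono fun y hy => by simp only [hy])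

lemma opA_const_mul (k : ℤ) (c : ℂ) (f : ℝ → ℂ) (z : ℝ) :
    opA k (fun y => c * f y) z = c * opA k f z := by
  unfold opA kernelOp
  split_ifs
  · simp
  · simp only [mul_left_comm _ c]
    exact integral_const_mul _ _

/-- The potential of a horizontal derivative. -/
lemma isWeakDeriv_potential (h : IsWeakDeriv (1, 0) F G) (hF : IsPeriodicL2 F) (hG : IsPeriodicL2 G) :
    IsWeakDeriv (1, 0) (potential F) (potential G) := by
  obtain ⟨hP, hPc⟩ := potential_spec hF.memLp
  obtain ⟨hQ, hQc⟩ := potential_spec hG.memLp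
  refine isWeakDeriv_x_of_coeff hP hQ fun k => ?_
  have h1 : opA k (coeff G k) = fun z => Complex.I * k * opA k (coeff F k) z := by
    rw [opA_congr (h.coeff_x hF hG k) k]
    ext z
    exact opA_const_mul k _ _ z
  filter_upwards [hPc k, hQc k] with z e1 e2
  rw [e1, e2, h1]
  ring

lemma lintegral_cell_le {f : ℝ × ℝ → ℂ} (hf : IsPeriodicL2 f) (hF : IsPeriodicL2 F)
    (h : ∀ k, ∫⁻ z in Ioi 0, ‖coeff f k z‖ₑ ^ 2 ≤ 4 * ∫⁻ z in Ioi 0, ‖coeff F k z‖ₑ ^ 2) :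
    ∫⁻ p in cell, ‖f p‖ₑ ^ 2 ≤ 4 * ∫⁻ p in cell, ‖F p‖ₑ ^ 2 := by
  rw [parseval hf.memLp, parseval hF.memLp, mul_left_comm, ← ENNReal.tsum_mul_left (a := 4)]
  exact mul_le_mul_right (ENNReal.tsum_le_tsum h) _

variable {X Z T S : ℝ × ℝ → ℂ}

lemma lintegral_congr_sq {f g : ℝ → ℂ} (h : f =ᵐ[halfLine] g) :
    ∫⁻ z in Ioi 0, ‖f z‖ₑ ^ 2 = ∫⁻ z in Ioi 0, ‖g z‖ₑ ^ 2 :=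
  lintegral_congr_ae (h.mono fun z hz => by simp only [hz])

lemma norm_I_mul_inv_le (k : ℤ) : ‖-(Complex.I * k * ((wave k)⁻¹ : ℝ))‖ ≤ wave k := by
  rw [norm_neg, norm_mul, norm_I_mul, Complex.norm_real, Real.norm_of_nonneg
    (inv_nonneg.2 (wave_nonneg k))]
  rcases one_le_wave_or k with rfl | h
  · simp [wave]
  · rwa [mul_inv_cancel₀ (by linarith)]

namespace IsDerivFamily

lemma lintegral_x_le (h : IsDerivFamily F X Z T S) (hF : IsPeriodicL2 F) :
    ∫⁻ p in cell, ‖X p‖ₑ ^ 2 ≤ 4 * ∫⁻ p in cell, ‖F p‖ₑ ^ 2 :=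
  lintegral_cell_le h.x hF fun k => (lintegral_congr_sq (h.coeff_x k)).trans_le
    (lintegral_opA_le (memLp_coeff hF.memLp k) (norm_I_mul_inv_le k))

lemma lintegral_z_le (h : IsDerivFamily F X Z T S) (hF : IsPeriodicL2 F) :
    ∫⁻ p in cell, ‖Z p‖ₑ ^ 2 ≤ 4 * ∫⁻ p in cell, ‖F p‖ₑ ^ 2 :=
  lintegral_cell_le h.z hF fun k => (lintegral_congr_sq (h.coeff_z k)).trans_le (by
    rcases one_le_wave_or k with rfl | h
    · simp [opB_zero]
    · simpa using lintegral_opB_le (k := k) (a := 1) (memLp_coeff hF.memLp k) (by simpa using h))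

lemma lintegral_xx_mode_le (h : IsDerivFamily F X Z T S) (hF : IsPeriodicL2 F) (k : ℤ) :
    ∫⁻ z in Ioi 0, ‖coeff T k z‖ₑ ^ 2 ≤ 4 * ∫⁻ z in Ioi 0, ‖coeff F k z‖ₑ ^ 2 :=
  (lintegral_congr_sq (h.coeff_xx k)).trans_le (lintegral_opA_le (memLp_coeff hF.memLp k) (by
    rw [Complex.norm_real, Real.norm_of_nonneg (wave_nonneg k)]))

lemma lintegral_xz_mode_le (h : IsDerivFamily F X Z T S) (hF : IsPeriodicL2 F) (k : ℤ) :
    ∫⁻ z in Ioi 0, ‖coeff S k z‖ₑ ^ 2 ≤ 4 * ∫⁻ z in Ioi 0, ‖coeff F k z‖ₑ ^ 2 :=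
  (lintegral_congr_sq (h.coeff_xz k)).trans_le
    (lintegral_opB_le (memLp_coeff hF.memLp k) (norm_I_mul k).le)

/-- The second derivatives of a potential are bounded in fractional Sobolev spaces. -/
lemma exists_gagliardoSq_le {σ : ℝ} (h0 : 0 ≤ σ) (h1 : σ < 1) : ∃ C : NNReal, ∀ F X Z T S : ℝ × ℝ → ℂ,
    IsDerivFamily F X Z T S → IsPeriodicL2 F → (∀ᵐ z ∂halfLine, coeff F 0 z = 0) →
    gagliardoSq σ T ≤ C * gagliardoSq σ F ∧ gagliardoSq σ S ≤ C * gagliardoSq σ F := by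
  rcases h0.eq_or_lt with rfl | h0
  · exact ⟨0, fun F X Z T S _ _ => by simp [gagliardoSq]⟩
  obtain ⟨C, hC⟩ := HalfCylinder.exists_gagliardoSq_le h0 h1
  refine ⟨C, fun F X Z T S h hF hF0 => ?_⟩
  have hA := fun k => memLp_opA (memLp_coeff hF.memLp k) k
  have hB := fun k => memLp_opB (memLp_coeff hF.memLp k) k
  have hsq : ∀ {k : ℤ} {c : ℂ} {f : ℝ → ℂ}, ‖c‖ = wave k →
      ∫⁻ z in Ioi 0, ‖c * f z‖ₑ ^ 2 = ENNReal.ofReal (wave k ^ 2) * ∫⁻ z in Ioi 0, ‖f z‖ₑ ^ 2 := by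
    intro k c f hc
    simp only [enorm_mul, mul_pow]
    rw [lintegral_const_mul' _ _ (by finiteness), enorm_sq_eq, hc]
  have hle : ∀ x : ℝ≥0∞, 4 * x ≤ 10 * x := fun x => by gcongr; norm_num
  constructor
  -- The modes κA of ∂ₓ²Ψ have vertical derivative -κ²B, of energy at most 4κ² times that of the
  -- source mode.
  · refine hC T F h.xx hF (fun k z => wave k * (-wave k * opB k (coeff F k) z))
      (fun k => ((hB k).const_mul _).const_mul _) (fun k => ?_)
      (fun k => (h.lintegral_xx_mode_le hF k).trans (hle _)) (fun k => ?_)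
    · exact ((isWeakDerivHL_opA (memLp_coeff hF.memLp k) k).const_mul (wave k : ℂ)).congr
        (h.coeff_xx k).symm (ae_of_all _ fun _ => rfl)
    · have hw : ‖(wave k : ℂ)‖ = wave k := by
        rw [Complex.norm_real, Real.norm_of_nonneg (wave_nonneg k)]
      rw [hsq hw]
      refine mul_le_mul_right ((lintegral_opB_le (memLp_coeff hF.memLp k) ?_).trans (hle _)) _
      rw [norm_neg, hw]
  -- The modes ikB of the mixed derivative have vertical derivative ik(f - κA), of energy at most
  -- 2(1 + 4)κ² times that of f: this is the origin of the constant 10.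
  · refine hC S F h.xz hF (fun k z => Complex.I * k * (coeff F k z - wave k * opA k (coeff F k) z))
      (fun k => ((memLp_coeff hF.memLp k).sub ((hA k).const_mul _)).const_mul _) (fun k => ?_)
      (fun k => (h.lintegral_xz_mode_le hF k).trans (hle _)) (fun k => ?_)
    · exact ((isWeakDerivHL_opB (memLp_coeff hF.memLp k)
        (fun hk : k = 0 => hk ▸ hF0)).const_mul
        (Complex.I * k)).congr (h.coeff_xz k).symm (ae_of_all _ fun _ => rfl)
    · rw [hsq (norm_I_mul k)]
      refine mul_le_mul_right ((lintegral_sub_sq_le (memLp_coeff hF.memLp k).1).trans ?_) _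
      have := lintegral_opA_le (k := k) (a := wave k) (memLp_coeff hF.memLp k) (by
        rw [Complex.norm_real, Real.norm_of_nonneg (wave_nonneg k)])
      calc _ ≤ 2 * ((∫⁻ z in Ioi 0, ‖coeff F k z‖ₑ ^ 2) + 4 * ∫⁻ z in Ioi 0, ‖coeff F k z‖ₑ ^ 2) := by
            gcongr
        _ = _ := by ring

end IsDerivFamily

end Potential

/-! ### Sobolev bounds of all orders -/

/-- A family of periodic square integrable weak derivatives up to the order `m`. -/
structure IsPeriodicFamily (m : ℕ) (f : ℝ × ℝ → ℂ) (P : ℕ × ℕ → ℝ × ℝ → ℂ) : Prop where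
  mem : ∀ β : ℕ × ℕ, β.1 + β.2 ≤ m → IsPeriodicL2 (P β)
  weak : ∀ β : ℕ × ℕ, β.1 + β.2 ≤ m → IsWeakDeriv β f (P β)

namespace IsPeriodicFamily

variable {m : ℕ} {f : ℝ × ℝ → ℂ} {P : ℕ × ℕ → ℝ × ℝ → ℂ}

lemma weak_x (h : IsPeriodicFamily m f P) {a b : ℕ} (hab : a + 1 + b ≤ m) :
    IsWeakDeriv (1, 0) (P (a, b)) (P (a + 1, b)) := by
  refine (h.weak (a, b) (by simp only; omega)).of_comp ?_
  have e : ((1, 0) + (a, b) : ℕ × ℕ) = (a + 1, b) := Prod.ext (add_comm _ _) (zero_add _)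
  rw [e]
  exact h.weak _ hab

lemma ae_eq_zero (h : IsPeriodicFamily m f P) : P (0, 0) =ᵐ[cellMeasure] f := by
  have h1 := h.weak (0, 0) (Nat.zero_le m)
  exact ae_cell_of_ae_upperHalf (h1.unique (IsWeakDeriv.refl h1.locInt))

lemma coeff_x (h : IsPeriodicFamily m f P) (k : ℤ) : ∀ a ≤ m,
    ∀ᵐ z ∂halfLine, coeff (P (a, 0)) k z = (Complex.I * k) ^ a * coeff f k z := by
  intro a
  induction a with
  | zero =>
    intro _
    filter_upwards [coeff_congr h.ae_eq_zero k] with z hz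
    rw [hz, pow_zero, one_mul]
  | succ a ih =>
    intro ha
    filter_upwards [ih (by omega), (h.weak_x (a := a) (b := 0) (by omega)).coeff_x
      (h.mem (a, 0) (by simp only; omega)) (h.mem (a + 1, 0) (by simp only; omega)) k] with z h1 h2
    rw [h2, h1, pow_succ]
    ring

lemma potential_weak (h : IsPeriodicFamily m f P) : ∀ a ≤ m,
    IsWeakDeriv (a, 0) (potential f) (potential (P (a, 0))) := by
  intro a
  induction a with
  | zero =>
    intro _
    rw [potential_congr h.ae_eq_zero]
    have hm : MemLp f 2 cellMeasure := (memLp_congr_ae h.ae_eq_zero).1 (h.mem (0, 0) (Nat.zero_le m)).memLp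
    exact IsWeakDeriv.refl (potential_spec hm).1.locallyIntegrableOn
  | succ a ih =>
    intro ha
    have h1 := (ih (by omega)).comp (isWeakDeriv_potential (h.weak_x (a := a) (b := 0) (by omega))
      (h.mem (a, 0) (by simp only; omega)) (h.mem (a + 1, 0) (by simp only; omega)))
    have e : ((1, 0) + (a, 0) : ℕ × ℕ) = (a + 1, 0) := Prod.ext (add_comm _ _) (zero_add _)
    rwa [e] at h1

end IsPeriodicFamily

/-- The square of the Sobolev norm computed with a given family of weak derivatives. -/
def hsSum (s : ℝ) (D : ℕ × ℕ → ℝ × ℝ → ℂ) : ℝ≥0∞ :=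
  (∑ n ∈ Finset.range (⌊s⌋₊ + 1), ∑ β ∈ Finset.HasAntidiagonal.antidiagonal n,
    ∫⁻ p in cell, ‖D β p‖ₑ ^ 2) +
  ∑ β ∈ Finset.HasAntidiagonal.antidiagonal ⌊s⌋₊, gagliardoSq (Int.fract s) (D β)

lemma lintegral_le_hsSum {s : ℝ} (D : ℕ × ℕ → ℝ × ℝ → ℂ) {β : ℕ × ℕ} (h : β.1 + β.2 ≤ ⌊s⌋₊) :
    ∫⁻ p in cell, ‖D β p‖ₑ ^ 2 ≤ hsSum s D := by
  refine le_add_right (le_trans ?_ (Finset.single_le_sum (fun _ _ => zero_le)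
    (Finset.mem_range.2 (Nat.lt_succ_of_le h))))
  exact Finset.single_le_sum (f := fun β => ∫⁻ p in cell, ‖D β p‖ₑ ^ 2) (fun _ _ => zero_le)
    (Finset.HasAntidiagonal.mem_antidiagonal.2 rfl)

lemma gagliardoSq_le_hsSum {s : ℝ} (D : ℕ × ℕ → ℝ × ℝ → ℂ) {β : ℕ × ℕ} (h : β.1 + β.2 = ⌊s⌋₊) :
    gagliardoSq (Int.fract s) (D β) ≤ hsSum s D :=
  le_add_left (Finset.single_le_sum (f := fun β => gagliardoSq (Int.fract s) (D β))
    (fun _ _ => zero_le) (Finset.HasAntidiagonal.mem_antidiagonal.2 h))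

lemma hsSum_congr {s : ℝ} {D E : ℕ × ℕ → ℝ × ℝ → ℂ} (h : ∀ β, D β =ᵐ[cellMeasure] E β) :
    hsSum s D = hsSum s E := by
  unfold hsSum
  congr 1
  · refine Finset.sum_congr rfl fun n _ => Finset.sum_congr rfl fun β _ => ?_
    exact lintegral_congr_ae ((h β).mono fun p hp => by simp only [hp])
  · exact Finset.sum_congr rfl fun β _ => gagliardoSq_congr (h β) _

lemma hsNorm_le {s : ℝ} {f : ℝ × ℝ → ℂ} {D : ℕ × ℕ → ℝ × ℝ → ℂ}
    (h : ∀ β : ℕ × ℕ, β.1 + β.2 ≤ ⌊s⌋₊ → IsWeakDeriv β f (D β)) :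
    hsNorm s f ≤ hsSum s D ^ (1 / 2 : ℝ) := iInf₂_le D h

/-- The infimum runs over arbitrary families of weak derivatives. One with infinite sum is harmless,
and one with finite sum can be periodized without changing its value, so periodic families suffice.
-/
lemma le_hsNorm {s : ℝ} {f : ℝ × ℝ → ℂ} {N : ℝ≥0∞} (hf : IsPeriodic f)
    (h : ∀ P, IsPeriodicFamily ⌊s⌋₊ f P → hsSum s P ≠ ⊤ → N ≤ hsSum s P ^ (1 / 2 : ℝ)) :
    N ≤ hsNorm s f := by
  refine le_iInf₂ fun D hD => ?_
  change N ≤ hsSum s D ^ (1 / 2 : ℝ)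
  by_cases ht : hsSum s D = ⊤
  · rw [ht, ENNReal.top_rpow_of_pos (by norm_num)]
    exact le_top
  have h1 := fun (β : ℕ × ℕ) hβ => (hD β hβ).periodize hf
    (ne_top_of_le_ne_top ht (lintegral_le_hsSum D hβ))
  have h2 : hsSum s (fun β => periodize (D β)) = hsSum s D :=
    hsSum_congr fun β => periodize_ae_eq (D β)
  have h3 := h (fun β => periodize (D β)) ⟨fun β hβ => (h1 β hβ).1, fun β hβ => (h1 β hβ).2⟩
    (by rwa [h2])
  rwa [h2] at h3

lemma hsSum_le {s : ℝ} {D : ℕ × ℕ → ℝ × ℝ → ℂ} {N : ℝ≥0∞}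
    (h1 : ∀ β : ℕ × ℕ, β.1 + β.2 ≤ ⌊s⌋₊ → ∫⁻ p in cell, ‖D β p‖ₑ ^ 2 ≤ N)
    (h2 : ∀ β : ℕ × ℕ, β.1 + β.2 = ⌊s⌋₊ → gagliardoSq (Int.fract s) (D β) ≤ N) :
    hsSum s D ≤ ((⌊s⌋₊ + 1) * (⌊s⌋₊ + 1) + (⌊s⌋₊ + 1) : ℕ) * N := by
  rw [Nat.cast_add, add_mul]
  refine add_le_add ?_ ?_
  · rw [Nat.cast_mul, mul_assoc]
    refine (Finset.sum_le_card_nsmul _ _ ((⌊s⌋₊ + 1 : ℕ) * N) fun n hn => ?_).trans_eq (by simp)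
    have hn' := Finset.mem_range.1 hn
    refine (Finset.sum_le_card_nsmul _ _ N fun β hβ => h1 β ?_).trans ?_
    · rw [Finset.HasAntidiagonal.mem_antidiagonal.1 hβ]
      omega
    · rw [Finset.Nat.card_antidiagonal, nsmul_eq_mul]
      gcongr
      omega
  · refine (Finset.sum_le_card_nsmul _ _ N fun β hβ => h2 β (Finset.HasAntidiagonal.mem_antidiagonal.1 hβ)).trans_eq ?_
    simp

/-- All derivatives of the potential of order between `1` and `m + 2`. -/
lemma exists_potential_deriv {m : ℕ} {σ : ℝ} {C : NNReal} (hC : ∀ F X Z T S : ℝ × ℝ → ℂ,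
      IsDerivFamily F X Z T S → IsPeriodicL2 F → (∀ᵐ z ∂halfLine, coeff F 0 z = 0) →
      gagliardoSq σ T ≤ C * gagliardoSq σ F ∧ gagliardoSq σ S ≤ C * gagliardoSq σ F)
    {F : ℝ × ℝ → ℂ} (hF : IsSource F) {P : ℕ × ℕ → ℝ × ℝ → ℂ} (hP : IsPeriodicFamily m F P) {N : ℝ≥0∞}
    (h1 : ∀ β : ℕ × ℕ, β.1 + β.2 ≤ m → ∫⁻ p in cell, ‖P β p‖ₑ ^ 2 ≤ N)
    (h2 : ∀ β : ℕ × ℕ, β.1 + β.2 = m → gagliardoSq σ (P β) ≤ N) :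
    ∀ b a : ℕ, 1 ≤ a + b → a + b ≤ m + 2 → ∃ E, IsPeriodicL2 E ∧ IsWeakDeriv (a, b) (potential F) E ∧
      ∫⁻ p in cell, ‖E p‖ₑ ^ 2 ≤ 4 ^ b * ((4 + C) * N) ∧
      (a + b = m + 2 → gagliardoSq σ E ≤ 4 ^ b * ((4 + C) * N)) := by
  have hfam := fun a (ha : a ≤ m) => exists_derivFamily (hP.mem (a, 0) (by simpa using ha)).memLp
  have hzero : ∀ a ≤ m, ∀ᵐ z ∂halfLine, coeff (P (a, 0)) 0 z = 0 := fun a ha => by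
    filter_upwards [hP.coeff_x 0 a ha, hF.coeff_zero] with z h1 h2
    rw [h1, h2, mul_zero]
  have hN4 : 4 * N ≤ (4 + C) * N := by gcongr; exact le_self_add
  have hNC : C * N ≤ (4 + C) * N := by gcongr; exact le_add_self
  have hN1 : N ≤ (4 + C) * N := le_trans (le_mul_of_one_le_left' (by norm_num)) hN4
  have h4 : ∀ β : ℕ × ℕ, β.1 + β.2 ≤ m → 4 * ∫⁻ p in cell, ‖P β p‖ₑ ^ 2 ≤ (4 + C) * N :=
    fun β hβ => le_trans (by gcongr; exact h1 β hβ) hN4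
  -- Induction on the vertical order in steps of two. For b = 0 and b = 1 the derivative is a first
  -- or second derivative of the potential of ∂ₓ^a F, because ∂ₓ commutes with the solution
  -- operator. For b + 2 the equation ∂_z²Ψ = F - ∂ₓ²Ψ moves two derivatives to the horizontal
  -- direction; each such step costs at most a factor 16.
  intro b
  induction b using Nat.strong_induction_on with
  | _ b ih =>
  intro a hab1 hab2
  match b, ih with
  | 0, _ =>
    simp only [pow_zero, one_mul]
    match a with
    | 0 => omega
    | 1 =>
      obtain ⟨X, Z, T, S, h⟩ := hfam 0 (Nat.zero_le m)
      have hp := hP.mem (0, 0) (Nat.zero_le m)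
      refine ⟨X, h.x, ?_, (h.lintegral_x_le hp).trans (h4 _ (Nat.zero_le m)), fun h => by omega⟩
      rw [← potential_congr hP.ae_eq_zero]
      exact h.weak_x hp.memLp
    | a + 2 =>
      obtain ⟨X, Z, T, S, h⟩ := hfam a (by omega)
      have hp := hP.mem (a, 0) (by simp only; omega)
      refine ⟨T, h.xx, ?_, (lintegral_cell_le h.xx hp (h.lintegral_xx_mode_le hp)).trans
        (h4 _ (by simp only; omega)), fun ham => ?_⟩
      · have e := (hP.potential_weak a (by omega)).comp ((h.weak_x hp.memLp).comp h.weak_xx)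
        have e1 : ((1, 0) + (1, 0) + (a, 0) : ℕ × ℕ) = (a + 2, 0) := Prod.ext (by simp; omega) rfl
        rwa [e1] at e
      · refine (hC _ X Z T S h hp (hzero a (by omega))).1.trans (le_trans ?_ hNC)
        gcongr
        exact h2 _ (by simp only; omega)
  | 1, _ =>
    have h5 : (4 + C) * N ≤ 4 ^ 1 * ((4 + C) * N) := le_mul_of_one_le_left' (by norm_num)
    match a with
    | 0 =>
      obtain ⟨X, Z, T, S, h⟩ := hfam 0 (Nat.zero_le m)
      have hp := hP.mem (0, 0) (Nat.zero_le m)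
      refine ⟨Z, h.z, ?_, ((h.lintegral_z_le hp).trans (h4 _ (Nat.zero_le m))).trans h5,
        fun h => by omega⟩
      rw [← potential_congr hP.ae_eq_zero]
      exact h.weak_z hp.memLp
    | a + 1 =>
      obtain ⟨X, Z, T, S, h⟩ := hfam a (by omega)
      have hp := hP.mem (a, 0) (by simp only; omega)
      refine ⟨S, h.xz, ?_, ((lintegral_cell_le h.xz hp (h.lintegral_xz_mode_le hp)).trans
        (h4 _ (by simp only; omega))).trans h5, fun ham => ?_⟩
      · have e := (hP.potential_weak a (by omega)).comp ((h.weak_z hp.memLp).comp h.weak_xz)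
        have e1 : ((1, 0) + (0, 1) + (a, 0) : ℕ × ℕ) = (a + 1, 1) := Prod.ext (by simp; omega) rfl
        rwa [e1] at e
      · refine le_trans ((hC _ X Z T S h hp (hzero a (by omega))).2.trans (le_trans ?_ hNC)) h5
        gcongr
        exact h2 _ (by simp only; omega)
  | b + 2, ih =>
    obtain ⟨E, hE, hEw, hEb, hEg⟩ := ih b (by omega) (a + 2) (by omega) (by omega)
    obtain ⟨X, Z, T, S, h⟩ := exists_derivFamily hF.memLp
    have hp := hP.mem (a, b) (by simp only; omega)
    have h6 : 2 * (N + 4 ^ b * ((4 + C) * N)) ≤ 4 ^ (b + 2) * ((4 + C) * N) := by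
      have h7 : N ≤ 4 ^ b * ((4 + C) * N) :=
        hN1.trans (le_mul_of_one_le_left' (one_le_pow₀ (by norm_num)))
      calc _ ≤ 2 * (4 ^ b * ((4 + C) * N) + 4 ^ b * ((4 + C) * N)) := by gcongr
        _ = 4 ^ (b + 1) * ((4 + C) * N) := by ring
        _ ≤ _ := by
            gcongr
            · norm_num
            · omega
    refine ⟨fun p => P (a, b) p - E p, ⟨fun x z hz => ?_, hp.memLp.sub hE.memLp⟩, ?_, ?_, fun ham => ?_⟩
    · simp only [hp.periodic x z hz, hE.periodic x z hz]
    -- E is the derivative of order (a + 2, b) of Ψ; read through T = ∂ₓ²Ψ it is the derivative of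
    -- order (a, b) of T.
    · have e1 : IsWeakDeriv (a, b) T E := by
        refine ((h.weak_x hF.memLp).comp h.weak_xx).of_comp ?_
        have e : ((a, b) + ((1, 0) + (1, 0)) : ℕ × ℕ) = (a + 2, b) := Prod.ext (by simp) (by simp)
        rwa [e]
      have e2 := ((h.weak_z hF.memLp).comp (h.weak_zz hF)).comp
        ((hP.weak (a, b) (by simp only; omega)).sub e1)
      have e : ((a, b) + ((0, 1) + (0, 1)) : ℕ × ℕ) = (a, b + 2) := Prod.ext (by simp) (by simp)
      rwa [e] at e2
    · refine (lintegral_sub_sq_le hp.memLp.1).trans (le_trans ?_ h6)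
      exact mul_le_mul_right (add_le_add (h1 _ (by simp only; omega)) hEb) _
    · refine (gagliardoSq_sub_le hp.memLp.1 σ).trans (le_trans ?_ h6)
      gcongr
      · exact h2 _ (by simp only; omega)
      · exact hEg (by omega)

/-- Sobolev bounds for the potential. -/
theorem exists_gradHsNorm_le {s : ℝ} (hs : 1 ≤ s) : ∃ C : NNReal, ∀ F : ℝ × ℝ → ℂ, IsSource F →
    gradHsNorm s (potential F) ≤ C * hsNorm (s - 1) F := by
  obtain ⟨C, hC⟩ := IsDerivFamily.exists_gagliardoSq_le (Int.fract_nonneg s) (Int.fract_lt_one s)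
  set m := ⌊s - 1⌋₊ with hm
  have hsm : ⌊s⌋₊ = m + 1 := by
    rw [hm, Nat.floor_sub_one]
    have : 1 ≤ ⌊s⌋₊ := Nat.one_le_floor_iff _ |>.2 hs
    omega
  have hfr : Int.fract (s - 1) = Int.fract s := Int.fract_sub_one s
  -- Two gradient components, times the number of terms in the norm, times the bound for a single
  -- derivative.
  let M : NNReal := 2 * (((⌊s⌋₊ + 1) * (⌊s⌋₊ + 1) + (⌊s⌋₊ + 1) : ℕ) * (4 ^ (m + 2) * (4 + C)))
  have hM : M ≠ 0 := by positivity
  refine ⟨M ^ (1 / 2 : ℝ), fun F hF => ?_⟩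
  have hM0 : M ^ (1 / 2 : ℝ) ≠ 0 := by
    rw [Ne, NNReal.rpow_eq_zero_iff]
    exact fun h => hM h.1
  -- Dividing by the constant leaves the norm of F alone on the right, where lower bounds for the
  -- infimum apply.
  rw [mul_comm, ← ENNReal.div_le_iff_le_mul (Or.inl (by exact_mod_cast hM0))
    (Or.inl ENNReal.coe_ne_top)]
  refine le_hsNorm hF.periodic fun P hP _ => ?_
  rw [ENNReal.div_le_iff_le_mul (Or.inl (by exact_mod_cast hM0)) (Or.inl ENNReal.coe_ne_top), mul_comm]
  set N := hsSum (s - 1) P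
  have h := exists_potential_deriv hC hF hP (N := N) (fun β hβ => lintegral_le_hsSum P hβ)
    (fun β hβ => hfr ▸ gagliardoSq_le_hsSum P hβ)
  -- One coherent choice of derivatives for all multi-indices, with a dummy value 0 outside the
  -- admissible orders. The same family then serves as derivatives of both gradient components.
  have h' : ∀ β : ℕ × ℕ, ∃ E : ℝ × ℝ → ℂ, 1 ≤ β.1 + β.2 → β.1 + β.2 ≤ m + 2 →
      IsWeakDeriv β (potential F) E ∧ ∫⁻ p in cell, ‖E p‖ₑ ^ 2 ≤ 4 ^ (m + 2) * ((4 + C) * N) ∧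
      (β.1 + β.2 = m + 2 → gagliardoSq (Int.fract s) E ≤ 4 ^ (m + 2) * ((4 + C) * N)) := by
    intro β
    by_cases hβ : 1 ≤ β.1 + β.2 ∧ β.1 + β.2 ≤ m + 2
    · obtain ⟨E, -, e1, e2, e3⟩ := h β.2 β.1 hβ.1 hβ.2
      have h4 : (4 : ℝ≥0∞) ^ β.2 * ((4 + C) * N) ≤ 4 ^ (m + 2) * ((4 + C) * N) := by
        gcongr
        · norm_num
        · omega
      exact ⟨E, fun _ _ => ⟨e1, e2.trans h4, fun e => (e3 e).trans h4⟩⟩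
    · exact ⟨0, fun h1 h2 => absurd ⟨h1, h2⟩ hβ⟩
  choose E hE using h'
  have hx := (hE (1, 0) le_rfl (by simp only; omega)).1
  have hz := (hE (0, 1) le_rfl (by simp only; omega)).1
  have key : ∀ γ : ℕ × ℕ, γ.1 + γ.2 = 1 → hsNorm s (E γ) ^ 2 ≤
      ((⌊s⌋₊ + 1) * (⌊s⌋₊ + 1) + (⌊s⌋₊ + 1) : ℕ) * (4 ^ (m + 2) * ((4 + C) * N)) := by
    intro γ hγ
    have hw := (hE γ hγ.ge (by omega)).1
    have e1 : ∀ β : ℕ × ℕ, β.1 + β.2 ≤ ⌊s⌋₊ → 1 ≤ (β + γ).1 + (β + γ).2 ∧ (β + γ).1 + (β + γ).2 ≤ m + 2 :=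
      fun β hβ => by
        simp only [Prod.fst_add, Prod.snd_add]
        omega
    have e2 := hsNorm_le (s := s) (f := E γ) (D := fun β => E (β + γ)) fun β hβ =>
      hw.of_comp (hE (β + γ) (e1 β hβ).1 (e1 β hβ).2).1
    refine (pow_le_pow_left' e2 2).trans ?_
    rw [← ENNReal.rpow_natCast, ← ENNReal.rpow_mul]
    norm_num
    have e3 := hsSum_le (s := s) (D := fun β => E (β + γ)) (N := 4 ^ (m + 2) * ((4 + C) * N))
      (fun β hβ => (hE (β + γ) (e1 β hβ).1 (e1 β hβ).2).2.1)
      (fun β hβ => (hE (β + γ) (e1 β hβ.le).1 (e1 β hβ.le).2).2.2 (by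
        simp only [Prod.fst_add, Prod.snd_add]
        omega))
    exact_mod_cast e3
  have h1 : gradHsNorm s (potential F) ≤ hsNormPair s (E (1, 0)) (E (0, 1)) :=
    iInf_le_of_le _ (iInf_le_of_le _ (iInf_le_of_le hx (iInf_le _ hz)))
  refine h1.trans ?_
  unfold hsNormPair
  rw [ENNReal.coe_rpow_of_nonneg _ (by norm_num), ← ENNReal.mul_rpow_of_nonneg _ _ (by norm_num)]
  refine ENNReal.rpow_le_rpow ((add_le_add (key _ rfl) (key _ rfl)).trans_eq ?_) (by norm_num)
  simp only [M]
  push_cast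
  ring

/-! ### First order multipliers and the Poisson kernel -/

/-- First order Fourier multipliers: `a |k|` for `k ≥ 0` and `b |k|` for `k ≤ 0`. -/
def IsFirstOrder (m : ℤ → ℂ) : Prop :=
  ∃ a b : ℂ, ‖a‖ = 1 ∧ ‖b‖ = 1 ∧ ∀ n : ℕ, m n = a * n ∧ m (-n) = b * n

lemma isFirstOrder_wave : IsFirstOrder fun k => wave k :=
  ⟨1, 1, norm_one, norm_one, fun n => ⟨by simp [wave], by simp [wave]⟩⟩

lemma isFirstOrder_I_mul : IsFirstOrder fun k => Complex.I * k :=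
  ⟨Complex.I, -Complex.I, Complex.norm_I, by rw [norm_neg, Complex.norm_I], fun n =>
    ⟨by simp, by simp⟩⟩

lemma IsFirstOrder.norm_eq {m : ℤ → ℂ} (hm : IsFirstOrder m) (k : ℤ) : ‖m k‖ = wave k := by
  obtain ⟨a, b, ha, hb, h⟩ := hm
  obtain ⟨n, rfl | rfl⟩ := k.eq_nat_or_neg
  · rw [(h n).1, norm_mul, ha, one_mul]
    simp [wave]
  · rw [(h n).2, norm_mul, hb, one_mul]
    simp [wave]

lemma character_nat (n : ℕ) (θ : ℝ) : character n θ = character 1 θ ^ n := by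
  rw [character, character, ← Complex.exp_nat_mul]
  congr 1
  push_cast
  ring

lemma character_neg_nat (n : ℕ) (θ : ℝ) : character (-n) θ = character (-1) θ ^ n := by
  rw [character, character, ← Complex.exp_nat_mul]
  congr 1
  push_cast
  ring

lemma character_neg_one (θ : ℝ) : character (-1) θ = (starRingEnd ℂ) (character 1 θ) := by
  rw [character, character, ← Complex.exp_conj]
  congr 1
  simp

/-- Each half of the series is ∑ n qⁿ = q/(1-q)² with q = exp(-t ± iθ), up to a unimodular factor.
The two denominators have equal modulus, and the resulting majorant is positive and proportional to
a Poisson kernel. -/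
lemma IsFirstOrder.hasSum {m : ℤ → ℂ} (hm : IsFirstOrder m) {t : ℝ} (ht : 0 < t) (θ : ℝ) :
    ∃ S : ℂ, HasSum (fun k => m k * Real.exp (-wave k * t) * character k θ) S ∧
      ‖S‖ ≤ 2 * Real.exp (-t) / ‖1 - Real.exp (-t) * character 1 θ‖ ^ 2 := by
  obtain ⟨a, b, ha, hb, h⟩ := hm
  have hr1 : Real.exp (-t) < 1 := Real.exp_lt_one_iff.mpr (by linarith)
  have hn : ∀ k, ‖(Real.exp (-t) : ℂ) * character k θ‖ = Real.exp (-t) := fun k => by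
    rw [norm_mul, norm_character, mul_one, Complex.norm_real, Real.norm_of_nonneg (Real.exp_pos _).le]
  have he : ∀ n : ℕ, Real.exp (-(n : ℝ) * t) = Real.exp (-t) ^ n := fun n => by
    rw [← Real.exp_nat_mul]
    congr 1
    ring
  have hw : ∀ n : ℕ, wave n = n := fun n => by simp [wave]
  have hw' : ∀ n : ℕ, wave (-n) = n := fun n => by simp [wave]
  have h1 := (hasSum_coe_mul_geometric_of_norm_lt_one ((hn 1).trans_lt hr1)).mul_left a
  have h2 := (hasSum_coe_mul_geometric_of_norm_lt_one ((hn (-1)).trans_lt hr1)).mul_left b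
  have h3 : HasSum (fun n : ℕ => m n * Real.exp (-wave n * t) * character n θ) _ :=
    h1.congr_fun fun n => by
      rw [(h n).1, hw, he, character_nat, mul_pow]
      push_cast
      ring
  have h4 : HasSum (fun n : ℕ => m (-n) * Real.exp (-wave (-n) * t) * character (-n) θ) _ :=
    h2.congr_fun fun n => by
      rw [(h n).2, hw', he, character_neg_nat, mul_pow]
      push_cast
      ring
  refine ⟨_, HasSum.of_nat_of_neg (f := fun k => m k * Real.exp (-wave k * t) * character k θ) h3 h4, ?_⟩
  have h0 : m 0 = 0 := by simpa using (h 0).1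
  have hc : ‖1 - (Real.exp (-t) : ℂ) * character (-1) θ‖ = ‖1 - (Real.exp (-t) : ℂ) * character 1 θ‖ := by
    rw [character_neg_one, ← Complex.norm_conj, map_sub, map_mul, map_one, Complex.conj_conj,
      Complex.conj_ofReal]
  rw [h0, zero_mul, zero_mul, sub_zero]
  refine (norm_add_le _ _).trans_eq ?_
  rw [norm_mul, norm_mul, ha, hb, norm_div, norm_div, hn, hn, norm_pow, norm_pow, hc]
  ring

/-- The mean of the Poisson kernel. -/
lemma integral_poisson {t : ℝ} (ht : 0 < t) (x : ℝ) :
    ∫ y in (0 : ℝ)..(2 * Real.pi), 2 * Real.exp (-t) / ‖1 - Real.exp (-t) * character 1 (x - y)‖ ^ 2 =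
      2 * Real.pi / Real.sinh t := by
  have hr1 : Real.exp (-t) < 1 := Real.exp_lt_one_iff.mpr (by linarith)
  have hr0 := Real.exp_pos (-t)
  have hn : ‖(Real.exp (-t) : ℂ) * character 1 x‖ = Real.exp (-t) := by
    rw [norm_mul, norm_character, mul_one, Complex.norm_real, Real.norm_of_nonneg hr0.le]
  -- Poisson's formula for the constant 1 at the point exp(-t + ix). The majorant is the Poisson
  -- kernel divided by (1 - exp(-2t))/(2 exp(-t)) = sinh t.
  have h := DiffContOnCl.circleAverage_poissonKernel_smul' (f := fun _ : ℂ => (1 : ℂ)) (c := 0) (R := 1)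
    (w := (Real.exp (-t) : ℂ) * character 1 x) diffContOnCl_const (by rwa [mem_ball_zero_iff, hn])
  have e : ∀ y : ℝ, ((‖circleMap 0 1 y - 0‖ ^ 2 - ‖(Real.exp (-t) : ℂ) * character 1 x - 0‖ ^ 2) /
      ‖(circleMap 0 1 y - 0) - ((Real.exp (-t) : ℂ) * character 1 x - 0)‖ ^ 2) • (1 : ℂ) =
      ((((1 - Real.exp (-t) ^ 2) / (2 * Real.exp (-t))) *
        (2 * Real.exp (-t) / ‖1 - Real.exp (-t) * character 1 (x - y)‖ ^ 2) : ℝ) : ℂ) := fun y => by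
    have h1 : circleMap 0 1 y = character 1 y := by
      simp only [circleMap, character]
      push_cast
      rw [zero_add, one_mul]
      congr 1
      ring
    have h2 : character 1 y - (Real.exp (-t) : ℂ) * character 1 x =
        character 1 y * (1 - Real.exp (-t) * character 1 (x - y)) := by
      have : character 1 x = character 1 y * character 1 (x - y) := by
        rw [← character_add]
        congr 1
        ring
      rw [this]
      ring
    rw [h1, sub_zero, sub_zero, h2, hn, norm_mul, norm_character, one_mul, Complex.real_smul, mul_one]
    congr 1
    field_simp
  rw [Real.circleAverage_def] at h
  simp only [e] at h
  rw [intervalIntegral.integral_ofReal, intervalIntegral.integral_const_mul, Complex.real_smul] at h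
  have h' : (2 * Real.pi)⁻¹ * ((1 - Real.exp (-t) ^ 2) / (2 * Real.exp (-t)) *
      ∫ y in (0 : ℝ)..(2 * Real.pi),
        2 * Real.exp (-t) / ‖1 - Real.exp (-t) * character 1 (x - y)‖ ^ 2) = 1 := by
    exact_mod_cast h
  have hs : (1 - Real.exp (-t) ^ 2) / (2 * Real.exp (-t)) = Real.sinh t := by
    have : Real.exp t * Real.exp (-t) = 1 := by rw [← Real.exp_add, add_neg_cancel, Real.exp_zero]
    rw [Real.sinh_eq, div_eq_div_iff (by positivity) two_ne_zero]
    linear_combination -2 * this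
  rw [hs] at h'
  have hpi := Real.pi_pos
  have hsp := Real.sinh_pos_iff.2 ht
  field_simp at h' ⊢
  linarith

/-- Fourier multipliers with an exponential cut-off act boundedly on bounded functions. -/
lemma IsFirstOrder.norm_tsum_le {m : ℤ → ℂ} (hm : IsFirstOrder m) {g : ℝ → ℂ} {M : ℝ}
    (hg : IntervalIntegrable g volume 0 (2 * Real.pi)) (hM : ∀ᵐ x ∂period, ‖g x‖ ≤ M) {t : ℝ}
    (ht : 0 < t) (x : ℝ) :
    ‖∑' k : ℤ, m k * Real.exp (-wave k * t) * ((1 / (2 * Real.pi) : ℂ) *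
      ∫ y in (0 : ℝ)..(2 * Real.pi), g y * Complex.exp (-(Complex.I * k * y))) * character k x‖ ≤
      M / Real.sinh t := by
  have hpi := Real.two_pi_pos
  have hg' : IntegrableOn g (Ioc 0 (2 * Real.pi)) :=
    (intervalIntegrable_iff_integrableOn_Ioc_of_le hpi.le).1 hg
  let f : ℤ → ℝ → ℂ := fun k y =>
    (1 / (2 * Real.pi) : ℂ) * g y * (m k * Real.exp (-wave k * t) * character k (x - y))
  have e : ∀ k : ℤ, m k * Real.exp (-wave k * t) * ((1 / (2 * Real.pi) : ℂ) *
      ∫ y in (0 : ℝ)..(2 * Real.pi), g y * Complex.exp (-(Complex.I * k * y))) * character k x =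
      ∫ y in Ioc 0 (2 * Real.pi), f k y := fun k => by
    rw [intervalIntegral.integral_of_le hpi.le]
    have : ∀ y : ℝ, f k y = (m k * Real.exp (-wave k * t) * (1 / (2 * Real.pi)) * character k x) *
        (g y * Complex.exp (-(Complex.I * k * y))) := fun y => by
      have h1 : character k (x - y) = character k x * Complex.exp (-(Complex.I * k * y)) := by
        rw [character, character, ← Complex.exp_add]
        congr 1
        push_cast
        ring
      simp only [f]
      rw [h1]
      ring
    simp only [this]
    rw [integral_const_mul]
    ring
  have hfn : ∀ k y, ‖f k y‖ = (1 / (2 * Real.pi)) * (wave k * Real.exp (-wave k * t)) * ‖g y‖ :=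
    fun k y => by
      simp only [f]
      rw [norm_mul, norm_mul, norm_mul, norm_mul, norm_character, hm.norm_eq, Complex.norm_real,
        Real.norm_of_nonneg (Real.exp_pos _).le, norm_div, norm_one, norm_mul, Complex.norm_ofNat,
        Complex.norm_real, Real.norm_of_nonneg Real.pi_pos.le]
      ring
  have hfi : ∀ k, IntegrableOn (f k) (Ioc 0 (2 * Real.pi)) := fun k => by
    refine Integrable.mul_bdd (c := ‖m k * Real.exp (-wave k * t)‖) (hg'.const_mul _) ?_ ?_
    · exact (Continuous.aestronglyMeasurable
        (continuous_const.mul ((continuous_character k).comp (continuous_const.sub continuous_id))))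
    · exact ae_of_all _ fun y => by rw [norm_mul, norm_character, mul_one]
  have hsum : Summable fun k => wave k * Real.exp (-wave k * t) := by
    obtain ⟨S, hS, -⟩ := isFirstOrder_wave.hasSum ht 0
    refine hS.summable.norm.congr fun k => ?_
    rw [norm_mul, norm_mul, norm_character, Complex.norm_real, Complex.norm_real,
      Real.norm_of_nonneg (Real.exp_pos _).le, Real.norm_of_nonneg (wave_nonneg k), mul_one]
  have hfs : Summable fun k => ∫ y in Ioc 0 (2 * Real.pi), ‖f k y‖ := by
    simp only [hfn, integral_const_mul]
    exact (hsum.mul_left _).mul_right _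
  rw [tsum_congr e, integral_tsum_of_summable_integral_norm hfi hfs,
    ← intervalIntegral.integral_of_le hpi.le]
  -- With the sum inside the integral the operator is a convolution, so the sup norm of g times the
  -- integral of the majorant bounds it.
  have hb : ∀ᵐ y, y ∈ Ioc 0 (2 * Real.pi) → ‖∑' k, f k y‖ ≤ (1 / (2 * Real.pi)) * M *
      (2 * Real.exp (-t) / ‖1 - Real.exp (-t) * character 1 (x - y)‖ ^ 2) := by
    rw [ae_restrict_iff' measurableSet_Ioc] at hM
    filter_upwards [hM] with y hy hyI
    obtain ⟨S, hS, hSb⟩ := hm.hasSum ht (x - y)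
    simp only [f]
    rw [tsum_mul_left, hS.tsum_eq, norm_mul, norm_mul, norm_div, norm_one, norm_mul, Complex.norm_ofNat,
        Complex.norm_real, Real.norm_of_nonneg Real.pi_pos.le]
    have hM0 : 0 ≤ M := (norm_nonneg _).trans (hy hyI)
    gcongr
    exact hy hyI
  have hr1 : Real.exp (-t) < 1 := Real.exp_lt_one_iff.mpr (by linarith)
  have hne : ∀ y, ‖1 - (Real.exp (-t) : ℂ) * character 1 (x - y)‖ ≠ 0 := fun y hy => by
    rw [norm_eq_zero, sub_eq_zero] at hy
    have := congrArg norm hy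
    rw [norm_one, norm_mul, norm_character, Complex.norm_real, mul_one,
      Real.norm_of_nonneg (Real.exp_pos _).le] at this
    linarith
  have hci : Continuous fun y => (1 / (2 * Real.pi)) * M *
      (2 * Real.exp (-t) / ‖1 - Real.exp (-t) * character 1 (x - y)‖ ^ 2) := by
    refine continuous_const.mul (continuous_const.div ?_ fun y => pow_ne_zero 2 (hne y))
    exact ((continuous_const.sub (continuous_const.mul
      ((continuous_character 1).comp (continuous_const.sub continuous_id)))).norm).pow 2
  refine (intervalIntegral.norm_integral_le_of_norm_le hpi.le hb
    (hci.intervalIntegrable _ _)).trans_eq ?_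
  rw [intervalIntegral.integral_const_mul, integral_poisson ht]
  field_simp

/-! ### Near and far field of the kernels -/

section Profile

/-- A majorant of `1 / sinh`, cut off at `δ`. -/
def logProfile (δ t : ℝ) : ℝ≥0∞ :=
  if t ≤ δ then ENNReal.ofReal (1 / δ)
  else if t ≤ 1 then ENNReal.ofReal (1 / t) else ENNReal.ofReal (4 * Real.exp (-t))

/-- Monotonicity of sinh and the lower bounds sinh δ ≥ δ, sinh u ≥ u, and sinh u ≥ exp(u)/4 for u >
1. Allowing a phase τ larger than u covers the reflected kernel, whose phase z + y exceeds |z - y|.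
-/
lemma inv_sinh_le_logProfile {δ u τ : ℝ} (hδ : 0 < δ) (hu : u ≤ τ) (hτ : δ ≤ τ) :
    ENNReal.ofReal (1 / Real.sinh τ) ≤ logProfile δ u := by
  have hle : ∀ a b : ℝ, 0 < a → a ≤ Real.sinh τ → 1 / a = b → ENNReal.ofReal (1 / Real.sinh τ) ≤
      ENNReal.ofReal b := fun a b ha h hb =>
    ENNReal.ofReal_le_ofReal (hb ▸ one_div_le_one_div_of_le ha h)
  unfold logProfile
  split_ifs with h1 h2
  · exact hle δ _ hδ ((Real.self_le_sinh_iff.2 hδ.le).trans (Real.sinh_le_sinh.2 hτ)) rfl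
  · have h0 : 0 < u := hδ.trans (not_le.1 h1)
    exact hle u _ h0 ((Real.self_le_sinh_iff.2 h0.le).trans (Real.sinh_le_sinh.2 hu)) rfl
  · have h3 : 1 < u := not_le.1 h2
    refine hle (Real.exp u / 4) _ (by positivity) (le_trans ?_ (Real.sinh_le_sinh.2 hu)) ?_
    · have e1 := Real.add_one_le_exp u
      have e2 : Real.exp (-u) ≤ 1 := Real.exp_le_one_iff.2 (by linarith)
      rw [Real.sinh_eq]
      linarith
    · rw [Real.exp_neg]
      field_simp

lemma lintegral_comp_abs (H : ℝ → ℝ≥0∞) : ∫⁻ t, H |t| = 2 * ∫⁻ t in Ioi 0, H t := by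
  have h := (Measure.measurePreserving_neg (volume : Measure ℝ)).setLIntegral_comp_preimage_emb
    (MeasurableEquiv.neg ℝ).measurableEmbedding (fun t => H |t|) (Ioi 0)
  simp only [abs_neg, neg_preimage, neg_Ioi, neg_zero] at h
  have h1 : ∫⁻ t in Ioi 0, H |t| = ∫⁻ t in Ioi 0, H t :=
    setLIntegral_congr_fun measurableSet_Ioi fun t ht => by rw [abs_of_pos ht]
  rw [← lintegral_add_compl _ measurableSet_Ioi (A := Ioi 0), compl_Ioi,
    setLIntegral_congr Iio_ae_eq_Iic.symm, h, h1, two_mul]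

/-- On t > 0 the plateau contributes 1, the range from δ to 1 the logarithm, the tail at most 4;
evenness doubles the sum. -/
lemma lintegral_logProfile_le {δ : ℝ} (hδ : 0 < δ) (hδ1 : δ ≤ 1) (z : ℝ) :
    ∫⁻ y, logProfile δ |z - y| ≤ ENNReal.ofReal (2 * (5 + Real.log (1 / δ))) := by
  have hlog : 0 ≤ Real.log (1 / δ) := Real.log_nonneg (by rwa [le_div_iff₀ hδ, one_mul])
  rw [lintegral_sub_left_eq_self (fun t => logProfile δ |t|) z, lintegral_comp_abs,
    ENNReal.ofReal_mul zero_le_two, ENNReal.ofReal_ofNat]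
  refine mul_le_mul_right ?_ _
  have hu : Ioi (0 : ℝ) ⊆ (Ioc 0 δ ∪ Ioc δ 1) ∪ Ioi 1 := fun t ht => by
    by_cases h1 : t ≤ δ
    · exact Or.inl (Or.inl ⟨ht, h1⟩)
    · by_cases h2 : t ≤ 1
      · exact Or.inl (Or.inr ⟨not_le.1 h1, h2⟩)
      · exact Or.inr (not_le.1 h2)
  refine (lintegral_mono_set hu).trans ((lintegral_union_le _ _ _).trans
    ((add_le_add_left (lintegral_union_le _ _ _) _).trans ?_))
  have e1 : ∫⁻ t in Ioc 0 δ, logProfile δ t = 1 := by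
    rw [setLIntegral_congr_fun measurableSet_Ioc (g := fun _ => ENNReal.ofReal (1 / δ))
      fun t ht => by
        simp only [logProfile]
        rw [if_pos ht.2], setLIntegral_const, Real.volume_Ioc, ← ENNReal.ofReal_mul (by positivity),
      sub_zero, one_div_mul_cancel hδ.ne', ENNReal.ofReal_one]
  have e2 : ∫⁻ t in Ioc δ 1, logProfile δ t = ENNReal.ofReal (Real.log (1 / δ)) := by
    rw [setLIntegral_congr_fun measurableSet_Ioc (g := fun t => ENNReal.ofReal (1 / t))
      fun t ht => by
        simp only [logProfile]
        rw [if_neg (not_le.2 ht.1), if_pos ht.2]]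
    have hi : IntervalIntegrable (fun t : ℝ => 1 / t) volume δ 1 :=
      intervalIntegral.intervalIntegrable_one_div (fun t ht => by
        rw [uIcc_of_le hδ1] at ht
        exact (hδ.trans_le ht.1).ne') continuousOn_id
    rw [← integral_one_div_of_pos hδ one_pos, intervalIntegral.integral_of_le hδ1,
      ofReal_integral_eq_lintegral_ofReal ((intervalIntegrable_iff_integrableOn_Ioc_of_le hδ1).1 hi)]
    exact (ae_restrict_mem measurableSet_Ioc).mono fun t ht => one_div_nonneg.2 (hδ.trans ht.1).le
  have e3 : ∫⁻ t in Ioi 1, logProfile δ t ≤ ENNReal.ofReal 4 := by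
    rw [setLIntegral_congr_fun measurableSet_Ioi (g := fun t => ENNReal.ofReal (4 * Real.exp (-t)))
      fun t ht => by
        simp only [logProfile]
        rw [if_neg (not_le.2 (hδ1.trans_lt ht)), if_neg (not_le.2 ht)]]
    have hi : IntegrableOn (fun t : ℝ => 4 * Real.exp (-t)) (Ioi 1) :=
      (integrableOn_exp_neg_Ioi 1).const_mul 4
    rw [← ofReal_integral_eq_lintegral_ofReal hi (ae_of_all _ fun t => by positivity),
      integral_const_mul, integral_exp_neg_Ioi]
    refine ENNReal.ofReal_le_ofReal ?_
    linarith [Real.exp_le_one_iff.2 (by norm_num : (-1 : ℝ) ≤ 0)]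
  rw [e1, e2]
  refine (add_le_add_right e3 _).trans_eq ?_
  rw [← ENNReal.ofReal_one, ← ENNReal.ofReal_add zero_le_one hlog,
    ← ENNReal.ofReal_add (by positivity) (by norm_num)]
  congr 1
  ring

end Profile

/-- Amplitudes `s` and phases `τ` of exponential kernels `s exp (-κ τ)`. -/
structure IsExpProfile (s τ : ℝ → ℝ → ℝ) : Prop where
  measurable_amp : Measurable (Function.uncurry s)
  measurable_phase : Measurable (Function.uncurry τ)
  amp_le : ∀ z y, |s z y| ≤ 1
  le_phase : ∀ z y, 0 ≤ z → 0 < y → |z - y| ≤ τ z y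

/-- The kernel with a given amplitude and phase. -/
def expKernel (s τ : ℝ → ℝ → ℝ) (κ z y : ℝ) : ℝ := s z y * Real.exp (-κ * τ z y)

variable {s τ : ℝ → ℝ → ℝ}

lemma IsExpProfile.isExpKernel (h : IsExpProfile s τ) {κ : ℝ} (hκ : 0 ≤ κ) :
    IsExpKernel κ (expKernel s τ κ) where
  measurable := h.measurable_amp.mul (Real.measurable_exp.comp (h.measurable_phase.const_mul (-κ)))
  bound z y hz hy := by
    rw [expKernel, abs_mul, Real.abs_exp]
    refine (mul_le_of_le_one_left (Real.exp_pos _).le (h.amp_le z y)).trans (Real.exp_le_exp.2 ?_)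
    nlinarith [h.le_phase z y hz hy]

/-- Truncating the amplitude by the size of the phase stays in the class, which allows one kernel to
be split at τ = δ into two of the same kind. -/
lemma IsExpProfile.indicator (h : IsExpProfile s τ) {S : Set ℝ} (hS : MeasurableSet S) :
    IsExpProfile (fun z y => S.indicator (fun _ => s z y) (τ z y)) τ where
  measurable_amp := by
    have : Function.uncurry (fun z y => S.indicator (fun _ => s z y) (τ z y)) =
        (Function.uncurry τ ⁻¹' S).indicator (Function.uncurry s) := by
      ext ⟨z, y⟩
      rfl
    rw [this]
    exact h.measurable_amp.indicator (h.measurable_phase hS)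
  measurable_phase := h.measurable_phase
  amp_le z y := by
    by_cases hy : τ z y ∈ S
    · rw [indicator_of_mem hy]
      exact h.amp_le z y
    · rw [indicator_of_notMem hy]
      simp
  le_phase := h.le_phase

lemma isExpProfile_of_le_abs {s : ℝ → ℝ → ℝ} (hs : Measurable (Function.uncurry s))
    (h : ∀ z y, |s z y| ≤ 1) : IsExpProfile s fun z y => |z - y| where
  measurable_amp := hs
  measurable_phase := Continuous.measurable (by unfold Function.uncurry; fun_prop)
  amp_le := h
  le_phase _ _ _ _ := le_rfl

lemma isExpProfile_U : IsExpProfile (fun _ _ => 1) fun z y => |z - y| :=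
  isExpProfile_of_le_abs measurable_const fun _ _ => by simp

lemma isExpProfile_V : IsExpProfile (fun z y => if y < z then 1 else -1) fun z y => |z - y| :=
  isExpProfile_of_le_abs (Measurable.ite (measurableSet_lt measurable_snd measurable_fst)
    measurable_const measurable_const) fun z y => by split_ifs <;> simp

lemma isExpProfile_W : IsExpProfile (fun _ _ => 1) fun z y => |z + y| where
  measurable_amp := measurable_const
  measurable_phase := Continuous.measurable (by unfold Function.uncurry; fun_prop)
  amp_le _ _ := by simp
  le_phase z y hz hy := by
    rw [abs_of_pos (by linarith : 0 < z + y)]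
    exact abs_le.2 ⟨by linarith, by linarith⟩

lemma kerU_eq (κ : ℝ) : kerU κ = expKernel (fun _ _ => 1) (fun z y => |z - y|) κ := by
  ext z y
  simp [kerU, expKernel]

lemma kerV_eq (κ : ℝ) :
    kerV κ = expKernel (fun z y => if y < z then 1 else -1) (fun z y => |z - y|) κ := by
  ext z y
  simp only [kerV, expKernel]
  split_ifs <;> ring

lemma kerW_eq (κ : ℝ) : kerW κ = expKernel (fun _ _ => 1) (fun z y => |z + y|) κ := by
  ext z y
  simp [kerW, expKernel]

section LogBound

variable {m : ℤ → ℂ} {f : ℝ × ℝ → ℂ} {M δ z : ℝ}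

lemma wave_mul_inv_sqrt_le (k : ℤ) {a : ℝ} (ha : 0 ≤ a) : wave k * ((√(wave k))⁻¹ * a) ≤ wave k * a := by
  rcases one_le_wave_or k with rfl | h
  · simp [wave]
  · have h1 : (√(wave k))⁻¹ ≤ 1 := inv_le_one_of_one_le₀ (Real.one_le_sqrt.2 h)
    have := wave_nonneg k
    gcongr
    exact mul_le_of_le_one_left ha h1

lemma IsFirstOrder.norm_mul_kernelOp_le (hm : IsFirstOrder m) (hs : IsExpProfile s τ)
    (hf : MemLp f 2 cellMeasure) (hz : 0 ≤ z) (k : ℤ) :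
    ‖m k * kernelOp (expKernel s τ (wave k)) (coeff f k) z‖ ≤ wave k * l2HL (coeff f k) := by
  rw [norm_mul, hm.norm_eq]
  rcases one_le_wave_or k with rfl | h
  · simp [wave]
  · refine le_trans ?_ (wave_mul_inv_sqrt_le k (l2HL_nonneg _))
    exact mul_le_mul_of_nonneg_left ((hs.isExpKernel (wave_nonneg k)).norm_kernelOp_le (by linarith)
      (memLp_coeff hf k) hz) (wave_nonneg k)

/-- The contribution of the far field. -/
lemma IsFirstOrder.norm_tsum_far_le (hm : IsFirstOrder m) (hs : IsExpProfile s τ)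
    (hf : IsPeriodicL2 f) (hM : ∀ᵐ p ∂cellMeasure, ‖f p‖ ≤ M) (hM0 : 0 ≤ M)
    (hsum : Summable fun k => wave k * l2HL (coeff f k)) (hz : 0 ≤ z) (hδ : 0 < δ) (hδ1 : δ ≤ 1)
    (hfar : ∀ y, s z y ≠ 0 → δ ≤ τ z y) (x : ℝ) :
    ‖∑' k : ℤ, m k * kernelOp (expKernel s τ (wave k)) (coeff f k) z * character k x‖ ≤
      M * (2 * (5 + Real.log (1 / δ))) := by
  have hlog : 0 ≤ Real.log (1 / δ) := Real.log_nonneg (by rwa [le_div_iff₀ hδ, one_mul])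
  let F : ℤ → ℝ → ℂ := fun k y =>
    m k * character k x * ((expKernel s τ (wave k) z y : ℂ) * coeff f k y)
  have e : ∀ k : ℤ, m k * kernelOp (expKernel s τ (wave k)) (coeff f k) z * character k x =
      ∫ y in Ioi 0, F k y := fun k => by
    simp only [F]
    rw [integral_const_mul, kernelOp]
    ring
  have h0 : m 0 = 0 := by simpa [wave] using hm.norm_eq 0
  have hFi : ∀ k, IntegrableOn (F k) (Ioi 0) := fun k => by
    rcases one_le_wave_or k with rfl | h
    · simp [F, h0]
    · exact ((hs.isExpKernel (wave_nonneg k)).integrable (by linarith) (memLp_coeff hf.memLp k) hz).const_mul _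
  have hFs : Summable fun k => ∫ y in Ioi 0, ‖F k y‖ := by
    refine Summable.of_nonneg_of_le (fun k => integral_nonneg fun y => norm_nonneg _) (fun k => ?_) hsum
    rcases one_le_wave_or k with rfl | h
    · simp [F, h0, wave]
    · have e1 : ∀ y, ‖F k y‖ = wave k * ‖(expKernel s τ (wave k) z y : ℂ) * coeff f k y‖ := fun y => by
        simp only [F]
        rw [norm_mul, norm_mul (m k), norm_character, mul_one, hm.norm_eq]
      simp only [e1]
      rw [integral_const_mul]
      refine le_trans ?_ (wave_mul_inv_sqrt_le k (l2HL_nonneg _))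
      exact mul_le_mul_of_nonneg_left ((hs.isExpKernel (wave_nonneg k)).norm_lintegral_le (by linarith)
        (memLp_coeff hf.memLp k) hz) (wave_nonneg k)
  rw [tsum_congr e, integral_tsum_of_summable_integral_norm hFi hFs]
  have hslice : ∀ᵐ y ∂halfLine, ∀ᵐ x' ∂period, ‖f (x', y)‖ ≤ M := by
    rw [cellMeasure_eq] at hM
    have := (Measure.measurePreserving_swap (μ := halfLine) (ν := period)).quasiMeasurePreserving.ae hM
    exact Measure.ae_ae_of_ae_prod this
  -- For fixed y the sum over k is a first order multiplier damped by exp(-|k|τ), applied to the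
  -- slice of f at height y; its sup norm is at most M/sinh τ.
  have hb : ∀ᵐ y ∂halfLine, ‖∑' k, F k y‖ₑ ≤ ENNReal.ofReal M * logProfile δ |z - y| := by
    filter_upwards [hslice, ae_slice_intervalIntegrable hf.memLp, ae_halfLine_pos] with y h1 h2 hy
    have e1 : ∀ k, F k y = (s z y : ℂ) * (m k * Real.exp (-wave k * τ z y) * coeff f k y * character k x) :=
      fun k => by
        simp only [F, expKernel]
        push_cast
        ring
    rw [tsum_congr e1, tsum_mul_left]
    by_cases hs0 : s z y = 0
    · simp [hs0]
    · have hτ := hfar y hs0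
      have h3 := hm.norm_tsum_le h2 h1 (hδ.trans_le hτ) x
      refine le_trans ?_ (mul_le_mul_right (inv_sinh_le_logProfile hδ (hs.le_phase z y hz hy) hτ) _)
      rw [← ENNReal.ofReal_mul hM0, ← ofReal_norm, norm_mul, Complex.norm_real, mul_one_div]
      refine ENNReal.ofReal_le_ofReal (le_trans ?_ h3)
      exact mul_le_of_le_one_left (norm_nonneg _) (hs.amp_le z y)
  have h4 : ‖∫ y in Ioi 0, ∑' k, F k y‖ₑ ≤ ENNReal.ofReal (M * (2 * (5 + Real.log (1 / δ)))) := by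
    refine (enorm_integral_le_lintegral_enorm _).trans ((lintegral_mono_ae hb).trans ?_)
    rw [lintegral_const_mul' _ _ ENNReal.ofReal_ne_top, ENNReal.ofReal_mul hM0]
    refine mul_le_mul_right ((setLIntegral_le_lintegral _ _).trans ?_) _
    exact lintegral_logProfile_le hδ hδ1 z
  rw [← ofReal_norm] at h4
  exact (ENNReal.ofReal_le_ofReal_iff (by positivity)).1 h4

/-- The contribution of the near field. -/
lemma IsExpProfile.norm_kernelOp_near_le (hs : IsExpProfile s τ) {κ : ℝ} (hκ : 0 ≤ κ) {g : ℝ → ℂ}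
    (hg : MemLp g 2 halfLine) (hz : 0 ≤ z) (hδ : 0 < δ) (hnear : ∀ y, s z y ≠ 0 → τ z y ≤ δ) :
    ‖kernelOp (expKernel s τ κ) g z‖ ≤ √(2 * δ) * l2HL g := by
  -- A phase of at most δ confines y to an interval of length 2δ around z, where the kernel is
  -- bounded by 1; Cauchy–Schwarz then gives √(2δ).
  have h1 : ‖kernelOp (expKernel s τ κ) g z‖ₑ ≤
      ∫⁻ y in Ioi 0, (Icc (z - δ) (z + δ)).indicator (fun _ => (1 : ℝ≥0∞)) y * ‖g y‖ₑ := by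
    refine (enorm_integral_le_lintegral_enorm _).trans (setLIntegral_mono' measurableSet_Ioi fun y hy => ?_)
    by_cases hs0 : s z y = 0
    · simp [expKernel, hs0]
    · have h2 := abs_le.1 ((hs.le_phase z y hz hy).trans (hnear y hs0))
      rw [indicator_of_mem (show y ∈ Icc (z - δ) (z + δ) from ⟨by linarith, by linarith⟩), one_mul]
      refine ((hs.isExpKernel hκ).enorm_le hz hy).trans (mul_le_of_le_one_left' ?_)
      rw [← ENNReal.ofReal_one]
      exact ENNReal.ofReal_le_ofReal (Real.exp_le_one_iff.2
        (by nlinarith [abs_nonneg (z - y)]))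
  have h2 : ‖kernelOp (expKernel s τ κ) g z‖ₑ ^ 2 ≤
      ENNReal.ofReal (2 * δ) * ENNReal.ofReal (l2HL g ^ 2) := by
    refine (pow_le_pow_left' h1 2).trans ((sq_lintegral_mul_le
      (measurable_const.indicator measurableSet_Icc).aemeasurable hg.1.enorm).trans ?_)
    rw [ofReal_l2HL_sq hg]
    refine mul_le_mul_left ?_ _
    have e1 : ∀ y, (Icc (z - δ) (z + δ)).indicator (fun _ => (1 : ℝ≥0∞)) y ^ 2 =
        (Icc (z - δ) (z + δ)).indicator (fun _ => (1 : ℝ≥0∞)) y := fun y => by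
      by_cases hy : y ∈ Icc (z - δ) (z + δ) <;> simp [hy]
    simp only [e1]
    refine (setLIntegral_le_lintegral _ _).trans_eq ?_
    rw [lintegral_indicator_const measurableSet_Icc, one_mul, Real.volume_Icc]
    congr 1
    ring
  rw [enorm_sq_eq, ← ENNReal.ofReal_mul (by positivity),
    ENNReal.ofReal_le_ofReal_iff (by positivity)] at h2
  refine abs_le_of_sq_le_sq' ?_ (mul_nonneg (Real.sqrt_nonneg _) (l2HL_nonneg _)) |>.2
  rwa [mul_pow, Real.sq_sqrt (by positivity)]

/-- Logarithmic bound for exponential kernels combined with first order multipliers. -/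
lemma IsFirstOrder.norm_tsum_kernelOp_le (hm : IsFirstOrder m) (hs : IsExpProfile s τ)
    (hf : IsPeriodicL2 f) (hM : ∀ᵐ p ∂cellMeasure, ‖f p‖ ≤ M) (hM0 : 0 ≤ M)
    (hsum : Summable fun k => wave k * l2HL (coeff f k)) (hz : 0 ≤ z) (hδ : 0 < δ) (hδ1 : δ ≤ 1) (x : ℝ) :
    ‖∑' k : ℤ, m k * kernelOp (expKernel s τ (wave k)) (coeff f k) z * character k x‖ ≤
      √(2 * δ) * (∑' k, wave k * l2HL (coeff f k)) + M * (2 * (5 + Real.log (1 / δ))) := by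
  -- The kernel is split into phases below δ, summed absolutely, and phases at least δ, where the
  -- cancellation between modes is used.
  have hn := hs.indicator (measurableSet_Iio (a := δ))
  have hf' := hs.indicator (measurableSet_Ici (a := δ))
  set sn := fun z y => (Iio δ).indicator (fun _ => s z y) (τ z y) with hsn
  set sf := fun z y => (Ici δ).indicator (fun _ => s z y) (τ z y) with hsf
  have e0 : ∀ z y, s z y = sn z y + sf z y := fun z y => by
    simp only [hsn, hsf]
    by_cases h : τ z y < δ
    · rw [indicator_of_mem (mem_Iio.2 h), indicator_of_notMem (notMem_Ici.2 h), add_zero]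
    · rw [indicator_of_notMem (notMem_Iio.2 (not_lt.1 h)), indicator_of_mem (mem_Ici.2 (not_lt.1 h)),
        zero_add]
  have h0 : m 0 = 0 := by simpa [wave] using hm.norm_eq 0
  have e : ∀ k : ℤ, m k * kernelOp (expKernel s τ (wave k)) (coeff f k) z * character k x =
      m k * kernelOp (expKernel sn τ (wave k)) (coeff f k) z * character k x +
      m k * kernelOp (expKernel sf τ (wave k)) (coeff f k) z * character k x := fun k => by
    rcases one_le_wave_or k with rfl | h
    · simp [h0]
    · rw [← add_mul, ← mul_add]
      congr 2
      unfold kernelOp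
      rw [← integral_add ((hn.isExpKernel (wave_nonneg k)).integrable (by linarith)
        (memLp_coeff hf.memLp k) hz) ((hf'.isExpKernel (wave_nonneg k)).integrable (by linarith)
        (memLp_coeff hf.memLp k) hz)]
      congr 1
      ext y
      simp only [expKernel]
      rw [e0]
      push_cast
      ring
  have hsummable : ∀ {s' : ℝ → ℝ → ℝ}, IsExpProfile s' τ → Summable fun k =>
      m k * kernelOp (expKernel s' τ (wave k)) (coeff f k) z * character k x := fun hs' => by
    refine Summable.of_norm_bounded hsum fun k => ?_
    rw [norm_mul, norm_character, mul_one]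
    exact hm.norm_mul_kernelOp_le hs' hf.memLp hz k
  rw [tsum_congr e, (hsummable hn).tsum_add (hsummable hf')]
  refine (norm_add_le _ _).trans (add_le_add ?_ ?_)
  · rw [← tsum_mul_left]
    refine tsum_of_norm_bounded (hsum.mul_left _).hasSum fun k => ?_
    rw [norm_mul, norm_character, mul_one, norm_mul, hm.norm_eq, mul_left_comm]
    refine mul_le_mul_of_nonneg_left (hn.norm_kernelOp_near_le (wave_nonneg k) (memLp_coeff hf.memLp k) hz hδ
      fun y hy => ?_) (wave_nonneg k)
    by_contra h
    exact hy (indicator_of_notMem (notMem_Iio.2 (not_le.1 h).le) _)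
  · refine hm.norm_tsum_far_le hf' hf hM hM0 hsum hz hδ hδ1 (fun y hy => ?_) x
    by_contra h
    exact hy (indicator_of_notMem (notMem_Ici.2 (not_le.1 h)) _)

end LogBound

/-! ### Mode bounds from Sobolev norms -/

section Families

variable {s : ℝ} {f : ℝ × ℝ → ℂ}

/-- A function of finite Sobolev norm has periodic weak derivatives bounded by the norm. -/
lemma exists_isPeriodicFamily (hf : IsPeriodic f) (hN : hsNorm s f ≠ ⊤) :
    ∃ P, IsPeriodicFamily ⌊s⌋₊ f P ∧
      ∀ β : ℕ × ℕ, β.1 + β.2 ≤ ⌊s⌋₊ → ∫⁻ p in cell, ‖P β p‖ₑ ^ 2 ≤ hsNorm s f ^ 2 := by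
  obtain ⟨P, hP⟩ : ∃ P, IsPeriodicFamily ⌊s⌋₊ f P := by
    by_contra! h
    exact hN (top_le_iff.1 (le_hsNorm hf fun P hP => absurd hP (h P)))
  refine ⟨P, hP, fun β hβ => ?_⟩
  have h1 : (∫⁻ p in cell, ‖P β p‖ₑ ^ 2) ^ (1 / 2 : ℝ) ≤ hsNorm s f := by
    refine le_hsNorm hf fun Q hQ _ => ENNReal.rpow_le_rpow ?_ (by norm_num)
    refine le_trans (le_of_eq (lintegral_congr_ae ?_)) (lintegral_le_hsSum Q hβ)
    filter_upwards [ae_cell_of_ae_upperHalf ((hP.weak β hβ).unique (hQ.weak β hβ))] with p hp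
    rw [hp]
  calc ∫⁻ p in cell, ‖P β p‖ₑ ^ 2 = ((∫⁻ p in cell, ‖P β p‖ₑ ^ 2) ^ (1 / 2 : ℝ)) ^ (2 : ℝ) := by
        rw [← ENNReal.rpow_mul]
        norm_num
    _ ≤ hsNorm s f ^ (2 : ℝ) := ENNReal.rpow_le_rpow h1 (by norm_num)
    _ = hsNorm s f ^ 2 := by norm_num

lemma summable_of_tsum_ofReal_le {ι : Type*} {g : ι → ℝ} {C : ℝ} (hg : ∀ i, 0 ≤ g i) (hC : 0 ≤ C)
    (h : ∑' i, ENNReal.ofReal (g i) ≤ ENNReal.ofReal C) : Summable g ∧ ∑' i, g i ≤ C := by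
  have hs : Summable g := by
    have := ENNReal.summable_toReal (ne_top_of_le_ne_top ENNReal.ofReal_ne_top h)
    simpa only [ENNReal.toReal_ofReal (hg _)] using this
  refine ⟨hs, ?_⟩
  rw [← ENNReal.ofReal_tsum_of_nonneg hg hs] at h
  exact (ENNReal.ofReal_le_ofReal_iff hC).1 h

/-- The modes of `f` satisfy the bounds of a function with `n` horizontal derivatives in `L²`. -/
structure HasModeBound (n : ℕ) (V : ℝ) (f : ℝ × ℝ → ℂ) : Prop where
  nonneg : 0 ≤ V
  isPeriodicL2 : IsPeriodicL2 f
  summable : Summable fun k => (wave k ^ n * l2HL (coeff f k)) ^ 2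
  tsum_le : ∑' k, (wave k ^ n * l2HL (coeff f k)) ^ 2 ≤ V ^ 2

lemma tsum_l2HL_sq_le {g : ℝ × ℝ → ℂ} {V : ℝ} (hg : MemLp g 2 cellMeasure)
    (h : ∫⁻ p in cell, ‖g p‖ₑ ^ 2 ≤ ENNReal.ofReal (V ^ 2)) :
    (Summable fun k => l2HL (coeff g k) ^ 2) ∧ ∑' k, l2HL (coeff g k) ^ 2 ≤ V ^ 2 := by
  refine summable_of_tsum_ofReal_le (fun k => sq_nonneg _) (sq_nonneg _) ?_
  simp only [ofReal_l2HL_sq (memLp_coeff hg _)]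
  rw [parseval hg] at h
  refine le_trans (le_mul_of_one_le_left' ?_) h
  rw [← ENNReal.ofReal_one]
  exact ENNReal.ofReal_le_ofReal (by linarith [Real.pi_gt_three])

lemma l2HL_const_mul (c : ℂ) (g : ℝ → ℂ) : l2HL (fun z => c * g z) = ‖c‖ * l2HL g := by
  have : (fun z => c * g z) = c • g := rfl
  rw [l2HL, l2HL, this, eLpNorm_const_smul, ENNReal.toReal_mul, toReal_enorm]

lemma l2HL_congr {g h : ℝ → ℂ} (e : g =ᵐ[halfLine] h) : l2HL g = l2HL h := by
  rw [l2HL, l2HL, eLpNorm_congr_ae e]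

/-- A horizontal derivative of order n multiplies the modes by (ik)^n, so Parseval for that
derivative is the claimed weighted sum. -/
lemma hasModeBound (hf : IsPeriodic f) (hN : hsNorm s f ≠ ⊤) {n : ℕ} (hn : n ≤ ⌊s⌋₊) {V : ℝ}
    (hV : (hsNorm s f).toReal ≤ V) : HasModeBound n V f := by
  obtain ⟨P, hP, hb⟩ := exists_isPeriodicFamily hf hN
  have hV0 : 0 ≤ V := ENNReal.toReal_nonneg.trans hV
  have hL : hsNorm s f ^ 2 ≤ ENNReal.ofReal (V ^ 2) := by
    rw [ENNReal.ofReal_pow hV0]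
    exact pow_le_pow_left' (ENNReal.le_ofReal_iff_toReal_le hN hV0 |>.2 hV) 2
  have e : ∀ k, l2HL (coeff (P (n, 0)) k) = wave k ^ n * l2HL (coeff f k) := fun k => by
    rw [l2HL_congr (hP.coeff_x k n hn), l2HL_const_mul, norm_pow, norm_I_mul]
  have h1 := tsum_l2HL_sq_le (hP.mem (n, 0) hn).memLp ((hb (n, 0) hn).trans hL)
  simp only [e] at h1
  exact ⟨hV0, ⟨hf, (memLp_congr_ae hP.ae_eq_zero).1 (hP.mem (0, 0) (Nat.zero_le _)).memLp⟩, h1.1, h1.2⟩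

end Families

/-! ### Uniformly summable mode families and the logarithmic bound -/

section Bounded

/-- The modes `c` are summable, uniformly in the height, and their Fourier series is bounded by `B`. -/
def IsModeBounded (c : ℤ → ℝ → ℂ) (B : ℝ) : Prop :=
  (∃ b : ℤ → ℝ, Summable b ∧ ∀ k z, 0 < z → ‖c k z‖ ≤ b k) ∧
    ∀ x z, 0 < z → ‖∑' k, c k z * character k x‖ ≤ B

variable {c d : ℤ → ℝ → ℂ} {A B : ℝ}

namespace IsModeBounded

lemma summable (h : IsModeBounded c B) (x : ℝ) {z : ℝ} (hz : 0 < z) :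
    Summable fun k => c k z * character k x := by
  obtain ⟨⟨b, hb, hc⟩, -⟩ := h
  refine Summable.of_norm_bounded hb fun k => ?_
  rw [norm_mul, norm_character, mul_one]
  exact hc k z hz

lemma of_summable {b : ℤ → ℝ} (hb : Summable b) (hc : ∀ k z, 0 < z → ‖c k z‖ ≤ b k)
    (hB : ∑' k, b k ≤ B) : IsModeBounded c B := by
  refine ⟨⟨b, hb, hc⟩, fun x z hz => (tsum_of_norm_bounded hb.hasSum fun k => ?_).trans hB⟩
  rw [norm_mul, norm_character, mul_one]
  exact hc k z hz

lemma add (hc : IsModeBounded c A) (hd : IsModeBounded d B) :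
    IsModeBounded (fun k z => c k z + d k z) (A + B) := by
  obtain ⟨a, ha, hca⟩ := hc.1
  obtain ⟨b, hb, hdb⟩ := hd.1
  refine ⟨⟨_, ha.add hb, fun k z hz => norm_add_le_of_le (hca k z hz) (hdb k z hz)⟩, fun x z hz => ?_⟩
  simp only [add_mul]
  rw [(hc.summable x hz).tsum_add (hd.summable x hz)]
  exact norm_add_le_of_le (hc.2 x z hz) (hd.2 x z hz)

lemma const_mul (hc : IsModeBounded c A) (w : ℂ) : IsModeBounded (fun k z => w * c k z) (‖w‖ * A) := by
  obtain ⟨a, ha, hca⟩ := hc.1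
  refine ⟨⟨_, ha.mul_left ‖w‖, fun k z hz => ?_⟩, fun x z hz => ?_⟩
  · rw [norm_mul]
    exact mul_le_mul_of_nonneg_left (hca k z hz) (norm_nonneg w)
  · simp only [mul_assoc]
    rw [tsum_mul_left, norm_mul]
    exact mul_le_mul_of_nonneg_left (hc.2 x z hz) (norm_nonneg w)

lemma sub (hc : IsModeBounded c A) (hd : IsModeBounded d B) :
    IsModeBounded (fun k z => c k z - d k z) (A + B) := by
  simpa [sub_eq_add_neg] using hc.add (hd.const_mul (-1))

lemma ae_norm_le (hc : IsModeBounded c B) {f : ℝ × ℝ → ℂ} (hf : IsPeriodicL2 f)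
    (h : ∀ k, coeff f k =ᵐ[halfLine] c k) : ∀ᵐ p ∂cellMeasure, ‖f p‖ ≤ B := by
  obtain ⟨b, hb, hcb⟩ := hc.1
  filter_upwards [ae_eq_tsum hf h hcb hb, ae_cell_pos] with p hp hz
  rw [hp]
  exact hc.2 p.1 p.2 hz

end IsModeBounded

end Bounded

section LogBound

variable {f : ℝ × ℝ → ℂ} {V M : ℝ}

lemma summable_wave_neg_two : Summable fun k => wave k ^ (-2 : ℝ) := summable_wave_rpow one_lt_two

lemma wave_rpow_neg_two (k : ℤ) : wave k ^ (-2 : ℝ) = (wave k ^ 2)⁻¹ := by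
  rw [Real.rpow_neg (wave_nonneg k)]
  norm_num

/-- Writing κ‖f_k‖ as κ⁻¹ · κ²‖f_k‖, the arithmetic-geometric inequality with weight V + 1 keeps the
bound linear in V + 1. -/
lemma HasModeBound.wave_summable (h : HasModeBound 2 V f) :
    (Summable fun k => wave k * l2HL (coeff f k)) ∧
      ∑' k, wave k * l2HL (coeff f k) ≤ ((∑' k, wave k ^ (-2 : ℝ)) + 1) * (V + 1) := by
  have hV := h.nonneg
  have h1 : ∀ k, wave k * l2HL (coeff f k) ≤
      (V + 1) * wave k ^ (-2 : ℝ) + (V + 1)⁻¹ * (wave k ^ 2 * l2HL (coeff f k)) ^ 2 := fun k => by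
    rw [wave_rpow_neg_two]
    rcases one_le_wave_or k with rfl | hk
    · simp [wave]
    · have hw : 0 < wave k := by linarith
      have hl := l2HL_nonneg (coeff f k)
      set w := wave k
      set l := l2HL (coeff f k)
      have e : (V + 1) * (w ^ 2)⁻¹ + (V + 1)⁻¹ * (w ^ 2 * l) ^ 2 - w * l * 2 =
          (V + 1) * (w⁻¹ - (V + 1)⁻¹ * (w ^ 2 * l)) ^ 2 := by
        field_simp
        ring
      have : 0 ≤ (V + 1) * (w⁻¹ - (V + 1)⁻¹ * (w ^ 2 * l)) ^ 2 := by positivity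
      have : 0 ≤ w * l := by positivity
      linarith
  have hs := (summable_wave_neg_two.mul_left (V + 1)).add (h.summable.mul_left (V + 1)⁻¹)
  have hs1 : Summable fun k => wave k * l2HL (coeff f k) :=
    Summable.of_nonneg_of_le (fun k => mul_nonneg (wave_nonneg k) (l2HL_nonneg _)) h1 hs
  refine ⟨hs1, (hs1.tsum_le_tsum h1 hs).trans ?_⟩
  rw [(summable_wave_neg_two.mul_left (V + 1)).tsum_add (h.summable.mul_left (V + 1)⁻¹),
    tsum_mul_left, tsum_mul_left, add_mul (∑' k, wave k ^ (-2 : ℝ)), one_mul,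
    mul_comm (V + 1) (∑' k, wave k ^ (-2 : ℝ))]
  gcongr
  rw [inv_mul_le_iff₀ (by linarith)]
  nlinarith [h.tsum_le]

lemma half_le_log_two_add (hV : 0 ≤ V) : 1 / 2 ≤ Real.log (2 + V) := by
  have := Real.log_le_log two_pos (show (2 : ℝ) ≤ 2 + V by linarith)
  linarith [Real.log_two_gt_d9]

/-- The constant in the logarithmic bound. -/
def logConst : ℝ := 2 * ((∑' k, wave k ^ (-2 : ℝ)) + 1) + 24

lemma logConst_ge : 24 ≤ logConst := by
  have : 0 ≤ ∑' k, wave k ^ (-2 : ℝ) := tsum_nonneg fun k => Real.rpow_nonneg (wave_nonneg k) _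
  unfold logConst
  linarith

lemma IsFirstOrder.isModeBounded {m : ℤ → ℂ} {s τ : ℝ → ℝ → ℝ} (hm : IsFirstOrder m)
    (hs : IsExpProfile s τ) (hf : HasModeBound 2 V f) (hM : ∀ᵐ p ∂cellMeasure, ‖f p‖ ≤ M) (hM0 : 0 ≤ M) :
    IsModeBounded (fun k z => m k * kernelOp (expKernel s τ (wave k)) (coeff f k) z)
      (logConst * (1 + M * Real.log (2 + V))) := by
  have hV := hf.nonneg
  obtain ⟨hs1, hs2⟩ := hf.wave_summable
  refine ⟨⟨_, hs1, fun k z hz => hm.norm_mul_kernelOp_le hs hf.isPeriodicL2.memLp hz.le k⟩,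
    fun x z hz => ?_⟩
  -- The splitting height is δ = (V + 1)⁻²: then √(2δ) absorbs the factor V + 1 of the near field,
  -- and log(1/δ) is only 2 log(V + 1).
  have hδ : 0 < ((V + 1) ^ 2)⁻¹ := by positivity
  refine (hm.norm_tsum_kernelOp_le hs hf.isPeriodicL2 hM hM0 hs1 hz.le hδ
    (inv_le_one_of_one_le₀ (by nlinarith)) x).trans ?_
  have h1 : √(2 * ((V + 1) ^ 2)⁻¹) ≤ 2 * (V + 1)⁻¹ := by
    refine Real.sqrt_le_iff.2 ⟨by positivity, ?_⟩
    rw [mul_pow, inv_pow]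
    gcongr
    norm_num
  have h2 : Real.log (1 / ((V + 1) ^ 2)⁻¹) ≤ 2 * Real.log (2 + V) := by
    rw [one_div, inv_inv, Real.log_pow]
    push_cast
    exact mul_le_mul_of_nonneg_left (Real.log_le_log (by linarith) (by linarith)) two_pos.le
  have h3 := half_le_log_two_add hV
  set c := ∑' k, wave k ^ (-2 : ℝ) with hc
  have hc0 : 0 ≤ c := tsum_nonneg fun k => Real.rpow_nonneg (wave_nonneg k) _
  have h4 : √(2 * ((V + 1) ^ 2)⁻¹) * (∑' k, wave k * l2HL (coeff f k)) ≤ 2 * (c + 1) := by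
    calc _ ≤ 2 * (V + 1)⁻¹ * ((c + 1) * (V + 1)) := by
          gcongr
          exact tsum_nonneg fun k => mul_nonneg (wave_nonneg k) (l2HL_nonneg _)
      _ = 2 * (c + 1) := by field_simp
  -- With L = log(2 + V) ≥ 1/2 one has 2(5 + 2L) ≤ 24L, which explains the 24 in the constant.
  have h5 : M * (2 * (5 + Real.log (1 / ((V + 1) ^ 2)⁻¹))) ≤ M * (24 * Real.log (2 + V)) := by
    exact mul_le_mul_of_nonneg_left (by linarith) hM0
  have h6 : 0 ≤ M * Real.log (2 + V) := mul_nonneg hM0 (by linarith)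
  unfold logConst
  rw [← hc]
  nlinarith

end LogBound

section SupNorm

lemma supNorm_le {f : ℝ × ℝ → ℂ} {B : ℝ} (h : ∀ᵐ p ∂cellMeasure, ‖f p‖ ≤ B) :
    supNorm f ≤ ENNReal.ofReal B := by
  rw [supNorm, eLpNorm_exponent_top]
  exact eLpNormEssSup_le_of_ae_bound h

lemma ae_norm_le_supNorm {f : ℝ × ℝ → ℂ} (h : supNorm f ≠ ⊤) :
    ∀ᵐ p ∂cellMeasure, ‖f p‖ ≤ (supNorm f).toReal := by
  rw [supNorm, eLpNorm_exponent_top] at h ⊢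
  filter_upwards [ae_le_eLpNormEssSup (f := f) (μ := cellMeasure)] with p hp
  rw [← toReal_enorm]
  exact ENNReal.toReal_mono h hp

lemma derivSupNorm_le {m : ℕ} {Ψ : ℝ × ℝ → ℂ} {B : ℝ} (D : ℕ × ℕ → ℝ × ℝ → ℂ)
    (hD : ∀ β : ℕ × ℕ, β.1 + β.2 = m → IsWeakDeriv β Ψ (D β) ∧ ∀ᵐ p ∂cellMeasure, ‖D β p‖ ≤ B) :
    derivSupNorm m Ψ ≤ ENNReal.ofReal B :=
  (iInf₂_le D fun β hβ => (hD β hβ).1).trans (iSup₂_le fun β hβ =>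
    supNorm_le (hD β (Finset.HasAntidiagonal.mem_antidiagonal.1 hβ)).2)

/-- When N is infinite the right side is infinite because L > 0, so only finite norms need an
estimate. -/
lemma le_mul_one_add_of_ne_top {B N : ℝ≥0∞} {C L : ℝ} (hC : 0 < C) (hL : 0 < L)
    (h : N ≠ ⊤ → B ≤ ENNReal.ofReal (C * (1 + N.toReal * L))) :
    B ≤ (C.toNNReal : ℝ≥0∞) * (1 + N * ENNReal.ofReal L) := by
  by_cases hN : N = ⊤
  · rw [hN, ENNReal.top_mul (by simpa using hL), add_top, ENNReal.mul_top (by simpa using hC)]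
    exact le_top
  · refine (h hN).trans_eq ?_
    rw [ENNReal.ofReal_mul hC.le, ENNReal.ofReal_add zero_le_one (by positivity),
      ENNReal.ofReal_mul ENNReal.toReal_nonneg, ENNReal.ofReal_toReal hN, ENNReal.ofReal_one]
    rfl

end SupNorm

section Kernels

variable {f : ℝ × ℝ → ℂ} {V M : ℝ} {m : ℤ → ℂ}

/-- The bound for a first order multiplier combined with an exponential kernel. -/
def logBound (V M : ℝ) : ℝ := logConst * (1 + M * Real.log (2 + V))

lemma IsFirstOrder.isModeBounded_U (hm : IsFirstOrder m) (hf : HasModeBound 2 V f)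
    (hM : ∀ᵐ p ∂cellMeasure, ‖f p‖ ≤ M) (hM0 : 0 ≤ M) :
    IsModeBounded (fun k z => m k * kernelOp (kerU (wave k)) (coeff f k) z) (logBound V M) := by
  simp only [kerU_eq]
  exact hm.isModeBounded isExpProfile_U hf hM hM0

lemma IsFirstOrder.isModeBounded_V (hm : IsFirstOrder m) (hf : HasModeBound 2 V f)
    (hM : ∀ᵐ p ∂cellMeasure, ‖f p‖ ≤ M) (hM0 : 0 ≤ M) :
    IsModeBounded (fun k z => m k * kernelOp (kerV (wave k)) (coeff f k) z) (logBound V M) := by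
  simp only [kerV_eq]
  exact hm.isModeBounded isExpProfile_V hf hM hM0

lemma IsFirstOrder.isModeBounded_W (hm : IsFirstOrder m) (hf : HasModeBound 2 V f)
    (hM : ∀ᵐ p ∂cellMeasure, ‖f p‖ ≤ M) (hM0 : 0 ≤ M) :
    IsModeBounded (fun k z => m k * kernelOp (kerW (wave k)) (coeff f k) z) (logBound V M) := by
  simp only [kerW_eq]
  exact hm.isModeBounded isExpProfile_W hf hM hM0

lemma opA_eq (hf : MemLp f 2 cellMeasure) (hm : IsFirstOrder m) (k : ℤ) {z : ℝ} (hz : 0 ≤ z) :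
    m k * opA k (coeff f k) z = (1 / 2 : ℂ) *
      (m k * kernelOp (kerU (wave k)) (coeff f k) z - m k * kernelOp (kerW (wave k)) (coeff f k) z) := by
  by_cases hk : k = 0
  · subst hk
    have : m 0 = 0 := by simpa [wave] using hm.norm_eq 0
    simp [this]
  · rw [opA_of_ne hk, kernelOp_kerA (wave_pos hk) (memLp_coeff hf k) hz]
    ring

lemma opB_eq (hf : MemLp f 2 cellMeasure) (hm : IsFirstOrder m) (k : ℤ) {z : ℝ} (hz : 0 ≤ z) :
    m k * opB k (coeff f k) z = (1 / 2 : ℂ) *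
      (m k * kernelOp (kerV (wave k)) (coeff f k) z - m k * kernelOp (kerW (wave k)) (coeff f k) z) := by
  by_cases hk : k = 0
  · subst hk
    have : m 0 = 0 := by simpa [wave] using hm.norm_eq 0
    simp [this]
  · rw [opB_of_ne hk, kernelOp_kerB (wave_pos hk) (memLp_coeff hf k) hz]
    ring

end Kernels

/-- As log(2 + V) is bounded below, local terms controlled by the sup norm alone are absorbed in the
logarithmic bound. -/
lemma le_logBound {M V : ℝ} (hM : 0 ≤ M) (hV : 0 ≤ V) :
    M ≤ logBound V M := by
  have h1 := half_le_log_two_add hV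
  have h2 := logConst_ge
  have h3 : M / 2 ≤ M * Real.log (2 + V) := by nlinarith
  unfold logBound
  nlinarith

lemma logBound_nonneg {M V : ℝ} (hM : 0 ≤ M) (hV : 0 ≤ V) : 0 ≤ logBound V M :=
  hM.trans (le_logBound hM hV)

/-- Logarithmic bound of the second derivatives. -/
lemma exists_derivSupNorm_two_le : ∃ C : NNReal, ∀ F : ℝ × ℝ → ℂ, IsSource F → hsNorm 2 F ≠ ⊤ →
    derivSupNorm 2 (potential F) ≤
      C * (1 + supNorm F * ENNReal.ofReal (Real.log (2 + (hsNorm 2 F).toReal))) := by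
  have hC := logConst_ge
  refine ⟨(2 * logConst).toNNReal, fun F hF hN => ?_⟩
  set V := (hsNorm 2 F).toReal with hV
  have hV0 : 0 ≤ V := ENNReal.toReal_nonneg
  have hL := half_le_log_two_add hV0
  refine le_mul_one_add_of_ne_top (by linarith) (by linarith) fun ht => ?_
  set M := (supNorm F).toReal with hM
  have hM0 : 0 ≤ M := ENNReal.toReal_nonneg
  have hFM : ∀ᵐ p ∂cellMeasure, ‖F p‖ ≤ M := ae_norm_le_supNorm ht
  have hb : HasModeBound 2 V F := hasModeBound hF.periodic hN (by norm_num) le_rfl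
  obtain ⟨X, Z, T, S, h⟩ := exists_derivFamily hF.memLp
  have hTb : ∀ᵐ p ∂cellMeasure, ‖T p‖ ≤ logBound V M := by
    have hm := isFirstOrder_wave
    filter_upwards [(((hm.isModeBounded_U hb hFM hM0).sub (hm.isModeBounded_W hb hFM hM0)).const_mul
      (1 / 2)).ae_norm_le h.xx fun k => (h.coeff_xx k).trans
        (ae_halfLine_pos.mono fun z hz => opA_eq hF.memLp hm k hz.le)] with p hp
    refine hp.trans_eq ?_
    norm_num
    ring
  have hSb : ∀ᵐ p ∂cellMeasure, ‖S p‖ ≤ logBound V M := by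
    have hm := isFirstOrder_I_mul
    filter_upwards [(((hm.isModeBounded_V hb hFM hM0).sub (hm.isModeBounded_W hb hFM hM0)).const_mul
      (1 / 2)).ae_norm_le h.xz fun k => (h.coeff_xz k).trans
        (ae_halfLine_pos.mono fun z hz => opB_eq hF.memLp hm k hz.le)] with p hp
    refine hp.trans_eq ?_
    norm_num
    ring
  have h2 : 2 * logConst * (1 + M * Real.log (2 + V)) = 2 * logBound V M := by
    unfold logBound
    ring
  rw [h2]
  have hMB := le_logBound hM0 hV0
  have hB0 := logBound_nonneg hM0 hV0
  -- The pure vertical derivative is F - T by the equation; the extra local term F accounts for the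
  -- factor 2.
  refine derivSupNorm_le (fun β => if β = (2, 0) then T else if β = (1, 1) then S else
    fun p => F p - T p) fun β hβ => ?_
  rcases β with ⟨a, b⟩
  simp only at hβ
  rcases a with _ | _ | a
  · obtain rfl : b = 2 := by omega
    refine ⟨(h.weak_z hF.memLp).comp (h.weak_zz hF), ?_⟩
    filter_upwards [hTb, hFM] with p h3 h4
    exact (norm_sub_le _ _).trans (by linarith)
  · obtain rfl : b = 1 := by omega
    refine ⟨(h.weak_z hF.memLp).comp h.weak_xz, ?_⟩
    filter_upwards [hSb] with p h3
    exact h3.trans (by linarith)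
  · obtain ⟨rfl, rfl⟩ : a = 0 ∧ b = 0 := by omega
    refine ⟨(h.weak_x hF.memLp).comp h.weak_xx, ?_⟩
    filter_upwards [hTb] with p h3
    exact h3.trans (by linarith)

/-! ### The gradient bound by splitting frequencies -/

section GradientBound

variable {F : ℝ × ℝ → ℂ} {A V : ℝ}

lemma sum_inv_wave_le (K : ℕ) :
    ∑ k ∈ Finset.Icc (-(K : ℤ)) K, (wave k)⁻¹ ≤ 2 * (1 + Real.log K) := by
  have h : ∀ K : ℕ, ∑ k ∈ Finset.Icc (-(K : ℤ)) K, (wave k)⁻¹ = 2 * (harmonic K : ℝ) := fun K => by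
    induction K with
    | zero => simp [wave]
    | succ n ih =>
      have e : Finset.Icc (-((n + 1 : ℕ) : ℤ)) (n + 1 : ℕ) =
          insert ((n : ℤ) + 1) (insert (-((n : ℤ) + 1)) (Finset.Icc (-(n : ℤ)) n)) := by
        ext j
        simp only [Finset.mem_Icc, Finset.mem_insert]
        omega
      rw [e, Finset.sum_insert (by simp only [Finset.mem_Icc, Finset.mem_insert]; omega),
        Finset.sum_insert (by simp only [Finset.mem_Icc]; omega), ih, harmonic_succ]
      have hw : wave ((n : ℤ) + 1) = n + 1 := by
        rw [wave]
        push_cast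
        exact abs_of_nonneg (by positivity)
      have hw' : wave (-((n : ℤ) + 1)) = n + 1 := by
        rw [← hw, wave, wave]
        push_cast
        exact abs_neg _
      rw [hw, hw']
      push_cast
      ring
  rw [h]
  linarith [harmonic_le_one_add_log K]

/-- Low frequencies are summed by Cauchy–Schwarz against ∑ 1/|k|, a harmonic sum giving the square
root of the logarithm. High frequencies use the H¹ bound and contribute a constant. -/
lemma tsum_inv_sqrt_wave_le (hA : 0 ≤ A) (hs : Summable fun k => l2HL (coeff F k) ^ 2)
    (hl : ∑' k, l2HL (coeff F k) ^ 2 ≤ A ^ 2) (hV : HasModeBound 1 V F) :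
    (Summable fun k => (√(wave k))⁻¹ * l2HL (coeff F k)) ∧
      ∑' k, (√(wave k))⁻¹ * l2HL (coeff F k) ≤
        (3 + ∑' k, wave k ^ (-2 : ℝ)) * (1 + A * √(Real.log (2 + V))) := by
  have hV0 := hV.nonneg
  have hL := half_le_log_two_add hV0
  set L := Real.log (2 + V) with hLdef
  set N := V + 1 with hN
  -- Beyond K one has κ ≥ N², so κ^{-1/2}‖F_k‖ ≤ ½(κ⁻² + N⁻²(κ‖F_k‖)²). Both terms have sums bounded
  -- independently of V, while log K stays below 2 log(2 + V).
  set K := ⌈N ^ 2⌉₊ with hK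
  set S := Finset.Icc (-(K : ℤ)) K with hS
  set b := fun k : ℤ => (√(wave k))⁻¹ * l2HL (coeff F k) with hb
  have hb0 : ∀ k, 0 ≤ b k := fun k => mul_nonneg (inv_nonneg.2 (Real.sqrt_nonneg _)) (l2HL_nonneg _)
  set t := fun k : ℤ => (1 / 2) * (wave k ^ (-2 : ℝ) + (N ^ 2)⁻¹ * (wave k ^ 1 * l2HL (coeff F k)) ^ 2)
    with ht
  have ht0 : ∀ k, 0 ≤ t k := fun k => by
    have := Real.rpow_nonneg (wave_nonneg k) (-2)
    positivity
  have hts : HasSum t ((1 / 2) * (∑' k, wave k ^ (-2 : ℝ) +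
      (N ^ 2)⁻¹ * ∑' k, (wave k ^ 1 * l2HL (coeff F k)) ^ 2)) :=
    (summable_wave_neg_two.hasSum.add (hV.summable.hasSum.mul_left _)).mul_left _
  have htail : ∀ k ∉ S, b k ≤ t k := fun k hk => by
    have hw : N ^ 2 ≤ wave k := by
      have h1 : K < k.natAbs := by
        simp only [hS, Finset.mem_Icc, not_and_or, not_le] at hk
        omega
      have h2 : wave k = k.natAbs := by rw [wave, Nat.cast_natAbs, Int.cast_abs]
      rw [h2]
      exact (Nat.le_ceil _).trans (by exact_mod_cast h1.le)
    have hw0 : 0 < wave k := lt_of_lt_of_le (by positivity) hw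
    simp only [hb, ht, wave_rpow_neg_two, pow_one]
    have hl0 := l2HL_nonneg (coeff F k)
    set l := l2HL (coeff F k)
    set r := √(wave k) with hr
    have hr0 : 0 < r := Real.sqrt_pos.2 hw0
    have e : wave k = r ^ 2 := (Real.sq_sqrt hw0.le).symm
    rw [e] at hw ⊢
    have hNpos : 0 < N := by positivity
    have h3 : 2 * (r⁻¹ * l) ≤ N ^ 2 * (r ^ 3)⁻¹ ^ 2 + (N ^ 2)⁻¹ * (r ^ 2 * l) ^ 2 := by
      have e1 : N ^ 2 * (r ^ 3)⁻¹ ^ 2 + (N ^ 2)⁻¹ * (r ^ 2 * l) ^ 2 - 2 * (r⁻¹ * l) =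
          (N * (r ^ 3)⁻¹ - N⁻¹ * (r ^ 2 * l)) ^ 2 := by
        field_simp
        ring
      nlinarith [sq_nonneg (N * (r ^ 3)⁻¹ - N⁻¹ * (r ^ 2 * l))]
    have h4 : N ^ 2 * (r ^ 3)⁻¹ ^ 2 ≤ ((r ^ 2) ^ 2)⁻¹ := by
      calc N ^ 2 * (r ^ 3)⁻¹ ^ 2 ≤ r ^ 2 * (r ^ 3)⁻¹ ^ 2 := by gcongr
        _ = ((r ^ 2) ^ 2)⁻¹ := by field_simp
    linarith
  have hle : ∀ k, b k ≤ (S : Set ℤ).indicator b k + t k := fun k => by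
    by_cases hk : k ∈ S
    · rw [indicator_of_mem (show k ∈ (S : Set ℤ) from hk)]
      linarith [ht0 k]
    · rw [indicator_of_notMem (show k ∉ (S : Set ℤ) from hk), zero_add]
      exact htail k hk
  have hSs : HasSum ((S : Set ℤ).indicator b) (∑ k ∈ S, b k) := by
    have h1 : HasSum ((S : Set ℤ).indicator b) (∑ k ∈ S, (S : Set ℤ).indicator b k) :=
      hasSum_sum_of_ne_finset_zero fun k hk => indicator_of_notMem (show k ∉ (S : Set ℤ) from hk) _
    rwa [Finset.sum_congr rfl fun k hk => indicator_of_mem (show k ∈ (S : Set ℤ) from hk) b] at h1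
  have hsum := hSs.add hts
  have hbs : Summable b := Summable.of_nonneg_of_le hb0 hle hsum.summable
  refine ⟨hbs, (hbs.tsum_le_tsum hle hsum.summable).trans ?_⟩
  rw [hsum.tsum_eq]
  set c := ∑' k, wave k ^ (-2 : ℝ) with hc
  have hc0 : 0 ≤ c := tsum_nonneg fun k => Real.rpow_nonneg (wave_nonneg k) _
  have h1 : (N ^ 2)⁻¹ * ∑' k, (wave k ^ 1 * l2HL (coeff F k)) ^ 2 ≤ 1 := by
    rw [inv_mul_le_iff₀ (by positivity), mul_one]
    refine hV.tsum_le.trans ?_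
    gcongr
    linarith
  have h2 : ∑ k ∈ S, b k ≤ 3 * (A * √L) := by
    refine abs_le_of_sq_le_sq' ?_ (by positivity) |>.2
    -- The term k = 0 vanishes since the inverse of zero is zero; the rest is at most 2(1 + 2L) ≤ 8L
    -- because L ≥ 1/2. The 8 is then rounded up to the square 9.
    have h3 : ∑ k ∈ S, (√(wave k))⁻¹ ^ 2 ≤ 8 * L := by
      have e : ∀ k, (√(wave k))⁻¹ ^ 2 = (wave k)⁻¹ := fun k => by
        rw [inv_pow, Real.sq_sqrt (wave_nonneg k)]
      simp only [e]
      refine (sum_inv_wave_le K).trans ?_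
      have h4 : Real.log K ≤ 2 * L := by
        rw [hLdef, ← Nat.cast_ofNat, ← Real.log_pow]
        refine Real.log_le_log ?_ ?_
        · exact_mod_cast Nat.ceil_pos.2 (by positivity)
        · refine (Nat.ceil_lt_add_one (by positivity)).le.trans ?_
          push_cast
          nlinarith
      linarith
    have h5 : ∑ k ∈ S, l2HL (coeff F k) ^ 2 ≤ A ^ 2 :=
      (hs.sum_le_tsum S fun k _ => sq_nonneg _).trans hl
    calc (∑ k ∈ S, b k) ^ 2 ≤ (∑ k ∈ S, (√(wave k))⁻¹ ^ 2) * ∑ k ∈ S, l2HL (coeff F k) ^ 2 :=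
          Finset.sum_mul_sq_le_sq_mul_sq _ _ _
      _ ≤ 8 * L * A ^ 2 := by gcongr
      _ ≤ 9 * L * A ^ 2 := by gcongr; norm_num
      _ = (3 * (A * √L)) ^ 2 := by
        rw [mul_pow, mul_pow, Real.sq_sqrt (by linarith)]
        ring
  have h6 : 0 ≤ A * √L := by positivity
  nlinarith

/-- Logarithmic bound of the gradient. -/
lemma exists_derivSupNorm_one_le : ∃ C : NNReal, ∀ F : ℝ × ℝ → ℂ, IsSource F → hsNorm 1 F ≠ ⊤ →
    derivSupNorm 1 (potential F) ≤
      C * (1 + l2Norm F * ENNReal.ofReal (√(Real.log (2 + (hsNorm 1 F).toReal)))) := by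
  have hC : 0 < 3 + ∑' k, wave k ^ (-2 : ℝ) :=
    add_pos_of_pos_of_nonneg three_pos (tsum_nonneg fun k => Real.rpow_nonneg (wave_nonneg k) _)
  refine ⟨(3 + ∑' k, wave k ^ (-2 : ℝ)).toNNReal, fun F hF hN => ?_⟩
  set V := (hsNorm 1 F).toReal with hV
  have hV0 : 0 ≤ V := ENNReal.toReal_nonneg
  have hL := half_le_log_two_add hV0
  refine le_mul_one_add_of_ne_top hC (Real.sqrt_pos.2 (by linarith)) fun ht => ?_
  set A := (l2Norm F).toReal with hA
  have hA0 : 0 ≤ A := ENNReal.toReal_nonneg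
  have hb : HasModeBound 1 V F := hasModeBound hF.periodic hN (by norm_num) le_rfl
  have hl := tsum_l2HL_sq_le (V := A) hF.memLp (by
    rw [ENNReal.ofReal_pow hA0, hA, ENNReal.ofReal_toReal ht, l2Norm, eLpNorm_two_sq]
    rfl)
  obtain ⟨hs1, hs2⟩ := tsum_inv_sqrt_wave_le hA0 hl.1 hl.2 hb
  obtain ⟨X, Z, T, S, h⟩ := exists_derivFamily hF.memLp
  -- The factor k/κ has modulus at most 1, so the horizontal derivative obeys the same absolute
  -- bound as the vertical one.
  have hX := (IsModeBounded.of_summable hs1 (c := fun k z =>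
    -(Complex.I * k * ((wave k)⁻¹ : ℝ)) * opA k (coeff F k) z) (fun k z hz => by
      rw [norm_mul]
      refine (mul_le_of_le_one_left (norm_nonneg _) ?_).trans (norm_opA_le (memLp_coeff hF.memLp k) hz.le)
      rw [norm_neg, norm_mul, norm_I_mul, Complex.norm_real, Real.norm_of_nonneg
        (inv_nonneg.2 (wave_nonneg k))]
      exact mul_inv_le_one) hs2).ae_norm_le h.x h.coeff_x
  have hZ := (IsModeBounded.of_summable hs1 (c := fun k z => opB k (coeff F k) z) (fun k z hz =>
    norm_opB_le (memLp_coeff hF.memLp k) hz.le) hs2).ae_norm_le h.z h.coeff_z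
  refine derivSupNorm_le (fun β => if β = (1, 0) then X else Z) fun β hβ => ?_
  rcases β with ⟨_ | a, b⟩
  · obtain rfl : b = 1 := by simp only at hβ; omega
    exact ⟨h.weak_z hF.memLp, hZ⟩
  · obtain ⟨rfl, rfl⟩ : a = 0 ∧ b = 0 := by simp only at hβ; omega
    exact ⟨h.weak_x hF.memLp, hX⟩

end GradientBound

/-! ### Sources in divergence form -/

section Divergence

variable {a g : ℝ → ℂ} {k : ℤ}

lemma kernelOp_mul_add {κ : ℝ} {K : ℝ → ℝ → ℝ} (hK : IsExpKernel κ K) (hκ : 0 < κ)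
    (ha : MemLp a 2 halfLine) (hg : MemLp g 2 halfLine) (w : ℂ) {z : ℝ} (hz : 0 ≤ z) :
    kernelOp K (fun y => w * a y + g y) z = w * kernelOp K a z + kernelOp K g z := by
  unfold kernelOp
  rw [← integral_const_mul, ← integral_add ((hK.integrable hκ ha hz).const_mul w) (hK.integrable hκ hg hz)]
  refine integral_congr_ae (ae_of_all _ fun y => ?_)
  simp only
  ring

variable {b : ℝ → ℂ}

/-- The horizontal derivative of the potential of a divergence, mode by mode. -/
lemma opA_divergence (ha : MemLp a 2 halfLine) (hb : MemLp b 2 halfLine) (hg : MemLp g 2 halfLine)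
    (h : IsWeakDerivHL b g) : ∀ᵐ z ∂halfLine,
    -(Complex.I * k * ((wave k)⁻¹ : ℝ)) * opA k (fun y => Complex.I * k * a y + g y) z =
      (1 / 2 : ℂ) * (((wave k : ℂ) * kernelOp (kerU (wave k)) a z - wave k * kernelOp (kerW (wave k)) a z) +
        (Complex.I * k * kernelOp (kerV (wave k)) b z + Complex.I * k * kernelOp (kerW (wave k)) b z)) := by
  by_cases hk : k = 0
  · subst hk
    exact ae_of_all _ fun z => by simp [wave]
  have hκ := wave_pos hk
  have hag : MemLp (fun y => Complex.I * k * a y + g y) 2 halfLine := (ha.const_mul _).add hg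
  have hw : (Complex.I * k) ^ 2 = -(wave k : ℂ) ^ 2 := by
    rw [mul_pow, Complex.I_sq, ← Complex.ofReal_pow, wave_sq]
    push_cast
    ring
  have hw0 : (wave k : ℂ) ≠ 0 := Complex.ofReal_ne_zero.2 hκ.ne'
  filter_upwards [(kernelOp_weakDeriv hκ h hb hg).1, ae_halfLine_pos] with z h1 hz
  rw [opA_of_ne hk, kernelOp_kerA hκ hag hz.le, kernelOp_mul_add (isExpKernel_kerU _) hκ ha hg _ hz.le,
    kernelOp_mul_add (isExpKernel_kerW hκ) hκ ha hg _ hz.le]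
  push_cast
  generalize kernelOp (kerU (wave k)) a z = u at *
  generalize kernelOp (kerW (wave k)) a z = w at *
  generalize kernelOp (kerU (wave k)) g z = u' at *
  generalize kernelOp (kerW (wave k)) g z = w' at *
  generalize kernelOp (kerV (wave k)) b z = v at *
  generalize kernelOp (kerW (wave k)) b z = w'' at *
  -- After the integration by parts the prefactor -ik/κ acts on ik(U - W)a and on -κ(V + W)b. By
  -- (ik)² = -κ² this leaves κ(U - W)a and ik(V + W)b, first order multipliers of the components.
  have e : Complex.I * k * u + u' - (Complex.I * k * w + w') =
      Complex.I * k * (u - w) - wave k * (v + w'') := by linear_combination h1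
  rw [e]
  field_simp
  linear_combination (-(u - w)) * hw

/-- The vertical derivative of the potential of a divergence, mode by mode. -/
lemma opB_divergence (ha : MemLp a 2 halfLine) (hb : MemLp b 2 halfLine) (hg : MemLp g 2 halfLine)
    (h : IsWeakDerivHL b g) : ∀ᵐ z ∂halfLine,
    opB k (fun y => Complex.I * k * a y + g y) z - b z + (if k ∈ ({0} : Finset ℤ) then b z else 0) =
      (1 / 2 : ℂ) * ((Complex.I * k * kernelOp (kerV (wave k)) a z - Complex.I * k * kernelOp (kerW (wave k)) a z) -
        ((wave k : ℂ) * kernelOp (kerU (wave k)) b z + wave k * kernelOp (kerW (wave k)) b z)) := by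
  -- For k ≠ 0 the jump of the odd kernel produces the local term b, which is subtracted. For k = 0
  -- there is no such term, and b is added back so that both sides vanish.
  by_cases hk : k = 0
  · subst hk
    exact ae_of_all _ fun z => by simp [wave, opB_zero]
  have hκ := wave_pos hk
  have hag : MemLp (fun y => Complex.I * k * a y + g y) 2 halfLine := (ha.const_mul _).add hg
  filter_upwards [(kernelOp_weakDeriv hκ h hb hg).2, ae_halfLine_pos] with z h1 hz
  rw [opB_of_ne hk, kernelOp_kerB hκ hag hz.le, kernelOp_mul_add (isExpKernel_kerV _) hκ ha hg _ hz.le,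
    kernelOp_mul_add (isExpKernel_kerW hκ) hκ ha hg _ hz.le, if_neg (by simpa using hk)]
  linear_combination (1 / 2 : ℂ) * h1

variable {f : ℝ × ℝ → ℂ} {M : ℝ}

/-- The zero mode is the horizontal average, which cannot exceed the sup norm. It is needed because
the local term in the vertical derivative is H₂ without its mean. -/
lemma ae_norm_trigPoly_zero_le (hf : ∀ᵐ p ∂cellMeasure, ‖f p‖ ≤ M) :
    ∀ᵐ p ∂cellMeasure, ‖trigPoly {0} (coeff f) p‖ ≤ M := by
  have h1 : ∀ᵐ p ∂(halfLine.prod period), ‖f p.swap‖ ≤ M := by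
    rw [cellMeasure_eq] at hf
    exact (Measure.measurePreserving_swap (μ := halfLine) (ν := period)).quasiMeasurePreserving.ae hf
  have h2 : ∀ᵐ y ∂halfLine, ‖coeff f 0 y‖ ≤ M := by
    filter_upwards [Measure.ae_ae_of_ae_prod h1] with y hy
    rw [period, ae_restrict_iff' measurableSet_Ioc] at hy
    have h3 : ‖∫ x in (0 : ℝ)..(2 * Real.pi), f (x, y) * Complex.exp (-(Complex.I * (0 : ℤ) * x))‖ ≤
        M * |2 * Real.pi - 0| := by
      refine intervalIntegral.norm_integral_le_of_norm_le_const_ae ?_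
      rw [uIoc_of_le Real.two_pi_pos.le]
      filter_upwards [hy] with x hx hx1
      simpa using hx hx1
    rw [sub_zero, abs_of_pos Real.two_pi_pos] at h3
    unfold coeff
    rw [norm_mul]
    have e : ‖(1 / (2 * Real.pi) : ℂ)‖ = (2 * Real.pi)⁻¹ := by
      rw [show (1 / (2 * Real.pi) : ℂ) = (((2 * Real.pi)⁻¹ : ℝ) : ℂ) by push_cast; ring, Complex.norm_real,
        Real.norm_of_nonneg (by positivity)]
    rw [e, inv_mul_le_iff₀ Real.two_pi_pos, mul_comm _ M]
    exact h3
  rw [cellMeasure_eq]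
  filter_upwards [Measure.quasiMeasurePreserving_snd.ae h2] with p hp
  simpa [trigPoly, norm_character] using hp

lemma hsNorm_le_hsNormPair_left (s : ℝ) (f g : ℝ × ℝ → ℂ) : hsNorm s f ≤ hsNormPair s f g := by
  calc hsNorm s f = (hsNorm s f ^ 2) ^ (1 / 2 : ℝ) := by
        rw [← ENNReal.rpow_natCast, ← ENNReal.rpow_mul]
        norm_num
    _ ≤ hsNormPair s f g := ENNReal.rpow_le_rpow le_self_add (by norm_num)

lemma hsNorm_le_hsNormPair_right (s : ℝ) (f g : ℝ × ℝ → ℂ) : hsNorm s g ≤ hsNormPair s f g := by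
  calc hsNorm s g ≤ hsNormPair s g f := hsNorm_le_hsNormPair_left s g f
    _ = hsNormPair s f g := by rw [hsNormPair, hsNormPair, add_comm]

variable {H₁ H₂ F G₁ G₂ : ℝ × ℝ → ℂ}

lemma IsWeakDiv.ae_eq (h : IsWeakDiv H₁ H₂ F) (h₁ : IsWeakDeriv (1, 0) H₁ G₁)
    (h₂ : IsWeakDeriv (0, 1) H₂ G₂) : F =ᵐ[cellMeasure] fun p => G₁ p + G₂ p := by
  refine ae_cell_of_ae_upperHalf (ae_eq_of_integral_testFunction h.locInt
    (h₁.locInt_deriv.add h₂.locInt_deriv) fun φ hφ => ?_)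
  have e1 := h.integral_eq φ hφ
  have e2 := h₁.integral_eq φ hφ
  have e3 := h₂.integral_eq φ hφ
  simp only [partialDeriv, Function.iterate_one, Function.iterate_zero, id_eq] at e2 e3
  rw [integral_add (hφ.dx.integrable_mul h.locInt_fst).integrableOn
    (hφ.dz.integrable_mul h.locInt_snd).integrableOn, e2, e3] at e1
  simp only [mul_add]
  rw [integral_add (hφ.integrable_mul h₁.locInt_deriv).integrableOn
    (hφ.integrable_mul h₂.locInt_deriv).integrableOn]
  linear_combination e1

/-- Logarithmic bound of the gradient for a source in divergence form. -/
lemma exists_derivSupNorm_one_le_of_isWeakDiv : ∃ C : NNReal, ∀ F H₁ H₂ : ℝ × ℝ → ℂ, IsSource F →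
    IsPeriodic H₁ → IsPeriodic H₂ → IsWeakDiv H₁ H₂ F → hsNormPair 2 H₁ H₂ ≠ ⊤ →
    derivSupNorm 1 (potential F) ≤ C * (1 + max (supNorm H₁) (supNorm H₂) *
      ENNReal.ofReal (Real.log (2 + (hsNormPair 2 H₁ H₂).toReal))) := by
  have hC := logConst_ge
  refine ⟨(4 * logConst).toNNReal, fun F H₁ H₂ hF hp₁ hp₂ hdiv hN => ?_⟩
  set V := (hsNormPair 2 H₁ H₂).toReal with hV
  have hV0 : 0 ≤ V := ENNReal.toReal_nonneg
  have hL := half_le_log_two_add hV0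
  refine le_mul_one_add_of_ne_top (by linarith) (by linarith) fun ht => ?_
  set M := (max (supNorm H₁) (supNorm H₂)).toReal with hM
  have hM0 : 0 ≤ M := ENNReal.toReal_nonneg
  have hM₁ : ∀ᵐ p ∂cellMeasure, ‖H₁ p‖ ≤ M :=
    (ae_norm_le_supNorm (ne_top_of_le_ne_top ht (le_max_left _ _))).mono fun p hp =>
      hp.trans (ENNReal.toReal_mono ht (le_max_left _ _))
  have hM₂ : ∀ᵐ p ∂cellMeasure, ‖H₂ p‖ ≤ M :=
    (ae_norm_le_supNorm (ne_top_of_le_ne_top ht (le_max_right _ _))).mono fun p hp =>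
      hp.trans (ENNReal.toReal_mono ht (le_max_right _ _))
  have hn₁ := ne_top_of_le_ne_top hN (hsNorm_le_hsNormPair_left 2 H₁ H₂)
  have hn₂ := ne_top_of_le_ne_top hN (hsNorm_le_hsNormPair_right 2 H₁ H₂)
  have hb₁ : HasModeBound 2 V H₁ := hasModeBound hp₁ hn₁ (by norm_num)
    (ENNReal.toReal_mono hN (hsNorm_le_hsNormPair_left 2 H₁ H₂))
  have hb₂ : HasModeBound 2 V H₂ := hasModeBound hp₂ hn₂ (by norm_num)
    (ENNReal.toReal_mono hN (hsNorm_le_hsNormPair_right 2 H₁ H₂))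
  obtain ⟨P, hP, -⟩ := exists_isPeriodicFamily hp₁ hn₁
  obtain ⟨Q, hQ, -⟩ := exists_isPeriodicFamily hp₂ hn₂
  have hP₁ := hP.mem (1, 0) (by norm_num)
  have hQ₁ := hQ.mem (0, 1) (by norm_num)
  -- The distributional identity becomes F = ∂ₓH₁ + ∂_zH₂ almost everywhere, since both derivatives
  -- are functions; the modes of F are then ik times those of H₁ plus the derivatives of those of
  -- H₂.
  have hFe := hdiv.ae_eq (hP.weak (1, 0) (by norm_num)) (hQ.weak (0, 1) (by norm_num))
  have hFk : ∀ k, coeff F k =ᵐ[halfLine] fun z =>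
      Complex.I * k * coeff H₁ k z + coeff (Q (0, 1)) k z := fun k => by
    filter_upwards [coeff_congr hFe k, coeff_add hP₁.memLp hQ₁.memLp k,
      hP.coeff_x k 1 (by norm_num)] with z h1 h2 h3
    rw [h1, h2, h3, pow_one]
  have ha := fun k => memLp_coeff hb₁.isPeriodicL2.memLp k
  have hb := fun k => memLp_coeff hb₂.isPeriodicL2.memLp k
  have hg := fun k => memLp_coeff hQ₁.memLp k
  have hw := fun k => (hQ.weak (0, 1) (by norm_num)).coeff_z hb₂.isPeriodicL2 hQ₁ k
  obtain ⟨X, Z, T, S, h⟩ := exists_derivFamily hF.memLp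
  have hm := isFirstOrder_wave
  have hn := isFirstOrder_I_mul
  have hX : ∀ᵐ p ∂cellMeasure, ‖X p‖ ≤ 2 * logBound V M := by
    filter_upwards [((((hm.isModeBounded_U hb₁ hM₁ hM0).sub (hm.isModeBounded_W hb₁ hM₁ hM0)).add
      ((hn.isModeBounded_V hb₂ hM₂ hM0).add (hn.isModeBounded_W hb₂ hM₂ hM0))).const_mul
        (1 / 2)).ae_norm_le h.x fun k => by
          filter_upwards [h.coeff_x k, opA_divergence (k := k) (ha k) (hb k) (hg k) (hw k)] with z h1 h2
          rw [h1, opA_congr (hFk k), h2]] with p hp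
    refine hp.trans_eq ?_
    norm_num
    ring
  have hE : IsPeriodicL2 (trigPoly {0} (coeff H₂)) := isPeriodicL2_trigPoly _ hb
  -- Removing the local term H₂ minus its mean from Z leaves a function whose modes are first order
  -- multipliers of exponential kernels only.
  have hR : IsPeriodicL2 fun p => Z p - H₂ p + trigPoly {0} (coeff H₂) p := by
    refine ⟨fun x z hz => ?_, (h.z.memLp.sub hb₂.isPeriodicL2.memLp).add hE.memLp⟩
    simp only [h.z.periodic x z hz, hp₂ x z hz, hE.periodic x z hz]
  have hRb : ∀ᵐ p ∂cellMeasure, ‖Z p - H₂ p + trigPoly {0} (coeff H₂) p‖ ≤ 2 * logBound V M := by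
    filter_upwards [((((hn.isModeBounded_V hb₁ hM₁ hM0).sub (hn.isModeBounded_W hb₁ hM₁ hM0)).sub
      ((hm.isModeBounded_U hb₂ hM₂ hM0).add (hm.isModeBounded_W hb₂ hM₂ hM0))).const_mul
        (1 / 2)).ae_norm_le hR fun k => by
          filter_upwards [h.coeff_z k, opB_divergence (k := k) (ha k) (hb k) (hg k) (hw k),
            coeff_add (f := fun p => Z p - H₂ p) (h.z.memLp.sub hb₂.isPeriodicL2.memLp) hE.memLp k,
            coeff_sub h.z.memLp hb₂.isPeriodicL2.memLp k] with z h1 h2 h3 h4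
          rw [h3, h4, h1, coeff_trigPoly, opB_congr (hFk k), h2]] with p hp
    refine hp.trans_eq ?_
    norm_num
    ring
  have hMB := le_logBound hM0 hV0
  -- Twice the logarithmic bound for the nonlocal part, and at most 2M for the local part H₂ minus
  -- its mean.
  have hZ : ∀ᵐ p ∂cellMeasure, ‖Z p‖ ≤ 4 * logBound V M := by
    filter_upwards [hRb, hM₂, ae_norm_trigPoly_zero_le hM₂] with p h1 h2 h3
    have e : Z p = (Z p - H₂ p + trigPoly {0} (coeff H₂) p) + (H₂ p - trigPoly {0} (coeff H₂) p) := by ring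
    rw [e]
    refine (norm_add_le _ _).trans ?_
    have := norm_sub_le (H₂ p) (trigPoly {0} (coeff H₂) p)
    linarith
  have hB0 := logBound_nonneg hM0 hV0
  have h2 : 4 * logConst * (1 + M * Real.log (2 + V)) = 4 * logBound V M := by
    unfold logBound
    ring
  rw [h2]
  refine derivSupNorm_le (fun β => if β = (1, 0) then X else Z) fun β hβ => ?_
  rcases β with ⟨_ | a, b⟩
  · obtain rfl : b = 1 := by simp only at hβ; omega
    exact ⟨h.weak_z hF.memLp, hZ⟩
  · obtain ⟨rfl, rfl⟩ : a = 0 ∧ b = 0 := by simp only at hβ; omega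
    exact ⟨h.weak_x hF.memLp, hX.mono fun p hp => hp.trans (by linarith)⟩

end Divergence

end HalfCylinder

end

theorem propositionB1 :
    -- the potential solves the Dirichlet problem
    (∀ F : ℝ × ℝ → ℂ, HalfCylinder.IsSource F →
      HalfCylinder.SolvesDirichlet F (HalfCylinder.potential F)) ∧
    -- Sobolev bounds of all orders
    (∀ s : ℝ, 1 ≤ s → ∃ C : NNReal, ∀ F : ℝ × ℝ → ℂ, HalfCylinder.IsSource F →
      HalfCylinder.hsNorm (s - 1) F ≠ ⊤ →
      HalfCylinder.gradHsNorm s (HalfCylinder.potential F) ≤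
        C * HalfCylinder.hsNorm (s - 1) F) ∧
    -- logarithmic bound of the second derivatives
    (∃ C : NNReal, ∀ F : ℝ × ℝ → ℂ, HalfCylinder.IsSource F →
      HalfCylinder.hsNorm 2 F ≠ ⊤ →
      HalfCylinder.derivSupNorm 2 (HalfCylinder.potential F) ≤
        C * (1 + HalfCylinder.supNorm F *
          ENNReal.ofReal (Real.log (2 + (HalfCylinder.hsNorm 2 F).toReal)))) ∧
    -- logarithmic bound of the gradient
    (∃ C : NNReal, ∀ F : ℝ × ℝ → ℂ, HalfCylinder.IsSource F →
      HalfCylinder.hsNorm 1 F ≠ ⊤ →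
      HalfCylinder.derivSupNorm 1 (HalfCylinder.potential F) ≤
        C * (1 + HalfCylinder.l2Norm F *
          ENNReal.ofReal (Real.sqrt (Real.log (2 + (HalfCylinder.hsNorm 1 F).toReal))))) ∧
    -- logarithmic bound of the gradient for a source in divergence form
    (∃ C : NNReal, ∀ F H₁ H₂ : ℝ × ℝ → ℂ, HalfCylinder.IsSource F →
      HalfCylinder.IsPeriodic H₁ → HalfCylinder.IsPeriodic H₂ →
      HalfCylinder.IsWeakDiv H₁ H₂ F →
      HalfCylinder.hsNormPair 2 H₁ H₂ ≠ ⊤ →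
      HalfCylinder.derivSupNorm 1 (HalfCylinder.potential F) ≤
        C * (1 + max (HalfCylinder.supNorm H₁) (HalfCylinder.supNorm H₂) *
          ENNReal.ofReal (Real.log (2 + (HalfCylinder.hsNormPair 2 H₁ H₂).toReal)))) := by
  refine ⟨fun F hF => HalfCylinder.solvesDirichlet_potential hF, fun s hs => ?_,
    HalfCylinder.exists_derivSupNorm_two_le, HalfCylinder.exists_derivSupNorm_one_le,
    HalfCylinder.exists_derivSupNorm_one_le_of_isWeakDiv⟩
  obtain ⟨C, hC⟩ := HalfCylinder.exists_gradHsNorm_le hs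
  exact ⟨C, fun F hF _ => hC F hF⟩
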